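/- **Theorem 2 (bootstrap variance consistency).** *Setting.* For each $\nu=1,2,\dots$ there is a finite population $\{(\mathbf x_i,y_i)\}_{i=1}^{N}$, $N=N_\nu$, $\mathbf x_i\in\mathbb R^q$, $y_i\in\mathbb R$, of independent (not necessarily identically distributed, possibly with deterministic $\mathbf x_i$) pairs with $E(y_i\mid\mathbf x_i)=m(\mathbf x_i;\boldsymbol\beta_0)$ for a known measurable function $m$ and some $\boldsymbol\beta_0\in\mathbb R^p$; write $e_i=y_i-m(\mathbf x_i;\boldsymbol\beta_0)$ and $\theta_N=N^{-1}\sum_{i=1}^N y_i$. A non-probability sample $B$, of size $|B|$, is selected by an unknown mechanism that is ignorable: $P(B=s\mid \mathbf X,\mathbf Y)=P(B=s\mid\mathbf X)$ a.s. for every set $s$ of units, where $\mathbf X=(\mathbf x_i)_i$, $\mathbf Y=(y_i)_i$. Given the population, a probability sample $A$ is drawn independently of $B$ by a design with inclusion probabilities $\pi_i=P(i\in A\mid\mathbf X,\mathbf Y)>0$ and expected size $\sum_i\pi_i=n_A$ (for instance of fixed size $n_A$); $w_i=\pi_i^{-1}$. Let $\mathbf h(\mathbf x;\boldsymbol\beta)\in\mathbb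 R^p$ be measurable and let $\Theta\subset\mathbb R^p$ be a compact convex parameter space with $\boldsymbol\beta_0$ in its interior. For multiplicities $c=(c_1,\dots,c_N)$ of the units let $\hat U_c(\boldsymbol\beta)=(\sum_i c_i)^{-1}\sum_i c_i\{y_i-m(\mathbf x_i;\boldsymbol\beta)\}\mathbf h(\mathbf x_i;\boldsymbol\beta)$; solving the estimating equations for $c$ means choosing, measurably, a point of $\Theta$ that is a zero of $\hat U_c$ whenever $\hat U_c$ has a zero in $\Theta$. Let $\hat{\boldsymbol\beta}$ be the solution for $c_i=1\{i\in B\}$, and let $$\hat\theta_I=\frac1N\sum_{i\in A}w_i\,m(\mathbf x_i;\hat{\boldsymbol\beta}).$$ *Bootstrap.* Given the data, independently for $k=1,\dots,L$: replication weights $w^{(k)}_i$, $i\in A$, are drawn from a law that depends on the population and $A$; independently of these, a simple random sample with replacement of size $|B|$ is drawn from $B$ and $\hat{\boldsymbol\beta}^{(k)}$ is the solution of the estimating equations for it. With $\hat\theta^{(k)}_I=N^{-1}\sum_{i\in A}w_i^{(k)}m(\mathbf x_i;\hat{\boldsymbol\beta}^{(k)})$, let $$\hat V_b(\hat\theta_I)=\frac1L\sum_{k=1}^L\bigl(\hat\theta_I^{(k)}-\hat\theta_I\bigr)^2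 .$$ *Assumptions* (limits are for $\nu\to\infty$; constants $C,c>0$ do not depend on $\nu$; $\mathrm{av}_B f_i=|B|^{-1}\sum_{i\in B}f_i$; all functions of $\boldsymbol\beta$ without argument are taken at $\boldsymbol\beta_0$; $\dot{\mathbf m}=\partial m/\partial\boldsymbol\beta$). 1. There are deterministic $n_B=n_{B,\nu}\to\infty$ with $n_B/N\to0$, $n_B\le Cn_A$, and $n_B\,P\bigl(\bigl||B|/n_B-1\bigr|\ge\varepsilon\bigr)\to0$ for all $\varepsilon>0$ (which is trivial if $|B|=n_B$ is fixed). Also $L=L_\nu\to\infty$. 2. For every $\mathbf x$, $m(\mathbf x;\cdot)$ and $\mathbf h(\mathbf x;\cdot)$ are $C^2$ on an open set containing $\Theta$, and on $\Theta$ they and their derivatives of order $1$ and $2$ are bounded in norm by $K(\mathbf x)$, $K$ measurable. 3. Bounded fourth moments: $N^{-1}\sum_{i=1}^NE\{\|\mathbf x_i\|^4+y_i^4+K(\mathbf x_i)^4\}\le C$. With $\Lambda_i=\{|y_i|+K(\mathbf x_i)\}K(\mathbf x_i)$, $E\{\mathrm{av}_B\Lambda_i^4\}\le C$ and $n_B\,P(\mathrm{av}_B\Lambda_i>C)\to0$.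 4. Identification: $n_B\,P\bigl(\exists\boldsymbol\beta\in\Theta:\ \bigl\|\mathrm{av}_B\{m(\mathbf x_i;\boldsymbol\beta_0)-m(\mathbf x_i;\boldsymbol\beta)\}\mathbf h(\mathbf x_i;\boldsymbol\beta)\bigr\|<c\|\boldsymbol\beta-\boldsymbol\beta_0\|\bigr)\to0$. 5. Each entry of $\mathrm{av}_B\,\mathbf h_i\dot{\mathbf m}_i'$ and of $\mathrm{av}_B\,e_i^2\mathbf h_i\mathbf h_i'$ differs from its expectation by $o_p(1)$. 6. Design: almost surely, for all $z\in\mathbb R^N$, $E\bigl[\bigl(N^{-1}\sum_{i\in A}w_iz_i-N^{-1}\sum_{i=1}^Nz_i\bigr)^2\mid\mathbf X,\mathbf Y\bigr]\le \frac{C}{n_A}N^{-1}\sum_{i=1}^Nz_i^2$. 7. Replication weights (additional assumption for the bootstrap), with $E_*$ the expectation over the weights given population and $A$: with probability tending to one, $E_*\bigl(N^{-1}\sum_{i\in A}(w_i^{(k)}-w_i)z_i\bigr)^4\le \frac{C}{n_A^{2}}N^{-1}\sum_{i\in A}w_iz_i^4$ for all $z\in\mathbb R^N$; and the replication method is consistent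 for the design variance of the weighted mean of $m_i=m(\mathbf x_i;\boldsymbol\beta_0)$: $$E_*\Bigl(N^{-1}\sum_{i\in A}(w_i^{(k)}-w_i)m_i\Bigr)^2=V\Bigl(N^{-1}\sum_{i\in A}w_im_i-N^{-1}\sum_{i=1}^Nm_i\Bigr)+o_p(n_A^{-1}).$$ *Conclusion.* $\hat\theta_I-\theta_N$ is square integrable for every $\nu$, and $$\hat V_b(\hat\theta_I)=V(\hat\theta_I-\theta_N)+o_p(n_B^{-1}),$$ that is, $|B|\{\hat V_b(\hat\theta_I)-V(\hat\theta_I-\theta_N)\}\to0$ in probability. Here $V$ is the variance, and $o_p$ refers to the law, under the superpopulation model, the selection of $B$, the design of $A$ and (for $o_p$) the bootstrap jointly. -/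

import Mathlib

open MeasureTheory ProbabilityTheory Filter Topology
open scoped ENNReal Gradient

noncomputable section

namespace MassImputation

/-- Values of the vector of auxiliary variables. -/
abbrev Cov (q : ℕ) : Type := EuclideanSpace ℝ (Fin q)

/-- Values of the regression parameter. -/
abbrev Param (p : ℕ) : Type := EuclideanSpace ℝ (Fin p)

/-- A finite population of size `N`: unit `i` carries the pair `(x_i, y_i)`. -/
abbrev Pop (q N : ℕ) : Type := Fin N → Cov q × ℝ

/-- `L` independent draws from the law `κ a`. -/
def iidKernel {α β : Type*} [MeasurableSpace α] [MeasurableSpace β] (κ : Kernel α β)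
    [IsMarkovKernel κ] (L : ℕ) : Kernel α (Fin L → β) where
  toFun a := Measure.pi fun _ => κ a
  measurable' := by
    refine Measurable.measure_of_isPiSystem_of_isProbabilityMeasure generateFrom_pi.symm
      isPiSystem_pi ?_
    rintro s ⟨t, ht, rfl⟩
    simp_rw [Measure.pi_pi]
    exact Finset.measurable_prod _ fun i _ =>
      Kernel.measurable_coe κ (ht i (Set.mem_univ i))

instance {α β : Type*} [MeasurableSpace α] [MeasurableSpace β] (κ : Kernel α β)
    [IsMarkovKernel κ] (L : ℕ) : IsMarkovKernel (iidKernel κ L) :=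
  ⟨fun a => inferInstanceAs (IsProbabilityMeasure (Measure.pi fun _ : Fin L => κ a))⟩

/-- Multiplicities of the units in a list `I` of `n` units. -/
def multiplicity {N n : ℕ} (I : Fin n → Fin N) : Fin N → ℕ :=
  fun i => (Finset.univ.filter fun j => I j = i).card

/-- Law of the multiplicities of the units in a simple random sample with replacement of
size `|B|` from `B`. -/
def resampleLaw {N : ℕ} (B : Finset (Fin N)) : Measure (Fin N → ℕ) :=
  (Measure.pi fun _ : Fin B.card => uniformOn (B : Set (Fin N))).map multiplicity

instance {N : ℕ} (B : Finset (Fin N)) : IsProbabilityMeasure (resampleLaw B) := by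
  have h : ∀ _ : Fin B.card, IsProbabilityMeasure (uniformOn (B : Set (Fin N))) := fun j =>
    isProbabilityMeasure_uniformOn B.finite_toSet
      (Finset.coe_nonempty.2 (Finset.card_pos.1 (lt_of_le_of_lt (Nat.zero_le _) j.2)))
  exact Measure.isProbabilityMeasure_map (measurable_of_countable _).aemeasurable

/-- One stage of the asymptotic framework: the superpopulation, the selection mechanism of the
non-probability sample `B`, the design of the probability sample `A`, and the method that makes
replication weights for `A`. These are arbitrary probability laws. -/
structure Stage (q : ℕ) where
  /-- population size -/
  N : ℕ
  /-- number of bootstrap replicates -/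
  L : ℕ
  /-- superpopulation law of `(x_i, y_i)` -/
  unit : Fin N → Measure (Cov q × ℝ)
  unit_prob : ∀ i, IsProbabilityMeasure (unit i)
  /-- conditional law of `B` given the population -/
  selB : Kernel (Pop q N) (Finset (Fin N))
  selB_markov : IsMarkovKernel selB
  /-- sampling design of `A`: conditional law of `A` given the population -/
  design : Kernel (Pop q N) (Finset (Fin N))
  design_markov : IsMarkovKernel design
  /-- conditional law of one set of replication weights given the population and `A` -/
  repW : Kernel (Pop q N × Finset (Fin N)) (Fin N → ℝ)
  repW_markov : IsMarkovKernel repW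

attribute [instance] Stage.unit_prob Stage.selB_markov Stage.design_markov Stage.repW_markov

namespace Stage

variable {p q : ℕ} (S : Stage q)

/-- Law of the population: the pairs `(x_i, y_i)` are independent. -/
def popLaw : Measure (Pop q S.N) := Measure.pi S.unit

/-- Joint law of the population and of `B`. -/
def lawB : Measure (Pop q S.N × Finset (Fin S.N)) := S.popLaw ⊗ₘ S.selB

/-- Joint law of the population and of `A`. -/
def lawA : Measure (Pop q S.N × Finset (Fin S.N)) := S.popLaw ⊗ₘ S.design

/-- Joint law of the population, of `B` and of `A`, which is drawn independently of `B` given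
the population. -/
def lawBA : Measure ((Pop q S.N × Finset (Fin S.N)) × Finset (Fin S.N)) :=
  S.lawB ⊗ₘ S.design.comap Prod.fst measurable_fst

/-- One bootstrap replicate, given the data `((pop, B), A)`: a set of replication weights for
`A` and, independently, the multiplicities in a with-replacement resample of `B`. -/
def replicate : Kernel ((Pop q S.N × Finset (Fin S.N)) × Finset (Fin S.N))
    ((Fin S.N → ℝ) × (Fin S.N → ℕ)) :=
  S.repW.comap (fun d => (d.1.1, d.2)) (by fun_prop) ×ₖ
    (Kernel.mk (fun B : Finset (Fin S.N) => resampleLaw B) (measurable_of_countable _)).comap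
      (fun d : (Pop q S.N × Finset (Fin S.N)) × Finset (Fin S.N) => d.1.2) (by fun_prop)

instance : IsMarkovKernel S.replicate := by
  have : IsMarkovKernel
      (Kernel.mk (fun B : Finset (Fin S.N) => resampleLaw B) (measurable_of_countable _)) :=
    ⟨fun B => inferInstanceAs (IsProbabilityMeasure (resampleLaw B))⟩
  unfold replicate
  infer_instance

/-- Outcomes `(((pop, B), A), replicates)`. -/
abbrev Outcome : Type :=
  ((Pop q S.N × Finset (Fin S.N)) × Finset (Fin S.N)) ×
    (Fin S.L → (Fin S.N → ℝ) × (Fin S.N → ℕ))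

/-- Joint law of everything; given the data, the `L` replicates are independent. -/
def law : Measure S.Outcome := S.lawBA ⊗ₘ iidKernel S.replicate S.L

/-- The selection mechanism of `B` is ignorable (missing at random):
`P(B = s | X, Y) = P(B = s | X)` almost surely, for every set `s` of units. -/
def Ignorable : Prop :=
  ∀ s : Finset (Fin S.N),
    (fun pop => (S.selB pop).real {s}) =ᵐ[S.popLaw]
      S.popLaw[fun pop => (S.selB pop).real {s} |
        MeasurableSpace.comap (fun (pop : Pop q S.N) (i : Fin S.N) => (pop i).1) inferInstance]

/-- The superpopulation model `E(y_i | x_i) = m(x_i; β₀)`. -/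
def MeanModel (m : Cov q → Param p → ℝ) (β₀ : Param p) : Prop :=
  ∀ i, (S.unit i)[fun z : Cov q × ℝ => z.2 | MeasurableSpace.comap Prod.fst inferInstance]
    =ᵐ[S.unit i] fun z => m z.1 β₀

/-- First-order inclusion probabilities `π_i = P(i ∈ A)` of the design. -/
def incl (pop : Pop q S.N) (i : Fin S.N) : ℝ := (S.design pop).real {A | i ∈ A}

/-- Survey weights `w_i = 1 / π_i`. -/
def weight (pop : Pop q S.N) (i : Fin S.N) : ℝ := (S.incl pop i)⁻¹

/-- Population mean `θ_N` of `y`. -/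
def thetaN (pop : Pop q S.N) : ℝ := (S.N : ℝ)⁻¹ * ∑ i, (pop i).2

/-- Error `N⁻¹ ∑_{i ∈ A} w_i z_i - N⁻¹ ∑_i z_i` of the Horvitz-Thompson estimator. -/
def htError (pop : Pop q S.N) (z : Fin S.N → ℝ) (A : Finset (Fin S.N)) : ℝ :=
  (S.N : ℝ)⁻¹ * ∑ i ∈ A, S.weight pop i * z i - (S.N : ℝ)⁻¹ * ∑ i, z i

/-- Difference `N⁻¹ ∑_{i ∈ A} v_i z_i - N⁻¹ ∑_{i ∈ A} w_i z_i` between the estimators of the mean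
of `z` with replication weights `v` and with the survey weights. -/
def repDiff (pop : Pop q S.N) (A : Finset (Fin S.N)) (z v : Fin S.N → ℝ) : ℝ :=
  (S.N : ℝ)⁻¹ * ∑ i ∈ A, (v i - S.weight pop i) * z i

end Stage

section Estimation

variable {p q N : ℕ}

/-- Multiplicities of the units in the sample `B` itself. -/
def ofSample (B : Finset (Fin N)) : Fin N → ℕ := fun i => if i ∈ B then 1 else 0

/-- Estimating function of a sample that contains unit `i` with multiplicity `c i`. -/
def estFun (m : Cov q → Param p → ℝ) (h : Cov q → Param p → Param p) (pop : Pop q N)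
    (c : Fin N → ℕ) (β : Param p) : Param p :=
  (∑ i, (c i : ℝ))⁻¹ • ∑ i, (c i : ℝ) • (((pop i).2 - m (pop i).1 β) • h (pop i).1 β)

/-- `sol` solves the estimating equations over the parameter space `Θ`: it takes values in `Θ`,
and it is a solution whenever the equations have a solution in `Θ`. -/
structure IsSolver (m : Cov q → Param p → ℝ) (h : Cov q → Param p → Param p)
    (Θ : Set (Param p)) (sol : Pop q N → (Fin N → ℕ) → Param p) : Prop where
  meas : ∀ c, Measurable fun pop => sol pop c
  mem : ∀ pop c, sol pop c ∈ Θ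
  root : ∀ pop c, (∃ β ∈ Θ, estFun m h pop c β = 0) → estFun m h pop c (sol pop c) = 0

/-- Average of `f i` over the units of `B`. -/
def avg (B : Finset (Fin N)) (f : Fin N → ℝ) : ℝ := (B.card : ℝ)⁻¹ * ∑ i ∈ B, f i

/-- Entry `(j, l)` of `n_B⁻¹ ∑_{i ∈ B} h_i ṁ_i'` at `β₀`. -/
def jacobian (m : Cov q → Param p → ℝ) (h : Cov q → Param p → Param p) (β₀ : Param p)
    (j l : Fin p) (ω : Pop q N × Finset (Fin N)) : ℝ :=
  avg ω.2 fun i => h (ω.1 i).1 β₀ j * (∇ (m (ω.1 i).1) β₀) l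

/-- Entry `(j, l)` of `n_B⁻¹ ∑_{i ∈ B} e_i² h_i h_i'` at `β₀`, where `e_i = y_i - m(x_i; β₀)`. -/
def scoreVar (m : Cov q → Param p → ℝ) (h : Cov q → Param p → Param p) (β₀ : Param p)
    (j l : Fin p) (ω : Pop q N × Finset (Fin N)) : ℝ :=
  avg ω.2 fun i => ((ω.1 i).2 - m (ω.1 i).1 β₀) ^ 2 * (h (ω.1 i).1 β₀ j * h (ω.1 i).1 β₀ l)

/-- The estimating function of `B` with `y_i` replaced by its model mean `m(x_i; β₀)`. -/
def meanEstFun (m : Cov q → Param p → ℝ) (h : Cov q → Param p → Param p) (β₀ : Param p)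
    (pop : Pop q N) (B : Finset (Fin N)) (β : Param p) : Param p :=
  (B.card : ℝ)⁻¹ • ∑ i ∈ B, (m (pop i).1 β₀ - m (pop i).1 β) • h (pop i).1 β

end Estimation

namespace Stage

variable {p q : ℕ} (S : Stage q)

/-- The mass imputation estimator `N⁻¹ ∑_{i ∈ A} w_i m(x_i; β̂)`. -/
def thetaI (m : Cov q → Param p → ℝ) (sol : Pop q S.N → (Fin S.N → ℕ) → Param p)
    (d : (Pop q S.N × Finset (Fin S.N)) × Finset (Fin S.N)) : ℝ :=
  (S.N : ℝ)⁻¹ * ∑ i ∈ d.2, S.weight d.1.1 i * m (d.1.1 i).1 (sol d.1.1 (ofSample d.1.2))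

/-- Replicate `N⁻¹ ∑_{i ∈ A} w_i^{(k)} m(x_i; β̂^{(k)})` of the mass imputation estimator; `r` holds
the replication weights and the multiplicities of the resample of `B`. -/
def thetaRep (m : Cov q → Param p → ℝ) (sol : Pop q S.N → (Fin S.N → ℕ) → Param p)
    (d : (Pop q S.N × Finset (Fin S.N)) × Finset (Fin S.N))
    (r : (Fin S.N → ℝ) × (Fin S.N → ℕ)) : ℝ :=
  (S.N : ℝ)⁻¹ * ∑ i ∈ d.2, r.1 i * m (d.1.1 i).1 (sol d.1.1 r.2)

/-- The bootstrap variance estimator `L⁻¹ ∑_k (θ̂_I^{(k)} - θ̂_I)²`. -/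
def bootVar (m : Cov q → Param p → ℝ) (sol : Pop q S.N → (Fin S.N → ℕ) → Param p)
    (ω : S.Outcome) : ℝ :=
  (S.L : ℝ)⁻¹ * ∑ k, (S.thetaRep m sol ω.1 (ω.2 k) - S.thetaI m sol ω.1) ^ 2

end Stage

/-- `Z ν = o_p(1)`, where `Z ν` is a random variable on a space with law `P ν`. -/
def IsLittleOp {Ω : ℕ → Type*} [∀ ν, MeasurableSpace (Ω ν)] (P : ∀ ν, Measure (Ω ν))
    (Z : ∀ ν, Ω ν → ℝ) : Prop :=
  ∀ ε > 0, Tendsto (fun ν => (P ν).real {ω | ε ≤ |Z ν ω|}) atTop (𝓝 0)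

end MassImputation

end

/-!
The error of the imputation estimator and, given the data, the error of a bootstrap replicate have
the same structure, and each normalized second moment is computed from a linearization.

**The estimator.** With `J` the mean of the average of `h_i ṁ_i'` over `B`, `γ` the mean of the
population average of `ṁ_i'`, and `α = γ J⁻¹`, a first-order expansion at `β₀` gives
`θ̂_I - θ_N ≈ T_A + av_B (e_i α(h_i))`, where `T_A` is the Horvitz-Thompson error of the weighted
mean of `m(x_i; β₀)`. The population mean of the `e_i` does not matter because `n_B / N → 0`. The
two terms are orthogonal, because `T_A` has mean zero given the population and `B`; by
ignorability, the `e_i` of the units of `B` are still centered and uncorrelated, and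
`n_B E(av_B (e_i α(h_i)))²` is asymptotically the mean of `av_B (e_i α(h_i))²`
(`tendsto_influence_sq`). Hence `n_B V(θ̂_I - θ_N)` is `n_B V(T_A)` plus that mean, up to `o(1)`
(`tendsto_variance`).

The remainders have to be negligible in mean square, not just in probability. The analytic part is
deterministic: when the average of the envelope over `B` is bounded, the mean estimating function
identifies `β₀`, and finitely many averages of `e_i` times a function of `x_i` (at a finite net of
`Θ`, and for the derivatives at `β₀`) are small, the estimating function has a zero in `Θ`, and all
its zeros are within a multiple of the noise of `β₀` (`Regular.sample_root`). Identification bounds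
the derivative at `β₀` from below, so the estimating function approximates an invertible linear map
on a ball of fixed radius, and the quantitative inverse function theorem gives the zero
(`zeros_of_perturbation`). The exceptional samples have probability
`o(1 / n_B)`, which suffices as `Θ` is bounded, and the noise is `O(n_B^{-1/2})` in fourth mean.

**The bootstrap.** The same deterministic argument applies to a resample, with `β̂` in place of `β₀`
and deviations from averages over `B` in place of the noise (`Regular.boot_root`). The error of a
replicate splits into the effect of the replication weights on the mean of `m(x_i; β₀)`, the linear
effect `α(Û_c(β̂))` of the resample, and a remainder. The first two terms are independent given the
data, and the second one is centered with variance `|B|⁻¹ av_B α((y_i - m_i) h_i)²`, taken at `β̂`;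
the replication method is consistent for the design variance, and the average converges to the same
limit as above (`tendsto_replicate_sq`). Finally, the `L` replicates are independent given the data
with fourth moments `O_p(n_B^{-2})`, so Chebyshev's inequality replaces their conditional second
moment by the bootstrap variance (`tendsto_bootVar_sub`).

Convergence in probability along the sequence of stages is convergence along a filter on the
disjoint union of the sample spaces (`whp`), so that the calculus of limits applies to it.
-/

namespace MassImputation

section

/-! ### Convergence in probability as convergence along a filter -/

section WithHighProbability

variable {Ω : ℕ → Type*} [∀ ν, MeasurableSpace (Ω ν)]

/-- The filter of the properties that hold with probability tending to one. A property is a set of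
pairs `⟨ν, ω⟩`, and convergence to `0` along this filter is `o_p(1)`. -/
def whp (P : ∀ ν, Measure (Ω ν)) : Filter (Σ ν, Ω ν) where
  sets := {s | Tendsto (fun ν => P ν {ω | (⟨ν, ω⟩ : Σ ν, Ω ν) ∉ s}) atTop (𝓝 0)}
  univ_sets := by simp
  sets_of_superset := by
    intro s t hs hst
    refine tendsto_of_tendsto_of_tendsto_of_le_of_le tendsto_const_nhds hs (fun _ => zero_le)
      fun ν => measure_mono fun ω hω h => hω (hst h)
  inter_sets := by
    intro s t hs ht
    have := hs.add ht
    rw [add_zero] at this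
    refine tendsto_of_tendsto_of_tendsto_of_le_of_le tendsto_const_nhds this (fun _ => zero_le)
      fun ν => (measure_mono ?_).trans (measure_union_le _ _)
    intro ω hω
    by_contra h
    simp only [Set.mem_union, Set.mem_ofPred_eq, not_or, not_not] at h
    exact hω h

variable {P : ∀ ν, Measure (Ω ν)}

theorem eventually_whp {p : (Σ ν, Ω ν) → Prop} :
    (∀ᶠ x in whp P, p x) ↔ Tendsto (fun ν => P ν {ω | ¬ p ⟨ν, ω⟩}) atTop (𝓝 0) := Iff.rfl

theorem eventually_whp_real [∀ ν, IsFiniteMeasure (P ν)] {p : (Σ ν, Ω ν) → Prop} :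
    (∀ᶠ x in whp P, p x) ↔ Tendsto (fun ν => (P ν).real {ω | ¬ p ⟨ν, ω⟩}) atTop (𝓝 0) := by
  rw [eventually_whp]
  simp only [Measure.real]
  rw [← ENNReal.toReal_zero, ENNReal.tendsto_toReal_iff (fun _ => measure_ne_top _ _) (by simp)]

theorem isLittleOp_iff [∀ ν, IsFiniteMeasure (P ν)] {Z : ∀ ν, Ω ν → ℝ} :
    IsLittleOp P Z ↔ Tendsto (fun x : Σ ν, Ω ν => Z x.1 x.2) (whp P) (𝓝 0) := by
  rw [Metric.tendsto_nhds]
  refine forall₂_congr fun ε hε => ?_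
  rw [eventually_whp_real]
  simp

theorem tendsto_fst_whp : Tendsto (Sigma.fst : (Σ ν, Ω ν) → ℕ) (whp P) atTop := by
  refine tendsto_atTop.2 fun n => ?_
  rw [eventually_whp]
  refine tendsto_const_nhds.congr' ?_
  filter_upwards [eventually_ge_atTop n] with ν hν
  simp [hν]

theorem eventually_whp_of_fst {p : ℕ → Prop} (hp : ∀ᶠ ν in atTop, p ν) :
    ∀ᶠ x in whp P, p x.1 := tendsto_fst_whp.eventually hp

theorem tendsto_whp_map {Ω' : ℕ → Type*} [∀ ν, MeasurableSpace (Ω' ν)]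
    {P' : ∀ ν, Measure (Ω' ν)} (f : ∀ ν, Ω' ν → Ω ν) (hf : ∀ ν, Measurable (f ν))
    (hmap : ∀ ν, (P' ν).map (f ν) = P ν) :
    Tendsto (fun x : Σ ν, Ω' ν => (⟨x.1, f x.1 x.2⟩ : Σ ν, Ω ν)) (whp P') (whp P) := by
  intro s hs
  have hs' : Tendsto (fun ν => P ν {ω | (⟨ν, ω⟩ : Σ ν, Ω ν) ∉ s}) atTop (𝓝 0) := hs
  change Tendsto _ _ _
  refine tendsto_of_tendsto_of_tendsto_of_le_of_le tendsto_const_nhds hs' (fun _ => zero_le)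
    fun ν => ?_
  rw [← hmap ν]
  exact Measure.le_map_apply (hf ν).aemeasurable {ω | (⟨ν, ω⟩ : Σ ν, Ω ν) ∉ s}

/-- Markov's inequality: a sequence whose means vanish is `o_p(1)`. -/
theorem tendsto_whp_of_lintegral {Z : (Σ ν, Ω ν) → ℝ} (hZ : ∀ x, 0 ≤ Z x)
    (hmeas : ∀ ν, AEMeasurable (fun ω => Z ⟨ν, ω⟩) (P ν))
    (h : Tendsto (fun ν => ∫⁻ ω, ENNReal.ofReal (Z ⟨ν, ω⟩) ∂P ν) atTop (𝓝 0)) :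
    Tendsto Z (whp P) (𝓝 0) := by
  rw [Metric.tendsto_nhds]
  intro ε hε
  rw [eventually_whp]
  have h2 := ENNReal.Tendsto.div_const h (b := ENNReal.ofReal ε) (Or.inr (by simpa using hε))
  rw [ENNReal.zero_div] at h2
  refine tendsto_of_tendsto_of_tendsto_of_le_of_le tendsto_const_nhds h2 (fun _ => zero_le)
    fun ν => ?_
  refine le_trans (measure_mono ?_) (meas_ge_le_lintegral_div (hmeas ν).ennreal_ofReal
    (by simpa using hε) (by simp))
  intro ω hω
  simp only [dist_zero_right, Real.norm_eq_abs, not_lt, Set.mem_ofPred_eq] at hω ⊢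
  rw [abs_of_nonneg (hZ _)] at hω
  exact ENNReal.ofReal_le_ofReal hω

/-- Bounded convergence: the means of a bounded `o_p(1)` sequence vanish. -/
theorem tendsto_lintegral_of_whp [∀ ν, IsProbabilityMeasure (P ν)] {Z : (Σ ν, Ω ν) → ℝ} {C : ℝ}
    (hC : ∀ᶠ ν in atTop, ∀ ω, Z ⟨ν, ω⟩ ≤ C) (hZ : Tendsto Z (whp P) (𝓝 0)) :
    Tendsto (fun ν => ∫⁻ ω, ENNReal.ofReal (Z ⟨ν, ω⟩) ∂P ν) atTop (𝓝 0) := by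
  rw [ENNReal.tendsto_nhds_zero]
  intro ε hε
  obtain ⟨δ, hδ, hδε⟩ : ∃ δ : ℝ, 0 < δ ∧ ENNReal.ofReal δ ≤ ε / 2 := by
    rcases eq_or_ne ε ∞ with rfl | hε'
    · exact ⟨1, one_pos, by simp [ENNReal.top_div]⟩
    · exact ⟨(ε / 2).toReal, ENNReal.toReal_pos (by simpa using hε.ne')
        (ENNReal.div_lt_top hε' (by simp)).ne,
        (ENNReal.ofReal_toReal (ENNReal.div_lt_top hε' (by simp)).ne).le⟩
  have h1 : ∀ᶠ x in whp P, Z x < δ := hZ.eventually (gt_mem_nhds hδ)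
  rw [eventually_whp] at h1
  have h2 := ENNReal.Tendsto.const_mul (a := ENNReal.ofReal C) h1 (Or.inr (by simp))
  rw [mul_zero, ENNReal.tendsto_nhds_zero] at h2
  filter_upwards [h2 (ε / 2) (by simpa using hε.ne'), hC] with ν hν hC
  set s := {ω | ¬ Z ⟨ν, ω⟩ < δ}
  calc ∫⁻ ω, ENNReal.ofReal (Z ⟨ν, ω⟩) ∂P ν
      ≤ ∫⁻ ω, (ENNReal.ofReal δ + (toMeasurable (P ν) s).indicator
          (fun _ => ENNReal.ofReal C) ω) ∂P ν := by
        refine lintegral_mono fun ω => ?_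
        by_cases hω : ω ∈ s
        · rw [Set.indicator_of_mem (subset_toMeasurable _ _ hω)]
          exact (ENNReal.ofReal_le_ofReal (hC ω)).trans le_add_self
        · have : Z ⟨ν, ω⟩ < δ := by simpa [s] using hω
          exact (ENNReal.ofReal_le_ofReal this.le).trans le_self_add
    _ = ENNReal.ofReal δ + ENNReal.ofReal C * P ν s := by
        rw [lintegral_add_left measurable_const, lintegral_const, measure_univ, mul_one,
          lintegral_indicator_const (measurableSet_toMeasurable _ _), measure_toMeasurable]
    _ ≤ ε / 2 + ε / 2 := add_le_add hδε hν
    _ = ε := ENNReal.add_halves ε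

end WithHighProbability

/-- Boundedness in probability, `O_p(1)`, along a filter: the product with anything that vanishes
along the filter vanishes along the filter. -/
def IsBigOp {X : Type*} (l : Filter X) (Z : X → ℝ) : Prop :=
  ∀ Y : X → ℝ, Tendsto Y l (𝓝 0) → Tendsto (fun x => Y x * Z x) l (𝓝 0)

namespace IsBigOp

variable {X : Type*} {l : Filter X} {Z W : X → ℝ}

theorem add (hZ : IsBigOp l Z) (hW : IsBigOp l W) : IsBigOp l fun x => Z x + W x := by
  intro Y hY
  simpa [mul_add] using (hZ Y hY).add (hW Y hY)

theorem mul (hZ : IsBigOp l Z) (hW : IsBigOp l W) : IsBigOp l fun x => Z x * W x := by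
  intro Y hY
  simpa [mul_assoc] using hW _ (hZ Y hY)

theorem of_bdd {C : ℝ} (h : ∀ᶠ x in l, |Z x| ≤ C) : IsBigOp l Z := by
  intro Y hY
  refine squeeze_zero_norm' (a := fun x => |Y x| * C) ?_ (by simpa using hY.abs.mul_const C)
  filter_upwards [h] with x hx
  rw [Real.norm_eq_abs, abs_mul]
  exact mul_le_mul_of_nonneg_left hx (abs_nonneg _)

theorem of_tendsto {a : ℝ} (h : Tendsto Z l (𝓝 a)) : IsBigOp l Z :=
  of_bdd (C := |a| + 1) ((h.abs.eventually (gt_mem_nhds (lt_add_one _))).mono fun _ h => h.le)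

theorem const (a : ℝ) : IsBigOp l fun _ => a := of_tendsto tendsto_const_nhds

theorem mono (hW : IsBigOp l W) (h : ∀ᶠ x in l, |Z x| ≤ |W x|) : IsBigOp l Z := by
  intro Y hY
  refine squeeze_zero_norm' (a := fun x => |Y x * W x|) ?_ (by simpa using (hW Y hY).abs)
  filter_upwards [h] with x hx
  rw [Real.norm_eq_abs, abs_mul, abs_mul]
  exact mul_le_mul_of_nonneg_left hx (abs_nonneg _)

theorem abs (hZ : IsBigOp l Z) : IsBigOp l fun x => |Z x| :=
  hZ.mono (.of_forall fun x => (abs_abs (Z x)).le)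

theorem sqrt (hZ : IsBigOp l Z) : IsBigOp l fun x => √(Z x) := by
  refine (hZ.abs.add (const 1)).mono (.of_forall fun x => ?_)
  rw [abs_of_nonneg (Real.sqrt_nonneg _), abs_of_nonneg (by positivity)]
  exact Real.sqrt_le_iff.2 ⟨by positivity, by nlinarith [le_abs_self (Z x), abs_nonneg (Z x)]⟩

end IsBigOp

/-- A sequence with bounded first absolute moments is bounded in probability. -/
theorem isBigOp_of_lintegral {Ω : ℕ → Type*} [∀ ν, MeasurableSpace (Ω ν)]
    {P : ∀ ν, Measure (Ω ν)} {Z : (Σ ν, Ω ν) → ℝ} {C : ℝ} (hZ : ∀ x, 0 ≤ Z x)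
    (hmeas : ∀ ν, AEMeasurable (fun ω => Z ⟨ν, ω⟩) (P ν))
    (h : ∀ᶠ ν in atTop, ∫⁻ ω, ENNReal.ofReal (Z ⟨ν, ω⟩) ∂P ν ≤ ENNReal.ofReal C) :
    IsBigOp (whp P) Z := by
  intro Y hY
  rw [Metric.tendsto_nhds]
  intro ε hε
  rw [eventually_whp, ENNReal.tendsto_nhds_zero]
  intro δ hδ
  obtain ⟨M, hM0, hM⟩ : ∃ M : ℝ, 0 < M ∧ ENNReal.ofReal C / ENNReal.ofReal M ≤ δ / 2 := by
    have : Tendsto (fun M : ℝ => ENNReal.ofReal C / ENNReal.ofReal M) atTop (𝓝 0) := by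
      have := ENNReal.Tendsto.const_div (a := ENNReal.ofReal C) ENNReal.tendsto_ofReal_atTop
        (Or.inr (by simp))
      simpa using this
    obtain ⟨M, h1, h2⟩ := (((ENNReal.tendsto_nhds_zero.1 this) (δ / 2)
      (by simpa using hδ.ne')).and (eventually_gt_atTop 0)).exists
    exact ⟨M, h2, h1⟩
  have h1 : ∀ᶠ x in whp P, |Y x| < ε / M := by
    have := hY.abs
    rw [abs_zero] at this
    exact this.eventually (gt_mem_nhds (by positivity))
  rw [eventually_whp, ENNReal.tendsto_nhds_zero] at h1
  filter_upwards [h1 (δ / 2) (by simpa using hδ.ne'), h] with ν hν hCν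
  calc P ν {ω | ¬ dist (Y ⟨ν, ω⟩ * Z ⟨ν, ω⟩) 0 < ε}
      ≤ P ν ({ω | ¬ |Y ⟨ν, ω⟩| < ε / M} ∪
          {ω | ENNReal.ofReal M ≤ ENNReal.ofReal (Z ⟨ν, ω⟩)}) := by
        refine measure_mono fun ω hω => ?_
        by_contra hcon
        simp only [Set.mem_union, Set.mem_ofPred_eq, not_or, not_not, not_le] at hcon
        obtain ⟨ha, hb⟩ := hcon
        have hb' : Z ⟨ν, ω⟩ < M := (ENNReal.ofReal_lt_ofReal_iff hM0).1 hb
        refine hω ?_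
        rw [dist_zero_right, Real.norm_eq_abs, abs_mul, abs_of_nonneg (hZ _)]
        calc |Y ⟨ν, ω⟩| * Z ⟨ν, ω⟩ ≤ |Y ⟨ν, ω⟩| * M :=
              mul_le_mul_of_nonneg_left hb'.le (abs_nonneg _)
          _ < ε / M * M := mul_lt_mul_of_pos_right ha hM0
          _ = ε := div_mul_cancel₀ _ hM0.ne'
    _ ≤ δ / 2 + δ / 2 := by
        refine (measure_union_le _ _).trans (add_le_add hν ?_)
        refine (meas_ge_le_lintegral_div (hmeas ν).ennreal_ofReal (by simpa using hM0)
          (by simp)).trans (le_trans ?_ hM)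
        exact ENNReal.div_le_div_right hCν _
    _ = δ := ENNReal.add_halves δ

end

section

/-! ### Envelopes and first-order expansions -/

section Expansion

variable {E F : Type*} [NormedAddCommGroup E] [NormedSpace ℝ E] [NormedAddCommGroup F]
  [NormedSpace ℝ F] {f : E → F} {O Θ : Set E} {k : ℝ}

theorem norm_sub_le_of_iteratedFDeriv_le (hO : IsOpen O) (hΘO : Θ ⊆ O) (hΘ : Convex ℝ Θ)
    (hf : ContDiffOn ℝ 2 f O) (hk : ∀ β ∈ Θ, ∀ j ≤ 2, ‖iteratedFDeriv ℝ j f β‖ ≤ k)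
    {β β' : E} (hβ : β ∈ Θ) (hβ' : β' ∈ Θ) : ‖f β - f β'‖ ≤ k * ‖β - β'‖ := by
  refine hΘ.norm_image_sub_le_of_norm_fderiv_le (𝕜 := ℝ) (fun x hx => ?_) (fun x hx => ?_) hβ' hβ
  · exact (hf.contDiffAt (hO.mem_nhds (hΘO hx))).differentiableAt (by norm_num)
  · rw [← norm_iteratedFDeriv_one]
    exact hk x hx 1 (by norm_num)

/-- First-order expansion about `β₀` of a function with bounded second derivative, with a bound
that is uniform over pairs of points at distance at most `ρ` from `β₀`. -/
theorem norm_sub_sub_fderiv_le (hO : IsOpen O) (hΘO : Θ ⊆ O) (hΘ : Convex ℝ Θ)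
    (hf : ContDiffOn ℝ 2 f O) (hk : ∀ β ∈ Θ, ∀ j ≤ 2, ‖iteratedFDeriv ℝ j f β‖ ≤ k)
    {β₀ β β' : E} {ρ : ℝ} (hβ₀ : β₀ ∈ Θ) (hβ : β ∈ Θ) (hβ' : β' ∈ Θ)
    (h1 : ‖β - β₀‖ ≤ ρ) (h2 : ‖β' - β₀‖ ≤ ρ) :
    ‖f β - f β' - fderiv ℝ f β₀ (β - β')‖ ≤ k * ρ * ‖β - β'‖ := by
  have hk0 : 0 ≤ k := (norm_nonneg _).trans (hk β₀ hβ₀ 0 (by norm_num))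
  have hlip : ∀ x ∈ Θ, ‖fderiv ℝ f x - fderiv ℝ f β₀‖ ≤ k * ‖x - β₀‖ := by
    intro x hx
    refine hΘ.norm_image_sub_le_of_norm_fderiv_le (𝕜 := ℝ) (fun y hy => ?_) (fun y hy => ?_) hβ₀ hx
    · exact ((hf.contDiffAt (hO.mem_nhds (hΘO hy))).fderiv_right (m := 1)
        (by norm_num)).differentiableAt (by norm_num)
    · rw [← norm_iteratedFDeriv_one, norm_iteratedFDeriv_fderiv]
      exact hk y hy 2 le_rfl
  have hconv : Convex ℝ (Θ ∩ Metric.closedBall β₀ ρ) := hΘ.inter (convex_closedBall _ _)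
  refine hconv.norm_image_sub_le_of_norm_hasFDerivWithin_le' (𝕜 := ℝ) (f' := fderiv ℝ f)
    (fun x hx => ?_) (fun x hx => ?_) ⟨hβ', by simpa [dist_eq_norm] using h2⟩
    ⟨hβ, by simpa [dist_eq_norm] using h1⟩
  · exact ((hf.contDiffAt (hO.mem_nhds (hΘO hx.1))).differentiableAt
      (by norm_num)).hasFDerivAt.hasFDerivWithinAt
  · refine (hlip x hx.1).trans (mul_le_mul_of_nonneg_left ?_ hk0)
    simpa [dist_eq_norm] using hx.2

end Expansion

variable {p q N : ℕ}

/-- The consequences of the smoothness assumptions that the argument uses: `K` is an envelope of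
`m`, `h` and their first derivatives at `β₀`, and of their Lipschitz constants and second-order
Taylor remainders over `Θ`. -/
structure Regular (m : Cov q → Param p → ℝ) (h : Cov q → Param p → Param p) (K : Cov q → ℝ)
    (Θ : Set (Param p)) (β₀ : Param p) : Prop where
  compact : IsCompact Θ
  mem_interior : β₀ ∈ interior Θ
  meas_m : Measurable (Function.uncurry m)
  meas_h : Measurable (Function.uncurry h)
  meas_K : Measurable K
  K_nonneg : ∀ x, 0 ≤ K x
  m_bdd : ∀ x, ∀ β ∈ Θ, |m x β| ≤ K x
  h_bdd : ∀ x, ∀ β ∈ Θ, ‖h x β‖ ≤ K x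
  m_lip : ∀ x, ∀ β ∈ Θ, ∀ β' ∈ Θ, |m x β - m x β'| ≤ K x * ‖β - β'‖
  h_lip : ∀ x, ∀ β ∈ Θ, ∀ β' ∈ Θ, ‖h x β - h x β'‖ ≤ K x * ‖β - β'‖
  dm_bdd : ∀ x, ‖fderiv ℝ (m x) β₀‖ ≤ K x
  dh_bdd : ∀ x, ‖fderiv ℝ (h x) β₀‖ ≤ K x
  m_lin : ∀ x, ∀ β ∈ Θ, ∀ β' ∈ Θ, ∀ ρ, ‖β - β₀‖ ≤ ρ → ‖β' - β₀‖ ≤ ρ →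
    |m x β - m x β' - fderiv ℝ (m x) β₀ (β - β')| ≤ K x * ρ * ‖β - β'‖
  h_lin : ∀ x, ∀ β ∈ Θ, ∀ β' ∈ Θ, ∀ ρ, ‖β - β₀‖ ≤ ρ → ‖β' - β₀‖ ≤ ρ →
    ‖h x β - h x β' - fderiv ℝ (h x) β₀ (β - β')‖ ≤ K x * ρ * ‖β - β'‖
  dm_meas : ∀ v, Measurable fun x => fderiv ℝ (m x) β₀ v
  dh_meas : ∀ v, Measurable fun x => fderiv ℝ (h x) β₀ v

/-- The directional derivative of a measurable family, as a limit of difference quotients. -/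
theorem measurable_fderiv_family {F : Type*} [NormedAddCommGroup F] [NormedSpace ℝ F]
    [MeasurableSpace F] [BorelSpace F] [SecondCountableTopology F] {f : Cov q → Param p → F}
    {β₀ : Param p} (hf : Measurable (Function.uncurry f))
    (hd : ∀ x, DifferentiableAt ℝ (f x) β₀) (v : Param p) :
    Measurable fun x => fderiv ℝ (f x) β₀ v := by
  have hmeas : ∀ β, Measurable fun x => f x β := fun β =>
    hf.comp (measurable_id.prodMk measurable_const)
  refine measurable_of_tendsto_metrizable (f := fun (n : ℕ) x =>
    ((n : ℝ) + 1) • (f x (β₀ + ((n : ℝ) + 1)⁻¹ • v) - f x β₀)) (fun n => ?_) ?_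
  · exact ((hmeas _).sub (hmeas _)).const_smul _
  · rw [tendsto_pi_nhds]
    intro x
    refine (hd x).hasFDerivAt.lim v (c := fun n : ℕ => (n : ℝ) + 1) ?_
    exact tendsto_norm_atTop_atTop.comp
      (tendsto_atTop_add_const_right _ _ tendsto_natCast_atTop_atTop)

/-- The smoothness hypotheses on a neighbourhood of `Θ`, with bounds on the derivatives of order at
most two on `Θ` itself, give the Lipschitz and second-order bounds of `Regular`; convexity of `Θ`
keeps the segments of the mean value inequality inside `Θ`. -/
theorem regular_of_contDiffOn {m : Cov q → Param p → ℝ} {h : Cov q → Param p → Param p}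
    (hm_meas : Measurable (Function.uncurry m)) (hh_meas : Measurable (Function.uncurry h))
    {Θ : Set (Param p)} (hΘ : IsCompact Θ) (hΘconv : Convex ℝ Θ)
    {β₀ : Param p} (hβ₀ : β₀ ∈ interior Θ) {O : Set (Param p)} (hO : IsOpen O) (hΘO : Θ ⊆ O)
    (hm_smooth : ∀ x, ContDiffOn ℝ 2 (m x) O) (hh_smooth : ∀ x, ContDiffOn ℝ 2 (h x) O)
    {K : Cov q → ℝ} (hK_meas : Measurable K)
    (hmK : ∀ x, ∀ β ∈ Θ, ∀ j ≤ 2, ‖iteratedFDeriv ℝ j (m x) β‖ ≤ K x)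
    (hhK : ∀ x, ∀ β ∈ Θ, ∀ j ≤ 2, ‖iteratedFDeriv ℝ j (h x) β‖ ≤ K x) :
    Regular m h K Θ β₀ := by
  have hβ : β₀ ∈ Θ := interior_subset hβ₀
  have hOβ : O ∈ 𝓝 β₀ := hO.mem_nhds (hΘO hβ)
  exact
  { compact := hΘ
    mem_interior := hβ₀
    meas_m := hm_meas
    meas_h := hh_meas
    meas_K := hK_meas
    K_nonneg := fun x => (norm_nonneg _).trans (hmK x β₀ hβ 0 (by norm_num))
    m_bdd := fun x β hβ => by simpa using hmK x β hβ 0 (by norm_num)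
    h_bdd := fun x β hβ => by simpa using hhK x β hβ 0 (by norm_num)
    m_lip := fun x β hβ β' hβ' =>
      norm_sub_le_of_iteratedFDeriv_le hO hΘO hΘconv (hm_smooth x) (hmK x) hβ hβ'
    h_lip := fun x β hβ β' hβ' =>
      norm_sub_le_of_iteratedFDeriv_le hO hΘO hΘconv (hh_smooth x) (hhK x) hβ hβ'
    dm_bdd := fun x => by simpa using hmK x β₀ hβ 1 (by norm_num)
    dh_bdd := fun x => by simpa using hhK x β₀ hβ 1 (by norm_num)
    m_lin := fun x β h1 β' h2 ρ h3 h4 =>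
      norm_sub_sub_fderiv_le hO hΘO hΘconv (hm_smooth x) (hmK x) hβ h1 h2 h3 h4
    h_lin := fun x β h1 β' h2 ρ h3 h4 =>
      norm_sub_sub_fderiv_le hO hΘO hΘconv (hh_smooth x) (hhK x) hβ h1 h2 h3 h4
    dm_meas := measurable_fderiv_family hm_meas fun x =>
      ((hm_smooth x).contDiffAt hOβ).differentiableAt (by norm_num)
    dh_meas := measurable_fderiv_family hh_meas fun x =>
      ((hh_smooth x).contDiffAt hOβ).differentiableAt (by norm_num) }

/-- Contribution of a unit `z = (x, y)` to the estimating function. -/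
noncomputable def psi (m : Cov q → Param p → ℝ) (h : Cov q → Param p → Param p) (z : Cov q × ℝ)
    (β : Param p) : Param p := (z.2 - m z.1 β) • h z.1 β

/-- Derivative at `β₀` of the contribution of a unit to the estimating function. -/
noncomputable def dpsi (m : Cov q → Param p → ℝ) (h : Cov q → Param p → Param p) (β₀ : Param p)
    (z : Cov q × ℝ) : Param p →L[ℝ] Param p :=
  (z.2 - m z.1 β₀) • fderiv ℝ (h z.1) β₀ - (fderiv ℝ (m z.1) β₀).smulRight (h z.1 β₀)

/-- The envelope `Λ = (|y| + K(x)) K(x)` of a unit. -/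
noncomputable def env (K : Cov q → ℝ) (z : Cov q × ℝ) : ℝ := (|z.2| + K z.1) * K z.1

namespace Regular

variable {m : Cov q → Param p → ℝ} {h : Cov q → Param p → Param p} {K : Cov q → ℝ}
  {Θ : Set (Param p)} {β₀ : Param p} (R : Regular m h K Θ β₀)
include R

theorem mem : β₀ ∈ Θ := interior_subset R.mem_interior

theorem env_nonneg (z : Cov q × ℝ) : 0 ≤ env K z := by
  have := R.K_nonneg z.1
  unfold env
  positivity

theorem res_le (z : Cov q × ℝ) {β : Param p} (hβ : β ∈ Θ) : |z.2 - m z.1 β| ≤ |z.2| + K z.1 :=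
  (abs_sub _ _).trans (by gcongr; exact R.m_bdd _ _ hβ)

theorem psi_le (z : Cov q × ℝ) {β : Param p} (hβ : β ∈ Θ) : ‖psi m h z β‖ ≤ env K z := by
  rw [psi, norm_smul, env]
  have := R.K_nonneg z.1
  exact mul_le_mul (R.res_le z hβ) (R.h_bdd _ _ hβ) (norm_nonneg _) (by positivity)

theorem psi_lip (z : Cov q × ℝ) {β β' : Param p} (hβ : β ∈ Θ) (hβ' : β' ∈ Θ) :
    ‖psi m h z β - psi m h z β'‖ ≤ 2 * env K z * ‖β - β'‖ := by
  have hK := R.K_nonneg z.1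
  have e : psi m h z β - psi m h z β' =
      (z.2 - m z.1 β) • (h z.1 β - h z.1 β') - (m z.1 β - m z.1 β') • h z.1 β' := by
    simp only [psi]; module
  rw [e]
  refine (norm_sub_le _ _).trans ?_
  rw [norm_smul, norm_smul, Real.norm_eq_abs, Real.norm_eq_abs]
  have h1 := mul_le_mul (R.res_le z hβ) (R.h_lip z.1 β hβ β' hβ') (norm_nonneg _) (by positivity)
  have h2 := mul_le_mul (R.m_lip z.1 β hβ β' hβ') (R.h_bdd z.1 β' hβ') (norm_nonneg _)
    (by positivity)
  have h3 : 0 ≤ |z.2| * K z.1 * ‖β - β'‖ := by positivity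
  refine (add_le_add h1 h2).trans ?_
  unfold env
  nlinarith

theorem dpsi_le (z : Cov q × ℝ) : ‖dpsi m h β₀ z‖ ≤ 2 * env K z := by
  have hK := R.K_nonneg z.1
  rw [dpsi]
  refine (norm_sub_le _ _).trans ?_
  rw [norm_smul, Real.norm_eq_abs, ContinuousLinearMap.norm_smulRight_apply]
  have h1 := mul_le_mul (R.res_le z R.mem) (R.dh_bdd z.1) (norm_nonneg _) (by positivity)
  have h2 := mul_le_mul (R.dm_bdd z.1) (R.h_bdd z.1 β₀ R.mem) (norm_nonneg _) (by positivity)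
  have h3 : 0 ≤ |z.2| * K z.1 := by positivity
  refine (add_le_add h1 h2).trans ?_
  unfold env
  nlinarith

/-- Strict differentiability of the estimating function at `β₀` with an explicit modulus, linear in
the envelope. -/
theorem psi_lin (z : Cov q × ℝ) {β β' : Param p} (hβ : β ∈ Θ) (hβ' : β' ∈ Θ) {ρ : ℝ}
    (h1 : ‖β - β₀‖ ≤ ρ) (h2 : ‖β' - β₀‖ ≤ ρ) :
    ‖psi m h z β - psi m h z β' - dpsi m h β₀ z (β - β')‖ ≤
      4 * env K z * ρ * ‖β - β'‖ := by
  have hK := R.K_nonneg z.1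
  have hρ : 0 ≤ ρ := (norm_nonneg _).trans h1
  set v := β - β' with hv
  have e : psi m h z β - psi m h z β' - dpsi m h β₀ z v =
      -((m z.1 β - m z.1 β' - fderiv ℝ (m z.1) β₀ v) • h z.1 β)
      - (fderiv ℝ (m z.1) β₀ v) • (h z.1 β - h z.1 β₀)
      + ((z.2 - m z.1 β') • (h z.1 β - h z.1 β' - fderiv ℝ (h z.1) β₀ v)
      - (m z.1 β' - m z.1 β₀) • fderiv ℝ (h z.1) β₀ v) := by
    simp only [psi, dpsi, sub_apply, smul_apply,
      ContinuousLinearMap.smulRight_apply]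
    module
  rw [e]
  have n1 : ‖-((m z.1 β - m z.1 β' - fderiv ℝ (m z.1) β₀ v) • h z.1 β)‖ ≤
      (K z.1 * ρ * ‖v‖) * K z.1 := by
    rw [norm_neg, norm_smul, Real.norm_eq_abs]
    exact mul_le_mul (R.m_lin _ _ hβ _ hβ' _ h1 h2) (R.h_bdd _ _ hβ) (norm_nonneg _)
      (by positivity)
  have n2 : ‖(fderiv ℝ (m z.1) β₀ v) • (h z.1 β - h z.1 β₀)‖ ≤ (K z.1 * ‖v‖) * (K z.1 * ρ) := by
    rw [norm_smul]
    refine mul_le_mul (ContinuousLinearMap.le_of_opNorm_le _ (R.dm_bdd _) _) ?_ (norm_nonneg _)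
      (by positivity)
    exact (R.h_lip _ _ hβ _ R.mem).trans (by gcongr)
  have n3 : ‖(z.2 - m z.1 β') • (h z.1 β - h z.1 β' - fderiv ℝ (h z.1) β₀ v)‖ ≤
      (|z.2| + K z.1) * (K z.1 * ρ * ‖v‖) := by
    rw [norm_smul]
    exact mul_le_mul (R.res_le _ hβ') (R.h_lin _ _ hβ _ hβ' _ h1 h2) (norm_nonneg _)
      (by positivity)
  have n4 : ‖(m z.1 β' - m z.1 β₀) • fderiv ℝ (h z.1) β₀ v‖ ≤ (K z.1 * ρ) * (K z.1 * ‖v‖) := by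
    rw [norm_smul]
    refine mul_le_mul ((R.m_lip _ _ hβ' _ R.mem).trans (by gcongr))
      (ContinuousLinearMap.le_of_opNorm_le _ (R.dh_bdd _) _) (norm_nonneg _) (by positivity)
  refine (norm_add_le _ _).trans
    ((add_le_add ((norm_sub_le _ _).trans (add_le_add n1 n2))
      ((norm_sub_le _ _).trans (add_le_add n3 n4))).trans ?_)
  have : 0 ≤ |z.2| * K z.1 * ρ * ‖v‖ := by positivity
  unfold env
  nlinarith

end Regular

/-! ### Averages over a sample -/

/-- Average of `f` over a sample that contains unit `i` with multiplicity `c i`. -/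
noncomputable def smean {E : Type*} [AddCommGroup E] [Module ℝ E] (c : Fin N → ℕ) (f : Fin N → E) : E :=
  (∑ i, (c i : ℝ))⁻¹ • ∑ i, (c i : ℝ) • f i

section Smean

variable {E F : Type*} [NormedAddCommGroup E] [NormedSpace ℝ E] [NormedAddCommGroup F]
  [NormedSpace ℝ F] (c : Fin N → ℕ)

theorem smean_add (f g : Fin N → E) : smean c (fun i => f i + g i) = smean c f + smean c g := by
  simp [smean, smul_add, Finset.sum_add_distrib]

theorem smean_sub (f g : Fin N → E) : smean c (fun i => f i - g i) = smean c f - smean c g := by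
  simp [smean, smul_sub, Finset.sum_sub_distrib]

theorem map_smean (φ : E →L[ℝ] F) (f : Fin N → E) : φ (smean c f) = smean c fun i => φ (f i) := by
  simp [smean]

theorem smean_mul_const (f : Fin N → ℝ) (a : ℝ) : smean c (fun i => f i * a) = smean c f * a := by
  simp only [smean, smul_eq_mul, ← mul_assoc, ← Finset.sum_mul]

theorem smean_const_mul (f : Fin N → ℝ) (a : ℝ) : smean c (fun i => a * f i) = a * smean c f := by
  simp_rw [mul_comm a, smean_mul_const]

theorem norm_smean_le (f : Fin N → E) : ‖smean c f‖ ≤ smean c fun i => ‖f i‖ := by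
  have h0 : (0 : ℝ) ≤ ∑ i, (c i : ℝ) := by positivity
  rw [smean, smean, norm_smul, Real.norm_of_nonneg (by positivity), smul_eq_mul]
  gcongr
  refine (norm_sum_le _ _).trans (Finset.sum_le_sum fun i _ => ?_)
  simp [norm_smul]

theorem smean_mono {f g : Fin N → ℝ} (h : ∀ i, f i ≤ g i) : smean c f ≤ smean c g := by
  simp only [smean, smul_eq_mul]
  gcongr with i
  exact h i

theorem smean_nonneg {f : Fin N → ℝ} (h : ∀ i, 0 ≤ f i) : 0 ≤ smean c f := by
  simp only [smean, smul_eq_mul]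
  exact mul_nonneg (by positivity) (Finset.sum_nonneg fun i _ => mul_nonneg (by positivity) (h i))

theorem smean_clm_apply (D : Fin N → E →L[ℝ] F) (v : E) :
    smean c D v = smean c fun i => D i v := by
  simp [smean]

end Smean

theorem smean_ofSample (B : Finset (Fin N)) (f : Fin N → ℝ) : smean (ofSample B) f = avg B f := by
  simp [smean, avg, ofSample]

theorem estFun_eq_smean (m : Cov q → Param p → ℝ) (h : Cov q → Param p → Param p)
    (pop : Pop q N) (c : Fin N → ℕ) (β : Param p) :
    estFun m h pop c β = smean c fun i => psi m h (pop i) β := rfl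

theorem meanEstFun_eq_smean (m : Cov q → Param p → ℝ) (h : Cov q → Param p → Param p)
    (β₀ : Param p) (pop : Pop q N) (B : Finset (Fin N)) (β : Param p) :
    meanEstFun m h β₀ pop B β =
      smean (ofSample B) fun i => psi m h ((pop i).1, m (pop i).1 β₀) β := by
  simp [meanEstFun, smean, psi, ofSample]

end

section

/-! ### Zeros of perturbed estimating functions -/

section Zeros

variable {E : Type*} [NormedAddCommGroup E] [NormedSpace ℝ E]

/-- A lower bound on a function at distance `ρ` of its zero passes to its linearization. -/
theorem le_norm_of_taylor {G : E → E} {D : E →L[ℝ] E} {Θ : Set E} {β₀ : E} {c M ρ : ℝ}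
    (hρ : 0 < ρ) (hball : Metric.closedBall β₀ ρ ⊆ Θ) (hMρ : M * ρ ≤ c / 4)
    (hG0 : G β₀ = 0) (hG : ∀ β ∈ Θ, c * ‖β - β₀‖ ≤ ‖G β‖)
    (hT : ∀ β ∈ Θ, ‖β - β₀‖ ≤ ρ → ‖G β - G β₀ - D (β - β₀)‖ ≤ M * ρ * ‖β - β₀‖) (v : E) :
    3 * c / 4 * ‖v‖ ≤ ‖D v‖ := by
  rcases eq_or_ne v 0 with rfl | hv
  · simp
  have hv' : 0 < ‖v‖ := norm_pos_iff.2 hv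
  set w := (ρ / ‖v‖) • v with hw
  have hnw : ‖w‖ = ρ := by
    rw [hw, norm_smul, Real.norm_of_nonneg (by positivity), div_mul_cancel₀ _ hv'.ne']
  have hmem : β₀ + w ∈ Θ := hball (by simp [hnw])
  have h1 := hG _ hmem
  have h2 := hT _ hmem (by simp [hnw])
  rw [add_sub_cancel_left, hG0, sub_zero] at h2
  rw [add_sub_cancel_left] at h1
  have h3 : ‖G (β₀ + w)‖ ≤ ‖G (β₀ + w) - D w‖ + ‖D w‖ := by
    simpa using norm_add_le (G (β₀ + w) - D w) (D w)
  have h4 : 3 * c / 4 * ‖w‖ ≤ ‖D w‖ := by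
    have := mul_le_mul_of_nonneg_right hMρ (norm_nonneg w)
    linarith
  rw [hw, map_smul, norm_smul, norm_smul, Real.norm_of_nonneg (by positivity)] at h4
  have : 0 < ρ / ‖v‖ := by positivity
  nlinarith

/-- If `F` is close to `G`, also in the derivative at `β₀`, and `G` grows linearly away from its
zero `β₀`, then `F` has a zero in `Θ`, all its zeros in `Θ` are close to `β₀`, and `F` is
bi-Lipschitz near `β₀`. -/
theorem zeros_of_perturbation [FiniteDimensional ℝ E] {F G : E → E} {DF DG : E →L[ℝ] E}
    {Θ : Set E} {β₀ : E} {c M ρ κ : ℝ} (hc : 0 < c) (hM : 0 ≤ M) (hρ : 0 < ρ)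
    (hball : Metric.closedBall β₀ ρ ⊆ Θ) (hMρ : M * ρ ≤ c / 4) (hκ : κ ≤ c * ρ / 4)
    (hG0 : G β₀ = 0) (hG : ∀ β ∈ Θ, c * ‖β - β₀‖ ≤ ‖G β‖)
    (hTG : ∀ β ∈ Θ, ‖β - β₀‖ ≤ ρ → ‖G β - G β₀ - DG (β - β₀)‖ ≤ M * ρ * ‖β - β₀‖)
    (hTF : ∀ β ∈ Θ, ∀ β' ∈ Θ, ‖β - β₀‖ ≤ ρ → ‖β' - β₀‖ ≤ ρ →
      ‖F β - F β' - DF (β - β')‖ ≤ M * ρ * ‖β - β'‖)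
    (hFG : ∀ β ∈ Θ, ‖F β - G β‖ ≤ κ) (hDFG : ‖DF - DG‖ ≤ c / 4) :
    (∃ β ∈ Θ, F β = 0) ∧ (∀ β ∈ Θ, F β = 0 → ‖β - β₀‖ ≤ ρ) ∧
      ∀ β ∈ Θ, ∀ β' ∈ Θ, ‖β - β₀‖ ≤ ρ → ‖β' - β₀‖ ≤ ρ → ‖β - β'‖ ≤ 4 / c * ‖F β - F β'‖ := by
  have hlow : ∀ v, c / 2 * ‖v‖ ≤ ‖DF v‖ := by
    intro v
    have h1 := le_norm_of_taylor hρ hball hMρ hG0 hG hTG v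
    have h2 : ‖(DF - DG) v‖ ≤ c / 4 * ‖v‖ := ContinuousLinearMap.le_of_opNorm_le _ hDFG v
    have h3 : ‖DG v‖ ≤ ‖DF v‖ + ‖(DF - DG) v‖ := by
      have := norm_sub_le (DF v) ((DF - DG) v)
      simpa using this
    linarith
  have hβ₀ : β₀ ∈ Θ := hball (by simp [hρ.le])
  refine ⟨?_, fun β hβ h0 => ?_, fun β hβ β' hβ' h1 h2 => ?_⟩
  · have hinj : Function.Injective (DF : E →ₗ[ℝ] E) := by
      refine (injective_iff_map_eq_zero _).2 fun v hv => ?_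
      have := hlow v
      have hv' : DF v = 0 := hv
      rw [hv', norm_zero] at this
      have h5 : ‖v‖ ≤ 0 := by
        by_contra hcon
        have : 0 < c / 2 * ‖v‖ := by
          have := not_le.1 hcon
          positivity
        linarith
      exact norm_le_zero_iff.1 h5
    have hsurj : Function.Surjective DF := (LinearMap.injective_iff_surjective
      (f := (DF : E →ₗ[ℝ] E))).1 hinj
    let r : DF.NonlinearRightInverse :=
      { toFun := Function.surjInv hsurj
        nnnorm := (2 / c).toNNReal
        bound' := fun y => by
          have := hlow (Function.surjInv hsurj y)
          rw [Function.surjInv_eq hsurj y] at this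
          rw [Real.coe_toNNReal _ (by positivity)]
          calc ‖Function.surjInv hsurj y‖ = 2 / c * (c / 2 * ‖Function.surjInv hsurj y‖) := by
                field_simp
            _ ≤ 2 / c * ‖y‖ := by gcongr
        right_inv' := fun y => Function.surjInv_eq hsurj y }
    have happ : ApproximatesLinearOn F DF (Metric.closedBall β₀ ρ) (M * ρ).toNNReal := by
      intro x hx y hy
      rw [Real.coe_toNNReal _ (by positivity)]
      exact hTF x (hball hx) y (hball hy) (by simpa [dist_eq_norm] using hx)
        (by simpa [dist_eq_norm] using hy)
    have := happ.surjOn_closedBall_of_nonlinearRightInverse r hρ.le subset_rfl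
    obtain ⟨β, hβ, hβ0⟩ := this (a := 0) (by
      have h0 := hFG β₀ hβ₀
      rw [hG0, sub_zero] at h0
      have e : r.nnnorm = (2 / c).toNNReal := rfl
      rw [Metric.mem_closedBall, dist_comm, dist_zero_right, e, Real.coe_toNNReal _ (by positivity),
        Real.coe_toNNReal _ (by positivity), inv_div]
      nlinarith)
    exact ⟨β, hball hβ, hβ0⟩
  · have h1 := hFG β hβ
    rw [h0, zero_sub, norm_neg] at h1
    have h2 := hG β hβ
    have : c * ‖β - β₀‖ ≤ c * ρ := by
      have : 0 < c * ρ := by positivity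
      linarith
    exact le_of_mul_le_mul_left this hc
  · have h3 := hTF β hβ β' hβ' h1 h2
    have h4 := hlow (β - β')
    have h5 : ‖DF (β - β')‖ ≤ ‖F β - F β'‖ + ‖F β - F β' - DF (β - β')‖ := by
      simpa using norm_sub_le (F β - F β') (F β - F β' - DF (β - β'))
    have h6 := mul_le_mul_of_nonneg_right hMρ (norm_nonneg (β - β'))
    have h7 : c / 4 * ‖β - β'‖ ≤ ‖F β - F β'‖ := by linarith
    calc ‖β - β'‖ = 4 / c * (c / 4 * ‖β - β'‖) := by field_simp
      _ ≤ _ := by gcongr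

end Zeros

end

section

/-! ### Solutions of the estimating equations for well-behaved samples -/

variable {p q N : ℕ}

theorem norm_le_sum_abs (v : Param p) : ‖v‖ ≤ ∑ j, |v j| := by
  conv_lhs => rw [← (EuclideanSpace.basisFun (Fin p) ℝ).sum_repr v]
  refine (norm_sum_le _ _).trans (Finset.sum_le_sum fun j _ => ?_)
  rw [norm_smul, OrthonormalBasis.norm_eq_one, mul_one]
  simp

theorem opNorm_le_sum_abs (D : Param p →L[ℝ] Param p) :
    ‖D‖ ≤ ∑ a : Fin p × Fin p, |D (EuclideanSpace.single a.2 1) a.1| := by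
  refine D.opNorm_le_bound (Finset.sum_nonneg fun _ _ => abs_nonneg _) fun v => ?_
  have hv : v = ∑ l, v l • EuclideanSpace.single l (1 : ℝ) := by
    conv_lhs => rw [← (EuclideanSpace.basisFun (Fin p) ℝ).sum_repr v]
    simp
  conv_lhs => rw [hv, map_sum]
  rw [Fintype.sum_prod_type_right, Finset.sum_mul]
  refine (norm_sum_le _ _).trans (Finset.sum_le_sum fun l _ => ?_)
  rw [map_smul, norm_smul, mul_comm]
  exact mul_le_mul (norm_le_sum_abs _) (PiLp.norm_apply_le v l) (norm_nonneg _)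
    (Finset.sum_nonneg fun _ _ => abs_nonneg _)

theorem smean_apply (c : Fin N → ℕ) (f : Fin N → Param p) (j : Fin p) :
    (smean c f) j = smean c fun i => f i j :=
  map_smean c (EuclideanSpace.proj j : Param p →L[ℝ] ℝ) f

/-- Constants for which samples are called well-behaved: `c` of the identification condition, a
bound `C` on averages of the envelope, the radius `ρ` of a ball about `β₀` in which estimating
functions are nearly linear, and the noise level `η` that can be tolerated on a finite `net`. -/
structure Tuning (Θ : Set (Param p)) (β₀ : Param p) where
  /-- slope of the mean estimating function -/
  c : ℝ
  /-- bound on averages of the envelope -/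
  C : ℝ
  /-- radius of a neighborhood of `β₀` -/
  ρ : ℝ
  /-- tolerated noise level -/
  η : ℝ
  /-- finite net of the parameter space -/
  net : Finset (Param p)
  c_pos : 0 < c
  C_nonneg : 0 ≤ C
  ρ_pos : 0 < ρ
  η_pos : 0 < η
  ball_subset : Metric.closedBall β₀ ρ ⊆ Θ
  ρ_le : 8 * (C + 1) * ρ ≤ c / 4
  η_le : η ≤ c * ρ / 16
  η_le' : η ≤ c / 8
  η_le_one : η ≤ 1
  net_subset : ↑net ⊆ Θ
  mem_net : β₀ ∈ net
  net_cover : ∀ β ∈ Θ, ∃ t ∈ net, 8 * (C + 1) * ‖β - t‖ ≤ c * ρ / 16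

/-- The radius, the noise level and the net depend on the identification constant and on the bound
for the envelope only, hence not on the stage. -/
theorem exists_tuning {Θ : Set (Param p)} {β₀ : Param p} (hΘ : IsCompact Θ)
    (hβ₀ : β₀ ∈ interior Θ) {c C : ℝ} (hc : 0 < c) (hC : 0 ≤ C) :
    ∃ t : Tuning Θ β₀, t.c = c ∧ t.C = C := by
  classical
  obtain ⟨r, hr, hball⟩ := Metric.nhds_basis_closedBall.mem_iff.1 (mem_interior_iff_mem_nhds.1 hβ₀)
  set ρ := min r (c / (32 * (C + 1))) with hρ
  have hρ0 : 0 < ρ := lt_min hr (by positivity)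
  have hρ1 : 8 * (C + 1) * ρ ≤ c / 4 := by
    calc 8 * (C + 1) * ρ ≤ 8 * (C + 1) * (c / (32 * (C + 1))) := by
          gcongr; exact min_le_right _ _
      _ = c / 4 := by field_simp; norm_num
  have hε : 0 < c * ρ / (128 * (C + 1)) := by positivity
  obtain ⟨T, hT, hTf, hcov⟩ := hΘ.finite_cover_balls hε
  refine ⟨{ c := c, C := C, ρ := ρ, η := min (c * ρ / 16) (min (c / 8) 1)
            net := insert β₀ hTf.toFinset
            c_pos := hc, C_nonneg := hC, ρ_pos := hρ0
            η_pos := lt_min (by positivity) (lt_min (by positivity) one_pos)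
            ball_subset := (Metric.closedBall_subset_closedBall (min_le_left _ _)).trans hball
            ρ_le := hρ1, η_le := min_le_left _ _
            η_le' := (min_le_right _ _).trans (min_le_left _ _)
            η_le_one := (min_le_right _ _).trans (min_le_right _ _)
            net_subset := ?_, mem_net := Finset.mem_insert_self _ _
            net_cover := ?_ }, rfl, rfl⟩
  · intro t ht
    rcases Finset.mem_insert.1 (Finset.mem_coe.1 ht) with rfl | ht
    · exact interior_subset hβ₀
    · exact hT (hTf.mem_toFinset.1 ht)
  · intro β hβ
    obtain ⟨t, ht, hβt⟩ := Set.mem_iUnion₂.1 (hcov hβ)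
    refine ⟨t, Finset.mem_insert_of_mem (hTf.mem_toFinset.2 ht), ?_⟩
    have : ‖β - t‖ ≤ c * ρ / (128 * (C + 1)) := by
      rw [← dist_eq_norm]; exact (Metric.mem_ball.1 hβt).le
    calc 8 * (C + 1) * ‖β - t‖ ≤ 8 * (C + 1) * (c * ρ / (128 * (C + 1))) := by gcongr
      _ = c * ρ / 16 := by field_simp; norm_num

section

variable (m : Cov q → Param p → ℝ) (h : Cov q → Param p → Param p) (K : Cov q → ℝ)
  {Θ : Set (Param p)} {β₀ : Param p} (τ : Tuning Θ β₀)

/-- Labels of the test functions for the noise in a sample: coordinates of `h` at the points of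
the net, and partial derivatives of `h` at `β₀`. -/
abbrev NoiseIdx : Type := (↥τ.net × Fin p) ⊕ (Fin p × Fin p)

/-- Test functions for the noise in a sample. -/
noncomputable def noiseTest : NoiseIdx τ → Cov q → ℝ
  | .inl a => fun x => h x a.1 a.2
  | .inr a => fun x => fderiv ℝ (h x) β₀ (EuclideanSpace.single a.2 1) a.1

/-- Total size of the averages over `B` of the errors `e_i`, weighted by the test functions. -/
noncomputable def noiseSize (pop : Pop q N) (B : Finset (Fin N)) : ℝ :=
  ∑ a, |smean (ofSample B) fun i => ((pop i).2 - m (pop i).1 β₀) * noiseTest h τ a (pop i).1|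

/-- Labels of the test functions for a resample: coordinates of the estimating function at the
points of the net and at a further point `b`, entries of its derivative at `β₀`, and the
envelope. -/
abbrev BootIdx : Type := (↥τ.net × Fin p) ⊕ (Fin p ⊕ ((Fin p × Fin p) ⊕ Unit))

/-- Test functions for a resample. -/
noncomputable def bootTest (pop : Pop q N) (b : Param p) : BootIdx τ → Fin N → ℝ
  | .inl a => fun i => psi m h (pop i) a.1 a.2
  | .inr (.inl j) => fun i => psi m h (pop i) b j
  | .inr (.inr (.inl a)) => fun i => dpsi m h β₀ (pop i) (EuclideanSpace.single a.2 1) a.1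
  | .inr (.inr (.inr _)) => fun i => env K (pop i)

/-- Total deviation of the averages of the test functions over a resample with multiplicities `c`
from their averages over `B`. -/
noncomputable def bootSize (pop : Pop q N) (B : Finset (Fin N)) (b : Param p) (c : Fin N → ℕ) : ℝ :=
  ∑ a, |smean c (bootTest m h K τ pop b a) - smean (ofSample B) (bootTest m h K τ pop b a)|

/-- A well-behaved sample `B`: the envelope has a bounded average, the mean estimating function
identifies `β₀`, and the noise is small. -/
structure GoodSample (pop : Pop q N) (B : Finset (Fin N)) : Prop where
  env_le : smean (ofSample B) (fun i => env K (pop i)) ≤ τ.C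
  ident : ∀ β ∈ Θ, τ.c * ‖β - β₀‖ ≤ ‖meanEstFun m h β₀ pop B β‖
  noise : noiseSize m h τ pop B ≤ τ.η

/-- Derivative at `β₀` of the estimating function. -/
noncomputable def dEst (β₀ : Param p) (pop : Pop q N) (c : Fin N → ℕ) : Param p →L[ℝ] Param p :=
  smean c fun i => dpsi m h β₀ (pop i)

/-- The average of `h_i ṁ_i'` over `B`, as a linear map. -/
noncomputable def jacMap (β₀ : Param p) (pop : Pop q N) (B : Finset (Fin N)) :
    Param p →L[ℝ] Param p :=
  smean (ofSample B) fun i => (fderiv ℝ (m (pop i).1) β₀).smulRight (h (pop i).1 β₀)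

variable {m h K τ}

theorem noiseSize_nonneg (pop : Pop q N) (B : Finset (Fin N)) : 0 ≤ noiseSize m h τ pop B :=
  Finset.sum_nonneg fun _ _ => abs_nonneg _

theorem bootSize_nonneg (pop : Pop q N) (B : Finset (Fin N)) (b : Param p) (c : Fin N → ℕ) :
    0 ≤ bootSize m h K τ pop B b c :=
  Finset.sum_nonneg fun _ _ => abs_nonneg _

theorem noise_net_le (pop : Pop q N) (B : Finset (Fin N)) {t : Param p} (ht : t ∈ τ.net) :
    ‖smean (ofSample B) fun i => ((pop i).2 - m (pop i).1 β₀) • h (pop i).1 t‖ ≤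
      noiseSize m h τ pop B := by
  refine (norm_le_sum_abs _).trans ?_
  rw [noiseSize, Fintype.sum_sum_type, Fintype.sum_prod_type]
  refine le_trans ?_ (le_add_of_nonneg_right (Finset.sum_nonneg fun _ _ => abs_nonneg _))
  refine le_trans (le_of_eq ?_) (Finset.single_le_sum (f := fun t : τ.net => ∑ j,
    |smean (ofSample B) fun i => ((pop i).2 - m (pop i).1 β₀) *
      noiseTest h τ (.inl (t, j)) (pop i).1|) (fun _ _ => Finset.sum_nonneg fun _ _ => abs_nonneg _)
      (Finset.mem_univ ⟨t, ht⟩))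
  refine Finset.sum_congr rfl fun j _ => ?_
  rw [smean_apply]
  rfl

theorem dnoise_le (pop : Pop q N) (B : Finset (Fin N)) :
    ‖dEst m h β₀ pop (ofSample B) + jacMap m h β₀ pop B‖ ≤ noiseSize m h τ pop B := by
  refine (opNorm_le_sum_abs _).trans ?_
  rw [noiseSize, Fintype.sum_sum_type]
  refine le_trans (le_of_eq ?_) (le_add_of_nonneg_left (Finset.sum_nonneg fun _ _ => abs_nonneg _))
  refine Finset.sum_congr rfl fun a _ => ?_
  rw [dEst, jacMap, ← smean_add, smean_clm_apply, smean_apply]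
  simp [dpsi, noiseTest]

theorem boot_net_le (pop : Pop q N) (B : Finset (Fin N)) (b : Param p) (c : Fin N → ℕ)
    {t : Param p} (ht : t ∈ τ.net) :
    ‖estFun m h pop c t - estFun m h pop (ofSample B) t‖ ≤ bootSize m h K τ pop B b c := by
  refine (norm_le_sum_abs _).trans ?_
  rw [bootSize, Fintype.sum_sum_type, Fintype.sum_prod_type]
  refine le_trans ?_ (le_add_of_nonneg_right (Finset.sum_nonneg fun _ _ => abs_nonneg _))
  refine le_trans (le_of_eq ?_) (Finset.single_le_sum (f := fun t : τ.net => ∑ j,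
    |smean c (bootTest m h K τ pop b (.inl (t, j))) -
      smean (ofSample B) (bootTest m h K τ pop b (.inl (t, j)))|)
      (fun _ _ => Finset.sum_nonneg fun _ _ => abs_nonneg _) (Finset.mem_univ ⟨t, ht⟩))
  refine Finset.sum_congr rfl fun j _ => ?_
  rw [PiLp.sub_apply, estFun_eq_smean, estFun_eq_smean, smean_apply, smean_apply]
  rfl

theorem boot_point_le (pop : Pop q N) (B : Finset (Fin N)) (b : Param p) (c : Fin N → ℕ) :
    ‖estFun m h pop c b - estFun m h pop (ofSample B) b‖ ≤ bootSize m h K τ pop B b c := by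
  refine (norm_le_sum_abs _).trans ?_
  rw [bootSize, Fintype.sum_sum_type, Fintype.sum_sum_type]
  refine le_trans ?_ (le_add_of_nonneg_left (Finset.sum_nonneg fun _ _ => abs_nonneg _))
  refine le_trans ?_ (le_add_of_nonneg_right (Finset.sum_nonneg fun _ _ => abs_nonneg _))
  refine le_of_eq (Finset.sum_congr rfl fun j _ => ?_)
  rw [PiLp.sub_apply, estFun_eq_smean, estFun_eq_smean, smean_apply, smean_apply]
  rfl

theorem boot_deriv_le (pop : Pop q N) (B : Finset (Fin N)) (b : Param p) (c : Fin N → ℕ) :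
    ‖dEst m h β₀ pop c - dEst m h β₀ pop (ofSample B)‖ ≤ bootSize m h K τ pop B b c := by
  refine (opNorm_le_sum_abs _).trans ?_
  rw [bootSize, Fintype.sum_sum_type, Fintype.sum_sum_type, Fintype.sum_sum_type]
  refine le_trans ?_ (le_add_of_nonneg_left (Finset.sum_nonneg fun _ _ => abs_nonneg _))
  refine le_trans ?_ (le_add_of_nonneg_left (Finset.sum_nonneg fun _ _ => abs_nonneg _))
  refine le_trans ?_ (le_add_of_nonneg_right (Finset.sum_nonneg fun _ _ => abs_nonneg _))
  refine le_of_eq (Finset.sum_congr rfl fun a _ => ?_)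
  rw [sub_apply, PiLp.sub_apply, dEst, dEst, smean_clm_apply, smean_clm_apply, smean_apply,
    smean_apply]
  rfl

theorem boot_env_le (pop : Pop q N) (B : Finset (Fin N)) (b : Param p) (c : Fin N → ℕ) :
    smean c (fun i => env K (pop i)) ≤
      smean (ofSample B) (fun i => env K (pop i)) + bootSize m h K τ pop B b c := by
  have key := Finset.single_le_sum (s := Finset.univ) (f := fun a : BootIdx τ =>
    |smean c (bootTest m h K τ pop b a) - smean (ofSample B) (bootTest m h K τ pop b a)|)
    (fun _ _ => abs_nonneg _) (Finset.mem_univ (Sum.inr (Sum.inr (Sum.inr ()))))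
  have : |smean c (fun i => env K (pop i)) - smean (ofSample B) (fun i => env K (pop i))| ≤
      bootSize m h K τ pop B b c := key
  linarith [le_abs_self (smean c (fun i => env K (pop i)) -
    smean (ofSample B) (fun i => env K (pop i)))]

variable (R : Regular m h K Θ β₀)
include R

theorem Regular.bootTest_le (pop : Pop q N) {b : Param p} (hb : b ∈ Θ) (a : BootIdx τ)
    (i : Fin N) : |bootTest m h K τ pop b a i| ≤ 2 * env K (pop i) := by
  have h0 := R.env_nonneg (pop i)
  rcases a with a | j | a | _
  · have h1 := PiLp.norm_apply_le (psi m h (pop i) a.1) a.2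
    have h2 := R.psi_le (pop i) (τ.net_subset a.1.2)
    change |psi m h (pop i) a.1 a.2| ≤ _
    rw [Real.norm_eq_abs] at h1
    linarith
  · have h1 := PiLp.norm_apply_le (psi m h (pop i) b) j
    have h2 := R.psi_le (pop i) hb
    change |psi m h (pop i) b j| ≤ _
    rw [Real.norm_eq_abs] at h1
    linarith
  · have h1 := PiLp.norm_apply_le (dpsi m h β₀ (pop i) (EuclideanSpace.single a.2 1)) a.1
    have h2 := ContinuousLinearMap.le_of_opNorm_le _ (R.dpsi_le (pop i))
      (EuclideanSpace.single a.2 (1 : ℝ))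
    change |dpsi m h β₀ (pop i) (EuclideanSpace.single a.2 1) a.1| ≤ _
    rw [PiLp.norm_single, norm_one, mul_one] at h2
    rw [Real.norm_eq_abs] at h1
    linarith
  · change |env K (pop i)| ≤ _
    rw [abs_of_nonneg h0]
    linarith

theorem Regular.noiseTest_le (a : NoiseIdx τ) (x : Cov q) : |noiseTest h τ a x| ≤ K x := by
  rcases a with a | a
  · exact (PiLp.norm_apply_le (h x a.1) a.2).trans (R.h_bdd x _ (τ.net_subset a.1.2))
  · refine (PiLp.norm_apply_le (fderiv ℝ (h x) β₀ (EuclideanSpace.single a.2 1)) a.1).trans ?_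
    simpa using ContinuousLinearMap.le_of_opNorm_le _ (R.dh_bdd x)
      (EuclideanSpace.single a.2 (1 : ℝ))

theorem Regular.measurable_noiseTest (a : NoiseIdx τ) : Measurable (noiseTest h τ a) := by
  rcases a with a | a
  · have : Measurable fun x => h x a.1 := R.meas_h.comp (measurable_id.prodMk measurable_const)
    exact (EuclideanSpace.proj a.2 : Param p →L[ℝ] ℝ).measurable.comp this
  · exact (EuclideanSpace.proj a.1 : Param p →L[ℝ] ℝ).measurable.comp (R.dh_meas _)

theorem Regular.estFun_taylor (pop : Pop q N) (c : Fin N → ℕ) {β β' : Param p} (hβ : β ∈ Θ)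
    (hβ' : β' ∈ Θ) {ρ : ℝ} (h1 : ‖β - β₀‖ ≤ ρ) (h2 : ‖β' - β₀‖ ≤ ρ) :
    ‖estFun m h pop c β - estFun m h pop c β' - dEst m h β₀ pop c (β - β')‖ ≤
      4 * smean c (fun i => env K (pop i)) * ρ * ‖β - β'‖ := by
  rw [estFun_eq_smean, estFun_eq_smean, dEst, smean_clm_apply, ← smean_sub, ← smean_sub]
  refine (norm_smean_le _ _).trans
    ((smean_mono c fun i => R.psi_lin (pop i) hβ hβ' h1 h2).trans (le_of_eq ?_))
  rw [smean_mul_const, smean_mul_const, smean_const_mul]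

theorem Regular.env_mean_le (z : Cov q × ℝ) : env K (z.1, m z.1 β₀) ≤ 2 * env K z := by
  have h0 := R.K_nonneg z.1
  have h1 := R.m_bdd z.1 β₀ R.mem
  have h2 := abs_nonneg z.2
  have h3 := mul_nonneg h2 h0
  unfold env
  simp only
  nlinarith

/-- The mean estimating function is an estimating function, of a population with the responses
`m(x_i; β₀)`. -/
theorem Regular.meanEstFun_taylor (pop : Pop q N) (B : Finset (Fin N)) {β : Param p}
    (hβ : β ∈ Θ) {ρ : ℝ} (h1 : ‖β - β₀‖ ≤ ρ) :
    ‖meanEstFun m h β₀ pop B β - meanEstFun m h β₀ pop B β₀ - (-jacMap m h β₀ pop B) (β - β₀)‖ ≤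
      8 * smean (ofSample B) (fun i => env K (pop i)) * ρ * ‖β - β₀‖ := by
  have hρ : 0 ≤ ρ := (norm_nonneg _).trans h1
  have := R.estFun_taylor (fun i => ((pop i).1, m (pop i).1 β₀)) (ofSample B) hβ R.mem h1
    (by simpa using hρ)
  have e : dEst m h β₀ (fun i => ((pop i).1, m (pop i).1 β₀)) (ofSample B) =
      -jacMap m h β₀ pop B := by
    have e1 : ∀ i, dpsi m h β₀ ((pop i).1, m (pop i).1 β₀) =
        -(fderiv ℝ (m (pop i).1) β₀).smulRight (h (pop i).1 β₀) := fun i => by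
      refine ContinuousLinearMap.ext fun v => ?_
      rw [dpsi, sub_apply, smul_apply, sub_self, zero_smul, zero_sub]
      rfl
    simp only [dEst, jacMap, smean, e1, smul_neg, Finset.sum_neg_distrib]
  rw [e] at this
  rw [meanEstFun_eq_smean, meanEstFun_eq_smean]
  refine this.trans ?_
  have h2 : smean (ofSample B) (fun i => env K ((pop i).1, m (pop i).1 β₀)) ≤
      2 * smean (ofSample B) (fun i => env K (pop i)) := by
    rw [← smean_const_mul]
    exact smean_mono _ fun i => R.env_mean_le (pop i)
  have h3 : 0 ≤ ρ * ‖β - β₀‖ := by positivity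
  nlinarith

/-- A bound on the noise at the points of the net is a bound on all of `Θ`, because the estimating
function is Lipschitz with constant controlled by the average of the envelope. -/
theorem Regular.noise_le (pop : Pop q N) (B : Finset (Fin N)) (g : GoodSample m h K τ pop B)
    {β : Param p} (hβ : β ∈ Θ) :
    ‖estFun m h pop (ofSample B) β - meanEstFun m h β₀ pop B β‖ ≤ τ.c * τ.ρ / 8 := by
  obtain ⟨t, ht, hβt⟩ := τ.net_cover β hβ
  have htΘ := τ.net_subset ht
  have e : estFun m h pop (ofSample B) β - meanEstFun m h β₀ pop B β =
      smean (ofSample B) fun i => ((pop i).2 - m (pop i).1 β₀) • h (pop i).1 β := by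
    rw [estFun_eq_smean, meanEstFun_eq_smean, ← smean_sub]
    congr 1
    ext1 i
    simp only [psi]
    module
  have e2 : (smean (ofSample B) fun i => ((pop i).2 - m (pop i).1 β₀) • h (pop i).1 β) =
      (smean (ofSample B) fun i => ((pop i).2 - m (pop i).1 β₀) • h (pop i).1 t) +
      smean (ofSample B) fun i =>
        ((pop i).2 - m (pop i).1 β₀) • (h (pop i).1 β - h (pop i).1 t) := by
    rw [← smean_add]
    congr 1
    ext1 i
    module
  rw [e, e2]
  have h1 := noise_net_le (m := m) (h := h) pop B ht
  have h2 : ‖smean (ofSample B) fun i =>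
      ((pop i).2 - m (pop i).1 β₀) • (h (pop i).1 β - h (pop i).1 t)‖ ≤
      smean (ofSample B) (fun i => env K (pop i)) * ‖β - t‖ := by
    rw [← smean_mul_const]
    refine (norm_smean_le _ _).trans (smean_mono _ fun i => ?_)
    rw [norm_smul, env, mul_assoc]
    have := R.K_nonneg (pop i).1
    exact mul_le_mul (R.res_le _ R.mem) (R.h_lip _ _ hβ _ htΘ) (norm_nonneg _) (by positivity)
  have h3 := g.env_le
  have h4 := g.noise
  have h5 := τ.η_le
  have h6 := τ.C_nonneg
  have h7 : smean (ofSample B) (fun i => env K (pop i)) * ‖β - t‖ ≤ 8 * (τ.C + 1) * ‖β - t‖ := by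
    gcongr
    linarith
  refine (norm_add_le _ _).trans ?_
  linarith

omit R in
theorem GoodSample.meanEstFun_self (pop : Pop q N) (B : Finset (Fin N)) :
    meanEstFun m h β₀ pop B β₀ = 0 := by
  simp [meanEstFun]

theorem Regular.smean_env_nonneg (pop : Pop q N) (c : Fin N → ℕ) :
    0 ≤ smean c fun i => env K (pop i) := smean_nonneg c fun i => R.env_nonneg (pop i)

/-- Zeros of the estimating function of multiplicities `c` that is close to the mean estimating
function of a well-behaved sample. -/
theorem Regular.zeros (pop : Pop q N) (B : Finset (Fin N)) (g : GoodSample m h K τ pop B)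
    (c : Fin N → ℕ) (h1 : smean c (fun i => env K (pop i)) ≤ τ.C + 1)
    (h2 : ∀ β ∈ Θ, ‖estFun m h pop c β - meanEstFun m h β₀ pop B β‖ ≤ τ.c * τ.ρ / 4)
    (h3 : ‖dEst m h β₀ pop c + jacMap m h β₀ pop B‖ ≤ τ.c / 4) :
    (∃ β ∈ Θ, estFun m h pop c β = 0) ∧ (∀ β ∈ Θ, estFun m h pop c β = 0 → ‖β - β₀‖ ≤ τ.ρ) ∧
      ∀ β ∈ Θ, ∀ β' ∈ Θ, ‖β - β₀‖ ≤ τ.ρ → ‖β' - β₀‖ ≤ τ.ρ →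
        ‖β - β'‖ ≤ 4 / τ.c * ‖estFun m h pop c β - estFun m h pop c β'‖ := by
  have hC := τ.C_nonneg
  have hρ := τ.ρ_pos
  refine zeros_of_perturbation τ.c_pos (by positivity : 0 ≤ 8 * (τ.C + 1)) τ.ρ_pos τ.ball_subset
    τ.ρ_le le_rfl (GoodSample.meanEstFun_self pop B) g.ident (fun β hβ hβρ => ?_)
    (fun β hβ β' hβ' hρ1 hρ2 => ?_) h2 (DG := -jacMap m h β₀ pop B) (by simpa using h3)
  · refine (R.meanEstFun_taylor pop B hβ hβρ).trans ?_
    gcongr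
    linarith [g.env_le]
  · refine (R.estFun_taylor pop c hβ hβ' hρ1 hρ2).trans ?_
    have := R.smean_env_nonneg pop c
    gcongr
    all_goals linarith

variable {sol : Pop q N → (Fin N → ℕ) → Param p} (hsol : IsSolver m h Θ sol)
include hsol

/-- On a good sample the solution is a zero, within `τ.ρ` of `β₀`, and its
distance to `β₀` is at most a multiple of the noise. -/
theorem Regular.sample_root (pop : Pop q N) (B : Finset (Fin N)) (g : GoodSample m h K τ pop B) :
    estFun m h pop (ofSample B) (sol pop (ofSample B)) = 0 ∧
    ‖sol pop (ofSample B) - β₀‖ ≤ τ.ρ ∧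
    ‖sol pop (ofSample B) - β₀‖ ≤ 4 / τ.c * noiseSize m h τ pop B := by
  have h0 := noiseSize_nonneg (m := m) (h := h) (τ := τ) pop B
  have hc := τ.c_pos
  have hρ := τ.ρ_pos
  obtain ⟨h1, h2, h3⟩ := R.zeros pop B g (ofSample B) (by linarith [g.env_le])
    (fun β hβ => (R.noise_le pop B g hβ).trans (by
      have : 0 < τ.c * τ.ρ := by positivity
      linarith))
    ((dnoise_le (τ := τ) pop B).trans (by linarith [g.noise, τ.η_le']))
  have hroot := hsol.root pop _ h1
  have hmem := hsol.mem pop (ofSample B)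
  have hclose := h2 _ hmem hroot
  refine ⟨hroot, hclose, ?_⟩
  refine (h3 _ hmem β₀ R.mem hclose (by simpa using hρ.le)).trans ?_
  rw [hroot, zero_sub, norm_neg, estFun_eq_smean]
  gcongr
  exact noise_net_le pop B τ.mem_net

/-- Linearization of the solution for a well-behaved sample. -/
theorem Regular.sample_linear (pop : Pop q N) (B : Finset (Fin N))
    (g : GoodSample m h K τ pop B) (J : Param p →L[ℝ] Param p) :
    ‖J (sol pop (ofSample B) - β₀) - estFun m h pop (ofSample B) β₀‖ ≤
      (4 * τ.C * ‖sol pop (ofSample B) - β₀‖ + noiseSize m h τ pop B + ‖jacMap m h β₀ pop B - J‖) *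
        ‖sol pop (ofSample B) - β₀‖ := by
  obtain ⟨h1, h2, h3⟩ := R.sample_root hsol pop B g
  set b := sol pop (ofSample B)
  have hb : b ∈ Θ := hsol.mem _ _
  have hT := R.estFun_taylor pop (ofSample B) hb R.mem le_rfl (by simp : ‖β₀ - β₀‖ ≤ ‖b - β₀‖)
  rw [h1, zero_sub] at hT
  set D := dEst m h β₀ pop (ofSample B)
  set A := jacMap m h β₀ pop B
  have e : J (b - β₀) - estFun m h pop (ofSample B) β₀ =
      (-estFun m h pop (ofSample B) β₀ - D (b - β₀)) + (D + A) (b - β₀) - (A - J) (b - β₀) := by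
    simp only [add_apply, sub_apply]
    abel
  rw [e]
  have n1 : ‖(D + A) (b - β₀)‖ ≤ noiseSize m h τ pop B * ‖b - β₀‖ :=
    ContinuousLinearMap.le_of_opNorm_le _ (dnoise_le pop B) _
  have n2 : ‖(A - J) (b - β₀)‖ ≤ ‖A - J‖ * ‖b - β₀‖ := ContinuousLinearMap.le_opNorm _ _
  have n3 : 4 * smean (ofSample B) (fun i => env K (pop i)) * ‖b - β₀‖ * ‖b - β₀‖ ≤
      4 * τ.C * ‖b - β₀‖ * ‖b - β₀‖ := by
    gcongr
    exact g.env_le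
  refine (norm_sub_le _ _).trans ((add_le_add ((norm_add_le _ _).trans
    (add_le_add (hT.trans n3) n1)) n2).trans (le_of_eq ?_))
  ring

/-- Zeros for a resample whose deviation from the well-behaved sample `B` is small. -/
theorem Regular.boot_root (pop : Pop q N) (B : Finset (Fin N)) (g : GoodSample m h K τ pop B)
    (c : Fin N → ℕ) (hW : bootSize m h K τ pop B (sol pop (ofSample B)) c ≤ τ.η) :
    estFun m h pop c (sol pop c) = 0 ∧
    ‖sol pop c - sol pop (ofSample B)‖ ≤
      4 / τ.c * bootSize m h K τ pop B (sol pop (ofSample B)) c := by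
  have hc := τ.c_pos
  have hρ := τ.ρ_pos
  have hC := τ.C_nonneg
  obtain ⟨r1, r2, -⟩ := R.sample_root hsol pop B g
  set b := sol pop (ofSample B) with hb_def
  have hb : b ∈ Θ := hsol.mem _ _
  set W := bootSize m h K τ pop B b c with hWdef
  have henv : smean c (fun i => env K (pop i)) ≤ τ.C + 1 := by
    have := boot_env_le (m := m) (h := h) (K := K) (τ := τ) pop B b c
    linarith [g.env_le, τ.η_le_one]
  have hsup : ∀ β ∈ Θ, ‖estFun m h pop c β - meanEstFun m h β₀ pop B β‖ ≤ τ.c * τ.ρ / 4 := by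
    intro β hβ
    obtain ⟨t, ht, hβt⟩ := τ.net_cover β hβ
    have htΘ := τ.net_subset ht
    have e : estFun m h pop c β - meanEstFun m h β₀ pop B β =
        (estFun m h pop c β - estFun m h pop c t) +
        (estFun m h pop c t - estFun m h pop (ofSample B) t) -
        (estFun m h pop (ofSample B) β - estFun m h pop (ofSample B) t) +
        (estFun m h pop (ofSample B) β - meanEstFun m h β₀ pop B β) := by abel
    have lip : ∀ c' : Fin N → ℕ, ‖estFun m h pop c' β - estFun m h pop c' t‖ ≤
        2 * smean c' (fun i => env K (pop i)) * ‖β - t‖ := by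
      intro c'
      rw [estFun_eq_smean, estFun_eq_smean, ← smean_sub]
      refine (norm_smean_le _ _).trans
        ((smean_mono c' fun i => R.psi_lip (pop i) hβ htΘ).trans (le_of_eq ?_))
      rw [smean_mul_const, smean_const_mul]
    have n1 := lip c
    have n2 := lip (ofSample B)
    have n3 := boot_net_le (m := m) (h := h) (K := K) pop B b c ht
    have n4 := R.noise_le pop B g hβ
    have hn := norm_nonneg (β - t)
    have n5 : 2 * smean c (fun i => env K (pop i)) * ‖β - t‖ ≤ 2 * (τ.C + 1) * ‖β - t‖ := by gcongr
    have n6 : 2 * smean (ofSample B) (fun i => env K (pop i)) * ‖β - t‖ ≤ 2 * τ.C * ‖β - t‖ := by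
      gcongr
      exact g.env_le
    rw [e]
    refine (norm_add_le _ _).trans ((add_le_add ((norm_sub_le _ _).trans
      (add_le_add (norm_add_le _ _) le_rfl)) le_rfl).trans ?_)
    have h5 := τ.η_le
    nlinarith
  have hder : ‖dEst m h β₀ pop c + jacMap m h β₀ pop B‖ ≤ τ.c / 4 := by
    have e : dEst m h β₀ pop c + jacMap m h β₀ pop B =
        (dEst m h β₀ pop c - dEst m h β₀ pop (ofSample B)) +
        (dEst m h β₀ pop (ofSample B) + jacMap m h β₀ pop B) := by abel
    rw [e]
    have n1 := boot_deriv_le (m := m) (h := h) (K := K) (τ := τ) pop B b c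
    have n2 := dnoise_le (m := m) (h := h) (τ := τ) pop B
    refine (norm_add_le _ _).trans ?_
    linarith [g.noise, τ.η_le']
  obtain ⟨h1, h2, h3⟩ := R.zeros pop B g c henv hsup hder
  have hroot := hsol.root pop _ h1
  have hmem := hsol.mem pop c
  refine ⟨hroot, (h3 _ hmem b hb (h2 _ hmem hroot) r2).trans ?_⟩
  have := boot_point_le (m := m) (h := h) (K := K) (τ := τ) pop B b c
  rw [r1, sub_zero] at this
  rw [hroot, zero_sub, norm_neg]
  gcongr

/-- For a well-behaved sample, the solution for an arbitrary resample is controlled by the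
deviation of the resample. When the deviation is not small, this holds because `Θ` is bounded. -/
theorem Regular.boot_dist_le {d : ℝ} (hd : ∀ β ∈ Θ, ∀ β' ∈ Θ, ‖β - β'‖ ≤ d) (pop : Pop q N)
    (B : Finset (Fin N)) (g : GoodSample m h K τ pop B) (c : Fin N → ℕ) :
    ‖sol pop c - sol pop (ofSample B)‖ ≤
      (4 / τ.c + d / τ.η) * bootSize m h K τ pop B (sol pop (ofSample B)) c := by
  have hc := τ.c_pos
  have hη := τ.η_pos
  have hd0 : 0 ≤ d := (norm_nonneg _).trans (hd _ (hsol.mem pop c) _ (hsol.mem pop c))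
  have hW0 := bootSize_nonneg (m := m) (h := h) (K := K) (τ := τ) pop B (sol pop (ofSample B)) c
  rcases le_or_gt (bootSize m h K τ pop B (sol pop (ofSample B)) c) τ.η with hW | hW
  · refine (R.boot_root hsol pop B g c hW).2.trans ?_
    gcongr
    have : 0 ≤ d / τ.η := by positivity
    linarith
  · refine (hd _ (hsol.mem pop c) _ (hsol.mem pop _)).trans ?_
    calc d = d / τ.η * τ.η := by field_simp
      _ ≤ (4 / τ.c + d / τ.η) * bootSize m h K τ pop B (sol pop (ofSample B)) c := by
        gcongr
        have : 0 ≤ 4 / τ.c := by positivity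
        linarith

/-- Linearization of the solution for a resample from a well-behaved sample. -/
theorem Regular.boot_linear {d : ℝ} (hd : ∀ β ∈ Θ, ∀ β' ∈ Θ, ‖β - β'‖ ≤ d) (pop : Pop q N)
    (B : Finset (Fin N)) (g : GoodSample m h K τ pop B) (J : Param p →L[ℝ] Param p) {k : ℝ}
    (hk : 4 / τ.c + d / τ.η ≤ k) (c : Fin N → ℕ) :
    ‖J (sol pop c - sol pop (ofSample B)) - estFun m h pop c (sol pop (ofSample B))‖ ≤
      (4 * (τ.C + 1) * (1 + k) * k + 2 * k + (1 + ‖J‖ * k) / τ.η) *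
        (‖sol pop (ofSample B) - β₀‖ + noiseSize m h τ pop B + ‖jacMap m h β₀ pop B - J‖ +
          bootSize m h K τ pop B (sol pop (ofSample B)) c) *
        bootSize m h K τ pop B (sol pop (ofSample B)) c := by
  have hc := τ.c_pos
  have hη := τ.η_pos
  have hC := τ.C_nonneg
  have hd0 : 0 ≤ d := (norm_nonneg _).trans (hd _ (hsol.mem pop c) _ (hsol.mem pop c))
  have hk0 : 0 ≤ k := le_trans (by positivity) hk
  have hnoise := noiseSize_nonneg (m := m) (h := h) (τ := τ) pop B
  have hW0 := bootSize_nonneg (m := m) (h := h) (K := K) (τ := τ) pop B (sol pop (ofSample B)) c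
  have hdist0 := R.boot_dist_le hsol hd pop B g c
  obtain ⟨r1, r2, -⟩ := R.sample_root hsol pop B g
  have hpt := boot_point_le (m := m) (h := h) (K := K) (τ := τ) pop B (sol pop (ofSample B)) c
  rw [r1, sub_zero] at hpt
  have henv0 := boot_env_le (m := m) (h := h) (K := K) (τ := τ) pop B (sol pop (ofSample B)) c
  have hder0 := boot_deriv_le (m := m) (h := h) (K := K) (τ := τ) pop B (sol pop (ofSample B)) c
  have hroot0 := R.boot_root hsol pop B g c
  set b := sol pop (ofSample B) with hb_def
  set b' := sol pop c
  have hb : b ∈ Θ := hsol.mem _ _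
  have hb' : b' ∈ Θ := hsol.mem _ _
  set W := bootSize m h K τ pop B b c with hWdef
  have hdist : ‖b' - b‖ ≤ k * W := hdist0.trans (by gcongr)
  set ε := ‖b - β₀‖ + noiseSize m h τ pop B + ‖jacMap m h β₀ pop B - J‖ with hε
  have hε0 : 0 ≤ ε := by positivity
  rcases le_or_gt W τ.η with hW | hW
  · obtain ⟨hroot, -⟩ := hroot0 hW
    have hT := R.estFun_taylor pop c hb' hb (ρ := ‖b - β₀‖ + ‖b' - b‖) (by
      rw [add_comm]; simpa using norm_add_le (b' - b) (b - β₀)) (by linarith [norm_nonneg (b' - b)])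
    rw [hroot, zero_sub] at hT
    set D := dEst m h β₀ pop c
    set D₀ := dEst m h β₀ pop (ofSample B)
    set A := jacMap m h β₀ pop B
    have e : J (b' - b) - estFun m h pop c b = (-estFun m h pop c b - D (b' - b)) +
        (D - D₀) (b' - b) + (D₀ + A) (b' - b) - (A - J) (b' - b) := by
      simp only [add_apply, sub_apply]
      abel
    have n0 : 4 * smean c (fun i => env K (pop i)) * (‖b - β₀‖ + ‖b' - b‖) * ‖b' - b‖ ≤
        4 * (τ.C + 1) * (ε + k * W) * (k * W) := by
      have h1 : smean c (fun i => env K (pop i)) ≤ τ.C + 1 := by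
        linarith [g.env_le, τ.η_le_one]
      have h2 : ‖b - β₀‖ ≤ ε := by
        have := norm_nonneg (A - J)
        linarith
      gcongr
    have n1 : ‖(D - D₀) (b' - b)‖ ≤ W * (k * W) :=
      (ContinuousLinearMap.le_of_opNorm_le _ hder0 _).trans (by gcongr)
    have n2 : ‖(D₀ + A) (b' - b)‖ ≤ noiseSize m h τ pop B * (k * W) :=
      (ContinuousLinearMap.le_of_opNorm_le _ (dnoise_le pop B) _).trans (by gcongr)
    have n3 : ‖(A - J) (b' - b)‖ ≤ ‖A - J‖ * (k * W) :=
      (ContinuousLinearMap.le_opNorm _ _).trans (by gcongr)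
    have n4 : noiseSize m h τ pop B * (k * W) + ‖A - J‖ * (k * W) ≤ ε * (k * W) := by
      rw [← add_mul]
      gcongr
      linarith [norm_nonneg (b - β₀)]
    have n5 : 4 * (τ.C + 1) * (ε + k * W) * (k * W) ≤
        4 * (τ.C + 1) * ((1 + k) * (ε + W)) * (k * W) := by
      gcongr
      nlinarith [mul_nonneg hk0 hε0]
    have n6 : W * (k * W) + ε * (k * W) ≤ 2 * k * (ε + W) * W := by
      have : 0 ≤ k * (ε + W) * W := by positivity
      linarith
    have n7 : 0 ≤ (1 + ‖J‖ * k) / τ.η * (ε + W) * W := by positivity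
    rw [e]
    refine (norm_sub_le _ _).trans ((add_le_add ((norm_add_le _ _).trans
      (add_le_add ((norm_add_le _ _).trans (add_le_add (hT.trans n0) n1)) n2)) n3).trans ?_)
    linarith
  -- for a large deviation `1 ≤ W / η`, so a bound linear in `W` is also quadratic
  · have n1 : ‖J (b' - b)‖ ≤ ‖J‖ * (k * W) := (J.le_opNorm _).trans (by gcongr)
    refine (norm_sub_le _ _).trans ((add_le_add n1 hpt).trans ?_)
    calc ‖J‖ * (k * W) + W = (1 + ‖J‖ * k) / τ.η * τ.η * W := by field_simp; ring
      _ ≤ (4 * (τ.C + 1) * (1 + k) * k + 2 * k + (1 + ‖J‖ * k) / τ.η) * (ε + W) * W := by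
        gcongr
        · have : 0 ≤ 4 * (τ.C + 1) * (1 + k) * k + 2 * k := by positivity
          linarith
        · linarith

end

end

section

/-! ### Second and fourth moments of sums -/

section Moments

variable {Ω : Type*} [MeasurableSpace Ω] {μ : Measure Ω}

/-- The Cauchy-Schwarz inequality for integrals of real functions. -/
theorem abs_integral_mul_le {f g : Ω → ℝ} (hf : MemLp f 2 μ) (hg : MemLp g 2 μ) :
    |∫ x, f x * g x ∂μ| ≤ √(∫ x, f x ^ 2 ∂μ) * √(∫ x, g x ^ 2 ∂μ) := by
  have hfg : Integrable (fun x => f x * g x) μ := hf.integrable_mul hg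
  have hf2 := hf.integrable_sq
  have hg2 := hg.integrable_sq
  have h : ∀ t : ℝ, 0 ≤ (∫ x, g x ^ 2 ∂μ) * (t * t) + (2 * ∫ x, f x * g x ∂μ) * t +
      ∫ x, f x ^ 2 ∂μ := by
    intro t
    have : 0 ≤ ∫ x, (f x + t * g x) ^ 2 ∂μ := integral_nonneg fun x => sq_nonneg _
    have e : ∫ x, (f x + t * g x) ^ 2 ∂μ =
        ∫ x, (f x ^ 2 + (2 * t) * (f x * g x) + (t * t) * g x ^ 2) ∂μ := by
      congr 1; ext x; ring
    rw [e, integral_add (hf2.fun_add (hfg.const_mul _)) (hg2.const_mul _),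
      integral_add hf2 (hfg.const_mul _), integral_const_mul, integral_const_mul] at this
    linarith
  have hd := discrim_le_zero h
  rw [discrim] at hd
  rw [← Real.sqrt_mul (integral_nonneg fun x => sq_nonneg _)]
  refine Real.abs_le_sqrt ?_
  linarith

theorem integrable_pow_four_add {f g : Ω → ℝ} (hfm : AEStronglyMeasurable f μ)
    (hgm : AEStronglyMeasurable g μ) (hf : Integrable (fun x => f x ^ 4) μ)
    (hg : Integrable (fun x => g x ^ 4) μ) : Integrable (fun x => (f x + g x) ^ 4) μ := by
  refine ((hf.add hg).const_mul 8).mono' ((hfm.add hgm).pow 4) (.of_forall fun x => ?_)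
  rw [Real.norm_of_nonneg (by positivity)]
  simp only [Pi.add_apply]
  nlinarith [sq_nonneg (f x - g x), sq_nonneg (f x + g x), sq_nonneg (f x ^ 2 - g x ^ 2),
    mul_nonneg (sq_nonneg (f x - g x)) (sq_nonneg (f x + g x)),
    sq_nonneg ((f x - g x) ^ 2), sq_nonneg (f x * (f x - g x)), sq_nonneg (g x * (f x - g x))]

theorem memLp_two_sq {f : Ω → ℝ} (hfm : AEStronglyMeasurable f μ)
    (hf : Integrable (fun x => f x ^ 4) μ) : MemLp (fun x => f x ^ 2) 2 μ := by
  refine (memLp_two_iff_integrable_sq (f := fun x => f x ^ 2) (hfm.pow 2)).2 ?_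
  simpa [← pow_mul] using hf

/-- Fourth moments of sums of martingale-like differences. -/
theorem integral_sum_pow_four_le {ι : Type*} (s : Finset ι) (X : ι → Ω → ℝ)
    (hm : ∀ i ∈ s, AEStronglyMeasurable (X i) μ)
    (hi : ∀ i ∈ s, Integrable (fun x => X i x ^ 4) μ)
    (horth : ∀ t ⊆ s, ∀ i ∈ s, i ∉ t → ∫ x, (∑ j ∈ t, X j x) ^ 3 * X i x ∂μ = 0) :
    Integrable (fun x => (∑ i ∈ s, X i x) ^ 4) μ ∧
      ∫ x, (∑ i ∈ s, X i x) ^ 4 ∂μ ≤ 16 * s.card * ∑ i ∈ s, ∫ x, X i x ^ 4 ∂μ := by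
  classical
  have key : ∀ t ⊆ s, Integrable (fun x => (∑ i ∈ t, X i x) ^ 4) μ ∧
      √(∫ x, (∑ i ∈ t, X i x) ^ 4 ∂μ) ≤ 4 * ∑ i ∈ t, √(∫ x, X i x ^ 4 ∂μ) := by
    intro t
    induction t using Finset.induction_on with
    | empty => intro; simp
    | insert i t hit ih =>
      intro hts
      obtain ⟨hti, hle⟩ := ih ((Finset.subset_insert _ _).trans hts)
      have his : i ∈ s := hts (Finset.mem_insert_self _ _)
      have hSm : AEStronglyMeasurable (fun x => ∑ i ∈ t, X i x) μ := by
        refine Finset.aestronglyMeasurable_fun_sum t fun j hj => ?_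
        exact hm j (hts (Finset.mem_insert_of_mem hj))
      have hXm := hm i his
      have hXi := hi i his
      set S : Ω → ℝ := fun x => ∑ i ∈ t, X i x with hS
      have hb : ∀ (f : Ω → ℝ), AEStronglyMeasurable f μ →
          (∀ x, |f x| ≤ S x ^ 4 + X i x ^ 4) → Integrable f μ := fun f hf hfb =>
        (hti.add hXi).mono' hf (.of_forall hfb)
      have i1 : Integrable (fun x => S x ^ 3 * X i x) μ := by
        refine hb _ ((hSm.pow 3).mul hXm) fun x => ?_
        rw [abs_le]
        constructor <;>
        nlinarith [sq_nonneg (S x ^ 2 - X i x ^ 2), sq_nonneg (S x * (S x - X i x)),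
          sq_nonneg (S x * (S x + X i x)), sq_nonneg (S x ^ 2), sq_nonneg (X i x ^ 2)]
      have i2 : Integrable (fun x => S x ^ 2 * X i x ^ 2) μ := by
        refine hb _ ((hSm.pow 2).mul (hXm.pow 2)) fun x => ?_
        rw [abs_of_nonneg (by positivity)]
        nlinarith [sq_nonneg (S x ^ 2 - X i x ^ 2), sq_nonneg (S x ^ 2), sq_nonneg (X i x ^ 2)]
      have hins : ∀ x, ∑ i ∈ insert i t, X i x = S x + X i x := fun x => by
        rw [Finset.sum_insert hit, add_comm]
      have hint : Integrable (fun x => (S x + X i x) ^ 4) μ :=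
        integrable_pow_four_add hSm hXm hti hXi
      simp_rw [hins]
      refine ⟨hint, ?_⟩
      have h1 : ∫ x, (S x + X i x) ^ 4 ∂μ ≤
          ∫ x, (S x ^ 4 + 4 * (S x ^ 3 * X i x) + 8 * (S x ^ 2 * X i x ^ 2) + 3 * X i x ^ 4) ∂μ := by
        refine integral_mono hint (((hti.add (i1.const_mul 4)).add (i2.const_mul 8)).add
          (hXi.const_mul 3)) fun x => ?_
        simp only
        nlinarith [sq_nonneg (X i x * (S x - X i x))]
      rw [integral_add ((hti.fun_add (i1.const_mul 4)).fun_add (i2.const_mul 8)) (hXi.const_mul 3),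
        integral_add (hti.fun_add (i1.const_mul 4)) (i2.const_mul 8),
        integral_add hti (i1.const_mul 4), integral_const_mul, integral_const_mul,
        integral_const_mul, horth t ((Finset.subset_insert _ _).trans hts) i his hit] at h1
      have h2 := abs_integral_mul_le (memLp_two_sq hSm hti) (memLp_two_sq hXm hXi)
      simp only [← pow_mul] at h2
      norm_num at h2
      have h3 := (le_abs_self _).trans h2
      set a := ∫ x, S x ^ 4 ∂μ
      set b := ∫ x, X i x ^ 4 ∂μ
      have ha : 0 ≤ a := integral_nonneg fun x => by positivity
      have hb' : 0 ≤ b := integral_nonneg fun x => by positivity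
      have h4 : ∫ x, (S x + X i x) ^ 4 ∂μ ≤ (√a + 4 * √b) ^ 2 := by
        have e1 := Real.sq_sqrt ha
        have e2 := Real.sq_sqrt hb'
        have e3 := mul_nonneg (Real.sqrt_nonneg a) (Real.sqrt_nonneg b)
        nlinarith
      rw [Finset.sum_insert hit]
      refine (Real.sqrt_le_left (by positivity)).2 h4 |>.trans ?_
      linarith
  obtain ⟨h1, h2⟩ := key s subset_rfl
  refine ⟨h1, ?_⟩
  have hnn : 0 ≤ ∫ x, (∑ i ∈ s, X i x) ^ 4 ∂μ := integral_nonneg fun x => by positivity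
  have h3 : ∫ x, (∑ i ∈ s, X i x) ^ 4 ∂μ ≤ (4 * ∑ i ∈ s, √(∫ x, X i x ^ 4 ∂μ)) ^ 2 :=
    (Real.sqrt_le_left (by positivity)).1 h2
  have h4 := sq_sum_le_card_mul_sum_sq (s := s) (f := fun i => √(∫ x, X i x ^ 4 ∂μ))
  have h5 : ∑ i ∈ s, √(∫ x, X i x ^ 4 ∂μ) ^ 2 = ∑ i ∈ s, ∫ x, X i x ^ 4 ∂μ :=
    Finset.sum_congr rfl fun i _ => Real.sq_sqrt (integral_nonneg fun x => by positivity)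
  rw [h5] at h4
  nlinarith

theorem integral_sum_sq_eq {ι : Type*} (s : Finset ι) (X : ι → Ω → ℝ)
    (hX : ∀ i ∈ s, MemLp (X i) 2 μ)
    (horth : ∀ i ∈ s, ∀ j ∈ s, i ≠ j → ∫ x, X i x * X j x ∂μ = 0) :
    ∫ x, (∑ i ∈ s, X i x) ^ 2 ∂μ = ∑ i ∈ s, ∫ x, X i x ^ 2 ∂μ := by
  have e : ∀ x, (∑ i ∈ s, X i x) ^ 2 = ∑ i ∈ s, ∑ j ∈ s, X i x * X j x := fun x => by
    rw [sq, Finset.sum_mul_sum]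
  have hij : ∀ i ∈ s, ∀ j ∈ s, Integrable (fun x => X i x * X j x) μ := fun i hi j hj =>
    (hX i hi).integrable_mul (hX j hj)
  simp_rw [e]
  rw [integral_finsetSum _ fun i hi => integrable_finsetSum _ fun j hj => hij i hi j hj]
  refine Finset.sum_congr rfl fun i hi => ?_
  rw [integral_finsetSum _ fun j hj => hij i hi j hj, Finset.sum_eq_single_of_mem i hi]
  · simp_rw [sq]
  · exact fun j hj hne => horth i hi j hj hne.symm

end Moments

/-! ### Redrawing one coordinate of a product measure -/

section Update

variable {ι : Type*} [Fintype ι] [DecidableEq ι] {X : ι → Type*} [∀ i, MeasurableSpace (X i)]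
  (μ : ∀ i, Measure (X i)) [∀ i, IsProbabilityMeasure (μ i)]

theorem measurePreserving_update (i : ι) :
    MeasurePreserving (fun z : (∀ i, X i) × X i => Function.update z.1 i z.2)
      ((Measure.pi μ).prod (μ i)) (Measure.pi μ) := by
  refine ⟨measurable_update', (Measure.pi_eq fun s hs => ?_).symm⟩
  rw [Measure.map_apply measurable_update' (MeasurableSet.univ_pi hs)]
  have : (fun z : (∀ i, X i) × X i => Function.update z.1 i z.2) ⁻¹' Set.univ.pi s =
      (Set.univ.pi (Function.update s i Set.univ)) ×ˢ s i := by
    ext ⟨ω, z⟩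
    simp only [Set.mem_preimage, Set.mem_univ_pi, Set.mem_prod]
    constructor
    · intro h
      refine ⟨fun j => ?_, by simpa using h i⟩
      rcases eq_or_ne j i with rfl | hj
      · simp
      · simpa [hj] using h j
    · rintro ⟨h, hz⟩ j
      rcases eq_or_ne j i with rfl | hj
      · simpa using hz
      · simpa [hj] using h j
  rw [this, Measure.prod_prod, Measure.pi_pi, ← Finset.mul_prod_erase _ _ (Finset.mem_univ i),
    ← Finset.mul_prod_erase _ (fun j => μ j (s j)) (Finset.mem_univ i)]
  rw [Function.update_self, measure_univ, one_mul, mul_comm]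
  congr 1
  refine Finset.prod_congr rfl fun j hj => ?_
  rw [Function.update_of_ne (Finset.ne_of_mem_erase hj)]

/-- A function whose integral over one coordinate vanishes, for all values of the others, has
integral zero. -/
theorem integral_pi_eq_zero (i : ι) {F : (∀ i, X i) → ℝ}
    (h : ∀ ω, ∫ z, F (Function.update ω i z) ∂μ i = 0) : ∫ ω, F ω ∂Measure.pi μ = 0 := by
  by_cases hF : Integrable F (Measure.pi μ)
  · have hmp := measurePreserving_update μ i
    have h1 : ∫ ω, F ω ∂Measure.pi μ =
        ∫ z, F (Function.update z.1 i z.2) ∂(Measure.pi μ).prod (μ i) := by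
      conv_lhs => rw [← hmp.map_eq]
      exact integral_map hmp.measurable.aemeasurable
        (by rw [hmp.map_eq]; exact hF.aestronglyMeasurable)
    rw [h1, integral_prod (fun z : (∀ i, X i) × X i => F (Function.update z.1 i z.2))
      (hmp.integrable_comp_of_integrable hF)]
    simp [h]
  · exact integral_undef hF

end Update

end

section

/-! ### Moments of averages over a with-replacement resample -/

variable {N : ℕ}

theorem integral_uniformOn {B : Finset (Fin N)} (a : Fin N → ℝ) :
    ∫ i, a i ∂uniformOn (B : Set (Fin N)) = avg B a := by
  rw [uniformOn, ProbabilityTheory.cond, integral_smul_measure, avg]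
  congr 1
  · rw [Measure.count_apply_finset]
    simp
  · rw [setIntegral_finset _ (Integrable.of_finite (μ := Measure.count)).integrableOn]
    simp

theorem sum_multiplicity {n : ℕ} (I : Fin n → Fin N) (a : Fin N → ℝ) :
    ∑ i, (multiplicity I i : ℝ) * a i = ∑ j, a (I j) := by
  rw [← Finset.sum_fiberwise Finset.univ I fun j => a (I j)]
  refine Finset.sum_congr rfl fun i _ => ?_
  rw [Finset.sum_congr rfl (g := fun _ => a i)
    (fun j hj => by rw [(Finset.mem_filter.1 hj).2]), Finset.sum_const, nsmul_eq_mul]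
  rfl

theorem smean_multiplicity {n : ℕ} (I : Fin n → Fin N) (a : Fin N → ℝ) :
    smean (multiplicity I) a = (n : ℝ)⁻¹ * ∑ j, a (I j) := by
  have h1 := sum_multiplicity I fun _ => (1 : ℝ)
  simp only [mul_one, Finset.sum_const, Finset.card_univ, Fintype.card_fin, nsmul_eq_mul] at h1
  simp only [smean, smul_eq_mul]
  rw [h1, sum_multiplicity]

theorem isProbabilityMeasure_uniformOn_finset {B : Finset (Fin N)} (hB : B.Nonempty) :
    IsProbabilityMeasure (uniformOn (B : Set (Fin N))) :=
  isProbabilityMeasure_uniformOn B.finite_toSet (Finset.coe_nonempty.2 hB)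

theorem integrable_resampleLaw (B : Finset (Fin N)) (f : (Fin N → ℕ) → ℝ) :
    Integrable f (resampleLaw B) := by
  have : IsFiniteMeasure (uniformOn (B : Set (Fin N))) := by
    rcases B.eq_empty_or_nonempty with rfl | hB
    · rw [Finset.coe_empty, uniformOn_empty_meas]
      infer_instance
    · have := isProbabilityMeasure_uniformOn_finset hB
      infer_instance
  exact (integrable_map_measure (measurable_of_countable f).aestronglyMeasurable
    (measurable_of_countable _).aemeasurable).2 .of_finite

theorem integral_resampleLaw (B : Finset (Fin N)) (f : (Fin N → ℕ) → ℝ) :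
    ∫ c, f c ∂resampleLaw B = ∫ I, f (multiplicity I)
      ∂Measure.pi fun _ : Fin B.card => uniformOn (B : Set (Fin N)) :=
  integral_map (measurable_of_countable _).aemeasurable
    (measurable_of_countable f).aestronglyMeasurable

section Centered

variable {B : Finset (Fin N)} (hB : B.Nonempty) (a : Fin N → ℝ)
include hB

theorem integral_pi_uniformOn_apply (j : Fin B.card) :
    ∫ I, a (I j) ∂Measure.pi (fun _ : Fin B.card => uniformOn (B : Set (Fin N))) = avg B a := by
  have := isProbabilityMeasure_uniformOn_finset hB
  rw [← integral_uniformOn]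
  have hmp := measurePreserving_eval (fun _ : Fin B.card => uniformOn (B : Set (Fin N))) j
  conv_rhs => rw [← hmp.map_eq]
  rw [integral_map hmp.measurable.aemeasurable (measurable_of_countable _).aestronglyMeasurable]

theorem integral_smean_resampleLaw :
    ∫ c, smean c a ∂resampleLaw B = avg B a := by
  have := isProbabilityMeasure_uniformOn_finset hB
  have hn : (B.card : ℝ) ≠ 0 := by simpa using hB.ne_empty
  rw [integral_resampleLaw]
  simp_rw [smean_multiplicity]
  rw [integral_const_mul, integral_finsetSum _ fun _ _ => .of_finite]
  simp_rw [integral_pi_uniformOn_apply hB]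
  simp [hn]

theorem integral_smean_sq_resampleLaw (ha : avg B a = 0) :
    ∫ c, smean c a ^ 2 ∂resampleLaw B = (B.card : ℝ)⁻¹ * avg B fun i => a i ^ 2 := by
  have := isProbabilityMeasure_uniformOn_finset hB
  have hn : (B.card : ℝ) ≠ 0 := by simpa using hB.ne_empty
  rw [integral_resampleLaw]
  simp_rw [smean_multiplicity, mul_pow]
  rw [integral_const_mul, integral_sum_sq_eq (μ := Measure.pi fun _ : Fin B.card =>
    uniformOn (B : Set (Fin N))) Finset.univ (fun j I => a (I j))]
  · simp_rw [integral_pi_uniformOn_apply hB fun i => a i ^ 2]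
    simp only [Finset.sum_const, Finset.card_univ, Fintype.card_fin, nsmul_eq_mul]
    field_simp
  · intro j _
    exact (memLp_two_iff_integrable_sq (measurable_of_countable _).aestronglyMeasurable).2
      .of_finite
  · intro j _ k _ hjk
    refine integral_pi_eq_zero _ j fun I => ?_
    simp only [Function.update_self, Function.update_of_ne hjk.symm]
    rw [integral_mul_const, integral_uniformOn, ha, zero_mul]

/-- Fourth-moment bound for the mean of a resample: the resampled units are independent and uniform on
`B`, so their mean deviates from the average over `B` by order `|B|^{-1/2}` in fourth mean. -/
theorem integral_smean_pow_four_resampleLaw :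
    ∫ c, (smean c a - avg B a) ^ 4 ∂resampleLaw B ≤
      256 * (B.card : ℝ)⁻¹ ^ 2 * avg B fun i => a i ^ 4 := by
  have := isProbabilityMeasure_uniformOn_finset hB
  have hn : (0 : ℝ) < B.card := by simpa using hB.card_pos
  set a' : Fin N → ℝ := fun i => a i - avg B a with ha'
  have hmean : avg B a' = 0 := by
    simp only [avg, ha', Finset.sum_sub_distrib, Finset.sum_const, nsmul_eq_mul, mul_sub]
    field_simp
    ring
  have e : ∀ I : Fin B.card → Fin N, smean (multiplicity I) a - avg B a =
      (B.card : ℝ)⁻¹ * ∑ j, a' (I j) := by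
    intro I
    rw [smean_multiplicity]
    simp only [ha', Finset.sum_sub_distrib, Finset.sum_const, Finset.card_univ, Fintype.card_fin,
      nsmul_eq_mul, mul_sub]
    field_simp
  rw [integral_resampleLaw]
  simp_rw [e, mul_pow]
  rw [integral_const_mul]
  have h1 := (integral_sum_pow_four_le (μ := Measure.pi fun _ : Fin B.card =>
    uniformOn (B : Set (Fin N))) Finset.univ (fun j I => a' (I j))
    (fun _ _ => (measurable_of_countable _).aestronglyMeasurable) (fun _ _ => .of_finite)
    (fun t _ j _ hj => by
      refine integral_pi_eq_zero _ j fun I => ?_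
      have h2 : ∀ z, ∑ k ∈ t, a' (Function.update I j z k) = ∑ k ∈ t, a' (I k) := fun z =>
        Finset.sum_congr rfl fun k hk => by
          rw [Function.update_of_ne (ne_of_mem_of_not_mem hk hj)]
      simp_rw [h2, Function.update_self]
      rw [integral_const_mul, integral_uniformOn, hmean, mul_zero])).2
  simp_rw [integral_pi_uniformOn_apply hB fun i => a' i ^ 4] at h1
  simp only [Finset.sum_const, Finset.card_univ, Fintype.card_fin, nsmul_eq_mul] at h1
  have h2 : avg B (fun i => a' i ^ 4) ≤ 16 * avg B fun i => a i ^ 4 := by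
    have hj : avg B a ^ 4 ≤ avg B fun i => a i ^ 4 := by
      have h3 := sq_sum_le_card_mul_sum_sq (s := B) (f := a)
      have h4 := sq_sum_le_card_mul_sum_sq (s := B) (f := fun i => a i ^ 2)
      simp only [← pow_mul] at h4
      norm_num at h4
      simp only [avg, mul_pow]
      have h5 : (∑ i ∈ B, a i) ^ 4 ≤ (B.card : ℝ) ^ 3 * ∑ i ∈ B, a i ^ 4 := by
        calc (∑ i ∈ B, a i) ^ 4 = ((∑ i ∈ B, a i) ^ 2) ^ 2 := by ring
          _ ≤ (B.card * ∑ i ∈ B, a i ^ 2) ^ 2 := by gcongr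
          _ = (B.card : ℝ) ^ 2 * (∑ i ∈ B, a i ^ 2) ^ 2 := by ring
          _ ≤ (B.card : ℝ) ^ 2 * (B.card * ∑ i ∈ B, a i ^ 4) := by gcongr
          _ = _ := by ring
      calc (B.card : ℝ)⁻¹ ^ 4 * (∑ i ∈ B, a i) ^ 4
          ≤ (B.card : ℝ)⁻¹ ^ 4 * ((B.card : ℝ) ^ 3 * ∑ i ∈ B, a i ^ 4) := by gcongr
        _ = _ := by field_simp
    have h6 : avg B (fun i => a' i ^ 4) ≤ avg B fun i => 8 * (a i ^ 4 + avg B a ^ 4) := by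
      unfold avg
      gcongr with i
      simp only [ha']
      set x := a i
      set y := avg B a
      change (x - y) ^ 4 ≤ 8 * (x ^ 4 + y ^ 4)
      nlinarith [sq_nonneg (x - y), sq_nonneg (x + y), sq_nonneg (x ^ 2 - y ^ 2),
        mul_nonneg (sq_nonneg (x - y)) (sq_nonneg (x + y)),
        sq_nonneg ((x + y) ^ 2), sq_nonneg (x * (x + y)), sq_nonneg (y * (x + y))]
    have h7 : avg B (fun i => 8 * (a i ^ 4 + avg B a ^ 4)) =
        8 * ((avg B fun i => a i ^ 4) + avg B a ^ 4) := by
      conv_lhs => rw [avg]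
      conv_rhs => rw [show (avg B fun i => a i ^ 4) = (B.card : ℝ)⁻¹ * ∑ i ∈ B, a i ^ 4 from rfl]
      rw [← Finset.mul_sum, Finset.sum_add_distrib, Finset.sum_const, nsmul_eq_mul]
      field_simp
    linarith
  calc (B.card : ℝ)⁻¹ ^ 4 * ∫ I, (∑ j, a' (I j)) ^ 4
        ∂Measure.pi (fun _ : Fin B.card => uniformOn (B : Set (Fin N)))
      ≤ (B.card : ℝ)⁻¹ ^ 4 * (16 * B.card * (B.card * (16 * avg B fun i => a i ^ 4))) := by
        gcongr
        exact h1.trans (by gcongr)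
    _ = _ := by field_simp; ring

end Centered

end

section

/-! ### The errors of the superpopulation model under ignorable selection -/

variable {p q : ℕ} {m : Cov q → Param p → ℝ} {h : Cov q → Param p → Param p} {K : Cov q → ℝ}
  {Θ : Set (Param p)} {β₀ : Param p}

/-- The error `y - m(x; β₀)` of a unit. -/
def err (m : Cov q → Param p → ℝ) (β₀ : Param p) (z : Cov q × ℝ) : ℝ := z.2 - m z.1 β₀

theorem Regular.measurable_m (R : Regular m h K Θ β₀) (β : Param p) :
    Measurable fun x => m x β := R.meas_m.comp (measurable_id.prodMk measurable_const)

theorem Regular.measurable_h (R : Regular m h K Θ β₀) (β : Param p) :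
    Measurable fun x => h x β := R.meas_h.comp (measurable_id.prodMk measurable_const)

theorem Regular.measurable_err (R : Regular m h K Θ β₀) : Measurable (err m β₀) :=
  measurable_snd.sub ((R.measurable_m β₀).comp measurable_fst)

theorem Regular.measurable_env (R : Regular m h K Θ β₀) : Measurable (env K) := by
  have := R.meas_K
  unfold env
  fun_prop

theorem Regular.abs_err_mul_le (R : Regular m h K Θ β₀) {a : Cov q → ℝ} {κ : ℝ}
    (ha : ∀ x, |a x| ≤ κ * K x) (z : Cov q × ℝ) : |err m β₀ z * a z.1| ≤ κ * env K z := by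
  have h0 := R.K_nonneg z.1
  have h1 := mul_le_mul (R.res_le z R.mem) (ha z.1) (abs_nonneg _) (by positivity)
  rw [abs_mul, env, err]
  linarith

namespace Stage

variable (S : Stage q)

instance : IsProbabilityMeasure S.popLaw := by unfold popLaw; infer_instance
instance : IsProbabilityMeasure S.lawB := by unfold lawB; infer_instance
instance : IsProbabilityMeasure S.lawA := by unfold lawA; infer_instance
instance : IsProbabilityMeasure S.lawBA := by unfold lawBA; infer_instance
instance : IsProbabilityMeasure S.law := by unfold law; infer_instance

/-- Law of the population on the event that the sample `B` is `s`. -/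
noncomputable def popLawOn (s : Finset (Fin S.N)) : Measure (Pop q S.N) :=
  S.popLaw.withDensity fun pop => S.selB pop {s}

theorem measurable_selB (s : Finset (Fin S.N)) : Measurable fun pop => S.selB pop {s} :=
  Kernel.measurable_coe _ (measurableSet_singleton s)

theorem lintegral_popLawOn (s : Finset (Fin S.N)) {f : Pop q S.N → ℝ≥0∞} (hf : Measurable f) :
    ∫⁻ pop, f pop ∂S.popLawOn s = ∫⁻ pop, S.selB pop {s} * f pop ∂S.popLaw := by
  rw [popLawOn, lintegral_withDensity_eq_lintegral_mul _ (S.measurable_selB s) hf]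
  rfl

theorem integral_popLawOn (s : Finset (Fin S.N)) (f : Pop q S.N → ℝ) :
    ∫ pop, f pop ∂S.popLawOn s = ∫ pop, (S.selB pop).real {s} * f pop ∂S.popLaw := by
  rw [popLawOn, integral_withDensity_eq_integral_toReal_smul (S.measurable_selB s)
    (.of_forall fun pop => measure_lt_top _ _)]
  rfl

theorem lintegral_lawB {f : Pop q S.N × Finset (Fin S.N) → ℝ≥0∞} (hf : Measurable f) :
    ∫⁻ ω, f ω ∂S.lawB = ∑ s, ∫⁻ pop, f (pop, s) ∂S.popLawOn s := by
  have h1 : ∀ s, ∫⁻ pop, f (pop, s) ∂S.popLawOn s = ∫⁻ pop, S.selB pop {s} * f (pop, s) ∂S.popLaw :=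
    fun s => S.lintegral_popLawOn s (hf.comp measurable_prodMk_right)
  simp_rw [h1]
  have h2 := lintegral_finsetSum (μ := S.popLaw) Finset.univ
    (f := fun s pop => S.selB pop {s} * f (pop, s)) fun s _ =>
      (S.measurable_selB s).mul (hf.comp measurable_prodMk_right)
  rw [lawB, Measure.lintegral_compProd hf, ← h2]
  refine lintegral_congr fun pop => ?_
  rw [lintegral_fintype]
  exact Finset.sum_congr rfl fun s _ => mul_comm _ _

theorem lawB_eq_sum : S.lawB = ∑ s, (S.popLawOn s).map fun pop => (pop, s) := by
  ext E hE
  rw [← lintegral_indicator_one hE, S.lintegral_lawB (measurable_one.indicator hE),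
    Measure.finsetSum_apply]
  refine Finset.sum_congr rfl fun s _ => ?_
  rw [← lintegral_indicator_one hE, lintegral_map (measurable_one.indicator hE)
    measurable_prodMk_right]

theorem integrable_popLawOn {f : Pop q S.N × Finset (Fin S.N) → ℝ} (hf : Integrable f S.lawB)
    (hfm : Measurable f) (s : Finset (Fin S.N)) :
    Integrable (fun pop => f (pop, s)) (S.popLawOn s) := by
  rw [lawB_eq_sum, integrable_finsetSum_measure] at hf
  have := hf s (Finset.mem_univ s)
  rwa [integrable_map_measure hfm.aestronglyMeasurable
    measurable_prodMk_right.aemeasurable] at this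

theorem integrable_lawB {f : Pop q S.N × Finset (Fin S.N) → ℝ} (hfm : Measurable f)
    (hf : ∀ s, Integrable (fun pop => f (pop, s)) (S.popLawOn s)) : Integrable f S.lawB := by
  rw [lawB_eq_sum, integrable_finsetSum_measure]
  intro s _
  rw [integrable_map_measure hfm.aestronglyMeasurable measurable_prodMk_right.aemeasurable]
  exact hf s

theorem integral_lawB {f : Pop q S.N × Finset (Fin S.N) → ℝ} (hf : Integrable f S.lawB)
    (hfm : Measurable f) : ∫ ω, f ω ∂S.lawB = ∑ s, ∫ pop, f (pop, s) ∂S.popLawOn s := by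
  rw [lawB_eq_sum] at hf ⊢
  rw [integral_finsetSum_measure (integrable_finsetSum_measure.1 hf)]
  refine Finset.sum_congr rfl fun s _ => ?_
  rw [integral_map measurable_prodMk_right.aemeasurable hfm.aestronglyMeasurable]

variable {S}

/-- The events that are determined by the auxiliary variable of a unit. -/
abbrev covSigma (q : ℕ) : MeasurableSpace (Cov q × ℝ) :=
  MeasurableSpace.comap Prod.fst inferInstance

/-- The events that are determined by the auxiliary variables of the population. -/
abbrev popCovSigma (q N : ℕ) : MeasurableSpace (Pop q N) :=
  MeasurableSpace.comap (fun (pop : Pop q N) (i : Fin N) => (pop i).1) inferInstance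

/-- The error of a unit is orthogonal to functions of its auxiliary variables. -/
theorem integral_mul_err (R : Regular m h K Θ β₀) (hmodel : S.MeanModel m β₀) (i : Fin S.N)
    (hy : Integrable (fun z : Cov q × ℝ => z.2) (S.unit i)) {f : Cov q → ℝ} (hf : Measurable f) :
    ∫ z, f z.1 * err m β₀ z ∂S.unit i = 0 := by
  by_cases hint : Integrable (fun z => f z.1 * err m β₀ z) (S.unit i)
  swap
  · exact integral_undef hint
  have h_le : covSigma q ≤ (inferInstance : MeasurableSpace (Cov q × ℝ)) := measurable_fst.comap_le
  have hfst : @Measurable _ _ (covSigma q) _ (Prod.fst : Cov q × ℝ → Cov q) := comap_measurable _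
  have hmx : StronglyMeasurable[covSigma q] fun z : Cov q × ℝ => m z.1 β₀ :=
    ((R.measurable_m β₀).comp hfst).stronglyMeasurable
  have hmi : Integrable (fun z : Cov q × ℝ => m z.1 β₀) (S.unit i) :=
    integrable_condExp.congr (hmodel i)
  have he : Integrable (err m β₀) (S.unit i) := hy.sub hmi
  have h1 : (S.unit i)[err m β₀ | covSigma q] =ᵐ[S.unit i] 0 := by
    have h2 := condExp_sub hy hmi (covSigma q)
    have h3 := condExp_of_stronglyMeasurable h_le hmx hmi
    rw [h3] at h2
    filter_upwards [h2, hmodel i] with z hz hz'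
    have : (S.unit i)[err m β₀ | covSigma q] z = (S.unit i)[fun z : Cov q × ℝ => z.2 | covSigma q] z - m z.1 β₀ := hz
    rw [this, hz']
    simp
  have h4 := condExp_mul_of_stronglyMeasurable_left (m := covSigma q) (μ := S.unit i)
    (f := fun z => f z.1) (g := err m β₀) ((hf.comp hfst).stronglyMeasurable) hint he
  rw [← integral_condExp h_le]
  refine integral_eq_zero_of_ae ?_
  filter_upwards [h4, h1] with z hz hz1
  have : (S.unit i)[fun z => f z.1 * err m β₀ z | covSigma q] z = f z.1 * (S.unit i)[err m β₀ | covSigma q] z := hz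
  rw [this, hz1]
  simp

/-- On the event that `B = s`, the error of unit `i` is orthogonal to functions of the population
that do not depend on `y_i`. This is where ignorability enters: the probability of the event is
a function of the auxiliary variables. -/
theorem integral_mul_err_popLawOn (R : Regular m h K Θ β₀) (hmodel : S.MeanModel m β₀)
    (hMAR : S.Ignorable) (s : Finset (Fin S.N)) (i : Fin S.N)
    (hy : Integrable (fun z : Cov q × ℝ => z.2) (S.unit i)) {φ : Pop q S.N → ℝ} (hφ : Measurable φ)
    (hdep : ∀ pop x y y', φ (Function.update pop i (x, y)) = φ (Function.update pop i (x, y'))) :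
    ∫ pop, φ pop * err m β₀ (pop i) ∂S.popLawOn s = 0 := by
  have hX : Measurable fun (pop : Pop q S.N) (i : Fin S.N) => (pop i).1 := by fun_prop
  set P : Pop q S.N → ℝ := S.popLaw[fun pop => (S.selB pop).real {s} | popCovSigma q S.N] with hP
  have hPmG : @Measurable _ _ (popCovSigma q S.N) _ P := stronglyMeasurable_condExp.measurable
  have hPm : Measurable P := hPmG.mono hX.comap_le le_rfl
  have hPdep : ∀ pop x y y', P (Function.update pop i (x, y)) = P (Function.update pop i (x, y')) := by
    intro pop x y y'
    refine hPmG.factorsThrough (funext fun j => ?_)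
    rcases eq_or_ne j i with rfl | hj
    · simp
    · simp [hj]
  rw [S.integral_popLawOn]
  have e : ∫ pop, (S.selB pop).real {s} * (φ pop * err m β₀ (pop i)) ∂S.popLaw =
      ∫ pop, P pop * (φ pop * err m β₀ (pop i)) ∂S.popLaw := by
    refine integral_congr_ae ?_
    filter_upwards [hMAR s] with pop hpop
    rw [hpop]
  rw [e, popLaw]
  refine integral_pi_eq_zero _ i fun pop => ?_
  simp only [Function.update_self]
  have h2 : Measurable fun x : Cov q => P (Function.update pop i (x, 0)) *
      φ (Function.update pop i (x, 0)) := by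
    have : Measurable fun x : Cov q => Function.update pop i (x, (0 : ℝ)) :=
      (measurable_update pop).comp (measurable_id.prodMk measurable_const)
    exact (hPm.comp this).mul (hφ.comp this)
  rw [← integral_mul_err R hmodel i hy h2]
  refine integral_congr_ae (.of_forall fun z => ?_)
  simp only
  rw [hPdep pop z.1 z.2 0, hdep pop z.1 z.2 0, mul_assoc]

end Stage

end

section

/-! ### Moments of the noise in the non-probability sample -/

variable {p q : ℕ} {m : Cov q → Param p → ℝ} {h : Cov q → Param p → Param p} {K : Cov q → ℝ}
  {Θ : Set (Param p)} {β₀ : Param p}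

/-- Average over `B` of the errors, weighted by a function `b` of the auxiliary variables. -/
noncomputable def noiseAvg {N : ℕ} (m : Cov q → Param p → ℝ) (β₀ : Param p) (b : Cov q → ℝ)
    (ω : Pop q N × Finset (Fin N)) : ℝ :=
  avg ω.2 fun i => err m β₀ (ω.1 i) * b (ω.1 i).1

theorem measurable_avg {N : ℕ} {f : Cov q × ℝ → ℝ} (hf : Measurable f) :
    Measurable fun ω : Pop q N × Finset (Fin N) => avg ω.2 fun i => f (ω.1 i) := by
  refine measurable_from_prod_countable_left fun s => ?_
  simp only [avg]
  fun_prop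

theorem Regular.measurable_noiseAvg (R : Regular m h K Θ β₀) {N : ℕ} {b : Cov q → ℝ}
    (hb : Measurable b) : Measurable (noiseAvg (N := N) m β₀ b) :=
  measurable_avg (f := fun z => err m β₀ z * b z.1) (R.measurable_err.mul (hb.comp measurable_fst))

namespace Stage

variable {S : Stage q}

theorem integrable_env_pow_four (R : Regular m h K Θ β₀)
    (hΛ : Integrable (fun ω => avg ω.2 fun i => env K (ω.1 i) ^ 4) S.lawB)
    (s : Finset (Fin S.N)) {i : Fin S.N} (hi : i ∈ s) :
    Integrable (fun pop : Pop q S.N => env K (pop i) ^ 4) (S.popLawOn s) := by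
  have h1 := S.integrable_popLawOn hΛ (measurable_avg (R.measurable_env.pow_const 4)) s
  refine (h1.const_mul (s.card : ℝ)).mono'
    ((R.measurable_env.comp (measurable_pi_apply i)).pow_const 4).aestronglyMeasurable
    (.of_forall fun pop => ?_)
  have hs : (s.card : ℝ) ≠ 0 := by simpa using Finset.ne_empty_of_mem hi
  rw [Real.norm_of_nonneg (by positivity), avg, ← mul_assoc, mul_inv_cancel₀ hs, one_mul]
  exact Finset.single_le_sum (f := fun i => env K (pop i) ^ 4) (fun _ _ => by positivity) hi

instance (s : Finset (Fin S.N)) : IsFiniteMeasure (S.popLawOn s) := by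
  refine ⟨?_⟩
  rw [popLawOn, withDensity_apply _ MeasurableSet.univ, Measure.restrict_univ]
  calc ∫⁻ pop, S.selB pop {s} ∂S.popLaw ≤ ∫⁻ _, 1 ∂S.popLaw :=
        lintegral_mono fun pop => prob_le_one
    _ < ∞ := by simp

section

variable (R : Regular m h K Θ β₀) (hmodel : S.MeanModel m β₀) (hMAR : S.Ignorable)
  (hy : ∀ i, Integrable (fun z : Cov q × ℝ => z.2) (S.unit i))
  (hΛ : Integrable (fun ω => avg ω.2 fun i => env K (ω.1 i) ^ 4) S.lawB)
  {b : Cov q → ℝ} {κ : ℝ} (hb : Measurable b) (hbK : ∀ x, |b x| ≤ κ * K x)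
include R hmodel hMAR hy hΛ hb hbK

omit hmodel hMAR hy hΛ hbK in
theorem measurable_err_mul (i : Fin S.N) :
    Measurable fun pop : Pop q S.N => err m β₀ (pop i) * b (pop i).1 :=
  (R.measurable_err.comp (measurable_pi_apply i)).mul
    (hb.comp (measurable_fst.comp (measurable_pi_apply i)))

omit hmodel hMAR hy in
theorem integrable_err_mul_pow_four (s : Finset (Fin S.N)) {i : Fin S.N} (hi : i ∈ s) :
    Integrable (fun pop : Pop q S.N => (err m β₀ (pop i) * b (pop i).1) ^ 4) (S.popLawOn s) := by
  refine ((integrable_env_pow_four R hΛ s hi).const_mul (κ ^ 4)).mono'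
    ((measurable_err_mul R hb i).pow_const 4).aestronglyMeasurable (.of_forall fun pop => ?_)
  rw [norm_pow, ← mul_pow]
  exact pow_le_pow_left₀ (norm_nonneg _) (R.abs_err_mul_le hbK (pop i)) 4

/-- Fourth moment of the noise on the event that `B = s`. -/
theorem integral_noise_pow_four_on (s : Finset (Fin S.N)) :
    Integrable (fun pop => noiseAvg m β₀ b (pop, s) ^ 4) (S.popLawOn s) ∧
    ∫ pop, noiseAvg m β₀ b (pop, s) ^ 4 ∂S.popLawOn s ≤
      κ ^ 4 * (16 * (s.card : ℝ)⁻¹ ^ 2) * ∫ pop, avg s (fun i => env K (pop i) ^ 4) ∂S.popLawOn s := by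
  obtain ⟨h1, h2⟩ := integral_sum_pow_four_le (μ := S.popLawOn s) s
    (fun i pop => err m β₀ (pop i) * b (pop i).1)
    (fun i _ => (measurable_err_mul R hb i).aestronglyMeasurable)
    (fun i hi => integrable_err_mul_pow_four R hΛ hb hbK s hi)
    (fun t _ i _ hit => by
      have := integral_mul_err_popLawOn R hmodel hMAR s i (hy i)
        (φ := fun pop => (∑ j ∈ t, err m β₀ (pop j) * b (pop j).1) ^ 3 * b (pop i).1)
        ((Finset.measurable_sum _ fun j _ => measurable_err_mul R hb j).pow_const 3 |>.mul
          (hb.comp (measurable_fst.comp (measurable_pi_apply i)))) ?_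
      · rw [← this]
        congr 1
        ext pop
        ring
      · intro pop x y y'
        have : ∀ y, ∑ j ∈ t, err m β₀ (Function.update pop i (x, y) j) *
            b (Function.update pop i (x, y) j).1 = ∑ j ∈ t, err m β₀ (pop j) * b (pop j).1 :=
          fun y => Finset.sum_congr rfl fun j hj => by
            rw [Function.update_of_ne (ne_of_mem_of_not_mem hj hit)]
        simp only [this, Function.update_self])
  have e : ∀ pop : Pop q S.N, noiseAvg m β₀ b (pop, s) ^ 4 =
      (s.card : ℝ)⁻¹ ^ 4 * (∑ i ∈ s, err m β₀ (pop i) * b (pop i).1) ^ 4 := fun pop => by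
    rw [← mul_pow]; rfl
  simp_rw [e]
  refine ⟨h1.const_mul _, ?_⟩
  rw [integral_const_mul]
  have h3 : ∑ i ∈ s, ∫ pop, (err m β₀ (pop i) * b (pop i).1) ^ 4 ∂S.popLawOn s ≤
      κ ^ 4 * ∑ i ∈ s, ∫ pop, env K (pop i) ^ 4 ∂S.popLawOn s := by
    rw [Finset.mul_sum]
    simp_rw [← integral_const_mul]
    refine Finset.sum_le_sum fun i hi => integral_mono
      (integrable_err_mul_pow_four R hΛ hb hbK s hi)
      ((integrable_env_pow_four R hΛ s hi).const_mul _) fun pop => ?_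
    have := pow_le_pow_left₀ (abs_nonneg _) (R.abs_err_mul_le hbK (pop i)) 4
    rw [Even.pow_abs (by decide)] at this
    rwa [← mul_pow]
  have h4 : ∫ pop, avg s (fun i => env K (pop i) ^ 4) ∂S.popLawOn s =
      (s.card : ℝ)⁻¹ * ∑ i ∈ s, ∫ pop, env K (pop i) ^ 4 ∂S.popLawOn s := by
    simp only [avg]
    rw [integral_const_mul, integral_finsetSum _ fun i hi => integrable_env_pow_four R hΛ s hi]
  rw [h4]
  rcases s.eq_empty_or_nonempty with rfl | hs
  · simp
  have hs' : (0 : ℝ) < s.card := by simpa using hs.card_pos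
  calc (s.card : ℝ)⁻¹ ^ 4 * ∫ pop, (∑ i ∈ s, err m β₀ (pop i) * b (pop i).1) ^ 4 ∂S.popLawOn s
      ≤ (s.card : ℝ)⁻¹ ^ 4 * (16 * s.card *
          (κ ^ 4 * ∑ i ∈ s, ∫ pop, env K (pop i) ^ 4 ∂S.popLawOn s)) := by
        gcongr
        exact h2.trans (by gcongr)
    _ = _ := by field_simp

/-- Fourth moment of the noise in samples that are not too small. -/
theorem integral_noise_pow_four {r : ℝ} (hr : 0 < r) :
    Integrable (fun ω : Pop q S.N × Finset (Fin S.N) =>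
      if r ≤ ω.2.card then noiseAvg m β₀ b ω ^ 4 else 0) S.lawB ∧
    ∫ ω, (if r ≤ ω.2.card then noiseAvg m β₀ b ω ^ 4 else 0) ∂S.lawB ≤
      κ ^ 4 * (16 / r ^ 2) * ∫ ω, avg ω.2 (fun i => env K (ω.1 i) ^ 4) ∂S.lawB := by
  have hmeas : Measurable fun ω : Pop q S.N × Finset (Fin S.N) =>
      if r ≤ ω.2.card then noiseAvg m β₀ b ω ^ 4 else 0 := by
    refine Measurable.ite ?_ ((R.measurable_noiseAvg hb).pow_const 4) measurable_const
    exact measurable_snd (MeasurableSet.of_discrete (s := {s : Finset (Fin S.N) | r ≤ s.card}))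
  have hon := integral_noise_pow_four_on R hmodel hMAR hy hΛ hb hbK
  have hint : Integrable (fun ω : Pop q S.N × Finset (Fin S.N) =>
      if r ≤ ω.2.card then noiseAvg m β₀ b ω ^ 4 else 0) S.lawB := by
    refine S.integrable_lawB hmeas fun s => ?_
    by_cases hs : r ≤ s.card
    · simpa [hs] using (hon s).1
    · simp [hs]
  refine ⟨hint, ?_⟩
  rw [S.integral_lawB hint hmeas, S.integral_lawB hΛ (measurable_avg (R.measurable_env.pow_const 4)),
    Finset.mul_sum]
  refine Finset.sum_le_sum fun s _ => ?_
  have hnn : 0 ≤ ∫ pop, avg s (fun i => env K (pop i) ^ 4) ∂S.popLawOn s :=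
    integral_nonneg fun pop => mul_nonneg (by positivity) (Finset.sum_nonneg fun _ _ => by positivity)
  by_cases hs : r ≤ s.card
  · simp only [hs, if_true]
    refine (hon s).2.trans ?_
    rw [div_eq_mul_inv, ← inv_pow]
    gcongr
  · simp only [hs, if_false, integral_zero]
    positivity

/-- First and second moment of the noise in samples that are not too small. -/
theorem integral_noise_sq (r : ℝ) :
    Integrable (fun ω : Pop q S.N × Finset (Fin S.N) =>
      if r ≤ ω.2.card then noiseAvg m β₀ b ω ^ 2 else 0) S.lawB ∧
    ∫ ω, (if r ≤ ω.2.card then noiseAvg m β₀ b ω else 0) ∂S.lawB = 0 ∧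
    ∫ ω, (if r ≤ ω.2.card then noiseAvg m β₀ b ω ^ 2 else 0) ∂S.lawB =
      ∫ ω, (if r ≤ ω.2.card then (ω.2.card : ℝ)⁻¹ * avg ω.2 (fun i =>
        (err m β₀ (ω.1 i) * b (ω.1 i).1) ^ 2) else 0) ∂S.lawB := by
  have hset : MeasurableSet {ω : Pop q S.N × Finset (Fin S.N) | r ≤ ω.2.card} :=
    measurable_snd (MeasurableSet.of_discrete (s := {s : Finset (Fin S.N) | r ≤ s.card}))
  have hmeas1 : Measurable fun ω : Pop q S.N × Finset (Fin S.N) =>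
      if r ≤ ω.2.card then noiseAvg m β₀ b ω else 0 :=
    Measurable.ite hset (R.measurable_noiseAvg hb) measurable_const
  have hmeas2 : Measurable fun ω : Pop q S.N × Finset (Fin S.N) =>
      if r ≤ ω.2.card then noiseAvg m β₀ b ω ^ 2 else 0 :=
    Measurable.ite hset ((R.measurable_noiseAvg hb).pow_const 2) measurable_const
  have hmeas3 : Measurable fun ω : Pop q S.N × Finset (Fin S.N) =>
      if r ≤ ω.2.card then (ω.2.card : ℝ)⁻¹ * avg ω.2 (fun i =>
        (err m β₀ (ω.1 i) * b (ω.1 i).1) ^ 2) else 0 := by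
    refine Measurable.ite hset (Measurable.mul ?_ ?_) measurable_const
    · exact (measurable_of_countable fun s : Finset (Fin S.N) => (s.card : ℝ)⁻¹).comp measurable_snd
    · exact measurable_avg (f := fun z => (err m β₀ z * b z.1) ^ 2)
        ((R.measurable_err.mul (hb.comp measurable_fst)).pow_const 2)
  -- everything is computed separately on each event `B = s`, under the restricted law
  have hX : ∀ (s : Finset (Fin S.N)), ∀ i ∈ s,
      MemLp (fun pop : Pop q S.N => err m β₀ (pop i) * b (pop i).1) 2 (S.popLawOn s) := by
    intro s i hi
    have hm := (measurable_err_mul R hb i).aestronglyMeasurable (μ := S.popLawOn s)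
    rw [memLp_two_iff_integrable_sq hm]
    exact (memLp_two_sq hm (integrable_err_mul_pow_four R hΛ hb hbK s hi)).integrable (by norm_num)
  have hS : ∀ s : Finset (Fin S.N),
      MemLp (fun pop => noiseAvg m β₀ b (pop, s)) 2 (S.popLawOn s) := fun s =>
    (memLp_finsetSum s (hX s)).const_mul (s.card : ℝ)⁻¹
  have hint2 : Integrable (fun ω : Pop q S.N × Finset (Fin S.N) =>
      if r ≤ ω.2.card then noiseAvg m β₀ b ω ^ 2 else 0) S.lawB := by
    refine S.integrable_lawB hmeas2 fun s => ?_
    by_cases hs : r ≤ s.card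
    · simpa [hs] using (hS s).integrable_sq
    · simp [hs]
  have hint1 : Integrable (fun ω : Pop q S.N × Finset (Fin S.N) =>
      if r ≤ ω.2.card then noiseAvg m β₀ b ω else 0) S.lawB := by
    refine S.integrable_lawB hmeas1 fun s => ?_
    by_cases hs : r ≤ s.card
    · simpa [hs] using (hS s).integrable (by norm_num)
    · simp [hs]
  have hint3 : Integrable (fun ω : Pop q S.N × Finset (Fin S.N) =>
      if r ≤ ω.2.card then (ω.2.card : ℝ)⁻¹ * avg ω.2 (fun i =>
        (err m β₀ (ω.1 i) * b (ω.1 i).1) ^ 2) else 0) S.lawB := by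
    refine S.integrable_lawB hmeas3 fun s => ?_
    by_cases hs : r ≤ s.card
    · simp only [hs, if_true, avg]
      exact ((integrable_finsetSum s fun i hi => (hX s i hi).integrable_sq).const_mul _).const_mul _
    · simp [hs]
  refine ⟨hint2, ?_, ?_⟩
  · rw [S.integral_lawB hint1 hmeas1]
    refine Finset.sum_eq_zero fun s _ => ?_
    by_cases hs : r ≤ s.card
    · simp only [hs, if_true, noiseAvg, avg]
      rw [integral_const_mul, integral_finsetSum _ fun i hi => (hX s i hi).integrable (by norm_num)]
      rw [Finset.sum_eq_zero fun i _ => ?_, mul_zero]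
      simp_rw [mul_comm (err m β₀ _)]
      exact integral_mul_err_popLawOn R hmodel hMAR s i (hy i)
        (φ := fun pop => b (pop i).1) (hb.comp (measurable_fst.comp (measurable_pi_apply i)))
        (fun pop x y y' => by simp)
    · simp [hs]
  · rw [S.integral_lawB hint2 hmeas2, S.integral_lawB hint3 hmeas3]
    refine Finset.sum_congr rfl fun s _ => ?_
    by_cases hs : r ≤ s.card
    · simp only [hs, if_true, noiseAvg, avg, mul_pow _ (∑ i ∈ s, _)]
      rw [integral_const_mul, integral_sum_sq_eq (μ := S.popLawOn s) s
        (fun i pop => err m β₀ (pop i) * b (pop i).1) (hX s), integral_const_mul,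
        integral_const_mul, integral_finsetSum _ fun i hi => (hX s i hi).integrable_sq]
      · ring
      · intro i _ j _ hij
        -- for `i ≠ j` the factor `e_i` does not depend on `y_j`, so `e_j` is centered given the rest
        have := integral_mul_err_popLawOn R hmodel hMAR s j (hy j)
          (φ := fun pop => err m β₀ (pop i) * b (pop i).1 * b (pop j).1)
          ((measurable_err_mul R hb i).mul (hb.comp (measurable_fst.comp (measurable_pi_apply j))))
          (fun pop x y y' => by simp [Function.update_of_ne hij])
        rw [← this]
        congr 1
        ext pop
        ring
    · simp [hs]

end

/-! ### Averages over the population -/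

/-- Second moment of the population mean of independent centered variables. -/
theorem integral_popMean_sq (g : Fin S.N → Cov q × ℝ → ℝ) (hg : ∀ i, MemLp (g i) 2 (S.unit i))
    (h0 : ∀ i, ∫ z, g i z ∂S.unit i = 0) :
    MemLp (fun pop : Pop q S.N => (S.N : ℝ)⁻¹ * ∑ i, g i (pop i)) 2 S.popLaw ∧
    ∫ pop, ((S.N : ℝ)⁻¹ * ∑ i, g i (pop i)) ^ 2 ∂S.popLaw =
      (S.N : ℝ)⁻¹ ^ 2 * ∑ i, ∫ pop, g i (pop i) ^ 2 ∂S.popLaw := by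
  have hL : ∀ i, MemLp (fun pop : Pop q S.N => g i (pop i)) 2 S.popLaw := fun i =>
    (hg i).comp_measurePreserving (measurePreserving_eval S.unit i)
  refine ⟨(memLp_finsetSum _ fun i _ => hL i).const_mul _, ?_⟩
  simp_rw [mul_pow]
  rw [integral_const_mul, integral_sum_sq_eq (μ := S.popLaw) Finset.univ
    (fun i pop => g i (pop i)) fun i _ => hL i]
  intro i _ j _ hij
  refine integral_pi_eq_zero S.unit j fun pop => ?_
  simp only [Function.update_of_ne hij, Function.update_self]
  rw [integral_const_mul, h0, mul_zero]

end Stage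

end

section

/-! ### The probability sample -/

variable {p q : ℕ} {m : Cov q → Param p → ℝ} {h : Cov q → Param p → Param p} {K : Cov q → ℝ}
  {Θ : Set (Param p)} {β₀ : Param p}

namespace Stage

variable (S : Stage q)

theorem map_fst_lawB : S.lawB.map Prod.fst = S.popLaw := Measure.fst_compProd _ _

theorem map_fst_lawBA : S.lawBA.map Prod.fst = S.lawB := Measure.fst_compProd _ _

theorem map_fst_law : S.law.map Prod.fst = S.lawBA := Measure.fst_compProd _ _

theorem lintegral_lawBA {f : (Pop q S.N × Finset (Fin S.N)) × Finset (Fin S.N) → ℝ≥0∞}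
    (hf : Measurable f) :
    ∫⁻ d, f d ∂S.lawBA = ∫⁻ ω, ∫⁻ A, f (ω, A) ∂S.design ω.1 ∂S.lawB := by
  rw [lawBA, Measure.lintegral_compProd hf]
  rfl

theorem map_lawBA : S.lawBA.map (fun d => (d.1.1, d.2)) = S.lawA := by
  have hm : Measurable fun d : (Pop q S.N × Finset (Fin S.N)) × Finset (Fin S.N) =>
      (d.1.1, d.2) := by fun_prop
  ext E hE
  have hE1 : Measurable (E.indicator (1 : Pop q S.N × Finset (Fin S.N) → ℝ≥0∞)) :=
    measurable_one.indicator hE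
  rw [← lintegral_indicator_one hE, ← lintegral_indicator_one hE, lintegral_map hE1 hm,
    S.lintegral_lawBA (f := fun d => E.indicator 1 (d.1.1, d.2)) (hE1.comp hm), lawA, Measure.lintegral_compProd hE1, ← S.map_fst_lawB,
    lintegral_map hE1.lintegral_kernel_prod_right' measurable_fst]

theorem ae_lawB_of_ae_popLaw {P : Pop q S.N → Prop} (hP : ∀ᵐ pop ∂S.popLaw, P pop) :
    ∀ᵐ ω ∂S.lawB, P ω.1 :=
  ae_of_ae_map measurable_fst.aemeasurable (by rwa [S.map_fst_lawB])

theorem measurable_weight (i : Fin S.N) : Measurable fun pop => S.weight pop i := by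
  unfold weight incl
  exact (Kernel.measurable_coe S.design (MeasurableSet.of_discrete)).ennreal_toReal.inv

variable {S}

theorem measurable_htError {X : Type*} [MeasurableSpace X] {f : X → Pop q S.N}
    (hf : Measurable f) {z : X → Fin S.N → ℝ} (hz : ∀ i, Measurable fun x => z x i) :
    Measurable fun d : X × Finset (Fin S.N) => S.htError (f d.1) (z d.1) d.2 := by
  refine measurable_from_prod_countable_left fun A => ?_
  have hw : ∀ i, Measurable fun x => S.weight (f x) i := fun i => (S.measurable_weight i).comp hf
  unfold htError
  exact ((Finset.measurable_sum _ fun i _ => (hw i).mul (hz i)).const_mul _).sub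
    ((Finset.measurable_sum _ fun i _ => hz i).const_mul _)

/-- The mean square of the Horvitz-Thompson error of a variable that may depend on `B`. -/
theorem lintegral_htError_sq_le {D : ℝ}
    (hD : ∀ᵐ pop ∂S.popLaw, ∀ z : Fin S.N → ℝ,
      ∫ A, S.htError pop z A ^ 2 ∂S.design pop ≤ D * ((S.N : ℝ)⁻¹ * ∑ i, z i ^ 2))
    {z : Pop q S.N × Finset (Fin S.N) → Fin S.N → ℝ} (hz : ∀ i, Measurable fun ω => z ω i) :
    ∫⁻ d, ENNReal.ofReal (S.htError d.1.1 (z d.1) d.2 ^ 2) ∂S.lawBA ≤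
      ∫⁻ ω, ENNReal.ofReal (D * ((S.N : ℝ)⁻¹ * ∑ i, z ω i ^ 2)) ∂S.lawB := by
  rw [S.lintegral_lawBA ((measurable_htError measurable_fst hz).pow_const 2).ennreal_ofReal]
  refine lintegral_mono_ae ?_
  filter_upwards [S.ae_lawB_of_ae_popLaw hD] with ω hω
  rw [← ofReal_integral_eq_lintegral_ofReal .of_finite (.of_forall fun A => sq_nonneg _)]
  exact ENNReal.ofReal_le_ofReal (hω (z ω))

theorem sum_weight_design (pop : Pop q S.N) (hpos : ∀ i, 0 < S.incl pop i) (z : Fin S.N → ℝ) :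
    ∫ A, ∑ i ∈ A, S.weight pop i * z i ∂S.design pop = ∑ i, z i := by
  classical
  have e : ∀ A : Finset (Fin S.N), ∑ i ∈ A, S.weight pop i * z i =
      ∑ i, {A : Finset (Fin S.N) | i ∈ A}.indicator (fun _ => S.weight pop i * z i) A := by
    intro A
    simp only [Set.indicator_apply, Set.mem_ofPred_eq]
    rw [← Finset.sum_filter]
    simp
  simp_rw [e]
  rw [integral_finsetSum _ fun i _ => .of_finite]
  refine Finset.sum_congr rfl fun i _ => ?_
  rw [integral_indicator_const _ MeasurableSet.of_discrete, smul_eq_mul, weight, ← mul_assoc]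
  change S.incl pop i * (S.incl pop i)⁻¹ * z i = z i
  rw [mul_inv_cancel₀ (hpos i).ne', one_mul]

/-- The Horvitz-Thompson estimator is unbiased. -/
theorem integral_htError (pop : Pop q S.N) (hpos : ∀ i, 0 < S.incl pop i) (z : Fin S.N → ℝ) :
    ∫ A, S.htError pop z A ∂S.design pop = 0 := by
  unfold htError
  rw [integral_sub .of_finite .of_finite, integral_const_mul, sum_weight_design pop hpos]
  simp

/-- The weighted sample mean of a nonnegative variable has the mean of the population mean. -/
theorem lintegral_weighted_mean
    (hpos : ∀ᵐ pop ∂S.popLaw, ∀ i, 0 < S.incl pop i) {z : Pop q S.N → Fin S.N → ℝ}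
    (hz : ∀ i, Measurable fun pop => z pop i) (hz0 : ∀ pop i, 0 ≤ z pop i) :
    ∫⁻ d, ENNReal.ofReal ((S.N : ℝ)⁻¹ * ∑ i ∈ d.2, S.weight d.1.1 i * z d.1.1 i) ∂S.lawBA =
      ∫⁻ pop, ENNReal.ofReal ((S.N : ℝ)⁻¹ * ∑ i, z pop i) ∂S.popLaw := by
  have hw0 : ∀ pop i, 0 ≤ S.weight pop i := fun pop i => inv_nonneg.2 measureReal_nonneg
  have hm : Measurable fun d : (Pop q S.N × Finset (Fin S.N)) × Finset (Fin S.N) =>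
      ENNReal.ofReal ((S.N : ℝ)⁻¹ * ∑ i ∈ d.2, S.weight d.1.1 i * z d.1.1 i) := by
    refine measurable_from_prod_countable_left fun A => ?_
    exact ((Finset.measurable_sum _ fun i _ => ((S.measurable_weight i).mul (hz i)).comp
      measurable_fst).const_mul _).ennreal_ofReal
  have hm2 : Measurable fun pop : Pop q S.N => ENNReal.ofReal ((S.N : ℝ)⁻¹ * ∑ i, z pop i) :=
    ((Finset.measurable_sum _ fun i _ => hz i).const_mul _).ennreal_ofReal
  rw [S.lintegral_lawBA hm, ← S.map_fst_lawB, lintegral_map hm2 measurable_fst]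
  refine lintegral_congr_ae ?_
  filter_upwards [S.ae_lawB_of_ae_popLaw hpos] with ω hω
  rw [← ofReal_integral_eq_lintegral_ofReal .of_finite (.of_forall fun A =>
    mul_nonneg (by positivity) (Finset.sum_nonneg fun i _ => mul_nonneg (hw0 _ _) (hz0 _ _))),
    integral_const_mul, sum_weight_design ω.1 hω]

/-- A Horvitz-Thompson error is orthogonal to functions of the population and `B`. -/
theorem integral_htError_mul (hpos : ∀ᵐ pop ∂S.popLaw, ∀ i, 0 < S.incl pop i)
    (z : Pop q S.N × Finset (Fin S.N) → Fin S.N → ℝ)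
    {g : Pop q S.N × Finset (Fin S.N) → ℝ}
    (hint : Integrable (fun d : (Pop q S.N × Finset (Fin S.N)) × Finset (Fin S.N) =>
      S.htError d.1.1 (z d.1) d.2 * g d.1) S.lawBA) :
    ∫ d, S.htError d.1.1 (z d.1) d.2 * g d.1 ∂S.lawBA = 0 := by
  rw [lawBA, Measure.integral_compProd (by simpa [lawBA] using hint)]
  refine integral_eq_zero_of_ae ?_
  filter_upwards [S.ae_lawB_of_ae_popLaw hpos] with ω hω
  simp only [Kernel.comap_apply]
  rw [integral_mul_const, integral_htError ω.1 hω, zero_mul]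
  rfl

end Stage

end

section

/-! ### The asymptotic framework -/

variable {p q : ℕ}

/-- The assumptions on the sequence of stages, with the smoothness assumptions replaced by their
consequences `Regular`. -/
structure Assumptions (S : ℕ → Stage q) (nA nB : ℕ → ℝ) (m : Cov q → Param p → ℝ)
    (h : Cov q → Param p → Param p) (K : Cov q → ℝ) (Θ : Set (Param p)) (β₀ : Param p)
    (sol : ∀ ν, Pop q (S ν).N → (Fin (S ν).N → ℕ) → Param p) : Prop where
  reg : Regular m h K Θ β₀
  nB_top : Tendsto nB atTop atTop
  nB_N : Tendsto (fun ν => nB ν / (S ν).N) atTop (𝓝 0)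
  nB_nA : ∃ C : ℝ, ∀ ν, nB ν ≤ C * nA ν
  L_top : Tendsto (fun ν => (S ν).L) atTop atTop
  card_B : ∀ ε > 0, Tendsto (fun ν => nB ν *
    (S ν).lawB.real {ω | ε ≤ |(ω.2.card : ℝ) / nB ν - 1|}) atTop (𝓝 0)
  card_A : ∀ ν, ∀ᵐ pop ∂(S ν).popLaw, ∑ i, (S ν).incl pop i = nA ν
  model : ∀ ν, (S ν).MeanModel m β₀
  ignorable : ∀ ν, (S ν).Ignorable
  solver : ∀ ν, IsSolver m h Θ (sol ν)
  mom : ∃ C : ℝ, ∀ ν, ∫⁻ pop, ENNReal.ofReal (((S ν).N : ℝ)⁻¹ *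
    ∑ i, (‖(pop i).1‖ ^ 4 + (pop i).2 ^ 4 + K (pop i).1 ^ 4)) ∂(S ν).popLaw ≤ ENNReal.ofReal C
  mom_B : ∃ C : ℝ, ∀ ν, ∫⁻ ω, ENNReal.ofReal (avg ω.2 fun i => env K (ω.1 i) ^ 4)
    ∂(S ν).lawB ≤ ENNReal.ofReal C
  bdd_B : ∃ C : ℝ, Tendsto (fun ν => nB ν * (S ν).lawB.real {ω | C < avg ω.2 fun i =>
    env K (ω.1 i)}) atTop (𝓝 0)
  ident : ∃ c > 0, Tendsto (fun ν => nB ν * (S ν).lawB.real {ω | ∃ β ∈ Θ,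
    ‖meanEstFun m h β₀ ω.1 ω.2 β‖ < c * ‖β - β₀‖}) atTop (𝓝 0)
  jac : ∀ j l, IsLittleOp (fun ν => (S ν).lawB) fun ν ω =>
    jacobian m h β₀ j l ω - ∫ ω', jacobian m h β₀ j l ω' ∂(S ν).lawB
  score : ∀ j l, IsLittleOp (fun ν => (S ν).lawB) fun ν ω =>
    scoreVar m h β₀ j l ω - ∫ ω', scoreVar m h β₀ j l ω' ∂(S ν).lawB
  incl_pos : ∀ ν, ∀ᵐ pop ∂(S ν).popLaw, ∀ i, 0 < (S ν).incl pop i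
  design : ∃ C : ℝ, ∀ ν, ∀ᵐ pop ∂(S ν).popLaw, ∀ z : Fin (S ν).N → ℝ,
    ∫ A, (S ν).htError pop z A ^ 2 ∂(S ν).design pop ≤
      C / nA ν * (((S ν).N : ℝ)⁻¹ * ∑ i, z i ^ 2)
  rep_four : ∃ C : ℝ, Tendsto (fun ν => (S ν).lawA.real {d | ¬ ∀ z : Fin (S ν).N → ℝ,
    ∫⁻ v, ENNReal.ofReal ((S ν).repDiff d.1 d.2 z v ^ 4) ∂(S ν).repW d ≤
      ENNReal.ofReal (C / nA ν ^ 2 *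
        (((S ν).N : ℝ)⁻¹ * ∑ i ∈ d.2, (S ν).weight d.1 i * z i ^ 4))}) atTop (𝓝 0)
  rep_var : IsLittleOp (fun ν => (S ν).lawA) fun ν d => nA ν *
    (∫ v, (S ν).repDiff d.1 d.2 (fun i => m (d.1 i).1 β₀) v ^ 2 ∂(S ν).repW d -
      Var[fun d' => (S ν).htError d'.1 (fun i => m (d'.1 i).1 β₀) d'.2; (S ν).lawA])

namespace Assumptions

variable {S : ℕ → Stage q} {nA nB : ℕ → ℝ} {m : Cov q → Param p → ℝ}
  {h : Cov q → Param p → Param p} {K : Cov q → ℝ} {Θ : Set (Param p)} {β₀ : Param p}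
  {sol : ∀ ν, Pop q (S ν).N → (Fin (S ν).N → ℕ) → Param p}
  (A : Assumptions S nA nB m h K Θ β₀ sol)
include A

theorem nB_pos : ∀ᶠ ν in atTop, 1 ≤ nB ν := A.nB_top.eventually_ge_atTop 1

theorem N_pos : ∀ᶠ ν in atTop, 0 < (S ν).N := by
  have h1 := (A.card_B 1 one_pos).eventually (gt_mem_nhds one_pos)
  filter_upwards [h1, A.nB_pos] with ν hν hnB
  by_contra hN
  have hN' : (S ν).N = 0 := by omega
  have : {ω : Pop q (S ν).N × Finset (Fin (S ν).N) | 1 ≤ |(ω.2.card : ℝ) / nB ν - 1|} =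
      Set.univ := by
    refine Set.eq_univ_of_forall fun ω => ?_
    have hc : ω.2.card = 0 := by
      have := Finset.card_le_univ ω.2
      rw [Fintype.card_fin] at this
      omega
    simp [hc]
  rw [this, probReal_univ] at hν
  linarith

theorem nA_pos (ν : ℕ) (hN : 0 < (S ν).N) : 0 < nA ν := by
  obtain ⟨pop, h1, h2⟩ := ((A.card_A ν).and (A.incl_pos ν)).exists
  rw [← h1]
  have : Nonempty (Fin (S ν).N) := ⟨⟨0, hN⟩⟩
  exact Finset.sum_pos (fun i _ => h2 i) Finset.univ_nonempty

theorem exists_ratio : ∃ C : ℝ, 0 < C ∧ ∀ᶠ ν in atTop, 0 < nA ν ∧ nB ν / nA ν ≤ C := by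
  obtain ⟨C, hC⟩ := A.nB_nA
  refine ⟨max C 1, by positivity, ?_⟩
  filter_upwards [A.N_pos] with ν hN
  have := A.nA_pos ν hN
  refine ⟨this, ?_⟩
  rw [div_le_iff₀ this]
  exact (hC ν).trans (by gcongr; exact le_max_left _ _)

/-- A bound of the mean fourth moments, of the responses and of the envelope. -/
theorem exists_moment : ∃ C : ℝ, 0 ≤ C ∧ ∀ ν,
    (∀ i, Integrable (fun pop : Pop q (S ν).N => (pop i).2 ^ 4) (S ν).popLaw) ∧
    (∀ i, Integrable (fun pop : Pop q (S ν).N => K (pop i).1 ^ 4) (S ν).popLaw) ∧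
    ∫ pop : Pop q (S ν).N, ((S ν).N : ℝ)⁻¹ * ∑ i, (pop i).2 ^ 4 ∂(S ν).popLaw ≤ C ∧
    ∫ pop : Pop q (S ν).N, ((S ν).N : ℝ)⁻¹ * ∑ i, K (pop i).1 ^ 4 ∂(S ν).popLaw ≤ C := by
  obtain ⟨C, hC⟩ := A.mom
  refine ⟨max C 0, le_max_right _ _, fun ν => ?_⟩
  have hK := A.reg.meas_K
  set G : Pop q (S ν).N → ℝ := fun pop => ((S ν).N : ℝ)⁻¹ *
    ∑ i, (‖(pop i).1‖ ^ 4 + (pop i).2 ^ 4 + K (pop i).1 ^ 4) with hG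
  have hG0 : ∀ pop, 0 ≤ G pop := fun pop => by positivity
  have hGm : Measurable G := by
    refine (Finset.measurable_sum _ fun i _ => ?_).const_mul _
    have h1 : Measurable fun pop : Pop q (S ν).N => (pop i).1 :=
      measurable_fst.comp (measurable_pi_apply i)
    have h2 : Measurable fun pop : Pop q (S ν).N => (pop i).2 :=
      measurable_snd.comp (measurable_pi_apply i)
    exact ((h1.norm.pow_const 4).add (h2.pow_const 4)).add ((hK.comp h1).pow_const 4)
  have hGi : Integrable G (S ν).popLaw := by
    refine ⟨hGm.aestronglyMeasurable, ?_⟩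
    rw [hasFiniteIntegral_iff_ofReal (.of_forall hG0)]
    exact (hC ν).trans_lt ENNReal.ofReal_lt_top
  have hGle : ∫ pop, G pop ∂(S ν).popLaw ≤ max C 0 := by
    rw [integral_eq_lintegral_of_nonneg_ae (.of_forall hG0) hGm.aestronglyMeasurable]
    refine ENNReal.toReal_le_of_le_ofReal (le_max_right _ _) ((hC ν).trans ?_)
    exact ENNReal.ofReal_le_ofReal (le_max_left _ _)
  have hterm : ∀ f : Cov q × ℝ → ℝ, Measurable f → (∀ z, 0 ≤ f z) →
      (∀ z, f z ≤ ‖z.1‖ ^ 4 + z.2 ^ 4 + K z.1 ^ 4) →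
      (∀ i, Integrable (fun pop : Pop q (S ν).N => f (pop i)) (S ν).popLaw) ∧
      ∫ pop : Pop q (S ν).N, ((S ν).N : ℝ)⁻¹ * ∑ i, f (pop i) ∂(S ν).popLaw ≤ max C 0 := by
    intro f hf hf0 hfle
    have hi : ∀ i, Integrable (fun pop : Pop q (S ν).N => f (pop i)) (S ν).popLaw := by
      intro i
      have hN : ((S ν).N : ℝ) ≠ 0 := by
        have := i.pos
        positivity
      refine (hGi.const_mul ((S ν).N : ℝ)).mono'
        (hf.comp (measurable_pi_apply i)).aestronglyMeasurable (.of_forall fun pop => ?_)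
      rw [Real.norm_of_nonneg (hf0 _), hG, ← mul_assoc, mul_inv_cancel₀ hN, one_mul]
      exact (hfle _).trans (Finset.single_le_sum (f := fun i =>
        ‖(pop i).1‖ ^ 4 + (pop i).2 ^ 4 + K (pop i).1 ^ 4) (fun _ _ => by positivity)
        (Finset.mem_univ i))
    refine ⟨hi, (integral_mono ((integrable_finsetSum _ fun i _ => hi i).const_mul _) hGi
      fun pop => ?_).trans hGle⟩
    simp only [hG]
    gcongr with i
    exact hfle _
  have h1 := hterm (fun z => z.2 ^ 4) (measurable_snd.pow_const 4) (fun z => by positivity)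
    fun z => by
      have : 0 ≤ ‖z.1‖ ^ 4 := by positivity
      have : 0 ≤ K z.1 ^ 4 := by positivity
      linarith
  have h2 := hterm (fun z => K z.1 ^ 4) ((hK.comp measurable_fst).pow_const 4)
    (fun z => by positivity) fun z => by
      have : 0 ≤ ‖z.1‖ ^ 4 := by positivity
      have : 0 ≤ z.2 ^ 4 := by positivity
      linarith
  exact ⟨h1.1, h2.1, h1.2, h2.2⟩

omit A in
theorem _root_.MassImputation.le_one_add_pow_four (x : ℝ) : x ≤ 1 + x ^ 4 := by
  nlinarith [sq_nonneg (x ^ 2 - 1), sq_nonneg (x - 1), sq_nonneg (x ^ 2)]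

omit A in
theorem _root_.MassImputation.abs_le_one_add_pow_four (x : ℝ) : |x| ≤ 1 + x ^ 4 := by
  have := le_one_add_pow_four |x|
  rwa [Even.pow_abs (by decide)] at this

omit A in
theorem _root_.MassImputation.sq_le_one_add_pow_four (x : ℝ) : x ^ 2 ≤ 1 + x ^ 4 := by
  nlinarith [sq_nonneg (x ^ 2 - 1), sq_nonneg (x ^ 2)]

theorem integrable_y (ν : ℕ) (i : Fin (S ν).N) :
    Integrable (fun z : Cov q × ℝ => z.2) ((S ν).unit i) := by
  obtain ⟨C, -, hC⟩ := A.exists_moment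
  have h1 := (hC ν).1 i
  have hmp := measurePreserving_eval (S ν).unit i
  have h2 : Integrable (fun z : Cov q × ℝ => z.2 ^ 4) ((S ν).unit i) :=
    (hmp.integrable_comp (g := fun z : Cov q × ℝ => z.2 ^ 4)
      (measurable_snd.pow_const 4).aestronglyMeasurable).1 h1
  refine ((integrable_const (1 : ℝ)).add h2).mono' measurable_snd.aestronglyMeasurable
    (.of_forall fun z => ?_)
  exact abs_le_one_add_pow_four z.2

theorem exists_moment_B : ∃ C : ℝ, 0 ≤ C ∧ ∀ ν,
    Integrable (fun ω => avg ω.2 fun i => env K (ω.1 i) ^ 4) (S ν).lawB ∧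
    ∫ ω, avg ω.2 (fun i => env K (ω.1 i) ^ 4) ∂(S ν).lawB ≤ C := by
  obtain ⟨C, hC⟩ := A.mom_B
  refine ⟨max C 0, le_max_right _ _, fun ν => ?_⟩
  have hm : Measurable fun ω : Pop q (S ν).N × Finset (Fin (S ν).N) =>
      avg ω.2 fun i => env K (ω.1 i) ^ 4 := measurable_avg (A.reg.measurable_env.pow_const 4)
  have h0 : ∀ ω : Pop q (S ν).N × Finset (Fin (S ν).N),
      0 ≤ avg ω.2 fun i => env K (ω.1 i) ^ 4 := fun ω =>
    mul_nonneg (by positivity) (Finset.sum_nonneg fun _ _ => by positivity)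
  refine ⟨⟨hm.aestronglyMeasurable, ?_⟩, ?_⟩
  · rw [hasFiniteIntegral_iff_ofReal (.of_forall h0)]
    exact (hC ν).trans_lt ENNReal.ofReal_lt_top
  · rw [integral_eq_lintegral_of_nonneg_ae (.of_forall h0) hm.aestronglyMeasurable]
    refine ENNReal.toReal_le_of_le_ofReal (le_max_right _ _) ((hC ν).trans ?_)
    exact ENNReal.ofReal_le_ofReal (le_max_left _ _)

theorem exists_diam : ∃ d : ℝ, 0 ≤ d ∧ ∀ β ∈ Θ, ∀ β' ∈ Θ, ‖β - β'‖ ≤ d := by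
  refine ⟨Metric.diam Θ, Metric.diam_nonneg, fun β hβ β' hβ' => ?_⟩
  rw [← dist_eq_norm]
  exact Metric.dist_le_diam_of_mem A.reg.compact.isBounded hβ hβ'

end Assumptions

/-! ### The solution for the sample `B` -/

/-- The solution of the estimating equations for the sample `B`. -/
def betaHat {N : ℕ} (sol : Pop q N → (Fin N → ℕ) → Param p) (ω : Pop q N × Finset (Fin N)) :
    Param p := sol ω.1 (ofSample ω.2)

theorem IsSolver.measurable_betaHat {N : ℕ} {m : Cov q → Param p → ℝ}
    {h : Cov q → Param p → Param p} {Θ : Set (Param p)} {sol : Pop q N → (Fin N → ℕ) → Param p}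
    (hsol : IsSolver m h Θ sol) : Measurable (betaHat sol) :=
  measurable_from_prod_countable_left fun B => hsol.meas (ofSample B)

theorem IsSolver.betaHat_mem {N : ℕ} {m : Cov q → Param p → ℝ}
    {h : Cov q → Param p → Param p} {Θ : Set (Param p)} {sol : Pop q N → (Fin N → ℕ) → Param p}
    (hsol : IsSolver m h Θ sol) (ω : Pop q N × Finset (Fin N)) : betaHat sol ω ∈ Θ :=
  hsol.mem _ _

namespace Assumptions

variable {S : ℕ → Stage q} {nA nB : ℕ → ℝ} {m : Cov q → Param p → ℝ}
  {h : Cov q → Param p → Param p} {K : Cov q → ℝ} {Θ : Set (Param p)} {β₀ : Param p}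
  {sol : ∀ ν, Pop q (S ν).N → (Fin (S ν).N → ℕ) → Param p}
  (A : Assumptions S nA nB m h K Θ β₀ sol)
include A

omit A in
theorem _root_.MassImputation.noiseSize_eq {N : ℕ} (τ : Tuning Θ β₀)
    (ω : Pop q N × Finset (Fin N)) :
    noiseSize m h τ ω.1 ω.2 = ∑ a, |noiseAvg m β₀ (noiseTest h τ a) ω| := by
  simp only [noiseSize, noiseAvg, smean_ofSample]
  rfl

omit A in
theorem _root_.MassImputation.sum_pow_four_le {ι : Type*} [Fintype ι] (f : ι → ℝ) :
    (∑ a, |f a|) ^ 4 ≤ (Fintype.card ι : ℝ) ^ 3 * ∑ a, f a ^ 4 := by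
  have h1 := sq_sum_le_card_mul_sum_sq (s := Finset.univ) (f := fun a => |f a|)
  have h2 := sq_sum_le_card_mul_sum_sq (s := Finset.univ) (f := fun a => f a ^ 2)
  simp only [sq_abs, ← pow_mul, Finset.card_univ] at h1 h2
  norm_num at h2
  calc (∑ a, |f a|) ^ 4 = ((∑ a, |f a|) ^ 2) ^ 2 := by ring
    _ ≤ (Fintype.card ι * ∑ a, f a ^ 2) ^ 2 := by gcongr
    _ = (Fintype.card ι : ℝ) ^ 2 * (∑ a, f a ^ 2) ^ 2 := by ring
    _ ≤ (Fintype.card ι : ℝ) ^ 2 * (Fintype.card ι * ∑ a, f a ^ 4) := by gcongr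
    _ = _ := by ring

/-- Size of the noise in a sample that is not too small; zero for small samples. -/
noncomputable def _root_.MassImputation.noiseOk {N : ℕ} (m : Cov q → Param p → ℝ)
    (h : Cov q → Param p → Param p) (τ : Tuning Θ β₀) (r : ℝ) (ω : Pop q N × Finset (Fin N)) : ℝ :=
  if r ≤ ω.2.card then noiseSize m h τ ω.1 ω.2 else 0

omit A in
theorem _root_.MassImputation.noiseOk_nonneg {N : ℕ} (τ : Tuning Θ β₀) (r : ℝ)
    (ω : Pop q N × Finset (Fin N)) : 0 ≤ noiseOk m h τ r ω := by
  unfold noiseOk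
  split_ifs
  exacts [noiseSize_nonneg _ _, le_rfl]

omit A in
theorem _root_.MassImputation.measurableSet_le_card {N : ℕ} (r : ℝ) :
    MeasurableSet {ω : Pop q N × Finset (Fin N) | r ≤ ω.2.card} :=
  measurable_snd (MeasurableSet.of_discrete (s := {s : Finset (Fin N) | r ≤ s.card}))

omit A in
theorem _root_.MassImputation.Regular.measurable_noiseOk (R : Regular m h K Θ β₀) {N : ℕ}
    (τ : Tuning Θ β₀) (r : ℝ) : Measurable (noiseOk (N := N) m h τ r) := by
  unfold noiseOk
  simp_rw [noiseSize_eq]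
  refine Measurable.ite (measurableSet_le_card r) ?_ measurable_const
  refine Finset.measurable_sum _ fun a _ => ?_
  exact (R.measurable_noiseAvg (R.measurable_noiseTest a)).abs

/-- The noise in the sample `B` is of the order `n_B^{-1/2}` in fourth mean. -/
theorem exists_noise_bound (τ : Tuning Θ β₀) : ∃ C : ℝ, 0 ≤ C ∧ ∀ᶠ ν in atTop,
    Integrable (fun ω => noiseOk m h τ (nB ν / 2) ω ^ 4) (S ν).lawB ∧
    ∫ ω, noiseOk m h τ (nB ν / 2) ω ^ 4 ∂(S ν).lawB ≤ C / nB ν ^ 2 := by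
  obtain ⟨C, hC0, hC⟩ := A.exists_moment_B
  set k : ℝ := (Fintype.card (NoiseIdx τ) : ℝ) with hk
  refine ⟨k ^ 3 * (k * (64 * C)), by positivity, ?_⟩
  filter_upwards [A.nB_pos] with ν hν
  have hr : 0 < nB ν / 2 := by linarith
  have hn : 0 < nB ν := by linarith
  have hb := fun a : NoiseIdx τ => Stage.integral_noise_pow_four A.reg (A.model ν) (A.ignorable ν)
    (A.integrable_y ν) (hC ν).1 (A.reg.measurable_noiseTest a) (κ := 1)
    (fun x => by simpa using A.reg.noiseTest_le a x) hr
  have hle : ∀ ω : Pop q (S ν).N × Finset (Fin (S ν).N), noiseOk m h τ (nB ν / 2) ω ^ 4 ≤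
      k ^ 3 * ∑ a, if nB ν / 2 ≤ ω.2.card then noiseAvg m β₀ (noiseTest h τ a) ω ^ 4 else 0 := by
    intro ω
    unfold noiseOk
    split_ifs with hω
    · rw [noiseSize_eq]
      exact sum_pow_four_le _
    · simp
  have hint : Integrable (fun ω : Pop q (S ν).N × Finset (Fin (S ν).N) => k ^ 3 * ∑ a,
      if nB ν / 2 ≤ ω.2.card then noiseAvg m β₀ (noiseTest h τ a) ω ^ 4 else 0) (S ν).lawB :=
    (integrable_finsetSum _ fun a _ => (hb a).1).const_mul _
  have hint2 : Integrable (fun ω => noiseOk m h τ (nB ν / 2) ω ^ 4) (S ν).lawB := by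
    refine hint.mono' ((A.reg.measurable_noiseOk τ _).pow_const 4).aestronglyMeasurable
      (.of_forall fun ω => ?_)
    rw [Real.norm_of_nonneg (by positivity)]
    exact hle ω
  refine ⟨hint2, (integral_mono hint2 hint hle).trans ?_⟩
  rw [integral_const_mul, integral_finsetSum _ fun a _ => (hb a).1]
  have h1 : ∀ a : NoiseIdx τ, ∫ ω : Pop q (S ν).N × Finset (Fin (S ν).N),
      (if nB ν / 2 ≤ ω.2.card then noiseAvg m β₀ (noiseTest h τ a) ω ^ 4 else 0) ∂(S ν).lawB ≤
      64 * C / nB ν ^ 2 := by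
    intro a
    refine (hb a).2.trans ?_
    calc (1 : ℝ) ^ 4 * (16 / (nB ν / 2) ^ 2) * ∫ ω, avg ω.2 (fun i => env K (ω.1 i) ^ 4) ∂(S ν).lawB
        ≤ (1 : ℝ) ^ 4 * (16 / (nB ν / 2) ^ 2) * C := by gcongr; exact (hC ν).2
      _ = _ := by field_simp; ring
  calc k ^ 3 * ∑ a : NoiseIdx τ, ∫ ω : Pop q (S ν).N × Finset (Fin (S ν).N),
      (if nB ν / 2 ≤ ω.2.card then noiseAvg m β₀ (noiseTest h τ a) ω ^ 4 else 0) ∂(S ν).lawB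
      ≤ k ^ 3 * ∑ a : NoiseIdx τ, 64 * C / nB ν ^ 2 := by
        gcongr with a
        exact h1 a
    _ = _ := by
        simp only [Finset.sum_const, Finset.card_univ, nsmul_eq_mul, ← hk]
        ring

end Assumptions

end

section

/-! ### Sequences that are negligible in mean square -/

section Negligible

variable {Ω : ℕ → Type*} [∀ ν, MeasurableSpace (Ω ν)]

/-- The mean square of `f ν` is `o(1 / n ν)`. -/
def Negligible (P : ∀ ν, Measure (Ω ν)) (n : ℕ → ℝ) (f : ∀ ν, Ω ν → ℝ) : Prop :=
  (∀ᶠ ν in atTop, MemLp (f ν) 2 (P ν)) ∧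
    Tendsto (fun ν => n ν * ∫ ω, f ν ω ^ 2 ∂P ν) atTop (𝓝 0)

variable {P : ∀ ν, Measure (Ω ν)} {n : ℕ → ℝ} (hn : ∀ᶠ ν in atTop, 0 ≤ n ν)
  {f g : ∀ ν, Ω ν → ℝ}
include hn

theorem Negligible.mono (hg : Negligible P n g)
    (hf : ∀ᶠ ν in atTop, AEStronglyMeasurable (f ν) (P ν))
    (h : ∀ᶠ ν in atTop, ∀ ω, |f ν ω| ≤ |g ν ω|) : Negligible P n f := by
  have h1 : ∀ᶠ ν in atTop, MemLp (f ν) 2 (P ν) := by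
    filter_upwards [hg.1, hf, h] with ν h1 h2 h3
    exact h1.mono h2 (.of_forall h3)
  refine ⟨h1, squeeze_zero' ?_ ?_ hg.2⟩
  · filter_upwards [hn] with ν h1
    exact mul_nonneg h1 (integral_nonneg fun _ => sq_nonneg _)
  · filter_upwards [hn, h, hg.1, h1] with ν h2 h3 h4 h5
    refine mul_le_mul_of_nonneg_left (integral_mono h5.integrable_sq h4.integrable_sq fun ω => ?_) h2
    exact sq_le_sq.2 (h3 ω)

theorem Negligible.add (hf : Negligible P n f) (hg : Negligible P n g) :
    Negligible P n fun ν ω => f ν ω + g ν ω := by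
  have h1 : ∀ᶠ ν in atTop, MemLp (fun ω => f ν ω + g ν ω) 2 (P ν) := by
    filter_upwards [hf.1, hg.1] with ν h1 h2
    exact h1.add h2
  refine ⟨h1, squeeze_zero' (g := fun ν => 2 * (n ν * ∫ ω, f ν ω ^ 2 ∂P ν) +
    2 * (n ν * ∫ ω, g ν ω ^ 2 ∂P ν)) ?_ ?_ ?_⟩
  · filter_upwards [hn] with ν h1
    exact mul_nonneg h1 (integral_nonneg fun _ => sq_nonneg _)
  · filter_upwards [hn, hf.1, hg.1, h1] with ν h2 h3 h4 h5
    have : ∫ ω, (f ν ω + g ν ω) ^ 2 ∂P ν ≤ ∫ ω, (2 * f ν ω ^ 2 + 2 * g ν ω ^ 2) ∂P ν := by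
      refine integral_mono h5.integrable_sq
        ((h3.integrable_sq.const_mul 2).add (h4.integrable_sq.const_mul 2)) fun ω => ?_
      simp only
      nlinarith [sq_nonneg (f ν ω - g ν ω)]
    rw [integral_add (h3.integrable_sq.const_mul 2) (h4.integrable_sq.const_mul 2),
      integral_const_mul, integral_const_mul] at this
    nlinarith [mul_le_mul_of_nonneg_left this h2]
  · simpa using (hf.2.const_mul 2).add (hg.2.const_mul 2)

omit hn in
theorem Negligible.const_mul (hf : Negligible P n f) (c : ℝ) :
    Negligible P n fun ν ω => c * f ν ω := by
  refine ⟨hf.1.mono fun ν h => h.const_mul c, ?_⟩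
  simp_rw [mul_pow]
  simp_rw [integral_const_mul]
  have := hf.2.const_mul (c ^ 2)
  rw [mul_zero] at this
  refine this.congr fun ν => by ring

theorem Negligible.sum {ι : Type*} (s : Finset ι) {f : ι → ∀ ν, Ω ν → ℝ}
    (hf : ∀ i ∈ s, Negligible P n (f i)) : Negligible P n fun ν ω => ∑ i ∈ s, f i ν ω := by
  classical
  induction s using Finset.induction_on with
  | empty => simp [Negligible]
  | insert i s his ih =>
    simp_rw [Finset.sum_insert his]
    exact (hf i (Finset.mem_insert_self _ _)).add hn
      (ih fun j hj => hf j (Finset.mem_insert_of_mem hj))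

omit hn in
theorem Negligible.comp {Ω' : ℕ → Type*} [∀ ν, MeasurableSpace (Ω' ν)]
    {P' : ∀ ν, Measure (Ω' ν)} (hf : Negligible P n f) (φ : ∀ ν, Ω' ν → Ω ν)
    (hφ : ∀ ν, Measurable (φ ν)) (hmap : ∀ ν, (P' ν).map (φ ν) = P ν) :
    Negligible P' n fun ν ω => f ν (φ ν ω) := by
  have hmp : ∀ ν, MeasurePreserving (φ ν) (P' ν) (P ν) := fun ν => ⟨hφ ν, hmap ν⟩
  refine ⟨hf.1.mono fun ν h => h.comp_measurePreserving (hmp ν), hf.2.congr' ?_⟩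
  filter_upwards [hf.1] with ν h1
  rw [← hmap ν, integral_map (hφ ν).aemeasurable]
  rw [hmap ν]
  exact h1.aestronglyMeasurable.pow 2

/-- A negligible remainder does not change the limit of the normalized variance. -/
theorem Negligible.variance_add [∀ ν, IsProbabilityMeasure (P ν)] {R : ∀ ν, Ω ν → ℝ}
    (hR : Negligible P n R) (hX : ∀ᶠ ν in atTop, MemLp (f ν) 2 (P ν))
    (hX0 : ∀ᶠ ν in atTop, ∫ ω, f ν ω ∂P ν = 0) {C : ℝ}
    (hXC : ∀ᶠ ν in atTop, n ν * ∫ ω, f ν ω ^ 2 ∂P ν ≤ C) :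
    Tendsto (fun ν => n ν * Var[fun ω => f ν ω + R ν ω; P ν] - n ν * ∫ ω, f ν ω ^ 2 ∂P ν)
      atTop (𝓝 0) := by
  have h1 : Tendsto (fun ν => 2 * (√C * √(n ν * ∫ ω, R ν ω ^ 2 ∂P ν)) +
      2 * (n ν * ∫ ω, R ν ω ^ 2 ∂P ν)) atTop (𝓝 0) := by
    have := (((Real.continuous_sqrt.tendsto 0).comp hR.2).const_mul √C).const_mul 2
    simpa using this.add (hR.2.const_mul 2)
  refine squeeze_zero_norm' ?_ h1
  filter_upwards [hn, hR.1, hX, hX0, hXC] with ν h2 h3 h4 h5 h6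
  have i1 : Integrable (fun ω => f ν ω * R ν ω) (P ν) := h4.integrable_mul h3
  have i2 := h4.integrable_sq
  have i3 := h3.integrable_sq
  have hm : ∫ ω, (f ν ω + R ν ω) ∂P ν = ∫ ω, R ν ω ∂P ν := by
    rw [integral_add (h4.integrable (by norm_num)) (h3.integrable (by norm_num)), h5, zero_add]
  have hs : ∫ ω, (f ν ω + R ν ω) ^ 2 ∂P ν =
      ∫ ω, f ν ω ^ 2 ∂P ν + 2 * ∫ ω, f ν ω * R ν ω ∂P ν + ∫ ω, R ν ω ^ 2 ∂P ν := by
    rw [← integral_const_mul, ← integral_add i2 (i1.const_mul 2),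
      ← integral_add (i2.fun_add (i1.const_mul 2)) i3]
    congr 1
    ext ω
    ring
  have hv : Var[fun ω => f ν ω + R ν ω; P ν] =
      ∫ ω, (f ν ω + R ν ω) ^ 2 ∂P ν - (∫ ω, R ν ω ∂P ν) ^ 2 := by
    have hX' : MemLp (fun ω => f ν ω + R ν ω) 2 (P ν) := h4.add h3
    rw [variance_eq_sub hX', hm]
    rfl
  have hJ : (∫ ω, R ν ω ∂P ν) ^ 2 ≤ ∫ ω, R ν ω ^ 2 ∂P ν := by
    have := variance_nonneg (R ν) (P ν)
    rw [variance_eq_sub h3] at this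
    simpa using this
  have hcs := abs_integral_mul_le h4 h3
  have hsq : n ν * (√(∫ ω, f ν ω ^ 2 ∂P ν) * √(∫ ω, R ν ω ^ 2 ∂P ν)) ≤
      √C * √(n ν * ∫ ω, R ν ω ^ 2 ∂P ν) := by
    have e : n ν * (√(∫ ω, f ν ω ^ 2 ∂P ν) * √(∫ ω, R ν ω ^ 2 ∂P ν)) =
        √(n ν * ∫ ω, f ν ω ^ 2 ∂P ν) * √(n ν * ∫ ω, R ν ω ^ 2 ∂P ν) := by
      rw [Real.sqrt_mul h2, Real.sqrt_mul h2]
      have := Real.mul_self_sqrt h2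
      calc _ = (√(n ν) * √(n ν)) * (√(∫ ω, f ν ω ^ 2 ∂P ν) * √(∫ ω, R ν ω ^ 2 ∂P ν)) := by rw [this]
        _ = _ := by ring
    rw [e]
    gcongr
  rw [hv, hs, Real.norm_eq_abs]
  set a := ∫ ω, f ν ω ^ 2 ∂P ν
  set b := ∫ ω, f ν ω * R ν ω ∂P ν
  set r := ∫ ω, R ν ω ^ 2 ∂P ν
  set t := (∫ ω, R ν ω ∂P ν) ^ 2
  have ht : 0 ≤ t := sq_nonneg _
  have hb := mul_le_mul_of_nonneg_left (hcs.trans le_rfl) h2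
  have hb2 := abs_le.1 hcs
  have e1 : n ν * (a + 2 * b + r - t) - n ν * a = 2 * (n ν * b) + n ν * (r - t) := by ring
  rw [e1]
  have h7 : |n ν * b| ≤ √C * √(n ν * r) := by
    rw [abs_mul, abs_of_nonneg h2]
    exact hb.trans hsq
  have h8 : |n ν * (r - t)| ≤ n ν * r := by
    rw [abs_of_nonneg (mul_nonneg h2 (sub_nonneg.2 hJ))]
    exact mul_le_mul_of_nonneg_left (by linarith) h2
  have h9 : 0 ≤ n ν * r := mul_nonneg h2 (integral_nonneg fun _ => sq_nonneg _)
  calc |2 * (n ν * b) + n ν * (r - t)| ≤ |2 * (n ν * b)| + |n ν * (r - t)| := abs_add_le _ _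
    _ ≤ 2 * (√C * √(n ν * r)) + 2 * (n ν * r) := by
      rw [abs_mul, abs_two]
      linarith

/-- Product of a sequence of fourth moments `O(n⁻²)` and a bounded sequence that vanishes in
probability. -/
theorem Negligible.mul_of_whp [∀ ν, IsProbabilityMeasure (P ν)] {C C' : ℝ}
    (hf : ∀ᶠ ν in atTop, AEStronglyMeasurable (f ν) (P ν) ∧
      Integrable (fun ω => f ν ω ^ 4) (P ν) ∧ n ν ^ 2 * ∫ ω, f ν ω ^ 4 ∂P ν ≤ C)
    (hgm : ∀ ν, Measurable (g ν)) (hgC : ∀ᶠ ν in atTop, ∀ ω, |g ν ω| ≤ C')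
    (hg : Tendsto (fun x : Σ ν, Ω ν => g x.1 x.2) (whp P) (𝓝 0)) :
    Negligible P n fun ν ω => f ν ω * g ν ω := by
  have hg4 : Tendsto (fun ν => ∫ ω, g ν ω ^ 4 ∂P ν) atTop (𝓝 0) := by
    have h1 := tendsto_lintegral_of_whp (P := P) (Z := fun x => g x.1 x.2 ^ 4) (C := C' ^ 4)
      (by
        filter_upwards [hgC] with ν hν ω
        have := pow_le_pow_left₀ (abs_nonneg _) (hν ω) 4
        rwa [Even.pow_abs (by decide)] at this) (by simpa using hg.pow 4)
    have h2 := (ENNReal.tendsto_toReal ENNReal.zero_ne_top).comp h1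
    refine h2.congr fun ν => ?_
    rw [integral_eq_lintegral_of_nonneg_ae (.of_forall fun ω => by positivity)
      ((hgm ν).pow_const 4).aestronglyMeasurable]
    rfl
  have hgi : ∀ᶠ ν in atTop, Integrable (fun ω => g ν ω ^ 4) (P ν) := by
    filter_upwards [hgC] with ν hν
    refine Integrable.of_bound ((hgm ν).pow_const 4).aestronglyMeasurable (C' ^ 4)
      (.of_forall fun ω => ?_)
    rw [norm_pow]
    exact pow_le_pow_left₀ (norm_nonneg _) (hν ω) 4
  refine ⟨?_, ?_⟩
  · filter_upwards [hf, hgC] with ν h1 h2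
    have h3 : MemLp (f ν) 2 (P ν) := by
      rw [memLp_two_iff_integrable_sq h1.1]
      exact (memLp_two_sq h1.1 h1.2.1).integrable (by norm_num)
    have := h3.mul (p := ∞) (q := 2) (r := 2)
      (memLp_top_of_bound (hgm ν).aestronglyMeasurable C' (.of_forall h2))
    rw [mul_comm] at this
    exact this
  · have h0 : Tendsto (fun ν => √C * √(∫ ω, g ν ω ^ 4 ∂P ν)) atTop (𝓝 0) := by
      simpa using ((Real.continuous_sqrt.tendsto 0).comp hg4).const_mul √C
    refine squeeze_zero' ?_ ?_ h0
    · filter_upwards [hn] with ν h1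
      exact mul_nonneg h1 (integral_nonneg fun _ => sq_nonneg _)
    · filter_upwards [hn, hf, hgi] with ν h1 h2 h3
      have hcs := abs_integral_mul_le (memLp_two_sq h2.1 h2.2.1)
        (memLp_two_sq (hgm ν).aestronglyMeasurable h3)
      simp only [← pow_mul, ← mul_pow] at hcs
      norm_num at hcs
      calc n ν * ∫ ω, (f ν ω * g ν ω) ^ 2 ∂P ν
          ≤ n ν * (√(∫ ω, f ν ω ^ 4 ∂P ν) * √(∫ ω, g ν ω ^ 4 ∂P ν)) :=
            mul_le_mul_of_nonneg_left ((le_abs_self _).trans hcs) h1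
        _ = √(n ν ^ 2 * ∫ ω, f ν ω ^ 4 ∂P ν) * √(∫ ω, g ν ω ^ 4 ∂P ν) := by
            rw [Real.sqrt_mul (sq_nonneg _), Real.sqrt_sq h1]
            ring
        _ ≤ _ := by
            gcongr
            exact h2.2.2

end Negligible

end

section

/-! ### Well-behaved samples and limits of the linearization -/

variable {p q : ℕ}

theorem gradient_apply (f : Param p → ℝ) (β : Param p) (l : Fin p) :
    (∇ f β) l = fderiv ℝ f β (EuclideanSpace.single l 1) := by
  rw [gradient, ← InnerProductSpace.toDual_symm_apply (𝕜 := ℝ) (y := fderiv ℝ f β)]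
  rw [EuclideanSpace.inner_single_right]
  simp

theorem jacMap_apply {N : ℕ} (m : Cov q → Param p → ℝ) (h : Cov q → Param p → Param p)
    (β₀ : Param p) (ω : Pop q N × Finset (Fin N)) (j l : Fin p) :
    jacMap m h β₀ ω.1 ω.2 (EuclideanSpace.single l 1) j = jacobian m h β₀ j l ω := by
  rw [jacMap, smean_clm_apply, smean_apply, smean_ofSample, jacobian]
  simp [gradient_apply, mul_comm]

/-- A functional on the parameters is bounded by the sum of its coordinates. -/
theorem norm_le_sum_abs_single (γ : Param p →L[ℝ] ℝ) :
    ‖γ‖ ≤ ∑ l, |γ (EuclideanSpace.single l 1)| := by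
  refine γ.opNorm_le_bound (Finset.sum_nonneg fun _ _ => abs_nonneg _) fun v => ?_
  have hv : v = ∑ l, v l • EuclideanSpace.single l (1 : ℝ) := by
    conv_lhs => rw [← (EuclideanSpace.basisFun (Fin p) ℝ).sum_repr v]
    simp
  conv_lhs => rw [hv, map_sum]
  rw [Finset.sum_mul]
  refine (norm_sum_le _ _).trans (Finset.sum_le_sum fun l _ => ?_)
  rw [map_smul, norm_smul, mul_comm]
  exact mul_le_mul_of_nonneg_left (PiLp.norm_apply_le v l) (norm_nonneg _)

/-- A linear map that is bounded below has, for every functional `γ`, a functional `α` that solves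
the adjoint equation. -/
theorem exists_functional (J : Param p →L[ℝ] Param p) {c : ℝ} (hc : 0 < c)
    (hJ : ∀ v, c * ‖v‖ ≤ ‖J v‖) (γ : Param p →L[ℝ] ℝ) :
    ∃ α : Param p →L[ℝ] ℝ, (∀ v, α (J v) = γ v) ∧ ‖α‖ ≤ ‖γ‖ / c := by
  have hinj : Function.Injective (J : Param p →ₗ[ℝ] Param p) := by
    rw [← LinearMap.ker_eq_bot, LinearMap.ker_eq_bot']
    intro v hv
    have := hJ v
    rw [show J v = 0 from hv, norm_zero] at this
    have h2 : ‖v‖ ≤ 0 := by nlinarith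
    simpa using h2
  set e := LinearEquiv.ofInjectiveEndo (J : Param p →ₗ[ℝ] Param p) hinj
  have he : ∀ v, e v = J v := fun v => rfl
  refine ⟨LinearMap.toContinuousLinearMap ((γ : Param p →ₗ[ℝ] ℝ) ∘ₗ (e.symm : Param p →ₗ[ℝ] Param p)),
    fun v => ?_, ?_⟩
  · simp [← he]
  · refine ContinuousLinearMap.opNorm_le_bound _ (by positivity) fun v => ?_
    have h1 := hJ (e.symm v)
    rw [← he, e.apply_symm_apply] at h1
    calc ‖γ (e.symm v)‖ ≤ ‖γ‖ * ‖e.symm v‖ := γ.le_opNorm _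
      _ ≤ ‖γ‖ * (‖v‖ / c) := by
        gcongr
        rw [le_div_iff₀ hc]
        linarith
      _ = _ := by ring

theorem eventually_exists_of_whp {Ω : ℕ → Type*} [∀ ν, MeasurableSpace (Ω ν)]
    {P : ∀ ν, Measure (Ω ν)} [∀ ν, IsProbabilityMeasure (P ν)] {Q : (Σ ν, Ω ν) → Prop}
    (hQ : ∀ᶠ x in whp P, Q x) : ∀ᶠ ν in atTop, ∃ ω, Q ⟨ν, ω⟩ := by
  rw [eventually_whp] at hQ
  filter_upwards [hQ.eventually (gt_mem_nhds one_pos)] with ν hν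
  by_contra hcon
  push Not at hcon
  have : {ω | ¬ Q ⟨ν, ω⟩} = Set.univ := Set.eq_univ_of_forall hcon
  rw [this, measure_univ] at hν
  exact lt_irrefl _ hν

/-- Deviation of the average of `h_i ṁ_i'` over `B` from its mean. -/
noncomputable def jacDev (S : Stage q) (m : Cov q → Param p → ℝ) (h : Cov q → Param p → Param p)
    (β₀ : Param p) (ω : Pop q S.N × Finset (Fin S.N)) : ℝ :=
  ∑ a : Fin p × Fin p, |jacobian m h β₀ a.1 a.2 ω - ∫ ω', jacobian m h β₀ a.1 a.2 ω' ∂S.lawB|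

/-- The sample `B` is well-behaved and not much smaller than `n`. -/
def IsGood {N : ℕ} (m : Cov q → Param p → ℝ) (h : Cov q → Param p → Param p) (K : Cov q → ℝ)
    {Θ : Set (Param p)} {β₀ : Param p} (τ : Tuning Θ β₀) (n : ℝ)
    (ω : Pop q N × Finset (Fin N)) : Prop :=
  GoodSample m h K τ ω.1 ω.2 ∧ n / 2 ≤ ω.2.card

/-- A measurable set of small probability outside of which the sample `B` is well-behaved. -/
noncomputable def badSet (S : Stage q) (m : Cov q → Param p → ℝ) (h : Cov q → Param p → Param p)
    (K : Cov q → ℝ) {Θ : Set (Param p)} {β₀ : Param p} (τ : Tuning Θ β₀) (n : ℝ) :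
    Set (Pop q S.N × Finset (Fin S.N)) :=
  toMeasurable S.lawB {ω | ¬ IsGood m h K τ n ω}

/-- The limits that enter the linearization of the estimators: the mean `J` of the average of
`h_i ṁ_i'` over `B`, the mean `γ` of the population average of `ṁ_i'`, and the functional
`α = γ J⁻¹`, which turns the estimating function into the influence of `B` on the imputation
estimator. -/
structure Linearization (S : ℕ → Stage q) (nB : ℕ → ℝ) (m : Cov q → Param p → ℝ)
    (h : Cov q → Param p → Param p) (K : Cov q → ℝ) (Θ : Set (Param p)) (β₀ : Param p) where
  τ : Tuning Θ β₀
  J : ℕ → Param p →L[ℝ] Param p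
  γ : ℕ → Param p →L[ℝ] ℝ
  α : ℕ → Param p →L[ℝ] ℝ
  M : ℝ
  M_nonneg : 0 ≤ M
  good : Tendsto (fun ν => nB ν * (S ν).lawB.real {ω | ¬ IsGood m h K τ (nB ν) ω}) atTop (𝓝 0)
  J_apply : ∀ ν j l, J ν (EuclideanSpace.single l 1) j = ∫ ω, jacobian m h β₀ j l ω ∂(S ν).lawB
  γ_apply : ∀ ν l, γ ν (EuclideanSpace.single l 1) = ∫ pop : Pop q (S ν).N, ((S ν).N : ℝ)⁻¹ *
    ∑ i, fderiv ℝ (m (pop i).1) β₀ (EuclideanSpace.single l 1) ∂(S ν).popLaw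
  α_comp : ∀ᶠ ν in atTop, ∀ v, α ν (J ν v) = γ ν v
  J_le : ∀ᶠ ν in atTop, ‖J ν‖ ≤ M
  γ_le : ∀ᶠ ν in atTop, ‖γ ν‖ ≤ M
  α_le : ∀ᶠ ν in atTop, ‖α ν‖ ≤ M

section

variable {S : ℕ → Stage q} {nA nB : ℕ → ℝ} {m : Cov q → Param p → ℝ}
  {h : Cov q → Param p → Param p} {K : Cov q → ℝ} {Θ : Set (Param p)} {β₀ : Param p}
  {sol : ∀ ν, Pop q (S ν).N → (Fin (S ν).N → ℕ) → Param p}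

theorem Regular.measurable_jacobian (R : Regular m h K Θ β₀) {N : ℕ} (j l : Fin p) :
    Measurable (jacobian (N := N) m h β₀ j l) := by
  refine measurable_avg (f := fun z => h z.1 β₀ j * (∇ (m z.1) β₀) l) ?_
  simp_rw [gradient_apply]
  exact ((EuclideanSpace.proj j : Param p →L[ℝ] ℝ).continuous.measurable.comp
    ((R.measurable_h β₀).comp measurable_fst)).mul ((R.dm_meas _).comp measurable_fst)

theorem Regular.abs_fderiv_single_le (R : Regular m h K Θ β₀) (x : Cov q) (l : Fin p) :
    |fderiv ℝ (m x) β₀ (EuclideanSpace.single l 1)| ≤ K x := by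
  have := (fderiv ℝ (m x) β₀).le_opNorm (EuclideanSpace.single l 1)
  rw [PiLp.norm_single, norm_one, mul_one] at this
  exact this.trans (R.dm_bdd x)

theorem Regular.abs_jacobian_le (R : Regular m h K Θ β₀) {N : ℕ} (j l : Fin p)
    (ω : Pop q N × Finset (Fin N)) :
    |jacobian m h β₀ j l ω| ≤ avg ω.2 fun i => env K (ω.1 i) := by
  rw [jacobian, ← smean_ofSample, ← smean_ofSample, ← Real.norm_eq_abs]
  refine (norm_smean_le _ _).trans (smean_mono _ fun i => ?_)
  rw [Real.norm_eq_abs, abs_mul, gradient_apply, env]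
  have h1 : |h (ω.1 i).1 β₀ j| ≤ K (ω.1 i).1 :=
    (PiLp.norm_apply_le _ j).trans (R.h_bdd _ _ R.mem)
  have := R.K_nonneg (ω.1 i).1
  exact mul_le_mul (h1.trans (le_add_of_nonneg_left (abs_nonneg _)))
    (R.abs_fderiv_single_le _ l) (abs_nonneg _) (by positivity)

theorem jacDev_nonneg (S : Stage q) (ω : Pop q S.N × Finset (Fin S.N)) :
    0 ≤ jacDev S m h β₀ ω := Finset.sum_nonneg fun _ _ => abs_nonneg _

theorem Regular.measurable_jacDev (R : Regular m h K Θ β₀) (S : Stage q) :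
    Measurable (jacDev S m h β₀) :=
  Finset.measurable_sum _ fun a _ => ((R.measurable_jacobian a.1 a.2).sub_const _).abs

theorem norm_jacMap_sub_le (S : Stage q) {J : Param p →L[ℝ] Param p}
    (hJ : ∀ j l, J (EuclideanSpace.single l 1) j = ∫ ω, jacobian m h β₀ j l ω ∂S.lawB)
    (ω : Pop q S.N × Finset (Fin S.N)) :
    ‖jacMap m h β₀ ω.1 ω.2 - J‖ ≤ jacDev S m h β₀ ω := by
  refine (opNorm_le_sum_abs _).trans (le_of_eq (Finset.sum_congr rfl fun a _ => ?_))
  rw [sub_apply, PiLp.sub_apply, jacMap_apply, hJ]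

theorem not_mem_badSet {S : Stage q} {τ : Tuning Θ β₀} {n : ℝ} {ω : Pop q S.N × Finset (Fin S.N)}
    (hω : ω ∉ badSet S m h K τ n) : IsGood m h K τ n ω := by
  by_contra hcon
  exact hω (subset_toMeasurable _ _ hcon)

theorem avg_sq_le {N : ℕ} (B : Finset (Fin N)) (f : Fin N → ℝ) :
    avg B f ^ 2 ≤ avg B fun i => f i ^ 2 := by
  rcases B.eq_empty_or_nonempty with rfl | hB
  · simp [avg]
  have hc : (0 : ℝ) < B.card := by exact_mod_cast hB.card_pos
  rw [avg, avg, mul_pow]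
  have := sq_sum_le_card_mul_sum_sq (s := B) (f := f)
  calc ((B.card : ℝ)⁻¹) ^ 2 * (∑ i ∈ B, f i) ^ 2
      ≤ ((B.card : ℝ)⁻¹) ^ 2 * (B.card * ∑ i ∈ B, f i ^ 2) := by gcongr
    _ = _ := by field_simp

theorem avg_le_one_add {N : ℕ} (B : Finset (Fin N)) (f : Fin N → ℝ) :
    avg B f ≤ 1 + avg B fun i => f i ^ 4 := by
  rw [← smean_ofSample, ← smean_ofSample]
  have h1 : smean (ofSample B) (fun _ => (1 : ℝ)) ≤ 1 := by
    rw [smean_ofSample, avg]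
    simp only [Finset.sum_const, nsmul_eq_mul, mul_one]
    exact inv_mul_le_one
  calc smean (ofSample B) f ≤ smean (ofSample B) fun i => 1 + f i ^ 4 :=
        smean_mono _ fun i => le_one_add_pow_four _
    _ ≤ _ := by
      rw [smean_add]
      linarith

namespace Assumptions

variable (A : Assumptions S nA nB m h K Θ β₀ sol)
include A

theorem exists_mean_env : ∃ C : ℝ, 0 ≤ C ∧ ∀ ν,
    Integrable (fun ω => avg ω.2 fun i => env K (ω.1 i)) (S ν).lawB ∧
    ∫ ω, avg ω.2 (fun i => env K (ω.1 i)) ∂(S ν).lawB ≤ C := by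
  obtain ⟨C, hC0, hC⟩ := A.exists_moment_B
  have h0 : ∀ ν, ∀ ω : Pop q (S ν).N × Finset (Fin (S ν).N), 0 ≤ avg ω.2 fun i => env K (ω.1 i) :=
    fun ν ω => mul_nonneg (by positivity) (Finset.sum_nonneg fun i _ => A.reg.env_nonneg _)
  have hi : ∀ ν, Integrable (fun ω => avg ω.2 fun i => env K (ω.1 i)) (S ν).lawB := fun ν => by
    refine ((integrable_const (1 : ℝ)).add (hC ν).1).mono'
      (measurable_avg A.reg.measurable_env).aestronglyMeasurable (.of_forall fun ω => ?_)
    rw [Real.norm_of_nonneg (h0 ν ω)]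
    exact avg_le_one_add _ _
  refine ⟨1 + C, by positivity, fun ν => ⟨hi ν, ?_⟩⟩
  calc ∫ ω, avg ω.2 (fun i => env K (ω.1 i)) ∂(S ν).lawB
      ≤ ∫ ω, (1 + avg ω.2 (fun i => env K (ω.1 i) ^ 4)) ∂(S ν).lawB :=
        integral_mono (hi ν) ((integrable_const (1 : ℝ)).add (hC ν).1) fun ω => avg_le_one_add _ _
    _ = 1 + ∫ ω, avg ω.2 (fun i => env K (ω.1 i) ^ 4) ∂(S ν).lawB := by
        rw [integral_add (integrable_const _) (hC ν).1]
        simp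
    _ ≤ 1 + C := by linarith [(hC ν).2]

theorem tendsto_jacDev :
    Tendsto (fun x : Σ ν, Pop q (S ν).N × Finset (Fin (S ν).N) => jacDev (S x.1) m h β₀ x.2)
      (whp fun ν => (S ν).lawB) (𝓝 0) := by
  rw [← Finset.sum_const_zero (s := (Finset.univ : Finset (Fin p × Fin p)))]
  refine tendsto_finsetSum _ fun a _ => ?_
  simpa using (isLittleOp_iff.1 (A.jac a.1 a.2)).abs

/-- Samples `B` are well-behaved, up to a probability `o(1 / n_B)`. -/
theorem tendsto_good {τ : Tuning Θ β₀}
    (hC : Tendsto (fun ν => nB ν * (S ν).lawB.real {ω | τ.C < avg ω.2 fun i =>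
      env K (ω.1 i)}) atTop (𝓝 0))
    (hc : Tendsto (fun ν => nB ν * (S ν).lawB.real {ω | ∃ β ∈ Θ,
      ‖meanEstFun m h β₀ ω.1 ω.2 β‖ < τ.c * ‖β - β₀‖}) atTop (𝓝 0)) :
    Tendsto (fun ν => nB ν * (S ν).lawB.real {ω | ¬ IsGood m h K τ (nB ν) ω}) atTop (𝓝 0) := by
  obtain ⟨D, hD0, hD⟩ := A.exists_noise_bound τ
  have hη := τ.η_pos
  have h1 : Tendsto (fun ν => nB ν * (S ν).lawB.real
      {ω | τ.η ≤ noiseOk m h τ (nB ν / 2) ω}) atTop (𝓝 0) := by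
    have h2 : Tendsto (fun ν => D / τ.η ^ 4 * (nB ν)⁻¹) atTop (𝓝 0) := by
      simpa using (tendsto_inv_atTop_zero.comp A.nB_top).const_mul (D / τ.η ^ 4)
    refine squeeze_zero' ?_ ?_ h2
    · filter_upwards [A.nB_pos] with ν hν
      positivity
    · filter_upwards [A.nB_pos, hD] with ν hν hDν
      have h3 := mul_meas_ge_le_integral_of_nonneg (μ := (S ν).lawB)
        (f := fun ω => noiseOk m h τ (nB ν / 2) ω ^ 4) (.of_forall fun ω => by positivity)
        hDν.1 (τ.η ^ 4)
      have h4 : (S ν).lawB.real {ω | τ.η ≤ noiseOk m h τ (nB ν / 2) ω} ≤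
          (S ν).lawB.real {ω | τ.η ^ 4 ≤ noiseOk m h τ (nB ν / 2) ω ^ 4} :=
        measureReal_mono fun ω hω => pow_le_pow_left₀ hη.le hω 4
      have h5 : τ.η ^ 4 * (S ν).lawB.real {ω | τ.η ≤ noiseOk m h τ (nB ν / 2) ω} ≤
          D / nB ν ^ 2 := (mul_le_mul_of_nonneg_left h4 (by positivity)).trans (h3.trans hDν.2)
      have hn : 0 < nB ν := by linarith
      calc nB ν * (S ν).lawB.real {ω | τ.η ≤ noiseOk m h τ (nB ν / 2) ω}
          = nB ν / τ.η ^ 4 * (τ.η ^ 4 *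
              (S ν).lawB.real {ω | τ.η ≤ noiseOk m h τ (nB ν / 2) ω}) := by field_simp
        _ ≤ nB ν / τ.η ^ 4 * (D / nB ν ^ 2) := by gcongr
        _ = _ := by field_simp
  have h2 := ((A.card_B (1 / 2) (by norm_num)).add hC).add (hc.add h1)
  simp only [add_zero] at h2
  refine squeeze_zero' ?_ ?_ h2
  · filter_upwards [A.nB_pos] with ν hν
    positivity
  · filter_upwards [A.nB_pos] with ν hν
    have hn : 0 < nB ν := by linarith
    set s₁ := {ω : Pop q (S ν).N × Finset (Fin (S ν).N) | (1 : ℝ) / 2 ≤ |(ω.2.card : ℝ) / nB ν - 1|}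
      with hs₁
    set s₂ := {ω : Pop q (S ν).N × Finset (Fin (S ν).N) | τ.C < avg ω.2 fun i => env K (ω.1 i)}
      with hs₂
    set s₃ := {ω : Pop q (S ν).N × Finset (Fin (S ν).N) | ∃ β ∈ Θ,
      ‖meanEstFun m h β₀ ω.1 ω.2 β‖ < τ.c * ‖β - β₀‖} with hs₃
    set s₄ := {ω : Pop q (S ν).N × Finset (Fin (S ν).N) | τ.η ≤ noiseOk m h τ (nB ν / 2) ω} with hs₄
    have hsub : (S ν).lawB.real {ω | ¬ IsGood m h K τ (nB ν) ω} ≤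
        ((S ν).lawB.real s₁ + (S ν).lawB.real s₂) + ((S ν).lawB.real s₃ + (S ν).lawB.real s₄) := by
      have h3 := measureReal_union_le (μ := (S ν).lawB) (s₁ ∪ s₂) (s₃ ∪ s₄)
      have h4 := measureReal_union_le (μ := (S ν).lawB) s₁ s₂
      have h5 := measureReal_union_le (μ := (S ν).lawB) s₃ s₄
      refine le_trans (measureReal_mono (s₂ := (s₁ ∪ s₂) ∪ (s₃ ∪ s₄)) fun ω hω => ?_)
        (by linarith)
      by_contra hcon
      simp only [hs₁, hs₂, hs₃, hs₄, Set.mem_union, Set.mem_ofPred_eq, not_or, not_le, not_lt,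
        not_exists, not_and] at hcon
      obtain ⟨⟨h3, h4⟩, h5, h6⟩ := hcon
      have h7 : nB ν / 2 ≤ ω.2.card := by
        have h8 : (1 : ℝ) / 2 < ω.2.card / nB ν := by linarith [(abs_lt.1 h3).1]
        rw [lt_div_iff₀ hn] at h8
        linarith
      rw [noiseOk, if_pos h7] at h6
      exact hω ⟨⟨by rwa [smean_ofSample], h5, h6.le⟩, h7⟩
    calc _ ≤ nB ν * (((S ν).lawB.real s₁ + (S ν).lawB.real s₂) +
        ((S ν).lawB.real s₃ + (S ν).lawB.real s₄)) := mul_le_mul_of_nonneg_left hsub hn.le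
      _ = _ := by ring

/-- Identification makes the mean Jacobian `J` bounded below. On a good sample it bounds the average
Jacobian from below, and the average Jacobian is within `o_p(1)` of `J`; as `J` is deterministic,
one sample with both properties suffices. -/
theorem exists_linearization : Nonempty (Linearization S nB m h K Θ β₀) := by
  obtain ⟨C₀, hC₀⟩ := A.bdd_B
  obtain ⟨c, hc, hid⟩ := A.ident
  obtain ⟨τ, hτc, hτC⟩ := exists_tuning A.reg.compact A.reg.mem_interior hc (le_max_right C₀ 0)
  have hgood := A.tendsto_good (τ := τ) (by
    rw [hτC]
    refine squeeze_zero' ?_ ?_ hC₀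
    · filter_upwards [A.nB_pos] with ν hν
      positivity
    · filter_upwards [A.nB_pos] with ν hν
      refine mul_le_mul_of_nonneg_left (measureReal_mono fun ω hω => ?_) (by linarith)
      exact (le_max_left C₀ 0).trans_lt hω) (by rwa [hτc])
  obtain ⟨D, hD0, hD⟩ := A.exists_mean_env
  obtain ⟨E, hE0, hE⟩ := A.exists_moment
  set J : ℕ → Param p →L[ℝ] Param p := fun ν => ∑ j, ∑ l,
    (∫ ω, jacobian m h β₀ j l ω ∂(S ν).lawB) • (EuclideanSpace.proj l : Param p →L[ℝ] ℝ).smulRight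
      (EuclideanSpace.single j (1 : ℝ)) with hJ
  set γ : ℕ → Param p →L[ℝ] ℝ := fun ν => ∑ l, (∫ pop : Pop q (S ν).N, ((S ν).N : ℝ)⁻¹ *
    ∑ i, fderiv ℝ (m (pop i).1) β₀ (EuclideanSpace.single l 1) ∂(S ν).popLaw) •
      (EuclideanSpace.proj l : Param p →L[ℝ] ℝ) with hγ
  have hJa : ∀ ν j l, J ν (EuclideanSpace.single l 1) j =
      ∫ ω, jacobian m h β₀ j l ω ∂(S ν).lawB := by
    intro ν j l
    have h1 : (J ν) (EuclideanSpace.single l 1) = ∑ x,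
        (∫ ω, jacobian m h β₀ x l ω ∂(S ν).lawB) • EuclideanSpace.single x (1 : ℝ) := by
      simp [hJ, sum_apply]
    rw [h1, WithLp.ofLp_sum, Finset.sum_apply, Finset.sum_eq_single j]
    · simp
    · intro x _ hx
      simp only [PiLp.smul_apply, PiLp.single_apply, smul_eq_mul]
      rw [if_neg (Ne.symm hx), mul_zero]
    · simp
  have hγa : ∀ ν l, γ ν (EuclideanSpace.single l 1) = ∫ pop : Pop q (S ν).N, ((S ν).N : ℝ)⁻¹ *
      ∑ i, fderiv ℝ (m (pop i).1) β₀ (EuclideanSpace.single l 1) ∂(S ν).popLaw := by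
    intro ν l
    simp [hγ, sum_apply, PiLp.single_apply]
  have hJle : ∀ ν, ‖J ν‖ ≤ (Fintype.card (Fin p × Fin p)) * D := by
    intro ν
    refine (opNorm_le_sum_abs _).trans ?_
    rw [← nsmul_eq_mul]
    refine Finset.sum_le_card_nsmul _ _ _ fun a _ => ?_
    rw [hJa]
    calc |∫ ω, jacobian m h β₀ a.1 a.2 ω ∂(S ν).lawB|
        ≤ ∫ ω, avg ω.2 (fun i => env K (ω.1 i)) ∂(S ν).lawB := by
          rw [← Real.norm_eq_abs]
          exact norm_integral_le_of_norm_le (hD ν).1 (.of_forall fun ω => A.reg.abs_jacobian_le _ _ ω)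
      _ ≤ D := (hD ν).2
  have hγle : ∀ ν, ‖γ ν‖ ≤ p * (1 + E) := by
    intro ν
    refine (norm_le_sum_abs_single _).trans ?_
    have : (p : ℝ) * (1 + E) = Finset.univ.card (α := Fin p) • (1 + E) := by
      rw [nsmul_eq_mul, Finset.card_univ, Fintype.card_fin]
    rw [this]
    refine Finset.sum_le_card_nsmul _ _ _ fun l _ => ?_
    rw [hγa]
    have hi : Integrable (fun pop : Pop q (S ν).N => 1 + ((S ν).N : ℝ)⁻¹ *
        ∑ i, K (pop i).1 ^ 4) (S ν).popLaw :=
      (integrable_const _).add ((integrable_finsetSum _ fun i _ => (hE ν).2.1 i).const_mul _)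
    rw [← Real.norm_eq_abs]
    refine (norm_integral_le_of_norm_le hi (.of_forall fun pop => ?_)).trans ?_
    · rw [norm_mul, Real.norm_of_nonneg (by positivity : (0 : ℝ) ≤ ((S ν).N : ℝ)⁻¹)]
      calc ((S ν).N : ℝ)⁻¹ * ‖∑ i, fderiv ℝ (m (pop i).1) β₀ (EuclideanSpace.single l 1)‖
          ≤ ((S ν).N : ℝ)⁻¹ * ∑ i, (1 + K (pop i).1 ^ 4) := by
            refine mul_le_mul_of_nonneg_left ((norm_sum_le _ _).trans
              (Finset.sum_le_sum fun i _ => ?_)) (by positivity)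
            exact (A.reg.abs_fderiv_single_le _ l).trans (le_one_add_pow_four _)
        _ ≤ _ := by
            rw [Finset.sum_add_distrib, mul_add]
            simp only [Finset.sum_const, Finset.card_univ, Fintype.card_fin, nsmul_eq_mul, mul_one]
            gcongr
            exact inv_mul_le_one
    · rw [integral_add (integrable_const _)
        ((integrable_finsetSum _ fun i _ => (hE ν).2.1 i).const_mul _)]
      simpa using (hE ν).2.2.2
  -- identification bounds the average Jacobian below, and its deviation from `J` costs `c / 4`
  have hbelow : ∀ᶠ ν in atTop, ∀ v, c / 2 * ‖v‖ ≤ ‖J ν v‖ := by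
    have hg : ∀ᶠ x in whp fun ν => (S ν).lawB, IsGood m h K τ (nB x.1) x.2 := by
      rw [eventually_whp_real]
      refine squeeze_zero' (.of_forall fun ν => measureReal_nonneg) ?_ hgood
      filter_upwards [A.nB_pos] with ν hν
      exact le_mul_of_one_le_left measureReal_nonneg hν
    have hd := A.tendsto_jacDev.eventually (gt_mem_nhds (by positivity : 0 < c / 4))
    filter_upwards [eventually_exists_of_whp (hg.and hd)] with ν ⟨ω, hω, hdω⟩ v
    have h1 := le_norm_of_taylor (D := -jacMap m h β₀ ω.1 ω.2) (M := 8 * (τ.C + 1)) τ.ρ_pos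
      τ.ball_subset τ.ρ_le
      (GoodSample.meanEstFun_self ω.1 ω.2) hω.1.ident (fun β hβ hβρ => by
        have := hω.1.env_le
        have := τ.C_nonneg
        refine (A.reg.meanEstFun_taylor ω.1 ω.2 hβ hβρ).trans ?_
        have := τ.ρ_pos
        gcongr
        linarith) v
    have h2 := norm_jacMap_sub_le (S ν) (hJa ν) ω
    have h3 := (jacMap m h β₀ ω.1 ω.2 - J ν).le_opNorm v
    have h4 : ‖jacMap m h β₀ ω.1 ω.2 v‖ ≤ ‖(jacMap m h β₀ ω.1 ω.2 - J ν) v‖ + ‖J ν v‖ := by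
      have := norm_add_le ((jacMap m h β₀ ω.1 ω.2 - J ν) v) (J ν v)
      rwa [sub_apply, sub_add_cancel] at this
    rw [neg_apply, norm_neg, hτc] at h1
    have h5 : ‖jacMap m h β₀ ω.1 ω.2 - J ν‖ * ‖v‖ ≤ c / 4 * ‖v‖ := by
      gcongr
      exact h2.trans hdω.le
    linarith
  have hex : ∀ ν, ∃ α : Param p →L[ℝ] ℝ, (∀ v, c / 2 * ‖v‖ ≤ ‖J ν v‖) →
      (∀ v, α (J ν v) = γ ν v) ∧ ‖α‖ ≤ ‖γ ν‖ / (c / 2) := by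
    intro ν
    by_cases hv : ∀ v, c / 2 * ‖v‖ ≤ ‖J ν v‖
    · obtain ⟨α, hα⟩ := exists_functional (J ν) (by positivity) hv (γ ν)
      exact ⟨α, fun _ => hα⟩
    · exact ⟨0, fun h => absurd h hv⟩
  choose α hα using hex
  refine ⟨
    { τ := τ, J := J, γ := γ, α := α
      M := (Fintype.card (Fin p × Fin p)) * D + p * (1 + E) + p * (1 + E) / (c / 2)
      M_nonneg := by positivity
      good := hgood
      J_apply := hJa
      γ_apply := hγa
      α_comp := hbelow.mono fun ν hν => (hα ν hν).1
      J_le := .of_forall fun ν => (hJle ν).trans ?_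
      γ_le := .of_forall fun ν => (hγle ν).trans ?_
      α_le := hbelow.mono fun ν hν => (hα ν hν).2.trans ?_ }⟩
  · rw [add_assoc]
    exact le_add_of_nonneg_right (by positivity)
  · linarith [show 0 ≤ (Fintype.card (Fin p × Fin p)) * D by positivity,
      show 0 ≤ p * (1 + E) / (c / 2) by positivity]
  · have h1 : ‖γ ν‖ / (c / 2) ≤ p * (1 + E) / (c / 2) := by
      gcongr
      exact hγle ν
    linarith [show 0 ≤ (Fintype.card (Fin p × Fin p)) * D by positivity,
      show 0 ≤ p * (1 + E) by positivity]

end Assumptions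

end

end

section

/-! ### Asymptotic linearity of the solution for the sample `B` -/

variable {p q : ℕ} {S : ℕ → Stage q} {nA nB : ℕ → ℝ} {m : Cov q → Param p → ℝ}
  {h : Cov q → Param p → Param p} {K : Cov q → ℝ} {Θ : Set (Param p)} {β₀ : Param p}
  {sol : ∀ ν, Pop q (S ν).N → (Fin (S ν).N → ℕ) → Param p}

/-- Contribution of `B` to the linearized estimator: the average over `B` of `e_i α(h_i)`, set to
zero for samples of size less than `r`. -/
noncomputable def influence {N : ℕ} (m : Cov q → Param p → ℝ) (h : Cov q → Param p → Param p)
    (β₀ : Param p) (α : Param p →L[ℝ] ℝ) (r : ℝ) (ω : Pop q N × Finset (Fin N)) : ℝ :=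
  if r ≤ ω.2.card then noiseAvg m β₀ (fun x => α (h x β₀)) ω else 0

/-- The average of `(e_i α(h_i))²` over `B`. -/
noncomputable def influenceVar {N : ℕ} (m : Cov q → Param p → ℝ) (h : Cov q → Param p → Param p)
    (β₀ : Param p) (α : Param p →L[ℝ] ℝ) (ω : Pop q N × Finset (Fin N)) : ℝ :=
  avg ω.2 fun i => (err m β₀ (ω.1 i) * α (h (ω.1 i).1 β₀)) ^ 2

theorem functional_eq_sum (α : Param p →L[ℝ] ℝ) (v : Param p) :
    α v = ∑ l, v l * α (EuclideanSpace.single l 1) := by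
  have hv : v = ∑ l, v l • EuclideanSpace.single l (1 : ℝ) := by
    conv_lhs => rw [← (EuclideanSpace.basisFun (Fin p) ℝ).sum_repr v]
    simp
  conv_lhs => rw [hv, map_sum]
  simp

theorem influenceVar_eq {N : ℕ} (α : Param p →L[ℝ] ℝ) (ω : Pop q N × Finset (Fin N)) :
    influenceVar m h β₀ α ω = ∑ j, ∑ l, α (EuclideanSpace.single j 1) *
      α (EuclideanSpace.single l 1) * scoreVar m h β₀ j l ω := by
  simp only [influenceVar, scoreVar, avg, Finset.mul_sum]
  have h1 : ∀ j : Fin p, ∑ l : Fin p, ∑ i ∈ ω.2, α (EuclideanSpace.single j 1) *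
      α (EuclideanSpace.single l 1) * ((ω.2.card : ℝ)⁻¹ * (((ω.1 i).2 - m (ω.1 i).1 β₀) ^ 2 *
        (h (ω.1 i).1 β₀ j * h (ω.1 i).1 β₀ l))) = ∑ i ∈ ω.2, ∑ l : Fin p, α (EuclideanSpace.single j 1) *
      α (EuclideanSpace.single l 1) * ((ω.2.card : ℝ)⁻¹ * (((ω.1 i).2 - m (ω.1 i).1 β₀) ^ 2 *
        (h (ω.1 i).1 β₀ j * h (ω.1 i).1 β₀ l))) := fun j => Finset.sum_comm
  simp only [h1]
  rw [Finset.sum_comm (s := Finset.univ) (t := ω.2)]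
  refine Finset.sum_congr rfl fun i _ => ?_
  rw [functional_eq_sum α (h (ω.1 i).1 β₀), mul_pow, sq (∑ l, _), Finset.sum_mul_sum,
    Finset.mul_sum, Finset.mul_sum]
  refine Finset.sum_congr rfl fun j _ => ?_
  rw [Finset.mul_sum, Finset.mul_sum]
  refine Finset.sum_congr rfl fun l _ => ?_
  simp only [err]
  ring

theorem Regular.abs_functional_le (R : Regular m h K Θ β₀) {α : Param p →L[ℝ] ℝ} {M : ℝ}
    (hα : ‖α‖ ≤ M) (x : Cov q) : |α (h x β₀)| ≤ M * K x := by
  have := α.le_opNorm (h x β₀)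
  have h1 := R.h_bdd x β₀ R.mem
  have h2 : (0 : ℝ) ≤ ‖α‖ := norm_nonneg _
  exact this.trans (mul_le_mul hα h1 (norm_nonneg _) (h2.trans hα))

theorem Regular.measurable_functional (R : Regular m h K Θ β₀) (α : Param p →L[ℝ] ℝ) :
    Measurable fun x => α (h x β₀) := α.continuous.measurable.comp (R.measurable_h β₀)

theorem Regular.measurable_influence (R : Regular m h K Θ β₀) {N : ℕ} (α : Param p →L[ℝ] ℝ)
    (r : ℝ) : Measurable (influence (N := N) m h β₀ α r) :=
  Measurable.ite (measurableSet_le_card r) (R.measurable_noiseAvg (R.measurable_functional α))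
    measurable_const

theorem Regular.measurable_influenceVar (R : Regular m h K Θ β₀) {N : ℕ} (α : Param p →L[ℝ] ℝ) :
    Measurable (influenceVar (N := N) m h β₀ α) :=
  measurable_avg (f := fun z => (err m β₀ z * α (h z.1 β₀)) ^ 2)
    ((R.measurable_err.mul ((R.measurable_functional α).comp measurable_fst)).pow_const 2)

theorem influenceVar_nonneg {N : ℕ} (α : Param p →L[ℝ] ℝ) (ω : Pop q N × Finset (Fin N)) :
    0 ≤ influenceVar m h β₀ α ω :=
  mul_nonneg (by positivity) (Finset.sum_nonneg fun _ _ => sq_nonneg _)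

theorem Regular.influenceVar_sq_le (R : Regular m h K Θ β₀) {N : ℕ} {α : Param p →L[ℝ] ℝ} {M : ℝ}
    (hα : ‖α‖ ≤ M) (ω : Pop q N × Finset (Fin N)) :
    influenceVar m h β₀ α ω ^ 2 ≤ M ^ 4 * avg ω.2 fun i => env K (ω.1 i) ^ 4 := by
  refine (avg_sq_le _ _).trans ?_
  rw [← smean_ofSample, ← smean_ofSample, ← smean_const_mul]
  refine smean_mono _ fun i => ?_
  have h1 := R.abs_err_mul_le (R.abs_functional_le hα) (ω.1 i)
  have h2 := pow_le_pow_left₀ (abs_nonneg _) h1 4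
  rw [Even.pow_abs (by decide), mul_pow M] at h2
  calc ((err m β₀ (ω.1 i) * α (h (ω.1 i).1 β₀)) ^ 2) ^ 2
      = (err m β₀ (ω.1 i) * α (h (ω.1 i).1 β₀)) ^ 4 := by ring
    _ ≤ _ := h2

/-- The influence of `B` is the value of the functional on the estimating function. -/
theorem functional_estFun {N : ℕ} (α : Param p →L[ℝ] ℝ) (ω : Pop q N × Finset (Fin N)) :
    α (estFun m h ω.1 (ofSample ω.2) β₀) = noiseAvg m β₀ (fun x => α (h x β₀)) ω := by
  rw [estFun_eq_smean, map_smean, smean_ofSample, noiseAvg]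
  simp [psi, err]

namespace Assumptions

variable (A : Assumptions S nA nB m h K Θ β₀ sol)
include A

theorem nB_nonneg : ∀ᶠ ν in atTop, 0 ≤ nB ν := A.nB_pos.mono fun _ h => zero_le_one.trans h

/-- The ratio of the size of `B` and its deterministic approximation tends to one. -/
theorem tendsto_card : Tendsto (fun x : Σ ν, Pop q (S ν).N × Finset (Fin (S ν).N) =>
    (x.2.2.card : ℝ) / nB x.1) (whp fun ν => (S ν).lawB) (𝓝 1) := by
  have h1 : IsLittleOp (fun ν => (S ν).lawB) fun ν ω => (ω.2.card : ℝ) / nB ν - 1 := by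
    intro ε hε
    refine squeeze_zero' (.of_forall fun ν => measureReal_nonneg) ?_ (A.card_B ε hε)
    filter_upwards [A.nB_pos] with ν hν
    exact le_mul_of_one_le_left measureReal_nonneg hν
  simpa using (isLittleOp_iff.1 h1).add_const 1

/-- The fourth moment of the noise is `O(1 / n_B²)`. -/
theorem negligible_noise_sq (τ : Tuning Θ β₀) :
    Negligible (fun ν => (S ν).lawB) nB fun ν ω => noiseOk m h τ (nB ν / 2) ω ^ 2 := by
  obtain ⟨C, hC0, hC⟩ := A.exists_noise_bound τ
  refine ⟨?_, ?_⟩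
  · filter_upwards [hC] with ν hν
    exact memLp_two_sq (A.reg.measurable_noiseOk τ _).aestronglyMeasurable hν.1
  · have h2 : Tendsto (fun ν => C * (nB ν)⁻¹) atTop (𝓝 0) := by
      simpa using (tendsto_inv_atTop_zero.comp A.nB_top).const_mul C
    refine squeeze_zero' ?_ ?_ h2
    · filter_upwards [A.nB_nonneg] with ν h1
      exact mul_nonneg h1 (integral_nonneg fun _ => sq_nonneg _)
    · filter_upwards [A.nB_pos, hC] with ν h1 h3
      have hn : 0 < nB ν := by linarith
      simp only [← pow_mul]
      norm_num
      calc nB ν * ∫ ω, noiseOk m h τ (nB ν / 2) ω ^ 4 ∂(S ν).lawB ≤ nB ν * (C / nB ν ^ 2) := by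
            gcongr
            exact h3.2
        _ = _ := by field_simp

variable (Λ : Linearization S nB m h K Θ β₀)

omit A in
theorem negligible_bad : Negligible (fun ν => (S ν).lawB) nB fun ν =>
    (badSet (S ν) m h K Λ.τ (nB ν)).indicator fun _ => (1 : ℝ) := by
  refine ⟨.of_forall fun ν => memLp_indicator_const 2 (measurableSet_toMeasurable _ _) 1
    (Or.inr (measure_ne_top _ _)), Λ.good.congr fun ν => ?_⟩
  have : ∀ ω, (badSet (S ν) m h K Λ.τ (nB ν)).indicator (fun _ => (1 : ℝ)) ω ^ 2 =
      (badSet (S ν) m h K Λ.τ (nB ν)).indicator (fun _ => (1 : ℝ)) ω := fun ω => by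
    by_cases hω : ω ∈ badSet (S ν) m h K Λ.τ (nB ν) <;> simp [hω]
  simp_rw [this]
  rw [integral_indicator_const (s := badSet (S ν) m h K Λ.τ (nB ν)) _
    (measurableSet_toMeasurable _ _), smul_eq_mul, mul_one, Measure.real, Measure.real, badSet, measure_toMeasurable]

theorem tendsto_bad : Tendsto (fun x : Σ ν, Pop q (S ν).N × Finset (Fin (S ν).N) =>
    (badSet (S x.1) m h K Λ.τ (nB x.1)).indicator (fun _ => (1 : ℝ)) x.2)
    (whp fun ν => (S ν).lawB) (𝓝 0) := by
  have h1 : ∀ᶠ x in whp fun ν => (S ν).lawB, x.2 ∉ badSet (S x.1) m h K Λ.τ (nB x.1) := by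
    rw [eventually_whp_real]
    refine squeeze_zero' (.of_forall fun ν => measureReal_nonneg) ?_ Λ.good
    filter_upwards [A.nB_pos] with ν hν
    simp only [not_not]
    rw [Set.ofPred_mem_eq, Measure.real, badSet, measure_toMeasurable]
    exact le_mul_of_one_le_left measureReal_nonneg hν
  refine tendsto_const_nhds.congr' ?_
  filter_upwards [h1] with x hx
  rw [Set.indicator_of_notMem hx]

theorem eventually_good : ∀ᶠ x : Σ ν, Pop q (S ν).N × Finset (Fin (S ν).N) in
    whp fun ν => (S ν).lawB, IsGood m h K Λ.τ (nB x.1) x.2 := by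
  rw [eventually_whp_real]
  refine squeeze_zero' (.of_forall fun ν => measureReal_nonneg) ?_ Λ.good
  filter_upwards [A.nB_pos] with ν hν
  exact le_mul_of_one_le_left measureReal_nonneg hν

omit A in
theorem _root_.MassImputation.noiseOk_of_isGood {N : ℕ} {τ : Tuning Θ β₀} {n : ℝ}
    {ω : Pop q N × Finset (Fin N)} (hω : IsGood m h K τ n ω) :
    noiseOk m h τ (n / 2) ω = noiseSize m h τ ω.1 ω.2 := if_pos hω.2

theorem measurable_dist (ν : ℕ) : Measurable fun ω => ‖betaHat (sol ν) ω - β₀‖ :=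
  ((A.solver ν).measurable_betaHat.sub_const β₀).norm

include Λ in
/-- The squared error of the solution for `B` is `o(n_B^{-1/2})` in mean square. -/
theorem negligible_dist_sq :
    Negligible (fun ν => (S ν).lawB) nB fun ν ω => ‖betaHat (sol ν) ω - β₀‖ ^ 2 := by
  obtain ⟨d, hd0, hd⟩ := A.exists_diam
  have hc := Λ.τ.c_pos
  have h1 := ((A.negligible_noise_sq Λ.τ).const_mul ((4 / Λ.τ.c) ^ 2)).add A.nB_nonneg
    ((negligible_bad Λ).const_mul (d ^ 2))
  refine h1.mono A.nB_nonneg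
    (.of_forall fun ν => ((A.measurable_dist ν).pow_const 2).aestronglyMeasurable)
    (.of_forall fun ν ω => ?_)
  rw [abs_of_nonneg (by positivity)]
  refine le_trans ?_ (le_abs_self _)
  by_cases hω : ω ∈ badSet (S ν) m h K Λ.τ (nB ν)
  · have h2 : ‖betaHat (sol ν) ω - β₀‖ ^ 2 ≤ d ^ 2 :=
      pow_le_pow_left₀ (norm_nonneg _) (hd _ ((A.solver ν).betaHat_mem ω) _ A.reg.mem) 2
    simp only [hω, Set.indicator_of_mem, mul_one]
    linarith [show 0 ≤ (4 / Λ.τ.c) ^ 2 * noiseOk m h Λ.τ (nB ν / 2) ω ^ 2 by positivity]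
  · have hg := not_mem_badSet hω
    have h2 := (A.reg.sample_root (A.solver ν) ω.1 ω.2 hg.1).2.2
    rw [noiseOk_of_isGood hg]
    simp only [hω, not_false_eq_true, Set.indicator_of_notMem, mul_zero, add_zero]
    rw [← mul_pow]
    exact pow_le_pow_left₀ (norm_nonneg _) h2 2

/-- Bound on the deviation of the average of `h_i ṁ_i'` over a well-behaved sample. -/
theorem norm_jacMap_sub_le_min {ν : ℕ} (hJ : ‖Λ.J ν‖ ≤ Λ.M)
    {ω : Pop q (S ν).N × Finset (Fin (S ν).N)} (hω : IsGood m h K Λ.τ (nB ν) ω) :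
    ‖jacMap m h β₀ ω.1 ω.2 - Λ.J ν‖ ≤
      min (jacDev (S ν) m h β₀ ω) ((Fintype.card (Fin p × Fin p)) * Λ.τ.C + Λ.M) := by
  refine le_min (norm_jacMap_sub_le (S ν) (Λ.J_apply ν) ω) ((norm_sub_le _ _).trans
    (add_le_add ((opNorm_le_sum_abs _).trans ?_) hJ))
  rw [← nsmul_eq_mul]
  refine Finset.sum_le_card_nsmul _ _ _ fun a _ => ?_
  rw [jacMap_apply]
  refine (A.reg.abs_jacobian_le _ _ ω).trans ?_
  rw [← smean_ofSample]
  exact hω.1.env_le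

theorem negligible_noise_mul_dev {C' : ℝ} (hC' : 0 ≤ C') :
    Negligible (fun ν => (S ν).lawB) nB fun ν ω =>
      noiseOk m h Λ.τ (nB ν / 2) ω * min (jacDev (S ν) m h β₀ ω) C' := by
  obtain ⟨C, hC0, hC⟩ := A.exists_noise_bound Λ.τ
  have h0 := A.tendsto_jacDev.min (tendsto_const_nhds (x := C'))
  rw [min_eq_left hC'] at h0
  refine Negligible.mul_of_whp A.nB_nonneg (C := C) (C' := C') ?_
    (fun ν => (A.reg.measurable_jacDev (S ν)).min measurable_const) (.of_forall fun ν ω => ?_) h0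
  · filter_upwards [hC, A.nB_pos] with ν h1 h2
    have hn : 0 < nB ν := by linarith
    refine ⟨(A.reg.measurable_noiseOk Λ.τ _).aestronglyMeasurable, h1.1, ?_⟩
    have h3 := h1.2
    rw [le_div_iff₀ (by positivity)] at h3
    linarith
  · rw [abs_of_nonneg (le_min (jacDev_nonneg _ _) hC')]
    exact min_le_right _ _

/-- The influence of `B` is of the order `n_B^{-1/2}` in fourth mean. -/
theorem exists_influence_bound : ∃ C : ℝ, ∀ᶠ ν in atTop,
    AEStronglyMeasurable (influence m h β₀ (Λ.α ν) (nB ν / 2)) (S ν).lawB ∧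
    Integrable (fun ω => influence m h β₀ (Λ.α ν) (nB ν / 2) ω ^ 4) (S ν).lawB ∧
    nB ν ^ 2 * ∫ ω, influence m h β₀ (Λ.α ν) (nB ν / 2) ω ^ 4 ∂(S ν).lawB ≤ C := by
  obtain ⟨C, hC0, hC⟩ := A.exists_moment_B
  refine ⟨64 * Λ.M ^ 4 * C, ?_⟩
  filter_upwards [A.nB_pos, Λ.α_le] with ν hν hα
  have hr : 0 < nB ν / 2 := by linarith
  have hn : 0 < nB ν := by linarith
  have hb := Stage.integral_noise_pow_four A.reg (A.model ν) (A.ignorable ν)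
    (A.integrable_y ν) (hC ν).1 (A.reg.measurable_functional (Λ.α ν))
    (A.reg.abs_functional_le hα) hr
  have he : ∀ ω : Pop q (S ν).N × Finset (Fin (S ν).N),
      influence m h β₀ (Λ.α ν) (nB ν / 2) ω ^ 4 = if nB ν / 2 ≤ ω.2.card then
        noiseAvg m β₀ (fun x => Λ.α ν (h x β₀)) ω ^ 4 else 0 := fun ω => by
    unfold influence
    split_ifs <;> simp
  simp_rw [he]
  refine ⟨(A.reg.measurable_influence _ _).aestronglyMeasurable, hb.1, ?_⟩
  calc _ ≤ nB ν ^ 2 * (Λ.M ^ 4 * (16 / (nB ν / 2) ^ 2) *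
        ∫ ω, avg ω.2 (fun i => env K (ω.1 i) ^ 4) ∂(S ν).lawB) := by
        gcongr
        exact hb.2
    _ ≤ nB ν ^ 2 * (Λ.M ^ 4 * (16 / (nB ν / 2) ^ 2) * C) := by
        gcongr
        exact (hC ν).2
    _ = _ := by
        field_simp
        ring

/-- Linearization of the solution for a well-behaved sample `B`. -/
theorem abs_linear_sub_influence_le {ν : ℕ} (h1 : ∀ v, Λ.α ν (Λ.J ν v) = Λ.γ ν v)
    (h2 : ‖Λ.α ν‖ ≤ Λ.M) (h4 : ‖Λ.J ν‖ ≤ Λ.M) {ω : Pop q (S ν).N × Finset (Fin (S ν).N)}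
    (hg : IsGood m h K Λ.τ (nB ν) ω) {n D k : ℝ} (hn : n = noiseOk m h Λ.τ (nB ν / 2) ω)
    (hD : D = min (jacDev (S ν) m h β₀ ω) ((Fintype.card (Fin p × Fin p)) * Λ.τ.C + Λ.M))
    (hk : k = 4 / Λ.τ.c) :
    |Λ.γ ν (betaHat (sol ν) ω - β₀) - influence m h β₀ (Λ.α ν) (nB ν / 2) ω| ≤
      Λ.M * ((4 * Λ.τ.C * k + 1) * k) * n ^ 2 + Λ.M * k * (n * D) := by
  have hC0 := Λ.τ.C_nonneg
  have hc := Λ.τ.c_pos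
  have hk0 : 0 ≤ k := by rw [hk]; positivity
  have hno : 0 ≤ n := by rw [hn]; exact noiseOk_nonneg (m := m) (h := h) Λ.τ (nB ν / 2) ω
  have h5 := (A.reg.sample_root (A.solver ν) ω.1 ω.2 hg.1).2.2
  have h6 := A.reg.sample_linear (A.solver ν) ω.1 ω.2 hg.1 (Λ.J ν)
  have h7 := A.norm_jacMap_sub_le_min Λ h4 hg
  rw [← noiseOk_of_isGood hg, ← hn] at h5 h6
  rw [← hk] at h5
  rw [← hD] at h7
  have e : Λ.γ ν (betaHat (sol ν) ω - β₀) - influence m h β₀ (Λ.α ν) (nB ν / 2) ω =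
      Λ.α ν (Λ.J ν (betaHat (sol ν) ω - β₀) - estFun m h ω.1 (ofSample ω.2) β₀) := by
    rw [map_sub (Λ.α ν), h1, functional_estFun, influence, if_pos hg.2]
  rw [e, ← Real.norm_eq_abs]
  have h8 : 0 ≤ ‖sol ν ω.1 (ofSample ω.2) - β₀‖ := norm_nonneg _
  have h9 : ‖Λ.J ν (betaHat (sol ν) ω - β₀) - estFun m h ω.1 (ofSample ω.2) β₀‖ ≤
      (4 * Λ.τ.C * (k * n) + n + D) * (k * n) := by
    refine h6.trans (mul_le_mul ?_ h5 h8 ?_)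
    · gcongr
    · have := (norm_nonneg _).trans h7
      positivity
  refine ((Λ.α ν).le_opNorm _).trans ((mul_le_mul h2 h9 (norm_nonneg _) Λ.M_nonneg).trans ?_)
  exact le_of_eq (by ring)

theorem negligible_influence_bad : Negligible (fun ν => (S ν).lawB) nB fun ν ω =>
    |influence m h β₀ (Λ.α ν) (nB ν / 2) ω *
      (badSet (S ν) m h K Λ.τ (nB ν)).indicator (fun _ => (1 : ℝ)) ω| := by
  obtain ⟨C, hC⟩ := A.exists_influence_bound Λ
  have hbad := Negligible.mul_of_whp (P := fun ν => (S ν).lawB) A.nB_nonneg (C' := 1)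
    (f := fun ν => influence m h β₀ (Λ.α ν) (nB ν / 2))
    (g := fun ν => (badSet (S ν) m h K Λ.τ (nB ν)).indicator fun _ => (1 : ℝ)) hC
    (fun ν => measurable_const.indicator (measurableSet_toMeasurable _ _))
    (.of_forall fun ν ω => by
      refine (norm_indicator_le_norm_self (fun _ => (1 : ℝ)) ω).trans ?_
      simp) (A.tendsto_bad Λ)
  refine hbad.mono A.nB_nonneg (.of_forall fun ν => ?_) (.of_forall fun ν ω => ?_)
  · exact (((A.reg.measurable_influence _ _).mul
      (measurable_const.indicator (measurableSet_toMeasurable _ _))).abs).aestronglyMeasurable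
  · rw [abs_abs]

/-- The solution for `B` is asymptotically linear: up to a remainder of order `o(n_B^{-1/2})` in
mean square, its effect `γ (β̂ - β₀)` on the population mean is the influence of `B`. -/
theorem negligible_linear : Negligible (fun ν => (S ν).lawB) nB fun ν ω =>
    Λ.γ ν (betaHat (sol ν) ω - β₀) - influence m h β₀ (Λ.α ν) (nB ν / 2) ω := by
  obtain ⟨d, hd0, hd⟩ := A.exists_diam
  have hc := Λ.τ.c_pos
  have hC0 := Λ.τ.C_nonneg
  have hM := Λ.M_nonneg
  obtain ⟨k, hk⟩ : ∃ k : ℝ, k = 4 / Λ.τ.c := ⟨_, rfl⟩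
  have hk0 : 0 ≤ k := by rw [hk]; positivity
  obtain ⟨C', hC'⟩ : ∃ C' : ℝ, C' = (Fintype.card (Fin p × Fin p)) * Λ.τ.C + Λ.M := ⟨_, rfl⟩
  have hnn : 0 ≤ C' := by rw [hC']; positivity
  have hg1 := Negligible.add A.nB_nonneg
    ((A.negligible_noise_sq Λ.τ).const_mul (Λ.M * ((4 * Λ.τ.C * k + 1) * k)))
    ((A.negligible_noise_mul_dev Λ hnn).const_mul (Λ.M * k))
  have hg2 := Negligible.add A.nB_nonneg ((negligible_bad Λ).const_mul (Λ.M * d))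
    (A.negligible_influence_bad Λ)
  refine (Negligible.add A.nB_nonneg hg1 hg2).mono A.nB_nonneg (.of_forall fun ν => ?_) ?_
  · exact (((Λ.γ ν).continuous.measurable.comp
      ((A.solver ν).measurable_betaHat.sub_const β₀)).sub
      (A.reg.measurable_influence _ _)).aestronglyMeasurable
  filter_upwards [Λ.α_comp, Λ.α_le, Λ.γ_le, Λ.J_le] with ν h1 h2 h3 h4 ω
  refine le_trans ?_ (le_abs_self _)
  by_cases hω : ω ∈ badSet (S ν) m h K Λ.τ (nB ν)
  · have h5 : |Λ.γ ν (betaHat (sol ν) ω - β₀)| ≤ Λ.M * d :=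
      ((Λ.γ ν).le_opNorm _).trans (mul_le_mul h3
        (hd _ ((A.solver ν).betaHat_mem ω) _ A.reg.mem) (norm_nonneg _) hM)
    have hno := noiseOk_nonneg (m := m) (h := h) Λ.τ (nB ν / 2) ω
    have h7 := le_min (jacDev_nonneg (m := m) (h := h) (β₀ := β₀) (S ν) ω) hnn
    have h8 := abs_sub (Λ.γ ν (betaHat (sol ν) ω - β₀)) (influence m h β₀ (Λ.α ν) (nB ν / 2) ω)
    rw [Set.indicator_of_mem hω, mul_one, mul_one]
    refine h8.trans ((add_le_add_left h5 _).trans (le_add_of_nonneg_left ?_))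
    positivity
  · rw [Set.indicator_of_notMem hω, mul_zero, mul_zero, abs_zero, add_zero, add_zero]
    exact A.abs_linear_sub_influence_le Λ h1 h2 h4 (not_mem_badSet hω) rfl (by rw [hC']) hk

end Assumptions

end

section

/-! ### Variance of the influence of `B` -/

variable {p q : ℕ} {S : ℕ → Stage q} {nA nB : ℕ → ℝ} {m : Cov q → Param p → ℝ}
  {h : Cov q → Param p → Param p} {K : Cov q → ℝ} {Θ : Set (Param p)} {β₀ : Param p}
  {sol : ∀ ν, Pop q (S ν).N → (Fin (S ν).N → ℕ) → Param p}

theorem Regular.abs_scoreVar_le (R : Regular m h K Θ β₀) {N : ℕ} (j l : Fin p)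
    (ω : Pop q N × Finset (Fin N)) :
    |scoreVar m h β₀ j l ω| ≤ 1 + avg ω.2 fun i => env K (ω.1 i) ^ 4 := by
  have h1 : |scoreVar m h β₀ j l ω| ≤ avg ω.2 fun i => env K (ω.1 i) ^ 2 := by
    rw [scoreVar, ← smean_ofSample, ← smean_ofSample, ← Real.norm_eq_abs]
    refine (norm_smean_le _ _).trans (smean_mono _ fun i => ?_)
    have hK : ∀ j, ∀ x, |h x β₀ j| ≤ 1 * K x := fun j x => by
      rw [one_mul]
      exact (PiLp.norm_apply_le _ j).trans (R.h_bdd _ _ R.mem)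
    have h2 := R.abs_err_mul_le (hK j) (ω.1 i)
    have h3 := R.abs_err_mul_le (hK l) (ω.1 i)
    rw [one_mul] at h2 h3
    calc ‖((ω.1 i).2 - m (ω.1 i).1 β₀) ^ 2 * (h (ω.1 i).1 β₀ j * h (ω.1 i).1 β₀ l)‖
        = |err m β₀ (ω.1 i) * h (ω.1 i).1 β₀ j| * |err m β₀ (ω.1 i) * h (ω.1 i).1 β₀ l| := by
          rw [← abs_mul, Real.norm_eq_abs, err]
          ring_nf
      _ ≤ env K (ω.1 i) * env K (ω.1 i) :=
          mul_le_mul h2 h3 (abs_nonneg _) (R.env_nonneg _)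
      _ = _ := by ring
  have h2 : smean (ofSample ω.2) (fun _ => (1 : ℝ)) ≤ 1 := by
    rw [smean_ofSample, avg]
    simp only [Finset.sum_const, nsmul_eq_mul, mul_one]
    exact inv_mul_le_one
  refine h1.trans ?_
  rw [← smean_ofSample, ← smean_ofSample]
  calc smean (ofSample ω.2) (fun i => env K (ω.1 i) ^ 2)
      ≤ smean (ofSample ω.2) fun i => 1 + env K (ω.1 i) ^ 4 :=
        smean_mono _ fun i => sq_le_one_add_pow_four _
    _ ≤ _ := by
      rw [smean_add]
      linarith

theorem Regular.measurable_scoreVar (R : Regular m h K Θ β₀) {N : ℕ} (j l : Fin p) :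
    Measurable (scoreVar (N := N) m h β₀ j l) := by
  refine measurable_avg (f := fun z => (z.2 - m z.1 β₀) ^ 2 * (h z.1 β₀ j * h z.1 β₀ l)) ?_
  have h1 : ∀ j, Measurable fun z : Cov q × ℝ => h z.1 β₀ j := fun j =>
    (EuclideanSpace.proj j : Param p →L[ℝ] ℝ).continuous.measurable.comp
      ((R.measurable_h β₀).comp measurable_fst)
  exact (R.measurable_err.pow_const 2).mul ((h1 j).mul (h1 l))

theorem abs_functional_single_le (α : Param p →L[ℝ] ℝ) (j : Fin p) :
    |α (EuclideanSpace.single j 1)| ≤ ‖α‖ := by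
  simpa using α.le_opNorm (EuclideanSpace.single j 1)

namespace Assumptions

variable (A : Assumptions S nA nB m h K Θ β₀ sol) (Λ : Linearization S nB m h K Θ β₀)
include A

omit A in
/-- The second moments of a bounded `o_p(1)` sequence vanish. -/
theorem _root_.MassImputation.tendsto_integral_sq {g : ∀ ν, Pop q (S ν).N × Finset (Fin (S ν).N) → ℝ} {C : ℝ}
    (hgm : ∀ ν, Measurable (g ν)) (hgC : ∀ᶠ ν in atTop, ∀ ω, |g ν ω| ≤ C)
    (hg : Tendsto (fun x : Σ ν, Pop q (S ν).N × Finset (Fin (S ν).N) => g x.1 x.2)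
      (whp fun ν => (S ν).lawB) (𝓝 0)) :
    Tendsto (fun ν => ∫ ω, g ν ω ^ 2 ∂(S ν).lawB) atTop (𝓝 0) := by
  have h1 := tendsto_lintegral_of_whp (P := fun ν => (S ν).lawB)
    (Z := fun x => g x.1 x.2 ^ 2) (C := C ^ 2)
    (by
      filter_upwards [hgC] with ν hν ω
      exact sq_le_sq' (abs_le.1 (hν ω)).1 (abs_le.1 (hν ω)).2) (by simpa using hg.pow 2)
  have h2 := (ENNReal.tendsto_toReal ENNReal.zero_ne_top).comp h1
  refine h2.congr fun ν => ?_
  rw [integral_eq_lintegral_of_nonneg_ae (.of_forall fun ω => sq_nonneg _)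
    ((hgm ν).pow_const 2).aestronglyMeasurable]
  rfl

/-- The influence term is centered, and its second moment is that of uncorrelated summands, even
though the sample is random: this is where ignorability enters. -/
theorem integral_influence : ∀ᶠ ν in atTop,
    MemLp (influence m h β₀ (Λ.α ν) (nB ν / 2)) 2 (S ν).lawB ∧
    ∫ ω, influence m h β₀ (Λ.α ν) (nB ν / 2) ω ∂(S ν).lawB = 0 ∧
    ∫ ω, influence m h β₀ (Λ.α ν) (nB ν / 2) ω ^ 2 ∂(S ν).lawB =
      ∫ ω, (if nB ν / 2 ≤ ω.2.card then (ω.2.card : ℝ)⁻¹ * influenceVar m h β₀ (Λ.α ν) ω else 0)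
        ∂(S ν).lawB := by
  obtain ⟨C, hC0, hC⟩ := A.exists_moment_B
  filter_upwards [Λ.α_le] with ν hα
  have hb := Stage.integral_noise_sq A.reg (A.model ν) (A.ignorable ν)
    (A.integrable_y ν) (hC ν).1 (A.reg.measurable_functional (Λ.α ν))
    (A.reg.abs_functional_le hα) (nB ν / 2)
  have he : ∀ ω : Pop q (S ν).N × Finset (Fin (S ν).N),
      influence m h β₀ (Λ.α ν) (nB ν / 2) ω ^ 2 = if nB ν / 2 ≤ ω.2.card then
        noiseAvg m β₀ (fun x => Λ.α ν (h x β₀)) ω ^ 2 else 0 := fun ω => by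
    unfold influence
    split_ifs <;> simp
  refine ⟨?_, hb.2.1, ?_⟩
  · rw [memLp_two_iff_integrable_sq (A.reg.measurable_influence _ _).aestronglyMeasurable]
    simp_rw [he]
    exact hb.1
  · simp_rw [he]
    exact hb.2.2

/-- Second moments of the average of `(e_i α(h_i))²` over `B`. -/
theorem exists_influenceVar_bound : ∃ C : ℝ, 0 ≤ C ∧ ∀ᶠ ν in atTop,
    MemLp (influenceVar m h β₀ (Λ.α ν)) 2 (S ν).lawB ∧
    ∫ ω, influenceVar m h β₀ (Λ.α ν) ω ^ 2 ∂(S ν).lawB ≤ C ∧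
    |∫ ω, influenceVar m h β₀ (Λ.α ν) ω ∂(S ν).lawB| ≤ 1 + C := by
  obtain ⟨C, hC0, hC⟩ := A.exists_moment_B
  have hM := Λ.M_nonneg
  refine ⟨Λ.M ^ 4 * C, by positivity, ?_⟩
  filter_upwards [Λ.α_le] with ν hα
  have hi : Integrable (fun ω => influenceVar m h β₀ (Λ.α ν) ω ^ 2) (S ν).lawB := by
    refine ((hC ν).1.const_mul (Λ.M ^ 4)).mono'
      ((A.reg.measurable_influenceVar _).pow_const 2).aestronglyMeasurable (.of_forall fun ω => ?_)
    rw [Real.norm_of_nonneg (sq_nonneg _)]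
    exact A.reg.influenceVar_sq_le hα ω
  have hmem : MemLp (influenceVar m h β₀ (Λ.α ν)) 2 (S ν).lawB :=
    (memLp_two_iff_integrable_sq (A.reg.measurable_influenceVar _).aestronglyMeasurable).2 hi
  have h2 : ∫ ω, influenceVar m h β₀ (Λ.α ν) ω ^ 2 ∂(S ν).lawB ≤ Λ.M ^ 4 * C :=
    calc _ ≤ ∫ ω, Λ.M ^ 4 * avg ω.2 (fun i => env K (ω.1 i) ^ 4) ∂(S ν).lawB :=
          integral_mono hi ((hC ν).1.const_mul _) fun ω => A.reg.influenceVar_sq_le hα ω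
      _ = Λ.M ^ 4 * ∫ ω, avg ω.2 (fun i => env K (ω.1 i) ^ 4) ∂(S ν).lawB := integral_const_mul _ _
      _ ≤ _ := by
          gcongr
          exact (hC ν).2
  refine ⟨hmem, h2, ?_⟩
  have h3 : ∫ ω, influenceVar m h β₀ (Λ.α ν) ω ∂(S ν).lawB ≤
      ∫ ω, (1 + influenceVar m h β₀ (Λ.α ν) ω ^ 2) ∂(S ν).lawB :=
    integral_mono (hmem.integrable (by norm_num)) ((integrable_const (1 : ℝ)).add hi) fun ω => by
      simp only
      nlinarith [sq_nonneg (influenceVar m h β₀ (Λ.α ν) ω - 1)]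
  rw [integral_add (integrable_const _) hi] at h3
  rw [abs_of_nonneg (integral_nonneg fun ω => influenceVar_nonneg _ ω)]
  simp only [integral_const, probReal_univ, smul_eq_mul, mul_one] at h3
  linarith

/-- `n_B` times the second moment of the influence term is asymptotically the mean of
`influenceVar`, because `n_B / |B|` tends to one in probability and is bounded on the samples
retained. -/
theorem tendsto_influence_sq :
    Tendsto (fun ν => nB ν * ∫ ω, influence m h β₀ (Λ.α ν) (nB ν / 2) ω ^ 2 ∂(S ν).lawB -
      ∫ ω, influenceVar m h β₀ (Λ.α ν) ω ∂(S ν).lawB) atTop (𝓝 0) := by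
  obtain ⟨C, hC0, hC⟩ := A.exists_influenceVar_bound Λ
  set g : ∀ ν, Pop q (S ν).N × Finset (Fin (S ν).N) → ℝ := fun ν ω =>
    (if nB ν / 2 ≤ ω.2.card then nB ν * (ω.2.card : ℝ)⁻¹ else 0) - 1 with hg
  have hgm : ∀ ν, Measurable (g ν) := fun ν => by
    refine Measurable.sub_const ?_ 1
    refine Measurable.ite (measurableSet_le_card _) ?_ measurable_const
    exact measurable_const.mul ((measurable_of_countable
      (f := fun s : Finset (Fin (S ν).N) => (s.card : ℝ)⁻¹)).comp measurable_snd)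
  have hgC : ∀ᶠ ν in atTop, ∀ ω, |g ν ω| ≤ 1 := by
    filter_upwards [A.nB_pos] with ν hν ω
    simp only [hg]
    split_ifs with hω
    · have hc : (0 : ℝ) < ω.2.card := by linarith
      have h1 : nB ν * (ω.2.card : ℝ)⁻¹ ≤ 2 := by
        rw [← div_eq_mul_inv, div_le_iff₀ hc]
        linarith
      have h2 : 0 ≤ nB ν * (ω.2.card : ℝ)⁻¹ := by positivity
      rw [abs_le]
      constructor <;> linarith
    · simp
  have hgt : Tendsto (fun x : Σ ν, Pop q (S ν).N × Finset (Fin (S ν).N) => g x.1 x.2)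
      (whp fun ν => (S ν).lawB) (𝓝 0) := by
    have h1 := (A.tendsto_card.inv₀ one_ne_zero).sub_const 1
    rw [inv_one, sub_self] at h1
    refine h1.congr' ?_
    filter_upwards [A.eventually_good Λ] with x hx
    simp only [hg]
    rw [if_pos hx.2, inv_div, div_eq_mul_inv]
  have h1 := tendsto_integral_sq hgm hgC hgt
  have h2 : Tendsto (fun ν => √(∫ ω, g ν ω ^ 2 ∂(S ν).lawB) * √C) atTop (𝓝 0) := by
    simpa using ((Real.continuous_sqrt.tendsto 0).comp h1).mul_const √C
  refine squeeze_zero_norm' ?_ h2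
  filter_upwards [A.integral_influence Λ, hC, hgC] with ν h3 h4 h5
  have hgL : MemLp (g ν) 2 (S ν).lawB :=
    MemLp.of_bound (hgm ν).aestronglyMeasurable 1 (.of_forall h5)
  have e : nB ν * ∫ ω, influence m h β₀ (Λ.α ν) (nB ν / 2) ω ^ 2 ∂(S ν).lawB -
      ∫ ω, influenceVar m h β₀ (Λ.α ν) ω ∂(S ν).lawB =
      ∫ ω, g ν ω * influenceVar m h β₀ (Λ.α ν) ω ∂(S ν).lawB := by
    have hi : Integrable (fun ω => g ν ω * influenceVar m h β₀ (Λ.α ν) ω) (S ν).lawB :=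
      hgL.integrable_mul h4.1
    have hV := h4.1.integrable (by norm_num : (1 : ℝ≥0∞) ≤ 2)
    rw [h3.2.2, ← integral_const_mul, sub_eq_iff_eq_add, ← integral_add hi hV]
    refine integral_congr_ae (.of_forall fun ω => ?_)
    simp only [hg]
    split_ifs <;> ring
  rw [e, Real.norm_eq_abs]
  refine (abs_integral_mul_le hgL h4.1).trans ?_
  gcongr
  exact h4.2.1

/-- The law of large numbers assumed for the entries of the average of `e_i² h_i h_i'`, in the
direction of the bounded functionals `α`. -/
theorem tendsto_influenceVar :
    Tendsto (fun x : Σ ν, Pop q (S ν).N × Finset (Fin (S ν).N) =>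
      influenceVar m h β₀ (Λ.α x.1) x.2 - ∫ ω, influenceVar m h β₀ (Λ.α x.1) ω ∂(S x.1).lawB)
      (whp fun ν => (S ν).lawB) (𝓝 0) := by
  obtain ⟨C, hC0, hC⟩ := A.exists_moment_B
  have hi : ∀ ν j l, Integrable (scoreVar m h β₀ j l) (S ν).lawB := fun ν j l =>
    ((integrable_const (1 : ℝ)).add (hC ν).1).mono'
      (A.reg.measurable_scoreVar j l).aestronglyMeasurable
      (.of_forall fun ω => A.reg.abs_scoreVar_le j l ω)
  have h1 : ∀ x : Σ ν, Pop q (S ν).N × Finset (Fin (S ν).N),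
      influenceVar m h β₀ (Λ.α x.1) x.2 - ∫ ω, influenceVar m h β₀ (Λ.α x.1) ω ∂(S x.1).lawB =
      ∑ j, ∑ l, Λ.α x.1 (EuclideanSpace.single j 1) * Λ.α x.1 (EuclideanSpace.single l 1) *
        (scoreVar m h β₀ j l x.2 - ∫ ω, scoreVar m h β₀ j l ω ∂(S x.1).lawB) := by
    intro x
    simp_rw [influenceVar_eq]
    rw [integral_finsetSum _ fun j _ => integrable_finsetSum _ fun l _ =>
      (hi x.1 j l).const_mul _, ← Finset.sum_sub_distrib]
    refine Finset.sum_congr rfl fun j _ => ?_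
    rw [integral_finsetSum _ fun l _ => (hi x.1 j l).const_mul _, ← Finset.sum_sub_distrib]
    refine Finset.sum_congr rfl fun l _ => ?_
    rw [integral_const_mul, mul_sub]
  simp_rw [h1]
  rw [← Finset.sum_const_zero (s := (Finset.univ : Finset (Fin p)))]
  refine tendsto_finsetSum _ fun j _ => ?_
  rw [← Finset.sum_const_zero (s := (Finset.univ : Finset (Fin p)))]
  refine tendsto_finsetSum _ fun l _ => ?_
  have hb : IsBigOp (whp fun ν => (S ν).lawB) fun x : Σ ν, Pop q (S ν).N × Finset (Fin (S ν).N) =>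
      Λ.α x.1 (EuclideanSpace.single j 1) * Λ.α x.1 (EuclideanSpace.single l 1) := by
    have h2 : ∀ j, IsBigOp (whp fun ν => (S ν).lawB)
        fun x : Σ ν, Pop q (S ν).N × Finset (Fin (S ν).N) => Λ.α x.1 (EuclideanSpace.single j 1) :=
      fun j => .of_bdd (C := Λ.M) <| (eventually_whp_of_fst Λ.α_le).mono fun x hx =>
        (abs_functional_single_le _ _).trans hx
    exact (h2 j).mul (h2 l)
  simpa [mul_comm] using hb _ (isLittleOp_iff.1 (A.score j l))

end Assumptions

end

section

/-! ### Variance of the imputation estimator -/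

variable {p q : ℕ} {S : ℕ → Stage q} {nA nB : ℕ → ℝ} {m : Cov q → Param p → ℝ}
  {h : Cov q → Param p → Param p} {K : Cov q → ℝ} {Θ : Set (Param p)} {β₀ : Param p}
  {sol : ∀ ν, Pop q (S ν).N → (Fin (S ν).N → ℕ) → Param p}

theorem popMean_sq_le {N : ℕ} (f : Fin N → ℝ) :
    ((N : ℝ)⁻¹ * ∑ i, f i) ^ 2 ≤ (N : ℝ)⁻¹ * ∑ i, f i ^ 2 := by
  simpa [avg] using avg_sq_le Finset.univ f

theorem memLp_two_of_pow_four {Ω : Type*} [MeasurableSpace Ω] {μ : Measure Ω} [IsFiniteMeasure μ]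
    {f : Ω → ℝ} (hf : AEStronglyMeasurable f μ) (hi : Integrable (fun ω => f ω ^ 4) μ) :
    MemLp f 2 μ :=
  (memLp_two_iff_integrable_sq hf).2 ((memLp_two_sq hf hi).integrable (by norm_num))

namespace Stage

theorem measurePreserving_fst_lawB (S : Stage q) :
    MeasurePreserving Prod.fst S.lawB S.popLaw := ⟨measurable_fst, S.map_fst_lawB⟩

theorem measurePreserving_fst_lawBA (S : Stage q) :
    MeasurePreserving Prod.fst S.lawBA S.lawB := ⟨measurable_fst, S.map_fst_lawBA⟩

end Stage

namespace Assumptions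

variable (A : Assumptions S nA nB m h K Θ β₀ sol) (Λ : Linearization S nB m h K Θ β₀)
include A

theorem measurable_m_betaHat (ν : ℕ) (i : Fin (S ν).N) :
    Measurable fun ω : Pop q (S ν).N × Finset (Fin (S ν).N) =>
      m (ω.1 i).1 (betaHat (sol ν) ω) :=
  A.reg.meas_m.comp ((measurable_fst.comp ((measurable_pi_apply i).comp measurable_fst)).prodMk
    (A.solver ν).measurable_betaHat)

theorem measurable_m_pop (ν : ℕ) (i : Fin (S ν).N) :
    Measurable fun pop : Pop q (S ν).N => m (pop i).1 β₀ :=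
  (A.reg.measurable_m β₀).comp (measurable_fst.comp (measurable_pi_apply i))

theorem measurable_K_pop (ν : ℕ) (i : Fin (S ν).N) :
    Measurable fun pop : Pop q (S ν).N => K (pop i).1 :=
  A.reg.meas_K.comp (measurable_fst.comp (measurable_pi_apply i))

/-- Mean squares of errors of Horvitz-Thompson estimators. -/
theorem exists_htError_bound : ∃ C : ℝ, 0 ≤ C ∧ ∀ ν,
    ∀ z : Pop q (S ν).N × Finset (Fin (S ν).N) → Fin (S ν).N → ℝ,
    (∀ i, Measurable fun ω => z ω i) →
    Integrable (fun ω => ((S ν).N : ℝ)⁻¹ * ∑ i, z ω i ^ 2) (S ν).lawB →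
    MemLp (fun d : (Pop q (S ν).N × Finset (Fin (S ν).N)) × Finset (Fin (S ν).N) =>
      (S ν).htError d.1.1 (z d.1) d.2) 2 (S ν).lawBA ∧
    (0 < nA ν → ∫ d, (S ν).htError d.1.1 (z d.1) d.2 ^ 2 ∂(S ν).lawBA ≤
      C / nA ν * ∫ ω, ((S ν).N : ℝ)⁻¹ * ∑ i, z ω i ^ 2 ∂(S ν).lawB) := by
  obtain ⟨C, hC⟩ := A.design
  refine ⟨max C 0, le_max_right _ _, fun ν z hz hi => ?_⟩
  have hm : Measurable fun d : (Pop q (S ν).N × Finset (Fin (S ν).N)) × Finset (Fin (S ν).N) =>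
      (S ν).htError d.1.1 (z d.1) d.2 := Stage.measurable_htError measurable_fst hz
  have h1 := Stage.lintegral_htError_sq_le (hC ν) hz
  have hi' := hi.const_mul (C / nA ν)
  have hfin : Integrable (fun d : (Pop q (S ν).N × Finset (Fin (S ν).N)) × Finset (Fin (S ν).N) =>
      (S ν).htError d.1.1 (z d.1) d.2 ^ 2) (S ν).lawBA := by
    refine ⟨(hm.pow_const 2).aestronglyMeasurable, ?_⟩
    rw [hasFiniteIntegral_iff_ofReal (.of_forall fun d => sq_nonneg _)]
    refine h1.trans_lt (lt_of_le_of_lt (lintegral_mono fun ω => ?_) hi'.2)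
    rw [← ofReal_norm]
    exact ENNReal.ofReal_le_ofReal (le_abs_self _)
  refine ⟨(memLp_two_iff_integrable_sq hm.aestronglyMeasurable).2 hfin, fun hA => ?_⟩
  rw [← integral_const_mul, integral_eq_lintegral_of_nonneg_ae (.of_forall fun d => sq_nonneg _)
    (hm.pow_const 2).aestronglyMeasurable]
  have h0 : ∀ ω, 0 ≤ max C 0 / nA ν * (((S ν).N : ℝ)⁻¹ * ∑ i, z ω i ^ 2) := fun ω => by positivity
  refine ENNReal.toReal_le_of_le_ofReal (integral_nonneg h0) (h1.trans ?_)
  rw [ofReal_integral_eq_lintegral_ofReal (hi.const_mul _) (.of_forall h0)]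
  refine lintegral_mono fun ω => ENNReal.ofReal_le_ofReal ?_
  gcongr
  exact le_max_left _ _

theorem integrable_mean_pow_four (ν : ℕ) : Integrable (fun pop : Pop q (S ν).N =>
    ((S ν).N : ℝ)⁻¹ * ∑ i, K (pop i).1 ^ 4) (S ν).popLaw := by
  obtain ⟨C, -, hC⟩ := A.exists_moment
  exact (integrable_finsetSum _ fun i _ => (hC ν).2.1 i).const_mul _

omit A in
theorem _root_.MassImputation.popMean_sq_le_one_add {N : ℕ} (f : Fin N → ℝ) :
    (N : ℝ)⁻¹ * ∑ i, f i ^ 2 ≤ 1 + (N : ℝ)⁻¹ * ∑ i, f i ^ 4 := by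
  calc (N : ℝ)⁻¹ * ∑ i, f i ^ 2 ≤ (N : ℝ)⁻¹ * ∑ i, (1 + f i ^ 4) := by
        gcongr with i
        exact sq_le_one_add_pow_four _
    _ ≤ _ := by
        rw [Finset.sum_add_distrib, mul_add]
        simp only [Finset.sum_const, Finset.card_univ, Fintype.card_fin, nsmul_eq_mul, mul_one]
        gcongr
        exact inv_mul_le_one

theorem integrable_mean_sq {ν : ℕ} {z : Pop q (S ν).N × Finset (Fin (S ν).N) → Fin (S ν).N → ℝ}
    (hz : ∀ i, Measurable fun ω => z ω i) {κ : ℝ} (hzK : ∀ ω i, |z ω i| ≤ κ * K (ω.1 i).1) :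
    Integrable (fun ω => ((S ν).N : ℝ)⁻¹ * ∑ i, z ω i ^ 2) (S ν).lawB := by
  have h1 := ((S ν).measurePreserving_fst_lawB.integrable_comp_of_integrable
    (A.integrable_mean_pow_four ν))
  refine (((integrable_const (1 : ℝ)).add h1).const_mul (κ ^ 2)).mono'
    (((Finset.measurable_sum _ fun i _ => (hz i).pow_const 2).const_mul _).aestronglyMeasurable)
    (.of_forall fun ω => ?_)
  rw [Real.norm_of_nonneg (by positivity)]
  calc ((S ν).N : ℝ)⁻¹ * ∑ i, z ω i ^ 2 ≤ ((S ν).N : ℝ)⁻¹ * ∑ i, κ ^ 2 * K (ω.1 i).1 ^ 2 := by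
        gcongr with i
        rw [← mul_pow]
        exact sq_le_sq' (abs_le.1 (hzK ω i)).1 (abs_le.1 (hzK ω i)).2
    _ = κ ^ 2 * (((S ν).N : ℝ)⁻¹ * ∑ i, K (ω.1 i).1 ^ 2) := by
        rw [← Finset.mul_sum]
        ring
    _ ≤ _ := by
        simp only [Pi.add_apply, Function.comp_apply]
        gcongr
        exact popMean_sq_le_one_add _

omit A in
theorem _root_.MassImputation.sq_le_of_dominated {f : Cov q × ℝ → ℝ}
    (hfK : ∀ z, |f z| ≤ |z.2| + K z.1) (z : Cov q × ℝ) :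
    f z ^ 2 ≤ 2 * (1 + z.2 ^ 4) + 2 * (1 + K z.1 ^ 4) := by
  have h1 := sq_le_sq' (abs_le.1 (hfK z)).1 (abs_le.1 (hfK z)).2
  have h2 := sq_le_one_add_pow_four z.2
  have h3 := sq_le_one_add_pow_four (K z.1)
  rw [← sq_abs z.2] at h2
  nlinarith [sq_nonneg (|z.2| - K z.1)]

theorem memLp_of_dominated {f : Cov q × ℝ → ℝ} (hf : Measurable f)
    (hfK : ∀ z, |f z| ≤ |z.2| + K z.1) {ν : ℕ} (i : Fin (S ν).N) :
    MemLp (fun pop : Pop q (S ν).N => f (pop i)) 2 (S ν).popLaw := by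
  obtain ⟨C, hC0, hC⟩ := A.exists_moment
  have hfm : Measurable fun pop : Pop q (S ν).N => f (pop i) := hf.comp (measurable_pi_apply i)
  rw [memLp_two_iff_integrable_sq hfm.aestronglyMeasurable]
  refine ((((integrable_const (1 : ℝ)).add ((hC ν).1 i)).const_mul 2).add
    (((integrable_const (1 : ℝ)).add ((hC ν).2.1 i)).const_mul 2)).mono'
    (hfm.pow_const 2).aestronglyMeasurable (.of_forall fun pop => ?_)
  rw [Real.norm_of_nonneg (sq_nonneg _)]
  exact sq_le_of_dominated hfK _

/-- A law of large numbers: population means of functions that are dominated by the responses and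
the envelope deviate from their means by `o(n_B^{-1/2})` in mean square. -/
theorem negligible_popMean {f : Cov q × ℝ → ℝ} (hf : Measurable f)
    (hfK : ∀ z, |f z| ≤ |z.2| + K z.1) :
    Negligible (fun ν => (S ν).popLaw) nB fun ν pop => ((S ν).N : ℝ)⁻¹ * ∑ i, f (pop i) -
      ∫ pop' : Pop q (S ν).N, ((S ν).N : ℝ)⁻¹ * ∑ i, f (pop' i) ∂(S ν).popLaw := by
  obtain ⟨C, hC0, hC⟩ := A.exists_moment
  have hf4 := sq_le_of_dominated hfK
  have hfm : ∀ ν, ∀ i : Fin (S ν).N, Measurable fun pop : Pop q (S ν).N => f (pop i) :=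
    fun ν i => hf.comp (measurable_pi_apply i)
  have hfi : ∀ ν, ∀ i : Fin (S ν).N, MemLp (fun pop : Pop q (S ν).N => f (pop i)) 2
      (S ν).popLaw := fun ν i => A.memLp_of_dominated hf hfK i
  have hmp := fun ν (i : Fin (S ν).N) => measurePreserving_eval (S ν).unit i
  have hfu : ∀ ν, ∀ i : Fin (S ν).N, MemLp f 2 ((S ν).unit i) := by
    intro ν i
    rw [← (hmp ν i).map_eq, memLp_map_measure_iff hf.aestronglyMeasurable
      (hmp ν i).measurable.aemeasurable]
    exact hfi ν i
  have hint : ∀ ν, ∀ i : Fin (S ν).N, ∫ pop : Pop q (S ν).N, f (pop i) ∂(S ν).popLaw =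
      ∫ z', f z' ∂(S ν).unit i := by
    intro ν i
    rw [← (hmp ν i).map_eq, integral_map (hmp ν i).measurable.aemeasurable hf.aestronglyMeasurable]
    rfl
  -- centering each unit separately leaves the centered mean unchanged, as the laws may differ
  have key := fun ν => Stage.integral_popMean_sq (S := S ν)
    (fun i z => f z - ∫ z', f z' ∂(S ν).unit i)
    (fun i => (hfu ν i).sub (memLp_const _))
    (fun i => by
      rw [integral_sub ((hfu ν i).integrable (by norm_num)) (integrable_const _)]
      simp)
  have he : ∀ ν, ∀ pop : Pop q (S ν).N, ((S ν).N : ℝ)⁻¹ * ∑ i, f (pop i) -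
      ∫ pop' : Pop q (S ν).N, ((S ν).N : ℝ)⁻¹ * ∑ i, f (pop' i) ∂(S ν).popLaw =
      ((S ν).N : ℝ)⁻¹ * ∑ i, (f (pop i) - ∫ z', f z' ∂(S ν).unit i) := by
    intro ν pop
    rw [integral_const_mul, integral_finsetSum _ fun i _ => (hfi ν i).integrable (by norm_num),
      ← mul_sub, ← Finset.sum_sub_distrib]
    congr 1
    refine Finset.sum_congr rfl fun i _ => ?_
    congr 1
    exact hint ν i
  simp_rw [Negligible, he]
  refine ⟨.of_forall fun ν => (key ν).1, ?_⟩
  have h2 : Tendsto (fun ν => nB ν / (S ν).N * (4 * (1 + C))) atTop (𝓝 0) := by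
    simpa using A.nB_N.mul_const (4 * (1 + C))
  refine squeeze_zero' ?_ ?_ h2
  · filter_upwards [A.nB_nonneg] with ν h1
    exact mul_nonneg h1 (integral_nonneg fun _ => sq_nonneg _)
  · filter_upwards [A.nB_nonneg, A.N_pos] with ν h1 hN
    have hN' : (0 : ℝ) < (S ν).N := by exact_mod_cast hN
    rw [(key ν).2]
    have h3 : ∀ i : Fin (S ν).N, ∫ pop : Pop q (S ν).N, (f (pop i) - ∫ z', f z' ∂(S ν).unit i) ^ 2
        ∂(S ν).popLaw ≤ ∫ pop : Pop q (S ν).N, f (pop i) ^ 2 ∂(S ν).popLaw := by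
      intro i
      have e : ∫ z', f z' ∂(S ν).unit i = ∫ pop : Pop q (S ν).N, f (pop i) ∂(S ν).popLaw :=
        (hint ν i).symm
      rw [e, ← variance_eq_integral (hfm ν i).aemeasurable]
      exact variance_le_expectation_sq (hfm ν i).aestronglyMeasurable
    have h4 : ((S ν).N : ℝ)⁻¹ * ∑ i, ∫ pop : Pop q (S ν).N, f (pop i) ^ 2 ∂(S ν).popLaw ≤
        4 * (1 + C) := by
      have h5 : ∀ i : Fin (S ν).N, ∫ pop : Pop q (S ν).N, f (pop i) ^ 2 ∂(S ν).popLaw ≤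
          4 + 2 * ∫ pop : Pop q (S ν).N, (pop i).2 ^ 4 ∂(S ν).popLaw +
            2 * ∫ pop : Pop q (S ν).N, K (pop i).1 ^ 4 ∂(S ν).popLaw := by
        intro i
        have i1 := ((hC ν).1 i).const_mul 2
        have i2 := ((hC ν).2.1 i).const_mul 2
        rw [← integral_const_mul, ← integral_const_mul]
        calc _ ≤ ∫ pop : Pop q (S ν).N, ((4 + 2 * (pop i).2 ^ 4) + 2 * K (pop i).1 ^ 4)
              ∂(S ν).popLaw :=
              integral_mono (hfi ν i).integrable_sq (((integrable_const (4 : ℝ)).add i1).add i2)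
                fun pop => by
                  have := hf4 (pop i)
                  simp only
                  linarith
          _ = _ := by
              rw [integral_add ((integrable_const (4 : ℝ)).fun_add i1) i2,
                integral_add (integrable_const (4 : ℝ)) i1]
              simp
      have h6 := (hC ν).2.2.1
      have h7 := (hC ν).2.2.2
      rw [integral_const_mul, integral_finsetSum _ fun i _ => (hC ν).1 i] at h6
      rw [integral_const_mul, integral_finsetSum _ fun i _ => (hC ν).2.1 i] at h7
      calc _ ≤ ((S ν).N : ℝ)⁻¹ * ∑ i, (4 + 2 * ∫ pop : Pop q (S ν).N, (pop i).2 ^ 4 ∂(S ν).popLaw +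
            2 * ∫ pop : Pop q (S ν).N, K (pop i).1 ^ 4 ∂(S ν).popLaw) := by
            gcongr with i
            exact h5 i
        _ = 4 + 2 * (((S ν).N : ℝ)⁻¹ *
              ∑ i, ∫ pop : Pop q (S ν).N, (pop i).2 ^ 4 ∂(S ν).popLaw) +
            2 * (((S ν).N : ℝ)⁻¹ *
              ∑ i, ∫ pop : Pop q (S ν).N, K (pop i).1 ^ 4 ∂(S ν).popLaw) := by
            simp only [Finset.sum_add_distrib, ← Finset.mul_sum, Finset.sum_const,
              Finset.card_univ, Fintype.card_fin, nsmul_eq_mul]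
            field_simp
        _ ≤ _ := by linarith
    calc nB ν * (((S ν).N : ℝ)⁻¹ ^ 2 * ∑ i, ∫ pop : Pop q (S ν).N,
          (f (pop i) - ∫ z', f z' ∂(S ν).unit i) ^ 2 ∂(S ν).popLaw)
        ≤ nB ν * (((S ν).N : ℝ)⁻¹ ^ 2 *
            ∑ i, ∫ pop : Pop q (S ν).N, f (pop i) ^ 2 ∂(S ν).popLaw) := by
          exact mul_le_mul_of_nonneg_left (mul_le_mul_of_nonneg_left
            (Finset.sum_le_sum fun i _ => h3 i) (by positivity)) h1
      _ = nB ν / (S ν).N * (((S ν).N : ℝ)⁻¹ *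
            ∑ i, ∫ pop : Pop q (S ν).N, f (pop i) ^ 2 ∂(S ν).popLaw) := by
          field_simp
      _ ≤ _ := by gcongr

end Assumptions

end

section

variable {p q : ℕ} {S : ℕ → Stage q} {nA nB : ℕ → ℝ} {m : Cov q → Param p → ℝ}
  {h : Cov q → Param p → Param p} {K : Cov q → ℝ} {Θ : Set (Param p)} {β₀ : Param p}
  {sol : ∀ ν, Pop q (S ν).N → (Fin (S ν).N → ℕ) → Param p}

/-- First-order expansion of a weighted sum of imputed values. -/
theorem Regular.abs_weighted_sub_le (R : Regular m h K Θ β₀) {N : ℕ} (pop : Pop q N)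
    (s : Finset (Fin N)) {u : Fin N → ℝ} (hu : ∀ i, 0 ≤ u i) (γ : Param p →L[ℝ] ℝ)
    {β β' : Param p} (hβ : β ∈ Θ) (hβ' : β' ∈ Θ) {ρ : ℝ} (h1 : ‖β - β₀‖ ≤ ρ)
    (h2 : ‖β' - β₀‖ ≤ ρ) :
    |∑ i ∈ s, u i * (m (pop i).1 β - m (pop i).1 β') - γ (β - β')| ≤
      ((∑ i ∈ s, u i * K (pop i).1) * ρ + ∑ l, |∑ i ∈ s, u i * fderiv ℝ (m (pop i).1) β₀
        (EuclideanSpace.single l 1) - γ (EuclideanSpace.single l 1)|) * ‖β - β'‖ := by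
  set g : Param p →L[ℝ] ℝ := ∑ i ∈ s, u i • fderiv ℝ (m (pop i).1) β₀ with hg
  have hga : ∀ v, g v = ∑ i ∈ s, u i * fderiv ℝ (m (pop i).1) β₀ v := fun v => by
    simp [hg, sum_apply]
  have e : ∑ i ∈ s, u i * (m (pop i).1 β - m (pop i).1 β') - γ (β - β') =
      ∑ i ∈ s, u i * (m (pop i).1 β - m (pop i).1 β' - fderiv ℝ (m (pop i).1) β₀ (β - β')) +
        (g - γ) (β - β') := by
    rw [sub_apply, hga]
    simp only [mul_sub, Finset.sum_sub_distrib]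
    ring
  rw [e, add_mul]
  refine (abs_add_le _ _).trans (add_le_add ?_ ?_)
  · refine (Finset.abs_sum_le_sum_abs _ _).trans ?_
    rw [Finset.sum_mul, Finset.sum_mul]
    refine Finset.sum_le_sum fun i _ => ?_
    rw [abs_mul, abs_of_nonneg (hu i), mul_assoc, mul_assoc]
    refine mul_le_mul_of_nonneg_left ?_ (hu i)
    rw [← mul_assoc]
    exact R.m_lin _ β hβ β' hβ' ρ h1 h2
  · refine ((g - γ).le_opNorm _).trans (mul_le_mul_of_nonneg_right
      ((norm_le_sum_abs_single _).trans (le_of_eq ?_)) (norm_nonneg _))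
    refine Finset.sum_congr rfl fun l _ => ?_
    rw [sub_apply, hga]

theorem Negligible.abs {Ω : ℕ → Type*} [∀ ν, MeasurableSpace (Ω ν)] {P : ∀ ν, Measure (Ω ν)}
    {n : ℕ → ℝ} {f : ∀ ν, Ω ν → ℝ} (hf : Negligible P n f) :
    Negligible P n fun ν ω => |f ν ω| := by
  refine ⟨hf.1.mono fun ν h => h.abs, ?_⟩
  simp_rw [sq_abs]
  exact hf.2

theorem Stage.integral_lawB_fst (S : Stage q) {g : Pop q S.N → ℝ}
    (hg : AEStronglyMeasurable g S.popLaw) : ∫ ω, g ω.1 ∂S.lawB = ∫ pop, g pop ∂S.popLaw := by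
  rw [← S.map_fst_lawB] at hg
  rw [← S.map_fst_lawB, integral_map measurable_fst.aemeasurable hg]

theorem Stage.integral_lawBA_fst (S : Stage q) {g : Pop q S.N × Finset (Fin S.N) → ℝ}
    (hg : AEStronglyMeasurable g S.lawB) : ∫ d, g d.1 ∂S.lawBA = ∫ ω, g ω ∂S.lawB := by
  rw [← S.map_fst_lawBA] at hg
  rw [← S.map_fst_lawBA, integral_map measurable_fst.aemeasurable hg]

namespace Assumptions

variable (A : Assumptions S nA nB m h K Θ β₀ sol) (Λ : Linearization S nB m h K Θ β₀)
include A

/-- The imputation estimator has a finite second moment. -/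
theorem memLp_theta (ν : ℕ) :
    MemLp (fun d => (S ν).thetaI m (sol ν) d - (S ν).thetaN d.1.1) 2 (S ν).lawBA := by
  obtain ⟨C, -, hC⟩ := A.exists_htError_bound
  obtain ⟨D, -, hD⟩ := A.exists_moment
  have h1 := (hC ν (fun ω i => m (ω.1 i).1 (betaHat (sol ν) ω)) (A.measurable_m_betaHat ν)
    (A.integrable_mean_sq (κ := 1) (A.measurable_m_betaHat ν) fun ω i => by
      rw [one_mul]
      exact A.reg.m_bdd _ _ ((A.solver ν).betaHat_mem ω))).1
  have hy : ∀ i : Fin (S ν).N, Measurable fun pop : Pop q (S ν).N => (pop i).2 := fun i =>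
    measurable_snd.comp (measurable_pi_apply i)
  have h2 : ∀ i : Fin (S ν).N, MemLp (fun pop : Pop q (S ν).N => |(pop i).2| + K (pop i).1) 2
      (S ν).popLaw := fun i =>
    (memLp_two_of_pow_four (hy i).aestronglyMeasurable ((hD ν).1 i)).abs.add
      (memLp_two_of_pow_four (A.measurable_K_pop ν i).aestronglyMeasurable ((hD ν).2.1 i))
  have h3 : MemLp (fun ω : Pop q (S ν).N × Finset (Fin (S ν).N) => ((S ν).N : ℝ)⁻¹ *
      ∑ i, (m (ω.1 i).1 (betaHat (sol ν) ω) - (ω.1 i).2)) 2 (S ν).lawB := by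
    have h5 : ∀ i : Fin (S ν).N, MemLp (fun ω : Pop q (S ν).N × Finset (Fin (S ν).N) =>
        m (ω.1 i).1 (betaHat (sol ν) ω) - (ω.1 i).2) 2 (S ν).lawB := by
      intro i
      have h4 : MemLp (fun ω : Pop q (S ν).N × Finset (Fin (S ν).N) =>
          |(ω.1 i).2| + K (ω.1 i).1) 2 (S ν).lawB :=
        (h2 i).comp_measurePreserving (S ν).measurePreserving_fst_lawB
      refine h4.mono' ((A.measurable_m_betaHat ν i).sub ((hy i).comp measurable_fst)).aestronglyMeasurable
        (.of_forall fun ω => ?_)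
      have := A.reg.m_bdd (ω.1 i).1 _ ((A.solver ν).betaHat_mem ω)
      refine (abs_sub _ _).trans ?_
      linarith
    exact (memLp_finsetSum Finset.univ fun i _ => h5 i).const_mul _
  refine (h1.add (h3.comp_measurePreserving (S ν).measurePreserving_fst_lawBA)).ae_eq
    (.of_forall fun d => ?_)
  simp only [Pi.add_apply, Function.comp_apply, Stage.htError, Stage.thetaI, Stage.thetaN,
    betaHat, Finset.sum_sub_distrib, mul_sub]
  ring

/-- Sampling the units of `A` and estimating `β₀` interact only to higher order. -/
theorem negligible_htError_diff : Negligible (fun ν => (S ν).lawBA) nB fun ν d =>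
    (S ν).htError d.1.1 (fun i => m (d.1.1 i).1 (betaHat (sol ν) d.1) - m (d.1.1 i).1 β₀) d.2 := by
  obtain ⟨Λ⟩ := A.exists_linearization
  obtain ⟨C, hC0, hC⟩ := A.exists_htError_bound
  obtain ⟨D, hD0, hD⟩ := A.exists_moment
  obtain ⟨c, hc0, hc⟩ := A.exists_ratio
  obtain ⟨d, hd0, hd⟩ := A.exists_diam
  have hz : ∀ ν, ∀ i, Measurable fun ω : Pop q (S ν).N × Finset (Fin (S ν).N) =>
      m (ω.1 i).1 (betaHat (sol ν) ω) - m (ω.1 i).1 β₀ := fun ν i =>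
    (A.measurable_m_betaHat ν i).sub ((A.measurable_m_pop ν i).comp measurable_fst)
  have hzK : ∀ ν, ∀ ω : Pop q (S ν).N × Finset (Fin (S ν).N), ∀ i,
      |m (ω.1 i).1 (betaHat (sol ν) ω) - m (ω.1 i).1 β₀| ≤
        K (ω.1 i).1 * ‖betaHat (sol ν) ω - β₀‖ := fun ν ω i =>
    A.reg.m_lip _ _ ((A.solver ν).betaHat_mem ω) _ A.reg.mem
  have hzK' : ∀ ν, ∀ ω : Pop q (S ν).N × Finset (Fin (S ν).N), ∀ i,
      |m (ω.1 i).1 (betaHat (sol ν) ω) - m (ω.1 i).1 β₀| ≤ d * K (ω.1 i).1 := fun ν ω i => by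
    refine (hzK ν ω i).trans ?_
    rw [mul_comm]
    exact mul_le_mul_of_nonneg_right (hd _ ((A.solver ν).betaHat_mem ω) _ A.reg.mem)
      (A.reg.K_nonneg _)
  have hzi := fun ν => A.integrable_mean_sq (hz ν) (hzK' ν)
  have hneg := A.negligible_dist_sq Λ
  refine ⟨.of_forall fun ν => (hC ν _ (hz ν) (hzi ν)).1, ?_⟩
  have h0 : Tendsto (fun ν => c * C * (√D * √(nB ν *
      ∫ ω, (‖betaHat (sol ν) ω - β₀‖ ^ 2) ^ 2 ∂(S ν).lawB))) atTop (𝓝 0) := by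
    simpa using (((Real.continuous_sqrt.tendsto 0).comp hneg.2).const_mul √D).const_mul (c * C)
  refine squeeze_zero' ?_ ?_ h0
  · filter_upwards [A.nB_nonneg] with ν h1
    exact mul_nonneg h1 (integral_nonneg fun _ => sq_nonneg _)
  · filter_upwards [A.nB_pos, hc, hneg.1] with ν h1 h2 h3
    have h4 := (hC ν _ (hz ν) (hzi ν)).2 h2.1
    have hKm : Measurable fun pop : Pop q (S ν).N => ((S ν).N : ℝ)⁻¹ * ∑ i, K (pop i).1 ^ 2 :=
      (Finset.measurable_sum _ fun i _ => (A.measurable_K_pop ν i).pow_const 2).const_mul _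
    have hKsq : ∀ pop : Pop q (S ν).N, (((S ν).N : ℝ)⁻¹ * ∑ i, K (pop i).1 ^ 2) ^ 2 ≤
        ((S ν).N : ℝ)⁻¹ * ∑ i, K (pop i).1 ^ 4 := fun pop => by
      refine (popMean_sq_le _).trans (le_of_eq ?_)
      simp only [← pow_mul]
    have hKi : Integrable (fun pop : Pop q (S ν).N =>
        (((S ν).N : ℝ)⁻¹ * ∑ i, K (pop i).1 ^ 2) ^ 2) (S ν).popLaw := by
      refine (A.integrable_mean_pow_four ν).mono' (hKm.pow_const 2).aestronglyMeasurable
        (.of_forall fun pop => ?_)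
      rw [Real.norm_of_nonneg (sq_nonneg _)]
      exact hKsq pop
    have hKL : MemLp (fun ω : Pop q (S ν).N × Finset (Fin (S ν).N) =>
        ((S ν).N : ℝ)⁻¹ * ∑ i, K (ω.1 i).1 ^ 2) 2 (S ν).lawB :=
      ((memLp_two_iff_integrable_sq hKm.aestronglyMeasurable).2 hKi).comp_measurePreserving
        (S ν).measurePreserving_fst_lawB
    have hKle : ∫ ω, (((S ν).N : ℝ)⁻¹ * ∑ i, K (ω.1 i).1 ^ 2) ^ 2 ∂(S ν).lawB ≤ D := by
      rw [(S ν).integral_lawB_fst (hKm.pow_const 2).aestronglyMeasurable]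
      exact (integral_mono hKi (A.integrable_mean_pow_four ν) hKsq).trans (hD ν).2.2.2
    have h5 : ∫ ω, ((S ν).N : ℝ)⁻¹ * ∑ i, (m (ω.1 i).1 (betaHat (sol ν) ω) -
        m (ω.1 i).1 β₀) ^ 2 ∂(S ν).lawB ≤
        √D * √(nB ν * ∫ ω, (‖betaHat (sol ν) ω - β₀‖ ^ 2) ^ 2 ∂(S ν).lawB) := by
      calc _ ≤ ∫ ω, (((S ν).N : ℝ)⁻¹ * ∑ i, K (ω.1 i).1 ^ 2) * ‖betaHat (sol ν) ω - β₀‖ ^ 2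
            ∂(S ν).lawB := by
            refine integral_mono (hzi ν) (hKL.integrable_mul h3) fun ω => ?_
            simp only
            rw [mul_assoc, Finset.sum_mul]
            gcongr with i
            rw [← mul_pow]
            exact sq_le_sq' (abs_le.1 (hzK ν ω i)).1 (abs_le.1 (hzK ν ω i)).2
        _ ≤ √(∫ ω, (((S ν).N : ℝ)⁻¹ * ∑ i, K (ω.1 i).1 ^ 2) ^ 2 ∂(S ν).lawB) *
            √(∫ ω, (‖betaHat (sol ν) ω - β₀‖ ^ 2) ^ 2 ∂(S ν).lawB) :=
            (le_abs_self _).trans (abs_integral_mul_le hKL h3)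
        _ ≤ _ := by
            have h6 : 0 ≤ ∫ ω, (‖betaHat (sol ν) ω - β₀‖ ^ 2) ^ 2 ∂(S ν).lawB :=
              integral_nonneg fun _ => sq_nonneg _
            refine mul_le_mul (Real.sqrt_le_sqrt hKle) (Real.sqrt_le_sqrt ?_)
              (Real.sqrt_nonneg _) (Real.sqrt_nonneg _)
            exact le_mul_of_one_le_left h6 h1
    have hpos : 0 ≤ √D * √(nB ν * ∫ ω, (‖betaHat (sol ν) ω - β₀‖ ^ 2) ^ 2 ∂(S ν).lawB) := by
      positivity
    calc _ ≤ nB ν * (C / nA ν * (√D * √(nB ν *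
          ∫ ω, (‖betaHat (sol ν) ω - β₀‖ ^ 2) ^ 2 ∂(S ν).lawB))) := by
          refine mul_le_mul_of_nonneg_left (h4.trans (mul_le_mul_of_nonneg_left h5 ?_))
            (by linarith)
          exact div_nonneg hC0 h2.1.le
      _ = nB ν / nA ν * C * (√D * √(nB ν *
          ∫ ω, (‖betaHat (sol ν) ω - β₀‖ ^ 2) ^ 2 ∂(S ν).lawB)) := by ring
      _ ≤ _ := by
          gcongr
          exact h2.2

/-- The effect of estimating `β₀` on the population mean is linear to first order. -/
theorem negligible_popMean_diff : Negligible (fun ν => (S ν).lawB) nB fun ν ω =>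
    ((S ν).N : ℝ)⁻¹ * ∑ i, (m (ω.1 i).1 (betaHat (sol ν) ω) - m (ω.1 i).1 β₀) -
      Λ.γ ν (betaHat (sol ν) ω - β₀) := by
  obtain ⟨D, hD0, hD⟩ := A.exists_moment
  obtain ⟨d, hd0, hd⟩ := A.exists_diam
  have hK := (A.negligible_popMean (A.reg.meas_K.comp measurable_fst) fun z => by
    rw [Function.comp_apply, abs_of_nonneg (A.reg.K_nonneg _)]
    exact le_add_of_nonneg_left (abs_nonneg _)).comp (P' := fun ν => (S ν).lawB)
      (fun ν => Prod.fst) (fun ν => measurable_fst) fun ν => (S ν).map_fst_lawB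
  have hg := fun l : Fin p => (A.negligible_popMean
    ((A.reg.dm_meas (EuclideanSpace.single l 1)).comp measurable_fst) fun z =>
      (A.reg.abs_fderiv_single_le z.1 l).trans
        (le_add_of_nonneg_left (abs_nonneg _))).comp (P' := fun ν => (S ν).lawB)
      (fun ν => Prod.fst) (fun ν => measurable_fst) fun ν => (S ν).map_fst_lawB
  simp only [Function.comp_apply, ← Λ.γ_apply] at hK hg
  have hsum := Negligible.sum A.nB_nonneg Finset.univ fun l _ => ((hg l).abs.const_mul d)
  have hall := Negligible.add A.nB_nonneg (Negligible.add A.nB_nonneg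
    ((A.negligible_dist_sq Λ).const_mul (1 + D)) (hK.abs.const_mul (d ^ 2))) hsum
  refine hall.mono A.nB_nonneg (.of_forall fun ν => ?_) (.of_forall fun ν ω => ?_)
  · exact (((Finset.measurable_sum _ fun i _ => (A.measurable_m_betaHat ν i).sub
      ((A.measurable_m_pop ν i).comp measurable_fst)).const_mul _).sub
      ((Λ.γ ν).continuous.measurable.comp
        ((A.solver ν).measurable_betaHat.sub_const β₀))).aestronglyMeasurable
  · refine le_trans ?_ (le_abs_self _)
    have h1 := A.reg.abs_weighted_sub_le ω.1 Finset.univ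
      (u := fun _ => ((S ν).N : ℝ)⁻¹) (fun _ => by positivity) (Λ.γ ν)
      ((A.solver ν).betaHat_mem ω) A.reg.mem (le_refl ‖betaHat (sol ν) ω - β₀‖) (by simp)
    simp only [← Finset.mul_sum] at h1
    have h2 := hd _ ((A.solver ν).betaHat_mem ω) _ A.reg.mem
    have h3 : ∫ pop : Pop q (S ν).N, ((S ν).N : ℝ)⁻¹ * ∑ i, K (pop i).1 ∂(S ν).popLaw ≤ 1 + D := by
      have hi := A.integrable_mean_pow_four ν
      calc _ ≤ ∫ pop : Pop q (S ν).N, (1 + ((S ν).N : ℝ)⁻¹ * ∑ i, K (pop i).1 ^ 4)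
            ∂(S ν).popLaw := by
            refine integral_mono_of_nonneg (.of_forall fun pop => mul_nonneg (by positivity)
              (Finset.sum_nonneg fun i _ => A.reg.K_nonneg _))
              ((integrable_const (1 : ℝ)).add hi) (.of_forall fun pop => ?_)
            have := avg_le_one_add Finset.univ fun i => K (pop i).1
            simpa [avg] using this
        _ = 1 + ∫ pop : Pop q (S ν).N, ((S ν).N : ℝ)⁻¹ * ∑ i, K (pop i).1 ^ 4 ∂(S ν).popLaw := by
            rw [integral_add (integrable_const _) hi]
            simp
        _ ≤ _ := by linarith [(hD ν).2.2.2]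
    set δ := ‖betaHat (sol ν) ω - β₀‖ with hδ
    have hδ0 : 0 ≤ δ := norm_nonneg _
    set E := ∫ pop : Pop q (S ν).N, ((S ν).N : ℝ)⁻¹ * ∑ i, K (pop i).1 ∂(S ν).popLaw
    set k := ((S ν).N : ℝ)⁻¹ * ∑ i, K (ω.1 i).1
    refine h1.trans ?_
    rw [add_mul]
    refine add_le_add ?_ ?_
    · have h4 : k ≤ (1 + D) + |k - E| := by linarith [le_abs_self (k - E)]
      have h5 : δ ^ 2 ≤ d ^ 2 := pow_le_pow_left₀ hδ0 h2 2
      calc k * δ * δ = k * δ ^ 2 := by ring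
        _ ≤ ((1 + D) + |k - E|) * δ ^ 2 := by gcongr
        _ = (1 + D) * δ ^ 2 + δ ^ 2 * |k - E| := by ring
        _ ≤ _ := by gcongr
    · rw [← Finset.mul_sum, mul_comm]
      gcongr

/-- The error of the imputation estimator without its negligible part: the error of the
Horvitz-Thompson estimator for `m(x_i; β₀)` and the influence of `B`. -/
theorem negligible_theta : Negligible (fun ν => (S ν).lawBA) nB fun ν d =>
    (S ν).thetaI m (sol ν) d - (S ν).thetaN d.1.1 -
      ((S ν).htError d.1.1 (fun i => m (d.1.1 i).1 β₀) d.2 +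
        influence m h β₀ (Λ.α ν) (nB ν / 2) d.1) := by
  have hE := A.negligible_popMean A.reg.measurable_err fun z =>
    A.reg.res_le z A.reg.mem
  have hE0 : ∀ ν, ∫ pop : Pop q (S ν).N, ((S ν).N : ℝ)⁻¹ * ∑ i, err m β₀ (pop i)
      ∂(S ν).popLaw = 0 := by
    intro ν
    have hdom : ∀ z, |err m β₀ z| ≤ |z.2| + K z.1 := fun z => A.reg.res_le z A.reg.mem
    rw [integral_const_mul, integral_finsetSum _ fun i _ =>
      (A.memLp_of_dominated A.reg.measurable_err hdom i).integrable (by norm_num)]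
    refine mul_eq_zero_of_right _ (Finset.sum_eq_zero fun i _ => ?_)
    have h1 := Stage.integral_mul_err A.reg (A.model ν) i (A.integrable_y ν i)
      (measurable_const (a := (1 : ℝ)))
    simp only [one_mul] at h1
    have hmp := measurePreserving_eval (S ν).unit i
    rw [← hmp.map_eq, integral_map hmp.measurable.aemeasurable
      A.reg.measurable_err.aestronglyMeasurable] at h1
    exact h1
  simp only [hE0, sub_zero] at hE
  have h1 := (hE.comp (P' := fun ν => (S ν).lawB)
      (fun ν => Prod.fst) (fun ν => measurable_fst) fun ν => (S ν).map_fst_lawB).const_mul (-1)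
  have h2 := Negligible.add A.nB_nonneg h1
    (Negligible.add A.nB_nonneg (A.negligible_popMean_diff Λ) (A.negligible_linear Λ))
  have h3 := Negligible.add A.nB_nonneg A.negligible_htError_diff
    (h2.comp (P' := fun ν => (S ν).lawBA) (fun ν => Prod.fst) (fun ν => measurable_fst)
      fun ν => (S ν).map_fst_lawBA)
  refine Eq.mp ?_ h3
  congr 1
  funext ν d
  simp only [Stage.htError, Stage.thetaI, Stage.thetaN, betaHat, err,
    Finset.sum_sub_distrib, mul_sub]
  ring

theorem memLp_htError (ν : ℕ) : MemLp (fun d : (Pop q (S ν).N × Finset (Fin (S ν).N)) ×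
    Finset (Fin (S ν).N) => (S ν).htError d.1.1 (fun i => m (d.1.1 i).1 β₀) d.2) 2 (S ν).lawBA := by
  obtain ⟨C, -, hC⟩ := A.exists_htError_bound
  exact (hC ν (fun ω i => m (ω.1 i).1 β₀) (fun i => (A.measurable_m_pop ν i).comp measurable_fst)
    (A.integrable_mean_sq (κ := 1) (fun i => (A.measurable_m_pop ν i).comp measurable_fst)
      fun ω i => by
        rw [one_mul]
        exact A.reg.m_bdd _ _ A.reg.mem)).1

theorem variance_htError (ν : ℕ) :
    Var[fun d => (S ν).htError d.1 (fun i => m (d.1 i).1 β₀) d.2; (S ν).lawA] =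
      ∫ d, (S ν).htError d.1.1 (fun i => m (d.1.1 i).1 β₀) d.2 ^ 2 ∂(S ν).lawBA := by
  have hL := A.memLp_htError ν
  have hm : Measurable fun d : Pop q (S ν).N × Finset (Fin (S ν).N) =>
      (S ν).htError d.1 (fun i => m (d.1 i).1 β₀) d.2 :=
    Stage.measurable_htError measurable_id (A.measurable_m_pop ν)
  have hf : Measurable fun d : (Pop q (S ν).N × Finset (Fin (S ν).N)) × Finset (Fin (S ν).N) =>
      (d.1.1, d.2) := by fun_prop
  have h0 : ∫ d, (S ν).htError d.1.1 (fun i => m (d.1.1 i).1 β₀) d.2 ∂(S ν).lawBA = 0 := by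
    have := Stage.integral_htError_mul (A.incl_pos ν) (fun ω i => m (ω.1 i).1 β₀)
      (g := fun _ => 1) (by simpa using hL.integrable (by norm_num))
    simpa using this
  rw [← (S ν).map_lawBA, variance_map hm.aemeasurable hf.aemeasurable]
  exact variance_of_integral_eq_zero (hm.comp hf).aemeasurable h0

/-- The design variance is of the order `1 / n_B`. -/
theorem exists_designVar_bound : ∃ C : ℝ, ∀ᶠ ν in atTop,
    nB ν * Var[fun d => (S ν).htError d.1 (fun i => m (d.1 i).1 β₀) d.2; (S ν).lawA] ≤ C := by
  obtain ⟨C, hC0, hC⟩ := A.exists_htError_bound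
  obtain ⟨D, hD0, hD⟩ := A.exists_moment
  obtain ⟨c, hc0, hc⟩ := A.exists_ratio
  refine ⟨c * C * (1 + D), ?_⟩
  filter_upwards [A.nB_nonneg, hc] with ν h1 h2
  rw [A.variance_htError]
  have hi := A.integrable_mean_sq (ν := ν) (κ := 1) (z := fun ω i => m (ω.1 i).1 β₀)
    (fun i => (A.measurable_m_pop ν i).comp measurable_fst)
      fun ω i => by
        rw [one_mul]
        exact A.reg.m_bdd _ _ A.reg.mem
  have h3 := (hC ν (fun ω i => m (ω.1 i).1 β₀)
    (fun i => (A.measurable_m_pop ν i).comp measurable_fst) hi).2 h2.1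
  have h4 : ∫ ω, ((S ν).N : ℝ)⁻¹ * ∑ i, m (ω.1 i).1 β₀ ^ 2 ∂(S ν).lawB ≤ 1 + D := by
    have hi4 := A.integrable_mean_pow_four ν
    have hi4' : Integrable (fun ω : Pop q (S ν).N × Finset (Fin (S ν).N) =>
        ((S ν).N : ℝ)⁻¹ * ∑ i, K (ω.1 i).1 ^ 4) (S ν).lawB :=
      (S ν).measurePreserving_fst_lawB.integrable_comp_of_integrable hi4
    calc _ ≤ ∫ ω, (1 + ((S ν).N : ℝ)⁻¹ * ∑ i, K (ω.1 i).1 ^ 4) ∂(S ν).lawB := by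
          refine integral_mono hi ((integrable_const (1 : ℝ)).add hi4') fun ω => ?_
          refine le_trans ?_ (popMean_sq_le_one_add _)
          refine mul_le_mul_of_nonneg_left (Finset.sum_le_sum fun i _ => ?_) (by positivity)
          exact sq_le_sq' (abs_le.1 (A.reg.m_bdd _ _ A.reg.mem)).1
            (abs_le.1 (A.reg.m_bdd _ _ A.reg.mem)).2
      _ = 1 + ∫ pop : Pop q (S ν).N, ((S ν).N : ℝ)⁻¹ * ∑ i, K (pop i).1 ^ 4 ∂(S ν).popLaw := by
          rw [integral_add (integrable_const _) hi4', ← (S ν).integral_lawB_fst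
            hi4.aestronglyMeasurable]
          simp
      _ ≤ _ := by linarith [(hD ν).2.2.2]
  calc _ ≤ nB ν * (C / nA ν * (1 + D)) := by
        refine mul_le_mul_of_nonneg_left (h3.trans (mul_le_mul_of_nonneg_left h4 ?_)) h1
        exact div_nonneg hC0 h2.1.le
    _ = nB ν / nA ν * C * (1 + D) := by ring
    _ ≤ _ := by
        gcongr
        exact h2.2

theorem memLp_influence :
  ∀ᶠ ν in atTop, MemLp (fun d : (Pop q (S ν).N × Finset (Fin (S ν).N)) ×
      Finset (Fin (S ν).N) => influence m h β₀ (Λ.α ν) (nB ν / 2) d.1) 2 (S ν).lawBA := by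
  filter_upwards [A.integral_influence Λ] with ν h1
  exact h1.1.comp_measurePreserving (S ν).measurePreserving_fst_lawBA

/-- The Horvitz-Thompson error is centered given the population and `B`, hence orthogonal to the
influence term. -/
theorem integral_leading_sq :
  ∀ᶠ ν in atTop, ∫ d, ((S ν).htError d.1.1 (fun i => m (d.1.1 i).1 β₀) d.2 +
      influence m h β₀ (Λ.α ν) (nB ν / 2) d.1) ^ 2 ∂(S ν).lawBA =
      Var[fun d => (S ν).htError d.1 (fun i => m (d.1 i).1 β₀) d.2; (S ν).lawA] +
        ∫ ω, influence m h β₀ (Λ.α ν) (nB ν / 2) ω ^ 2 ∂(S ν).lawB := by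
  filter_upwards [A.memLp_influence Λ, A.integral_influence Λ] with ν h1 h2
  have hX := A.memLp_htError ν
  have hXZ : Integrable (fun d : (Pop q (S ν).N × Finset (Fin (S ν).N)) ×
      Finset (Fin (S ν).N) => (S ν).htError d.1.1 (fun i => m (d.1.1 i).1 β₀) d.2 *
        influence m h β₀ (Λ.α ν) (nB ν / 2) d.1) (S ν).lawBA := hX.integrable_mul h1
  have h3 := Stage.integral_htError_mul (A.incl_pos ν) (fun ω i => m (ω.1 i).1 β₀) hXZ
  rw [A.variance_htError, ← (S ν).integral_lawBA_fst h2.1.integrable_sq.aestronglyMeasurable,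
    ← integral_add hX.integrable_sq h1.integrable_sq]
  have h4 : ∫ d, ((S ν).htError d.1.1 (fun i => m (d.1.1 i).1 β₀) d.2 +
      influence m h β₀ (Λ.α ν) (nB ν / 2) d.1) ^ 2 ∂(S ν).lawBA =
      ∫ d, (((S ν).htError d.1.1 (fun i => m (d.1.1 i).1 β₀) d.2 ^ 2 +
      influence m h β₀ (Λ.α ν) (nB ν / 2) d.1 ^ 2) +
      2 * ((S ν).htError d.1.1 (fun i => m (d.1.1 i).1 β₀) d.2 *
        influence m h β₀ (Λ.α ν) (nB ν / 2) d.1)) ∂(S ν).lawBA := by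
    congr 1
    funext d
    ring
  rw [h4, integral_add (hX.integrable_sq.fun_add h1.integrable_sq) (hXZ.const_mul 2),
    integral_const_mul, h3, mul_zero, add_zero]

/-- The variance of the imputation estimator is the sum of the design variance and of the variance
of the influence of `B`, up to `o(1 / n_B)`. -/
theorem tendsto_variance : Tendsto (fun ν =>
    nB ν * Var[fun d => (S ν).thetaI m (sol ν) d - (S ν).thetaN d.1.1; (S ν).lawBA] -
      (nB ν * Var[fun d => (S ν).htError d.1 (fun i => m (d.1 i).1 β₀) d.2; (S ν).lawA] +
        ∫ ω, influenceVar m h β₀ (Λ.α ν) ω ∂(S ν).lawB)) atTop (𝓝 0) := by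
  obtain ⟨C, hC⟩ := A.exists_designVar_bound
  obtain ⟨D, hD0, hD⟩ := A.exists_influenceVar_bound Λ
  have hinf := A.tendsto_influence_sq Λ
  have hZ := A.memLp_influence Λ
  have hsq := A.integral_leading_sq Λ
  have h1 : ∀ᶠ ν in atTop, MemLp (fun d : (Pop q (S ν).N × Finset (Fin (S ν).N)) ×
      Finset (Fin (S ν).N) => (S ν).htError d.1.1 (fun i => m (d.1.1 i).1 β₀) d.2 +
        influence m h β₀ (Λ.α ν) (nB ν / 2) d.1) 2 (S ν).lawBA :=
    hZ.mono fun ν h1 => (A.memLp_htError ν).add h1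
  have h2 : ∀ᶠ ν in atTop, ∫ d, ((S ν).htError d.1.1 (fun i => m (d.1.1 i).1 β₀) d.2 +
        influence m h β₀ (Λ.α ν) (nB ν / 2) d.1) ∂(S ν).lawBA = 0 := by
    filter_upwards [hZ, A.integral_influence Λ] with ν h1 h2
    have hX := A.memLp_htError ν
    have h3 := Stage.integral_htError_mul (A.incl_pos ν) (fun ω i => m (ω.1 i).1 β₀)
      (g := fun _ => 1) (by simpa using hX.integrable (by norm_num))
    simp only [mul_one] at h3
    rw [integral_add (hX.integrable (by norm_num)) (h1.integrable (by norm_num)), h3,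
      (S ν).integral_lawBA_fst h2.1.aestronglyMeasurable, h2.2.1, add_zero]
  have h3 : ∀ᶠ ν in atTop, nB ν * ∫ d, ((S ν).htError d.1.1 (fun i => m (d.1.1 i).1 β₀) d.2 +
        influence m h β₀ (Λ.α ν) (nB ν / 2) d.1) ^ 2 ∂(S ν).lawBA ≤ C + (1 + (1 + D)) := by
    filter_upwards [hsq, hC, hD, hinf.eventually (gt_mem_nhds one_pos)] with ν h1 h2 h3 h4
    rw [h1, mul_add]
    linarith [(abs_le.1 h3.2.2).2]
  have key := Negligible.variance_add A.nB_nonneg (A.negligible_theta Λ) h1 h2 h3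
  have h4 := key.add hinf
  rw [add_zero] at h4
  refine h4.congr' ?_
  filter_upwards [hsq] with ν h5
  rw [h5]
  simp only [add_sub_cancel]
  ring

end Assumptions

end

section

/-! ### Moments of a bootstrap replicate, given the data -/

variable {p q : ℕ} {m : Cov q → Param p → ℝ} {h : Cov q → Param p → Param p} {K : Cov q → ℝ}
  {Θ : Set (Param p)} {β₀ : Param p}

section Abstract

variable {Ω : Type*} [MeasurableSpace Ω] {μ : Measure Ω} [IsProbabilityMeasure μ]

theorem integral_sq_le_sqrt {f : Ω → ℝ} (hf : AEStronglyMeasurable f μ)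
    (hi : Integrable (fun ω => f ω ^ 4) μ) : ∫ ω, f ω ^ 2 ∂μ ≤ √(∫ ω, f ω ^ 4 ∂μ) := by
  have h1 := abs_integral_mul_le (memLp_two_sq hf hi) (memLp_const (1 : ℝ) (p := 2) (μ := μ))
  simp only [mul_one, ← pow_mul, one_pow, integral_const, probReal_univ, smul_eq_mul,
    Real.sqrt_one] at h1
  exact (le_abs_self _).trans h1

omit [IsProbabilityMeasure μ] in
/-- The second moment of a sum of two orthogonal terms and a remainder. -/
theorem abs_integral_sq_sub_le {X Y Z : Ω → ℝ} (hX : MemLp X 2 μ) (hY : MemLp Y 2 μ)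
    (hZ : MemLp Z 2 μ) (hXY : ∫ ω, X ω * Y ω ∂μ = 0) :
    |∫ ω, (X ω + Y ω + Z ω) ^ 2 ∂μ - (∫ ω, X ω ^ 2 ∂μ + ∫ ω, Y ω ^ 2 ∂μ)| ≤
      2 * (√(∫ ω, X ω ^ 2 ∂μ + ∫ ω, Y ω ^ 2 ∂μ) * √(∫ ω, Z ω ^ 2 ∂μ)) + ∫ ω, Z ω ^ 2 ∂μ := by
  have iXY : Integrable (fun ω => X ω * Y ω) μ := hX.integrable_mul hY
  have hS : MemLp (fun ω => X ω + Y ω) 2 μ := hX.add hY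
  have iSZ : Integrable (fun ω => (X ω + Y ω) * Z ω) μ := hS.integrable_mul hZ
  have h1 : ∫ ω, (X ω + Y ω) ^ 2 ∂μ = ∫ ω, X ω ^ 2 ∂μ + ∫ ω, Y ω ^ 2 ∂μ := by
    have e : ∫ ω, (X ω + Y ω) ^ 2 ∂μ = ∫ ω, ((X ω ^ 2 + Y ω ^ 2) + 2 * (X ω * Y ω)) ∂μ := by
      congr 1
      funext ω
      ring
    rw [e, integral_add (hX.integrable_sq.fun_add hY.integrable_sq) (iXY.const_mul 2),
      integral_const_mul, hXY, mul_zero, add_zero,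
      integral_add hX.integrable_sq hY.integrable_sq]
  have h2 : ∫ ω, (X ω + Y ω + Z ω) ^ 2 ∂μ =
      ∫ ω, (X ω + Y ω) ^ 2 ∂μ + 2 * ∫ ω, (X ω + Y ω) * Z ω ∂μ + ∫ ω, Z ω ^ 2 ∂μ := by
    rw [← integral_const_mul, ← integral_add hS.integrable_sq (iSZ.const_mul 2),
      ← integral_add (hS.integrable_sq.fun_add (iSZ.const_mul 2)) hZ.integrable_sq]
    congr 1
    funext ω
    ring
  have h3 := abs_integral_mul_le hS hZ
  rw [h2, h1]
  rw [h1] at h3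
  have h4 : 0 ≤ ∫ ω, Z ω ^ 2 ∂μ := integral_nonneg fun _ => sq_nonneg _
  have h5 := abs_le.1 h3
  rw [abs_le]
  constructor <;> linarith [h5.1, h5.2]

omit [IsProbabilityMeasure μ] in
theorem integral_add_sq_le {X Y : Ω → ℝ} (hX : MemLp X 2 μ) (hY : MemLp Y 2 μ) :
    ∫ ω, (X ω + Y ω) ^ 2 ∂μ ≤ 2 * ∫ ω, X ω ^ 2 ∂μ + 2 * ∫ ω, Y ω ^ 2 ∂μ := by
  rw [← integral_const_mul, ← integral_const_mul,
    ← integral_add (hX.integrable_sq.const_mul 2) (hY.integrable_sq.const_mul 2)]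
  refine integral_mono (hX.add hY).integrable_sq
    ((hX.integrable_sq.const_mul 2).add (hY.integrable_sq.const_mul 2)) fun ω => ?_
  simp only
  nlinarith [sq_nonneg (X ω - Y ω)]

/-- Fourth moment under a product law from a bound on conditional fourth moments. -/
theorem integral_prod_pow_four_le {C : Type*} [MeasurableSpace C] [Countable C]
    [MeasurableSingletonClass C] {ρ : Measure C} [IsProbabilityMeasure ρ] {R : Ω → C → ℝ}
    (hR : ∀ c, Measurable fun ω => R ω c) {g : C → ℝ} (hg0 : ∀ c, 0 ≤ g c) (hg : Integrable g ρ)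
    (h : ∀ c, ∫⁻ ω, ENNReal.ofReal (R ω c ^ 4) ∂μ ≤ ENNReal.ofReal (g c)) :
    Integrable (fun r : Ω × C => R r.1 r.2 ^ 4) (μ.prod ρ) ∧
      ∫ r, R r.1 r.2 ^ 4 ∂μ.prod ρ ≤ ∫ c, g c ∂ρ := by
  have hm : Measurable fun r : Ω × C => R r.1 r.2 := measurable_from_prod_countable_left hR
  have h1 : ∫⁻ r, ENNReal.ofReal (R r.1 r.2 ^ 4) ∂μ.prod ρ ≤ ENNReal.ofReal (∫ c, g c ∂ρ) := by
    rw [lintegral_prod_symm _ (hm.pow_const 4).ennreal_ofReal.aemeasurable,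
      ofReal_integral_eq_lintegral_ofReal hg (.of_forall hg0)]
    exact lintegral_mono h
  have h4 : ∀ r : Ω × C, 0 ≤ R r.1 r.2 ^ 4 := fun r => by positivity
  refine ⟨⟨(hm.pow_const 4).aestronglyMeasurable, ?_⟩, ?_⟩
  · rw [hasFiniteIntegral_iff_ofReal (.of_forall h4)]
    exact h1.trans_lt ENNReal.ofReal_lt_top
  · rw [integral_eq_lintegral_of_nonneg_ae (.of_forall h4) (hm.pow_const 4).aestronglyMeasurable]
    exact ENNReal.toReal_le_of_le_ofReal (integral_nonneg hg0) h1

end Abstract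

section Resample

variable {N : ℕ} (R : Regular m h K Θ β₀) (pop : Pop q N) {B : Finset (Fin N)}
include R

/-- The deviation of a resample from `B` is of the order `|B|^{-1/2}` in fourth mean. -/
theorem Regular.integral_bootSize_pow_four_le (τ : Tuning Θ β₀) (hB : B.Nonempty) {b : Param p}
    (hb : b ∈ Θ) : ∫ c, bootSize m h K τ pop B b c ^ 4 ∂resampleLaw B ≤
      4096 * (Fintype.card (BootIdx τ) : ℝ) ^ 4 * ((B.card : ℝ)⁻¹ ^ 2 *
        avg B fun i => env K (pop i) ^ 4) := by
  set k : ℝ := (Fintype.card (BootIdx τ) : ℝ) with hk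
  have h1 : ∀ a : BootIdx τ, ∫ c, (smean c (bootTest m h K τ pop b a) -
      smean (ofSample B) (bootTest m h K τ pop b a)) ^ 4 ∂resampleLaw B ≤
      4096 * ((B.card : ℝ)⁻¹ ^ 2 * avg B fun i => env K (pop i) ^ 4) := by
    intro a
    rw [smean_ofSample]
    refine (integral_smean_pow_four_resampleLaw hB _).trans ?_
    have h2 : avg B (fun i => bootTest m h K τ pop b a i ^ 4) ≤
        16 * avg B fun i => env K (pop i) ^ 4 := by
      rw [← smean_ofSample, ← smean_ofSample, ← smean_const_mul]
      refine smean_mono _ fun i => ?_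
      have h3 := pow_le_pow_left₀ (abs_nonneg _) (R.bootTest_le pop hb a i) 4
      rw [Even.pow_abs (by decide), mul_pow] at h3
      linarith
    calc _ ≤ 256 * (B.card : ℝ)⁻¹ ^ 2 * (16 * avg B fun i => env K (pop i) ^ 4) := by gcongr
      _ = _ := by ring
  calc ∫ c, bootSize m h K τ pop B b c ^ 4 ∂resampleLaw B
      ≤ ∫ c, k ^ 3 * ∑ a : BootIdx τ, (smean c (bootTest m h K τ pop b a) -
          smean (ofSample B) (bootTest m h K τ pop b a)) ^ 4 ∂resampleLaw B :=
        integral_mono (integrable_resampleLaw _ _) (integrable_resampleLaw _ _) fun c =>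
          sum_pow_four_le _
    _ = k ^ 3 * ∑ a : BootIdx τ, ∫ c, (smean c (bootTest m h K τ pop b a) -
          smean (ofSample B) (bootTest m h K τ pop b a)) ^ 4 ∂resampleLaw B := by
        rw [integral_const_mul, integral_finsetSum _ fun a _ => integrable_resampleLaw _ _]
    _ ≤ k ^ 3 * ∑ a : BootIdx τ, 4096 * ((B.card : ℝ)⁻¹ ^ 2 * avg B fun i => env K (pop i) ^ 4) := by
        gcongr with a
        exact h1 a
    _ = _ := by
        simp only [Finset.sum_const, Finset.card_univ, nsmul_eq_mul, ← hk]
        ring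

omit R in
/-- Mean and variance of the linear part of the effect of resampling. -/
theorem integral_functional_estFun (α : Param p →L[ℝ] ℝ) (hB : B.Nonempty) {b : Param p}
    (hb : estFun m h pop (ofSample B) b = 0) :
    ∫ c, α (estFun m h pop c b) ∂resampleLaw B = 0 ∧
    ∫ c, α (estFun m h pop c b) ^ 2 ∂resampleLaw B =
      (B.card : ℝ)⁻¹ * avg B fun i => α (psi m h (pop i) b) ^ 2 := by
  have h0 : avg B (fun i => α (psi m h (pop i) b)) = 0 := by
    rw [← smean_ofSample, ← map_smean, ← estFun_eq_smean, hb, map_zero]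
  simp_rw [estFun_eq_smean, map_smean]
  exact ⟨(integral_smean_resampleLaw hB _).trans h0, integral_smean_sq_resampleLaw hB _ h0⟩

/-- The variance of the linear part of the effect of resampling is close to the variance of the
influence of `B`. -/
theorem Regular.abs_avg_functional_sq_sub_le {α : Param p →L[ℝ] ℝ} {M : ℝ} (hα : ‖α‖ ≤ M)
    {b : Param p} (hb : b ∈ Θ) :
    |avg B (fun i => α (psi m h (pop i) b) ^ 2) - influenceVar m h β₀ α (pop, B)| ≤
      4 * M ^ 2 * ‖b - β₀‖ * (1 + avg B fun i => env K (pop i) ^ 4) := by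
  have hM : 0 ≤ M := (norm_nonneg _).trans hα
  have e : influenceVar m h β₀ α (pop, B) = avg B fun i => α (psi m h (pop i) β₀) ^ 2 := by
    simp [influenceVar, psi, err]
  rw [e, ← smean_ofSample, ← smean_ofSample, ← smean_ofSample, ← smean_sub, ← Real.norm_eq_abs]
  refine (norm_smean_le _ _).trans ?_
  have h2 : smean (ofSample B) (fun _ => (1 : ℝ)) ≤ 1 := by
    rw [smean_ofSample, avg]
    simp only [Finset.sum_const, nsmul_eq_mul, mul_one]
    exact inv_mul_le_one
  calc smean (ofSample B) (fun i => ‖α (psi m h (pop i) b) ^ 2 - α (psi m h (pop i) β₀) ^ 2‖)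
      ≤ smean (ofSample B) fun i => 4 * M ^ 2 * ‖b - β₀‖ * (1 + env K (pop i) ^ 4) := by
        refine smean_mono _ fun i => ?_
        have hE := R.env_nonneg (pop i)
        have h3 : ‖α (psi m h (pop i) b) - α (psi m h (pop i) β₀)‖ ≤
            M * (2 * env K (pop i) * ‖b - β₀‖) := by
          rw [← map_sub]
          exact (α.le_opNorm _).trans (mul_le_mul hα (R.psi_lip _ hb R.mem) (norm_nonneg _) hM)
        have h4 : ∀ β ∈ Θ, ‖α (psi m h (pop i) β)‖ ≤ M * env K (pop i) := fun β hβ =>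
          (α.le_opNorm _).trans (mul_le_mul hα (R.psi_le _ hβ) (norm_nonneg _) hM)
        have h5 : ‖α (psi m h (pop i) b) + α (psi m h (pop i) β₀)‖ ≤ 2 * (M * env K (pop i)) :=
          (norm_add_le _ _).trans (by linarith [h4 b hb, h4 β₀ R.mem])
        calc ‖α (psi m h (pop i) b) ^ 2 - α (psi m h (pop i) β₀) ^ 2‖
            = ‖α (psi m h (pop i) b) - α (psi m h (pop i) β₀)‖ *
                ‖α (psi m h (pop i) b) + α (psi m h (pop i) β₀)‖ := by
              rw [← norm_mul]
              ring_nf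
          _ ≤ M * (2 * env K (pop i) * ‖b - β₀‖) * (2 * (M * env K (pop i))) :=
              mul_le_mul h3 h5 (norm_nonneg _) (by positivity)
          _ = 4 * M ^ 2 * ‖b - β₀‖ * env K (pop i) ^ 2 := by ring
          _ ≤ _ := by
              gcongr
              exact sq_le_one_add_pow_four _
    _ = 4 * M ^ 2 * ‖b - β₀‖ * (smean (ofSample B) (fun _ => (1 : ℝ)) +
          smean (ofSample B) fun i => env K (pop i) ^ 4) := by
        rw [smean_const_mul, smean_add]
    _ ≤ _ := by gcongr

end Resample

namespace Stage

variable (S : Stage q)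

theorem weight_nonneg (pop : Pop q S.N) (i : Fin S.N) : 0 ≤ S.weight pop i :=
  inv_nonneg.2 measureReal_nonneg

/-- The weighted mean `N⁻¹ ∑_{i ∈ A} w_i z_i`. -/
noncomputable def wmean (pop : Pop q S.N) (A : Finset (Fin S.N)) (z : Fin S.N → ℝ) : ℝ :=
  (S.N : ℝ)⁻¹ * ∑ i ∈ A, S.weight pop i * z i

theorem wmean_eq (pop : Pop q S.N) (A : Finset (Fin S.N)) (z : Fin S.N → ℝ) :
    S.wmean pop A z = ∑ i ∈ A, ((S.N : ℝ)⁻¹ * S.weight pop i) * z i := by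
  simp only [wmean, Finset.mul_sum, mul_assoc]

theorem wmean_nonneg (pop : Pop q S.N) (A : Finset (Fin S.N)) {z : Fin S.N → ℝ}
    (hz : ∀ i, 0 ≤ z i) : 0 ≤ S.wmean pop A z :=
  mul_nonneg (by positivity)
    (Finset.sum_nonneg fun i _ => mul_nonneg (S.weight_nonneg pop i) (hz i))

theorem abs_wmean_le (pop : Pop q S.N) (A : Finset (Fin S.N)) {z z' : Fin S.N → ℝ}
    (hz : ∀ i, |z i| ≤ z' i) : |S.wmean pop A z| ≤ S.wmean pop A z' := by
  rw [wmean_eq, wmean_eq]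
  refine (Finset.abs_sum_le_sum_abs _ _).trans (Finset.sum_le_sum fun i _ => ?_)
  have := S.weight_nonneg pop i
  rw [abs_mul, abs_of_nonneg (by positivity)]
  exact mul_le_mul_of_nonneg_left (hz i) (by positivity)

theorem wmean_mul_const (pop : Pop q S.N) (A : Finset (Fin S.N)) (z : Fin S.N → ℝ) (a : ℝ) :
    S.wmean pop A (fun i => z i * a) = S.wmean pop A z * a := by
  simp only [wmean, Finset.mul_sum, Finset.sum_mul, mul_assoc]

theorem replicate_apply (d : (Pop q S.N × Finset (Fin S.N)) × Finset (Fin S.N)) :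
    S.replicate d = (S.repW (d.1.1, d.2)).prod (resampleLaw d.1.2) := by
  have : IsMarkovKernel (Kernel.mk (fun B : Finset (Fin S.N) => resampleLaw B)
      (measurable_of_countable _)) :=
    ⟨fun B => inferInstanceAs (IsProbabilityMeasure (resampleLaw B))⟩
  rw [replicate, Kernel.prod_apply]
  rfl

theorem thetaRep_sub (m : Cov q → Param p → ℝ) (β₀ : Param p)
    (sol : Pop q S.N → (Fin S.N → ℕ) → Param p)
    (d : (Pop q S.N × Finset (Fin S.N)) × Finset (Fin S.N)) (r : (Fin S.N → ℝ) × (Fin S.N → ℕ)) :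
    S.thetaRep m sol d r - S.thetaI m sol d =
      S.repDiff d.1.1 d.2 (fun i => m (d.1.1 i).1 β₀) r.1 +
      S.repDiff d.1.1 d.2 (fun i => m (d.1.1 i).1 (sol d.1.1 r.2) - m (d.1.1 i).1 β₀) r.1 +
      S.wmean d.1.1 d.2 (fun i => m (d.1.1 i).1 (sol d.1.1 r.2) -
        m (d.1.1 i).1 (betaHat sol d.1)) := by
  simp only [thetaRep, thetaI, repDiff, wmean, betaHat, ← mul_add, ← mul_sub,
    ← Finset.sum_add_distrib, ← Finset.sum_sub_distrib]
  congr 1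
  refine Finset.sum_congr rfl fun i _ => ?_
  ring

theorem measurable_repDiff (pop : Pop q S.N) (A : Finset (Fin S.N)) (z : Fin S.N → ℝ) :
    Measurable fun v => S.repDiff pop A z v := by
  unfold repDiff
  fun_prop

end Stage

end

section

variable {p q : ℕ} {m : Cov q → Param p → ℝ} {h : Cov q → Param p → Param p} {K : Cov q → ℝ}
  {Θ : Set (Param p)} {β₀ : Param p}

section GivenData

variable {S : Stage q} {sol : Pop q S.N → (Fin S.N → ℕ) → Param p}
  (R : Regular m h K Θ β₀) (hsol : IsSolver m h Θ sol) {τ : Tuning Θ β₀}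
  {d : (Pop q S.N × Finset (Fin S.N)) × Finset (Fin S.N)}
  {D : ℝ} (hD : 0 ≤ D)
  (hrep : ∀ z : Fin S.N → ℝ, ∫⁻ v, ENNReal.ofReal (S.repDiff d.1.1 d.2 z v ^ 4)
    ∂S.repW (d.1.1, d.2) ≤ ENNReal.ofReal (D * S.wmean d.1.1 d.2 fun i => z i ^ 4))
  {k : ℝ} (hk : ∀ c, ‖sol d.1.1 c - betaHat sol d.1‖ ≤
    k * bootSize m h K τ d.1.1 d.1.2 (betaHat sol d.1) c)

/-- Deviation of a resample from the sample `B`, measured at the solution for `B`. -/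
noncomputable def bootDev (S : Stage q) (sol : Pop q S.N → (Fin S.N → ℕ) → Param p)
    (m : Cov q → Param p → ℝ) (h : Cov q → Param p → Param p) (K : Cov q → ℝ) (τ : Tuning Θ β₀)
    (d : (Pop q S.N × Finset (Fin S.N)) × Finset (Fin S.N)) (c : Fin S.N → ℕ) : ℝ :=
  bootSize m h K τ d.1.1 d.1.2 (betaHat sol d.1) c

/-- Given the data, mean fourth power of the deviation of a resample. -/
noncomputable def bootDevFour (S : Stage q) (sol : Pop q S.N → (Fin S.N → ℕ) → Param p)
    (m : Cov q → Param p → ℝ) (h : Cov q → Param p → Param p) (K : Cov q → ℝ) (τ : Tuning Θ β₀)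
    (d : (Pop q S.N × Finset (Fin S.N)) × Finset (Fin S.N)) : ℝ :=
  ∫ c, bootDev S sol m h K τ d c ^ 4 ∂resampleLaw d.1.2

theorem bootDev_nonneg (c : Fin S.N → ℕ) : 0 ≤ bootDev S sol m h K τ d c := bootSize_nonneg _ _ _ _

theorem bootDevFour_nonneg : 0 ≤ bootDevFour S sol m h K τ d :=
  integral_nonneg fun c => by positivity

theorem integral_bootDev_sq_le :
    ∫ c, bootDev S sol m h K τ d c ^ 2 ∂resampleLaw d.1.2 ≤ √(bootDevFour S sol m h K τ d) :=
  integral_sq_le_sqrt (measurable_of_countable _).aestronglyMeasurable (integrable_resampleLaw _ _)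

theorem integrable_snd_replicate (f : (Fin S.N → ℕ) → ℝ) :
    Integrable (fun r : (Fin S.N → ℝ) × (Fin S.N → ℕ) => f r.2) (S.replicate d) := by
  rw [S.replicate_apply]
  exact measurePreserving_snd.integrable_comp_of_integrable (integrable_resampleLaw d.1.2 f)

theorem memLp_snd_replicate (f : (Fin S.N → ℕ) → ℝ) :
    MemLp (fun r : (Fin S.N → ℝ) × (Fin S.N → ℕ) => f r.2) 2 (S.replicate d) := by
  refine (memLp_two_iff_integrable_sq ?_).2 (integrable_snd_replicate fun c => f c ^ 2)
  exact ((measurable_of_countable f).comp measurable_snd).aestronglyMeasurable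

theorem integral_snd_replicate (f : (Fin S.N → ℕ) → ℝ) :
    ∫ r, f r.2 ∂S.replicate d = ∫ c, f c ∂resampleLaw d.1.2 := by
  rw [S.replicate_apply, integral_fun_snd]
  simp

theorem integral_fst_replicate (f : (Fin S.N → ℝ) → ℝ) :
    ∫ r, f r.1 ∂S.replicate d = ∫ v, f v ∂S.repW (d.1.1, d.2) := by
  rw [S.replicate_apply, integral_fun_fst]
  simp

theorem pow_four_add_le (a b : ℝ) : (a + b) ^ 4 ≤ 8 * (a ^ 4 + b ^ 4) := by
  nlinarith [sq_nonneg (a - b), sq_nonneg (a + b), sq_nonneg (a ^ 2 - b ^ 2),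
    mul_nonneg (sq_nonneg (a - b)) (sq_nonneg (a + b)), sq_nonneg ((a - b) ^ 2),
    mul_nonneg (sq_nonneg (a - b)) (add_nonneg (sq_nonneg a) (sq_nonneg b))]

include R hD hrep in
theorem replicate_main_pow_four :
    Integrable (fun r => S.repDiff d.1.1 d.2 (fun i => m (d.1.1 i).1 β₀) r.1 ^ 4) (S.replicate d) ∧
    ∫ r, S.repDiff d.1.1 d.2 (fun i => m (d.1.1 i).1 β₀) r.1 ^ 4 ∂S.replicate d ≤
      D * S.wmean d.1.1 d.2 fun i => K (d.1.1 i).1 ^ 4 := by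
  have hle : S.wmean d.1.1 d.2 (fun i => m (d.1.1 i).1 β₀ ^ 4) ≤
      S.wmean d.1.1 d.2 fun i => K (d.1.1 i).1 ^ 4 := by
    refine (le_abs_self _).trans (S.abs_wmean_le _ _ fun i => ?_)
    rw [abs_pow]
    exact pow_le_pow_left₀ (abs_nonneg _) (R.m_bdd _ _ R.mem) 4
  have h0 : 0 ≤ S.wmean d.1.1 d.2 fun i => K (d.1.1 i).1 ^ 4 :=
    S.wmean_nonneg _ _ fun i => by positivity
  rw [S.replicate_apply]
  have := integral_prod_pow_four_le (μ := S.repW (d.1.1, d.2)) (ρ := resampleLaw d.1.2)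
    (R := fun v _ => S.repDiff d.1.1 d.2 (fun i => m (d.1.1 i).1 β₀) v)
    (fun c => S.measurable_repDiff _ _ _)
    (g := fun _ => D * S.wmean d.1.1 d.2 fun i => K (d.1.1 i).1 ^ 4)
    (fun _ => mul_nonneg hD h0) (integrable_const _) fun c =>
      (hrep _).trans (ENNReal.ofReal_le_ofReal (mul_le_mul_of_nonneg_left hle hD))
  simpa using this

include R hsol hD hrep hk in
theorem replicate_rest_pow_four :
    Integrable (fun r => S.repDiff d.1.1 d.2 (fun i => m (d.1.1 i).1 (sol d.1.1 r.2) -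
      m (d.1.1 i).1 β₀) r.1 ^ 4) (S.replicate d) ∧
    ∫ r, S.repDiff d.1.1 d.2 (fun i => m (d.1.1 i).1 (sol d.1.1 r.2) -
      m (d.1.1 i).1 β₀) r.1 ^ 4 ∂S.replicate d ≤
      D * S.wmean d.1.1 d.2 (fun i => K (d.1.1 i).1 ^ 4) *
        (8 * (‖betaHat sol d.1 - β₀‖ ^ 4 + k ^ 4 * bootDevFour S sol m h K τ d)) := by
  have h0 : 0 ≤ S.wmean d.1.1 d.2 fun i => K (d.1.1 i).1 ^ 4 :=
    S.wmean_nonneg _ _ fun i => by positivity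
  rw [S.replicate_apply]
  have key := integral_prod_pow_four_le (μ := S.repW (d.1.1, d.2)) (ρ := resampleLaw d.1.2)
    (R := fun v c => S.repDiff d.1.1 d.2 (fun i => m (d.1.1 i).1 (sol d.1.1 c) -
      m (d.1.1 i).1 β₀) v) (fun c => S.measurable_repDiff _ _ _)
    (g := fun c => D * S.wmean d.1.1 d.2 (fun i => K (d.1.1 i).1 ^ 4) *
      (8 * (‖betaHat sol d.1 - β₀‖ ^ 4 + k ^ 4 * bootDev S sol m h K τ d c ^ 4)))
    (fun c => by positivity) (integrable_resampleLaw _ _) fun c => by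
      refine (hrep _).trans (ENNReal.ofReal_le_ofReal ?_)
      rw [mul_assoc]
      refine mul_le_mul_of_nonneg_left ?_ hD
      have h1 : S.wmean d.1.1 d.2 (fun i => (m (d.1.1 i).1 (sol d.1.1 c) - m (d.1.1 i).1 β₀) ^ 4) ≤
          S.wmean d.1.1 d.2 (fun i => K (d.1.1 i).1 ^ 4) * ‖sol d.1.1 c - β₀‖ ^ 4 := by
        rw [← S.wmean_mul_const]
        refine (le_abs_self _).trans (S.abs_wmean_le _ _ fun i => ?_)
        rw [abs_pow, ← mul_pow]
        exact pow_le_pow_left₀ (abs_nonneg _) (R.m_lip _ _ (hsol.mem _ _) _ R.mem) 4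
      refine h1.trans (mul_le_mul_of_nonneg_left ?_ h0)
      have h2 : ‖sol d.1.1 c - β₀‖ ≤ ‖betaHat sol d.1 - β₀‖ + k * bootDev S sol m h K τ d c := by
        have h3 := norm_add_le (betaHat sol d.1 - β₀) (sol d.1.1 c - betaHat sol d.1)
        rw [show betaHat sol d.1 - β₀ + (sol d.1.1 c - betaHat sol d.1) = sol d.1.1 c - β₀ by
          abel] at h3
        exact h3.trans (add_le_add_right (hk c) _)
      calc _ ≤ (‖betaHat sol d.1 - β₀‖ + k * bootDev S sol m h K τ d c) ^ 4 :=
            pow_le_pow_left₀ (norm_nonneg _) h2 4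
        _ ≤ _ := by
            rw [← mul_pow]
            exact pow_four_add_le _ _
  refine ⟨key.1, key.2.trans (le_of_eq ?_)⟩
  rw [integral_const_mul, integral_const_mul, integral_add (integrable_const _)
    (integrable_resampleLaw _ _), integral_const_mul]
  simp [bootDevFour]

include R hsol hk in
theorem abs_wmean_sub_le (c : Fin S.N → ℕ) :
    |S.wmean d.1.1 d.2 (fun i => m (d.1.1 i).1 (sol d.1.1 c) -
        m (d.1.1 i).1 (betaHat sol d.1))| ≤
      S.wmean d.1.1 d.2 (fun i => K (d.1.1 i).1) * k * bootDev S sol m h K τ d c := by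
  have h1 : |S.wmean d.1.1 d.2 (fun i => m (d.1.1 i).1 (sol d.1.1 c) -
      m (d.1.1 i).1 (betaHat sol d.1))| ≤
      S.wmean d.1.1 d.2 (fun i => K (d.1.1 i).1) * ‖sol d.1.1 c - betaHat sol d.1‖ := by
    rw [← S.wmean_mul_const]
    exact S.abs_wmean_le _ _ fun i => R.m_lip _ _ (hsol.mem _ _) _ (hsol.betaHat_mem _)
  refine h1.trans ?_
  rw [mul_assoc]
  exact mul_le_mul_of_nonneg_left (hk c) (S.wmean_nonneg _ _ fun i => R.K_nonneg _)

include R hsol hD hrep hk in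
/-- Given the data, fourth moment of the error of a bootstrap replicate. -/
theorem replicate_pow_four :
    Integrable (fun r => (S.thetaRep m sol d r - S.thetaI m sol d) ^ 4) (S.replicate d) ∧
    ∫ r, (S.thetaRep m sol d r - S.thetaI m sol d) ^ 4 ∂S.replicate d ≤
      64 * (D * S.wmean d.1.1 d.2 (fun i => K (d.1.1 i).1 ^ 4) +
        D * S.wmean d.1.1 d.2 (fun i => K (d.1.1 i).1 ^ 4) *
          (8 * (‖betaHat sol d.1 - β₀‖ ^ 4 + k ^ 4 * bootDevFour S sol m h K τ d)) +
        (S.wmean d.1.1 d.2 (fun i => K (d.1.1 i).1) * k) ^ 4 * bootDevFour S sol m h K τ d) := by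
  obtain ⟨i0, h0⟩ := replicate_main_pow_four R hD hrep
  obtain ⟨i1, h1⟩ := replicate_rest_pow_four R hsol hD hrep hk
  have iW : Integrable (fun r : (Fin S.N → ℝ) × (Fin S.N → ℕ) =>
      (S.wmean d.1.1 d.2 (fun i => K (d.1.1 i).1) * k) ^ 4 * bootDev S sol m h K τ d r.2 ^ 4)
      (S.replicate d) := integrable_snd_replicate fun c =>
    (S.wmean d.1.1 d.2 (fun i => K (d.1.1 i).1) * k) ^ 4 * bootDev S sol m h K τ d c ^ 4
  have hb : ∀ r, (S.thetaRep m sol d r - S.thetaI m sol d) ^ 4 ≤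
      64 * (S.repDiff d.1.1 d.2 (fun i => m (d.1.1 i).1 β₀) r.1 ^ 4 +
        S.repDiff d.1.1 d.2 (fun i => m (d.1.1 i).1 (sol d.1.1 r.2) - m (d.1.1 i).1 β₀) r.1 ^ 4 +
        (S.wmean d.1.1 d.2 (fun i => K (d.1.1 i).1) * k) ^ 4 *
          bootDev S sol m h K τ d r.2 ^ 4) := by
    intro r
    rw [S.thetaRep_sub m β₀]
    set x := S.repDiff d.1.1 d.2 (fun i => m (d.1.1 i).1 β₀) r.1
    set y := S.repDiff d.1.1 d.2 (fun i => m (d.1.1 i).1 (sol d.1.1 r.2) - m (d.1.1 i).1 β₀) r.1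
    have h3 := pow_le_pow_left₀ (abs_nonneg _) (abs_wmean_sub_le (τ := τ) R hsol hk r.2) 4
    rw [Even.pow_abs (by decide), mul_pow] at h3
    have h4 := pow_four_add_le (x + y) (S.wmean d.1.1 d.2 (fun i => m (d.1.1 i).1 (sol d.1.1 r.2) -
      m (d.1.1 i).1 (betaHat sol d.1)))
    have h5 := pow_four_add_le x y
    have h6 : 0 ≤ (S.wmean d.1.1 d.2 (fun i => K (d.1.1 i).1) * k) ^ 4 *
        bootDev S sol m h K τ d r.2 ^ 4 := by positivity
    linarith
  have iB := ((i0.fun_add i1).fun_add iW).const_mul 64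
  have iT : Integrable (fun r => (S.thetaRep m sol d r - S.thetaI m sol d) ^ 4)
      (S.replicate d) := by
    refine iB.mono' ?_ (.of_forall fun r => ?_)
    · refine Measurable.aestronglyMeasurable (Measurable.pow_const (Measurable.sub_const ?_ _) 4)
      refine measurable_from_prod_countable_left fun c => ?_
      simp only [Stage.thetaRep]
      refine (Finset.measurable_sum _ fun i _ => ?_).const_mul _
      exact (measurable_pi_apply i).mul_const _
    · rw [Real.norm_of_nonneg (by positivity)]
      exact hb r
  refine ⟨iT, (integral_mono iT iB hb).trans ?_⟩
  rw [integral_const_mul, integral_add (i0.fun_add i1) iW, integral_add i0 i1, integral_const_mul,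
    integral_snd_replicate fun c => bootDev S sol m h K τ d c ^ 4]
  refine mul_le_mul_of_nonneg_left ?_ (by norm_num)
  exact add_le_add (add_le_add h0 h1) le_rfl

end GivenData

end

section

variable {p q : ℕ} {m : Cov q → Param p → ℝ} {h : Cov q → Param p → Param p} {K : Cov q → ℝ}
  {Θ : Set (Param p)} {β₀ : Param p}

/-- Total deviation of the entries of the weighted mean of `ṁ_i` over `A` from those of `γ`. -/
noncomputable def gradDev (S : Stage q) (m : Cov q → Param p → ℝ) (β₀ : Param p)
    (γ : Param p →L[ℝ] ℝ) (ω : Pop q S.N × Finset (Fin S.N)) : ℝ :=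
  ∑ l, |S.wmean ω.1 ω.2 (fun i => fderiv ℝ (m (ω.1 i).1) β₀ (EuclideanSpace.single l 1)) -
    γ (EuclideanSpace.single l 1)|

theorem gradDev_nonneg (S : Stage q) (γ : Param p →L[ℝ] ℝ) (ω : Pop q S.N × Finset (Fin S.N)) :
    0 ≤ gradDev S m β₀ γ ω := Finset.sum_nonneg fun _ _ => abs_nonneg _

section GivenData

variable {S : Stage q} {sol : Pop q S.N → (Fin S.N → ℕ) → Param p}
  (R : Regular m h K Θ β₀) (hsol : IsSolver m h Θ sol) {τ : Tuning Θ β₀}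
  {d : (Pop q S.N × Finset (Fin S.N)) × Finset (Fin S.N)}

include R hsol in
/-- Linearization of the effect of a resample on the imputed weighted mean. -/
theorem abs_wmean_sub_functional_le {D M k k₂ : ℝ} (hd : ∀ β ∈ Θ, ∀ β' ∈ Θ, ‖β - β'‖ ≤ D)
    (g : GoodSample m h K τ d.1.1 d.1.2) {J : Param p →L[ℝ] Param p} {γ α : Param p →L[ℝ] ℝ}
    (hαJ : ∀ v, α (J v) = γ v) (hα : ‖α‖ ≤ M) (hJ : ‖J‖ ≤ M)
    (hk : 4 / τ.c + D / τ.η ≤ k)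
    (hk₂ : 4 * (τ.C + 1) * (1 + k) * k + 2 * k + (1 + M * k) / τ.η ≤ k₂) (c : Fin S.N → ℕ) :
    |S.wmean d.1.1 d.2 (fun i => m (d.1.1 i).1 (sol d.1.1 c) -
        m (d.1.1 i).1 (betaHat sol d.1)) - α (estFun m h d.1.1 c (betaHat sol d.1))| ≤
      (k * (S.wmean d.1.1 d.2 (fun i => K (d.1.1 i).1) * ‖betaHat sol d.1 - β₀‖ +
          gradDev S m β₀ γ (d.1.1, d.2)) +
        M * k₂ * (‖betaHat sol d.1 - β₀‖ + noiseSize m h τ d.1.1 d.1.2 +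
          ‖jacMap m h β₀ d.1.1 d.1.2 - J‖) +
        (k ^ 2 * S.wmean d.1.1 d.2 (fun i => K (d.1.1 i).1) + M * k₂) *
          bootDev S sol m h K τ d c) * bootDev S sol m h K τ d c := by
  have hc := τ.c_pos
  have hη := τ.η_pos
  have hC := τ.C_nonneg
  have hd0 : 0 ≤ D := (norm_nonneg _).trans (hd _ (hsol.mem d.1.1 c) _ (hsol.mem d.1.1 c))
  have hk0 : 0 ≤ k := le_trans (by positivity) hk
  have hM : 0 ≤ M := (norm_nonneg _).trans hα
  have hnoise := noiseSize_nonneg (m := m) (h := h) (τ := τ) d.1.1 d.1.2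
  have hlin := R.boot_linear hsol hd d.1.1 d.1.2 g J hk c
  have hdist : ‖sol d.1.1 c - betaHat sol d.1‖ ≤ k * bootDev S sol m h K τ d c :=
    (R.boot_dist_le hsol hd d.1.1 d.1.2 g c).trans
      (mul_le_mul_of_nonneg_right hk (bootSize_nonneg _ _ _ _))
  change ‖J (sol d.1.1 c - betaHat sol d.1) - estFun m h d.1.1 c (betaHat sol d.1)‖ ≤
    _ * (‖betaHat sol d.1 - β₀‖ + noiseSize m h τ d.1.1 d.1.2 + ‖jacMap m h β₀ d.1.1 d.1.2 - J‖ +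
      bootDev S sol m h K τ d c) * bootDev S sol m h K τ d c at hlin
  have hW0 : 0 ≤ bootDev S sol m h K τ d c := bootDev_nonneg c
  have hG0 := gradDev_nonneg (m := m) (β₀ := β₀) S γ (d.1.1, d.2)
  have hkA : 0 ≤ S.wmean d.1.1 d.2 (fun i => K (d.1.1 i).1) :=
    S.wmean_nonneg _ _ fun i => R.K_nonneg _
  have hexp := R.abs_weighted_sub_le d.1.1 d.2
    (u := fun i => (S.N : ℝ)⁻¹ * S.weight d.1.1 i)
    (fun i => mul_nonneg (by positivity) (S.weight_nonneg _ _)) γ (hsol.mem d.1.1 c)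
    (hsol.betaHat_mem d.1) (ρ := ‖betaHat sol d.1 - β₀‖ + k * bootDev S sol m h K τ d c)
    (by
      have h3 := norm_add_le (betaHat sol d.1 - β₀) (sol d.1.1 c - betaHat sol d.1)
      rw [show betaHat sol d.1 - β₀ + (sol d.1.1 c - betaHat sol d.1) = sol d.1.1 c - β₀ by
        abel] at h3
      linarith) (by linarith [mul_nonneg hk0 hW0])
  simp only [← S.wmean_eq] at hexp
  change |_| ≤ (_ + gradDev S m β₀ γ (d.1.1, d.2)) * _ at hexp
  have hα' : |γ (sol d.1.1 c - betaHat sol d.1) - α (estFun m h d.1.1 c (betaHat sol d.1))| ≤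
      M * ‖J (sol d.1.1 c - betaHat sol d.1) - estFun m h d.1.1 c (betaHat sol d.1)‖ := by
    rw [← hαJ, ← map_sub, ← Real.norm_eq_abs]
    exact α.le_of_opNorm_le hα _
  have hk2 : 4 * (τ.C + 1) * (1 + k) * k + 2 * k + (1 + ‖J‖ * k) / τ.η ≤ k₂ := by
    refine le_trans ?_ hk₂
    gcongr
  generalize S.wmean d.1.1 d.2 (fun i => m (d.1.1 i).1 (sol d.1.1 c) -
    m (d.1.1 i).1 (betaHat sol d.1)) = X at hexp ⊢
  generalize S.wmean d.1.1 d.2 (fun i => K (d.1.1 i).1) = a at hexp hkA ⊢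
  generalize gradDev S m β₀ γ (d.1.1, d.2) = G at hexp hG0 ⊢
  generalize bootDev S sol m h K τ d c = W at *
  generalize ‖J (sol d.1.1 c - betaHat sol d.1) - estFun m h d.1.1 c (betaHat sol d.1)‖ = Y at *
  generalize γ (sol d.1.1 c - betaHat sol d.1) = x at *
  generalize α (estFun m h d.1.1 c (betaHat sol d.1)) = y at *
  have hδ0 := norm_nonneg (betaHat sol d.1 - β₀)
  generalize ‖betaHat sol d.1 - β₀‖ = δ at *
  have hjn := norm_nonneg (jacMap m h β₀ d.1.1 d.1.2 - J)
  generalize ‖jacMap m h β₀ d.1.1 d.1.2 - J‖ = j at *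
  generalize noiseSize m h τ d.1.1 d.1.2 = n at *
  have t1 : |X - x| ≤ (a * (δ + k * W) + G) * (k * W) :=
    hexp.trans (mul_le_mul_of_nonneg_left hdist (by positivity))
  have t2 : |x - y| ≤ M * (k₂ * (δ + n + j + W) * W) := by
    refine hα'.trans (mul_le_mul_of_nonneg_left (hlin.trans ?_) hM)
    gcongr
  calc |X - y| ≤ |X - x| + |x - y| := abs_sub_le _ _ _
    _ ≤ (a * (δ + k * W) + G) * (k * W) + M * (k₂ * (δ + n + j + W) * W) := add_le_add t1 t2
    _ = _ := by ring

include R hsol in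
/-- Given the data, the second moment of the error of a bootstrap replicate is close to the sum of
the replication estimate of the design variance and of the variance of the linearized effect of
resampling: the replication weights and the resample are independent and the latter effect has
mean zero. -/
theorem abs_replicate_sq_sub_le {D : ℝ} (hD : 0 ≤ D)
    (hrep : ∀ z : Fin S.N → ℝ, ∫⁻ v, ENNReal.ofReal (S.repDiff d.1.1 d.2 z v ^ 4)
      ∂S.repW (d.1.1, d.2) ≤ ENNReal.ofReal (D * S.wmean d.1.1 d.2 fun i => z i ^ 4))
    {k : ℝ} (hk : ∀ c, ‖sol d.1.1 c - betaHat sol d.1‖ ≤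
      k * bootSize m h K τ d.1.1 d.1.2 (betaHat sol d.1) c)
    (hB : d.1.2.Nonempty) (hroot : estFun m h d.1.1 (ofSample d.1.2) (betaHat sol d.1) = 0)
    (α : Param p →L[ℝ] ℝ) {ε b : ℝ}
    (hQ : ∀ c, |S.wmean d.1.1 d.2 (fun i => m (d.1.1 i).1 (sol d.1.1 c) -
        m (d.1.1 i).1 (betaHat sol d.1)) - α (estFun m h d.1.1 c (betaHat sol d.1))| ≤
      (ε + b * bootDev S sol m h K τ d c) * bootDev S sol m h K τ d c)
    {V Y : ℝ} (hV : ∫ v, S.repDiff d.1.1 d.2 (fun i => m (d.1.1 i).1 β₀) v ^ 2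
        ∂S.repW (d.1.1, d.2) + (d.1.2.card : ℝ)⁻¹ *
          avg d.1.2 (fun i => α (psi m h (d.1.1 i) (betaHat sol d.1)) ^ 2) = V)
    (hY : 2 * √(D * S.wmean d.1.1 d.2 (fun i => K (d.1.1 i).1 ^ 4) *
        (8 * (‖betaHat sol d.1 - β₀‖ ^ 4 + k ^ 4 * bootDevFour S sol m h K τ d))) +
      4 * (ε ^ 2 * √(bootDevFour S sol m h K τ d) + b ^ 2 * bootDevFour S sol m h K τ d) ≤ Y) :
    |∫ r, (S.thetaRep m sol d r - S.thetaI m sol d) ^ 2 ∂S.replicate d - V| ≤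
      2 * (√V * √Y) + Y := by
  obtain ⟨i0, -⟩ := replicate_main_pow_four R hD hrep
  obtain ⟨i1, h1⟩ := replicate_rest_pow_four R hsol hD hrep hk
  set X₀ : (Fin S.N → ℝ) × (Fin S.N → ℕ) → ℝ := fun r =>
    S.repDiff d.1.1 d.2 (fun i => m (d.1.1 i).1 β₀) r.1 with hX₀
  set X₁ : (Fin S.N → ℝ) × (Fin S.N → ℕ) → ℝ := fun r =>
    S.repDiff d.1.1 d.2 (fun i => m (d.1.1 i).1 (sol d.1.1 r.2) - m (d.1.1 i).1 β₀) r.1 with hX₁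
  set P : (Fin S.N → ℕ) → ℝ := fun c => α (estFun m h d.1.1 c (betaHat sol d.1)) with hP
  set Q : (Fin S.N → ℕ) → ℝ := fun c => S.wmean d.1.1 d.2 (fun i => m (d.1.1 i).1 (sol d.1.1 c) -
    m (d.1.1 i).1 (betaHat sol d.1)) - P c with hQdef
  have mX₀ : AEStronglyMeasurable X₀ (S.replicate d) :=
    ((S.measurable_repDiff _ _ _).comp measurable_fst).aestronglyMeasurable
  have mX₁ : AEStronglyMeasurable X₁ (S.replicate d) :=
    (measurable_from_prod_countable_left fun c =>
      S.measurable_repDiff d.1.1 d.2 fun i => m (d.1.1 i).1 (sol d.1.1 c) - m (d.1.1 i).1 β₀ :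
        Measurable X₁).aestronglyMeasurable
  have l0 := memLp_two_of_pow_four mX₀ i0
  have l1 := memLp_two_of_pow_four mX₁ i1
  have lP : MemLp (fun r : (Fin S.N → ℝ) × (Fin S.N → ℕ) => P r.2) 2 (S.replicate d) :=
    memLp_snd_replicate P
  have lQ : MemLp (fun r : (Fin S.N → ℝ) × (Fin S.N → ℕ) => Q r.2) 2 (S.replicate d) :=
    memLp_snd_replicate Q
  obtain ⟨hP0, hP2⟩ := integral_functional_estFun d.1.1 α hB hroot
  -- the weights and the resample are independent, and `P` has mean zero as `β̂` is a zero
  have horth : ∫ r, X₀ r * P r.2 ∂S.replicate d = 0 := by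
    rw [S.replicate_apply]
    have := integral_prod_mul (μ := S.repW (d.1.1, d.2)) (ν := resampleLaw d.1.2)
      (fun v => S.repDiff d.1.1 d.2 (fun i => m (d.1.1 i).1 β₀) v) P
    rw [show ∫ c, P c ∂resampleLaw d.1.2 = 0 from hP0, mul_zero] at this
    exact this
  have hV' : ∫ r, X₀ r ^ 2 ∂S.replicate d + ∫ r, P r.2 ^ 2 ∂S.replicate d = V := by
    rw [← hV, ← hP2]
    congr 1
    · exact integral_fst_replicate fun v =>
        S.repDiff d.1.1 d.2 (fun i => m (d.1.1 i).1 β₀) v ^ 2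
    · exact integral_snd_replicate fun c => P c ^ 2
  have key := abs_integral_sq_sub_le (Z := fun r => X₁ r + Q r.2) l0 lP (l1.add lQ) horth
  rw [hV'] at key
  have hT : ∀ r, S.thetaRep m sol d r - S.thetaI m sol d =
      X₀ r + P r.2 + (X₁ r + Q r.2) := by
    intro r
    rw [S.thetaRep_sub m β₀]
    simp only [hX₀, hX₁, hQdef]
    ring
  simp_rw [hT]
  have hQ2 : ∫ r, Q r.2 ^ 2 ∂S.replicate d ≤
      2 * (ε ^ 2 * √(bootDevFour S sol m h K τ d) + b ^ 2 * bootDevFour S sol m h K τ d) := by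
    rw [integral_snd_replicate fun c => Q c ^ 2]
    calc ∫ c, Q c ^ 2 ∂resampleLaw d.1.2
        ≤ ∫ c, (2 * ε ^ 2 * bootDev S sol m h K τ d c ^ 2 +
            2 * b ^ 2 * bootDev S sol m h K τ d c ^ 4) ∂resampleLaw d.1.2 := by
          refine integral_mono (integrable_resampleLaw _ _) (integrable_resampleLaw _ _) fun c => ?_
          have h3 := pow_le_pow_left₀ (abs_nonneg _) (hQ c) 2
          rw [sq_abs] at h3
          refine h3.trans ?_
          nlinarith [sq_nonneg (ε * bootDev S sol m h K τ d c - b * bootDev S sol m h K τ d c ^ 2)]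
      _ = 2 * ε ^ 2 * ∫ c, bootDev S sol m h K τ d c ^ 2 ∂resampleLaw d.1.2 +
            2 * b ^ 2 * bootDevFour S sol m h K τ d := by
          rw [integral_add (integrable_resampleLaw _ _) (integrable_resampleLaw _ _),
            integral_const_mul, integral_const_mul, bootDevFour]
      _ ≤ 2 * ε ^ 2 * √(bootDevFour S sol m h K τ d) +
            2 * b ^ 2 * bootDevFour S sol m h K τ d :=
          add_le_add_left (mul_le_mul_of_nonneg_left integral_bootDev_sq_le (by positivity)) _
      _ = _ := by ring
  have hX2 : ∫ r, X₁ r ^ 2 ∂S.replicate d ≤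
      √(D * S.wmean d.1.1 d.2 (fun i => K (d.1.1 i).1 ^ 4) *
        (8 * (‖betaHat sol d.1 - β₀‖ ^ 4 + k ^ 4 * bootDevFour S sol m h K τ d))) :=
    (integral_sq_le_sqrt mX₁ i1).trans (Real.sqrt_le_sqrt h1)
  have hZ : ∫ r, (X₁ r + Q r.2) ^ 2 ∂S.replicate d ≤ Y := by
    have := integral_add_sq_le l1 lQ
    linarith
  refine key.trans ?_
  gcongr

end GivenData

end

section

/-! ### Limits in probability for the data -/

theorem IsBigOp.pow {X : Type*} {l : Filter X} {Z : X → ℝ} (hZ : IsBigOp l Z) (n : ℕ) :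
    IsBigOp l fun x => Z x ^ n := by
  induction n with
  | zero => simpa using IsBigOp.const 1
  | succ n ih => simpa only [pow_succ] using ih.mul hZ

/-- Negligibility in mean square implies convergence to zero in probability. -/
theorem Negligible.tendsto {Ω : ℕ → Type*} [∀ ν, MeasurableSpace (Ω ν)] {P : ∀ ν, Measure (Ω ν)}
    {n : ℕ → ℝ} {f : ∀ ν, Ω ν → ℝ} (hf : Negligible P n f) (hn : ∀ᶠ ν in atTop, 1 ≤ n ν)
    (hm : ∀ ν, Measurable (f ν)) :
    Tendsto (fun x : Σ ν, Ω ν => f x.1 x.2) (whp P) (𝓝 0) := by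
  have h1 : Tendsto (fun x : Σ ν, Ω ν => f x.1 x.2 ^ 2) (whp P) (𝓝 0) := by
    refine tendsto_whp_of_lintegral (fun x => sq_nonneg _)
      (fun ν => ((hm ν).pow_const 2).aemeasurable) ?_
    have h2 := ENNReal.tendsto_ofReal hf.2
    rw [ENNReal.ofReal_zero] at h2
    refine tendsto_of_tendsto_of_tendsto_of_le_of_le' tendsto_const_nhds h2
      (.of_forall fun _ => zero_le) ?_
    filter_upwards [hf.1, hn] with ν h3 h4
    rw [← ofReal_integral_eq_lintegral_ofReal h3.integrable_sq (.of_forall fun _ => sq_nonneg _)]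
    exact ENNReal.ofReal_le_ofReal
      (le_mul_of_one_le_left (integral_nonneg fun _ => sq_nonneg _) h4)
  have h2 := (Real.continuous_sqrt.tendsto 0).comp h1
  simp only [Real.sqrt_zero, Function.comp_def, Real.sqrt_sq_eq_abs] at h2
  exact (tendsto_zero_iff_abs_tendsto_zero _).2 h2

variable {p q : ℕ} {S : ℕ → Stage q} {nA nB : ℕ → ℝ} {m : Cov q → Param p → ℝ}
  {h : Cov q → Param p → Param p} {K : Cov q → ℝ} {Θ : Set (Param p)} {β₀ : Param p}
  {sol : ∀ ν, Pop q (S ν).N → (Fin (S ν).N → ℕ) → Param p}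

/-- The data at some stage: the population and the samples `B` and `A`. -/
abbrev Data (S : ℕ → Stage q) : Type :=
  Σ ν, (Pop q (S ν).N × Finset (Fin (S ν).N)) × Finset (Fin (S ν).N)

/-- The filter of the sets of data that have probability tending to one. -/
noncomputable abbrev dataFilter (S : ℕ → Stage q) : Filter (Data S) := whp fun ν => (S ν).lawBA

theorem tendsto_sampleB : Tendsto (fun x : Data S =>
    (⟨x.1, x.2.1⟩ : Σ ν, Pop q (S ν).N × Finset (Fin (S ν).N))) (dataFilter S)
    (whp fun ν => (S ν).lawB) :=
  tendsto_whp_map (P := fun ν => (S ν).lawB) (P' := fun ν => (S ν).lawBA)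
    (fun _ => Prod.fst) (fun _ => measurable_fst) fun ν => (S ν).map_fst_lawBA

theorem tendsto_sampleA : Tendsto (fun x : Data S =>
    (⟨x.1, (x.2.1.1, x.2.2)⟩ : Σ ν, Pop q (S ν).N × Finset (Fin (S ν).N))) (dataFilter S)
    (whp fun ν => (S ν).lawA) :=
  tendsto_whp_map (P := fun ν => (S ν).lawA) (P' := fun ν => (S ν).lawBA)
    (fun ν d => (d.1.1, d.2)) (fun _ => by fun_prop) fun ν => (S ν).map_lawBA

namespace Assumptions

variable (A : Assumptions S nA nB m h K Θ β₀ sol) (Λ : Linearization S nB m h K Θ β₀)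
include A

theorem tendsto_nA : Tendsto nA atTop atTop := by
  obtain ⟨C, hC0, hC⟩ := A.exists_ratio
  refine tendsto_atTop_mono' _ ?_ (A.nB_top.atTop_div_const hC0)
  filter_upwards [hC] with ν h1
  rw [div_le_iff₀ hC0, mul_comm]
  exact (div_le_iff₀ h1.1).1 h1.2

include Λ in
theorem tendsto_dist : Tendsto (fun x : Data S => ‖betaHat (sol x.1) x.2.1 - β₀‖)
    (dataFilter S) (𝓝 0) := by
  have h1 := (A.negligible_dist_sq Λ).tendsto A.nB_pos fun ν => (A.measurable_dist ν).pow_const 2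
  have h2 := (Real.continuous_sqrt.tendsto 0).comp (h1.comp tendsto_sampleB)
  simpa only [Real.sqrt_zero, Function.comp_def, Real.sqrt_sq (norm_nonneg _)] using h2

theorem tendsto_good_data : ∀ᶠ x in dataFilter S, IsGood m h K Λ.τ (nB x.1) x.2.1 :=
  tendsto_sampleB.eventually (A.eventually_good Λ)

theorem tendsto_noiseSize : Tendsto (fun x : Data S => noiseSize m h Λ.τ x.2.1.1 x.2.1.2)
    (dataFilter S) (𝓝 0) := by
  have h1 := (A.negligible_noise_sq Λ.τ).tendsto A.nB_pos fun ν =>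
    (A.reg.measurable_noiseOk Λ.τ _).pow_const 2
  have h2 := (Real.continuous_sqrt.tendsto 0).comp (h1.comp tendsto_sampleB)
  simp only [Real.sqrt_zero, Function.comp_def, Real.sqrt_sq (noiseOk_nonneg _ _ _)] at h2
  refine h2.congr' ?_
  filter_upwards [A.tendsto_good_data Λ] with x hx
  exact noiseOk_of_isGood hx

theorem tendsto_jacMap : Tendsto (fun x : Data S => ‖jacMap m h β₀ x.2.1.1 x.2.1.2 - Λ.J x.1‖)
    (dataFilter S) (𝓝 0) := by
  have h1 := A.tendsto_jacDev.comp tendsto_sampleB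
  have h2 : ∀ x : Data S, ‖jacMap m h β₀ x.2.1.1 x.2.1.2 - Λ.J x.1‖ ≤
      jacDev (S x.1) m h β₀ x.2.1 := fun x => norm_jacMap_sub_le (S x.1) (Λ.J_apply x.1) x.2.1
  exact squeeze_zero (fun x => norm_nonneg _) h2 h1

theorem tendsto_gradDev : Tendsto (fun x : Data S =>
    gradDev (S x.1) m β₀ (Λ.γ x.1) (x.2.1.1, x.2.2)) (dataFilter S) (𝓝 0) := by
  rw [← Finset.sum_const_zero (s := (Finset.univ : Finset (Fin p)))]
  refine tendsto_finsetSum _ fun l _ => ?_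
  rw [← abs_zero]
  refine Tendsto.abs ?_
  set f : Cov q × ℝ → ℝ := fun z => fderiv ℝ (m z.1) β₀ (EuclideanSpace.single l 1) with hf
  have hfm : Measurable f := (A.reg.dm_meas _).comp measurable_fst
  have hfK : ∀ z, |f z| ≤ 1 * K z.1 := fun z => by
    rw [one_mul]
    exact A.reg.abs_fderiv_single_le z.1 l
  have hz : ∀ ν, ∀ i : Fin (S ν).N, Measurable fun ω : Pop q (S ν).N × Finset (Fin (S ν).N) =>
      f (ω.1 i) := fun ν i => hfm.comp ((measurable_pi_apply i).comp measurable_fst)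
  have h1 : Tendsto (fun x : Data S => (S x.1).htError x.2.1.1 (fun i => f (x.2.1.1 i)) x.2.2)
      (dataFilter S) (𝓝 0) := by
    obtain ⟨C, hC0, hC⟩ := A.exists_htError_bound
    obtain ⟨D, hD0, hD⟩ := A.exists_moment
    obtain ⟨r, -, hr⟩ := A.exists_ratio
    refine Negligible.tendsto (P := fun ν => (S ν).lawBA) (n := fun _ => 1)
      (f := fun ν d => (S ν).htError d.1.1 (fun i => f (d.1.1 i)) d.2) ⟨.of_forall fun ν =>
        (hC ν (fun ω i => f (ω.1 i)) (hz ν) (A.integrable_mean_sq (hz ν)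
          fun ω i => hfK (ω.1 i))).1, ?_⟩ (.of_forall fun _ => le_rfl)
      (fun ν => Stage.measurable_htError measurable_fst (hz ν))
    have h2 : Tendsto (fun ν => C / nA ν * (1 + D)) atTop (𝓝 0) := by
      simpa using (A.tendsto_nA.const_div_atTop C).mul_const (1 + D)
    refine squeeze_zero' (.of_forall fun ν => by
      rw [one_mul]
      exact integral_nonneg fun _ => sq_nonneg _) ?_ h2
    filter_upwards [hr] with ν h3
    rw [one_mul]
    refine ((hC ν (fun ω i => f (ω.1 i)) (hz ν) (A.integrable_mean_sq (hz ν)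
      fun ω i => hfK (ω.1 i))).2 h3.1).trans ?_
    refine mul_le_mul_of_nonneg_left ?_ (div_nonneg hC0 h3.1.le)
    have hi := A.integrable_mean_pow_four ν
    have hi' : Integrable (fun ω : Pop q (S ν).N × Finset (Fin (S ν).N) =>
        ((S ν).N : ℝ)⁻¹ * ∑ i, K (ω.1 i).1 ^ 4) (S ν).lawB := (S ν).measurePreserving_fst_lawB.integrable_comp_of_integrable hi
    calc ∫ ω : Pop q (S ν).N × Finset (Fin (S ν).N), ((S ν).N : ℝ)⁻¹ * ∑ i, f (ω.1 i) ^ 2 ∂(S ν).lawB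
        ≤ ∫ ω : Pop q (S ν).N × Finset (Fin (S ν).N),
            (1 + ((S ν).N : ℝ)⁻¹ * ∑ i, K (ω.1 i).1 ^ 4) ∂(S ν).lawB := by
          refine integral_mono (A.integrable_mean_sq (hz ν) fun ω i => hfK (ω.1 i))
            ((integrable_const (1 : ℝ)).add hi') fun ω => ?_
          refine le_trans ?_ (popMean_sq_le_one_add fun i => K (ω.1 i).1)
          refine mul_le_mul_of_nonneg_left (Finset.sum_le_sum fun i _ => ?_) (by positivity)
          have := hfK (ω.1 i)
          rw [one_mul] at this
          exact sq_le_sq' (abs_le.1 this).1 (abs_le.1 this).2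
      _ = 1 + ∫ pop : Pop q (S ν).N, ((S ν).N : ℝ)⁻¹ * ∑ i, K (pop i).1 ^ 4 ∂(S ν).popLaw := by
          rw [integral_add (integrable_const _) hi', ← (S ν).integral_lawB_fst
            hi.aestronglyMeasurable]
          simp
      _ ≤ _ := by linarith [(hD ν).2.2.2]
  have h2 := (A.negligible_popMean hfm fun z => (hfK z).trans (by
    rw [one_mul]
    linarith [abs_nonneg z.2])).tendsto A.nB_pos fun ν =>
      ((Finset.measurable_sum _ fun i _ => hfm.comp (measurable_pi_apply i)).const_mul _).sub_const _
  have h3 : Tendsto (fun x : Data S => (⟨x.1, x.2.1.1⟩ : Σ ν, Pop q (S ν).N)) (dataFilter S)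
      (whp fun ν => (S ν).popLaw) :=
    (tendsto_whp_map (P := fun ν => (S ν).popLaw) (P' := fun ν => (S ν).lawB)
      (fun _ => Prod.fst) (fun _ => measurable_fst) fun ν => (S ν).map_fst_lawB).comp tendsto_sampleB
  have h4 := h1.add (h2.comp h3)
  rw [add_zero] at h4
  refine h4.congr fun x => ?_
  rw [Λ.γ_apply]
  simp only [Function.comp_def, Stage.htError, Stage.wmean, hf]
  ring

/-- Weighted means of dominated functions of the auxiliary variables are bounded in probability. -/
theorem isBigOp_wmean {f : Cov q → ℝ} (hf : Measurable f) (hf0 : ∀ x, 0 ≤ f x)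
    (hfK : ∀ x, f x ≤ 1 + K x ^ 4) : IsBigOp (dataFilter S) fun x =>
      (S x.1).wmean x.2.1.1 x.2.2 fun i => f (x.2.1.1 i).1 := by
  obtain ⟨D, hD0, hD⟩ := A.exists_moment
  have hz : ∀ ν, ∀ i : Fin (S ν).N, Measurable fun pop : Pop q (S ν).N => f (pop i).1 :=
    fun ν i => hf.comp (measurable_fst.comp (measurable_pi_apply i))
  refine isBigOp_of_lintegral (C := 1 + D) (fun x => (S x.1).wmean_nonneg _ _ fun i => hf0 _)
    (fun ν => Measurable.aemeasurable ?_) (.of_forall fun ν => ?_)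
  · simp only [Stage.wmean]
    refine measurable_from_prod_countable_left fun s => ?_
    refine (Finset.measurable_sum _ fun i _ => ?_).const_mul _
    exact (((S ν).measurable_weight i).comp measurable_fst).mul ((hz ν i).comp measurable_fst)
  · have h1 := Stage.lintegral_weighted_mean (S := S ν) (A.incl_pos ν) (hz ν) fun pop i => hf0 _
    simp only [Stage.wmean]
    rw [h1]
    have hi := A.integrable_mean_pow_four ν
    calc ∫⁻ pop : Pop q (S ν).N, ENNReal.ofReal (((S ν).N : ℝ)⁻¹ * ∑ i, f (pop i).1) ∂(S ν).popLaw
        ≤ ∫⁻ pop : Pop q (S ν).N, ENNReal.ofReal (1 + ((S ν).N : ℝ)⁻¹ * ∑ i, K (pop i).1 ^ 4)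
            ∂(S ν).popLaw := by
          refine lintegral_mono fun pop => ENNReal.ofReal_le_ofReal ?_
          calc ((S ν).N : ℝ)⁻¹ * ∑ i, f (pop i).1
              ≤ ((S ν).N : ℝ)⁻¹ * ∑ i, (1 + K (pop i).1 ^ 4) :=
                mul_le_mul_of_nonneg_left (Finset.sum_le_sum fun i _ => hfK _) (by positivity)
            _ ≤ _ := by
                rw [Finset.sum_add_distrib, mul_add]
                simp only [Finset.sum_const, Finset.card_univ, Fintype.card_fin, nsmul_eq_mul,
                  mul_one]
                gcongr
                exact inv_mul_le_one
      _ = ENNReal.ofReal (∫ pop : Pop q (S ν).N, (1 + ((S ν).N : ℝ)⁻¹ * ∑ i, K (pop i).1 ^ 4)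
            ∂(S ν).popLaw) :=
          (ofReal_integral_eq_lintegral_ofReal ((integrable_const (1 : ℝ)).add hi)
            (.of_forall fun pop => add_nonneg zero_le_one (by positivity))).symm
      _ ≤ _ := by
          refine ENNReal.ofReal_le_ofReal ?_
          rw [integral_add (integrable_const _) hi]
          simpa using (hD ν).2.2.2

theorem isBigOp_env : IsBigOp (dataFilter S) fun x =>
    avg x.2.1.2 fun i => env K (x.2.1.1 i) ^ 4 := by
  obtain ⟨C, hC⟩ := A.mom_B
  have hm : ∀ ν, Measurable fun ω : Pop q (S ν).N × Finset (Fin (S ν).N) =>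
      avg ω.2 fun i => env K (ω.1 i) ^ 4 := fun ν => measurable_avg (A.reg.measurable_env.pow_const 4)
  refine isBigOp_of_lintegral (C := C) (fun x => mul_nonneg (by positivity)
    (Finset.sum_nonneg fun _ _ => by positivity)) (fun ν => ((hm ν).comp measurable_fst).aemeasurable)
    (.of_forall fun ν => ?_)
  refine le_trans (le_of_eq ?_) (hC ν)
  rw [← (S ν).map_fst_lawBA, lintegral_map (hm ν).ennreal_ofReal measurable_fst]

/-- The fourth moment of the deviation of a resample is `O_p(n_B^{-2})`. -/
theorem isBigOp_bootDevFour : IsBigOp (dataFilter S) fun x =>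
    nB x.1 ^ 2 * bootDevFour (S x.1) (sol x.1) m h K Λ.τ x.2 := by
  refine ((IsBigOp.const (4 * (4096 * (Fintype.card (BootIdx Λ.τ) : ℝ) ^ 4))).mul
    A.isBigOp_env).mono ?_
  filter_upwards [A.tendsto_good_data Λ, eventually_whp_of_fst A.nB_pos] with x hx hn
  have hc : (0 : ℝ) < x.2.1.2.card := by linarith [hx.2]
  have hE : 0 ≤ avg x.2.1.2 fun i => env K (x.2.1.1 i) ^ 4 :=
    mul_nonneg (by positivity) (Finset.sum_nonneg fun _ _ => by positivity)
  have h1 := A.reg.integral_bootSize_pow_four_le x.2.1.1 Λ.τ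
    (Finset.card_pos.1 (by exact_mod_cast hc)) ((A.solver x.1).betaHat_mem x.2.1)
  have h0 : 0 ≤ bootDevFour (S x.1) (sol x.1) m h K Λ.τ x.2 := bootDevFour_nonneg
  rw [abs_of_nonneg (by positivity), abs_of_nonneg (by positivity)]
  have h2 : nB x.1 ^ 2 * (x.2.1.2.card : ℝ)⁻¹ ^ 2 ≤ 4 := by
    rw [← mul_pow, ← div_eq_mul_inv]
    have h3 : nB x.1 / x.2.1.2.card ≤ 2 := by
      rw [div_le_iff₀ hc]
      linarith [hx.2]
    calc (nB x.1 / x.2.1.2.card) ^ 2 ≤ 2 ^ 2 := pow_le_pow_left₀ (by positivity) h3 2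
      _ = 4 := by norm_num
  calc nB x.1 ^ 2 * bootDevFour (S x.1) (sol x.1) m h K Λ.τ x.2
      ≤ nB x.1 ^ 2 * (4096 * (Fintype.card (BootIdx Λ.τ) : ℝ) ^ 4 *
          ((x.2.1.2.card : ℝ)⁻¹ ^ 2 * avg x.2.1.2 fun i => env K (x.2.1.1 i) ^ 4)) :=
        mul_le_mul_of_nonneg_left h1 (by positivity)
    _ = nB x.1 ^ 2 * (x.2.1.2.card : ℝ)⁻¹ ^ 2 * (4096 * (Fintype.card (BootIdx Λ.τ) : ℝ) ^ 4 *
          avg x.2.1.2 fun i => env K (x.2.1.1 i) ^ 4) := by ring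
    _ ≤ 4 * (4096 * (Fintype.card (BootIdx Λ.τ) : ℝ) ^ 4 *
          avg x.2.1.2 fun i => env K (x.2.1.1 i) ^ 4) :=
        mul_le_mul_of_nonneg_right h2 (by positivity)
    _ = _ := by ring

end Assumptions

end

section

/-! ### Conditional moments of the bootstrap replicates -/

variable {p q : ℕ} {S : ℕ → Stage q} {nA nB : ℕ → ℝ} {m : Cov q → Param p → ℝ}
  {h : Cov q → Param p → Param p} {K : Cov q → ℝ} {Θ : Set (Param p)} {β₀ : Param p}
  {sol : ∀ ν, Pop q (S ν).N → (Fin (S ν).N → ℕ) → Param p}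

namespace Assumptions

variable (A : Assumptions S nA nB m h K Θ β₀ sol) (Λ : Linearization S nB m h K Θ β₀)
include A

theorem exists_repDiff_bound : ∃ (C : ℝ) (D : ℕ → ℝ), 0 ≤ C ∧ (∀ ν, 0 ≤ D ν) ∧
    (∀ᶠ ν in atTop, nB ν ^ 2 * D ν ≤ C) ∧
    ∀ᶠ x in dataFilter S, ∀ z : Fin (S x.1).N → ℝ,
      ∫⁻ v, ENNReal.ofReal ((S x.1).repDiff x.2.1.1 x.2.2 z v ^ 4)
        ∂(S x.1).repW (x.2.1.1, x.2.2) ≤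
        ENNReal.ofReal (D x.1 * (S x.1).wmean x.2.1.1 x.2.2 fun i => z i ^ 4) := by
  obtain ⟨C, hC⟩ := A.rep_four
  obtain ⟨r, hr0, hr⟩ := A.exists_ratio
  refine ⟨max C 0 * r ^ 2, fun ν => max C 0 / nA ν ^ 2, by positivity, fun ν => by positivity, ?_, ?_⟩
  · filter_upwards [hr, A.nB_nonneg] with ν h1 h2
    have h3 : 0 ≤ nB ν / nA ν := div_nonneg h2 h1.1.le
    calc nB ν ^ 2 * (max C 0 / nA ν ^ 2) = max C 0 * (nB ν / nA ν) ^ 2 := by ring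
      _ ≤ max C 0 * r ^ 2 :=
        mul_le_mul_of_nonneg_left (pow_le_pow_left₀ h3 h1.2 2) (le_max_right _ _)
  · have h1 : ∀ᶠ x : Σ ν, Pop q (S ν).N × Finset (Fin (S ν).N) in whp fun ν => (S ν).lawA,
        ∀ z : Fin (S x.1).N → ℝ, ∫⁻ v, ENNReal.ofReal ((S x.1).repDiff x.2.1 x.2.2 z v ^ 4)
          ∂(S x.1).repW x.2 ≤ ENNReal.ofReal (C / nA x.1 ^ 2 *
            (((S x.1).N : ℝ)⁻¹ * ∑ i ∈ x.2.2, (S x.1).weight x.2.1 i * z i ^ 4)) :=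
      eventually_whp_real.2 hC
    filter_upwards [tendsto_sampleA.eventually h1] with x hx z
    refine (hx z).trans (ENNReal.ofReal_le_ofReal ?_)
    refine mul_le_mul_of_nonneg_right ?_ ((S x.1).wmean_nonneg _ _ fun i => by positivity)
    gcongr
    exact le_max_left _ _

theorem norm_sol_sub_le {d : ℝ} (hd : ∀ β ∈ Θ, ∀ β' ∈ Θ, ‖β - β'‖ ≤ d) {ν : ℕ}
    {ω : Pop q (S ν).N × Finset (Fin (S ν).N)} (hω : IsGood m h K Λ.τ (nB ν) ω)
    (c : Fin (S ν).N → ℕ) : ‖sol ν ω.1 c - betaHat (sol ν) ω‖ ≤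
      (4 / Λ.τ.c + d / Λ.τ.η) * bootSize m h K Λ.τ ω.1 ω.2 (betaHat (sol ν) ω) c :=
  A.reg.boot_dist_le (A.solver ν) hd ω.1 ω.2 hω.1 c

theorem isBigOp_wmean_env : IsBigOp (dataFilter S) fun x =>
    (S x.1).wmean x.2.1.1 x.2.2 fun i => K (x.2.1.1 i).1 :=
  A.isBigOp_wmean (f := K) A.reg.meas_K A.reg.K_nonneg fun _ => le_one_add_pow_four _

theorem isBigOp_wmean_env_pow_four : IsBigOp (dataFilter S) fun x =>
    (S x.1).wmean x.2.1.1 x.2.2 fun i => K (x.2.1.1 i).1 ^ 4 :=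
  A.isBigOp_wmean (f := fun x => K x ^ 4) (A.reg.meas_K.pow_const 4)
    (fun x => by positivity) fun x => by linarith

include Λ in
/-- Given the data, the fourth moment of the error of a bootstrap replicate is `O_p(n_B^{-2})`. -/
theorem isBigOp_replicate_pow_four :
    (∀ᶠ x in dataFilter S, Integrable (fun r => ((S x.1).thetaRep m (sol x.1) x.2 r -
      (S x.1).thetaI m (sol x.1) x.2) ^ 4) ((S x.1).replicate x.2)) ∧
    IsBigOp (dataFilter S) fun x => nB x.1 ^ 2 *
      ∫ r, ((S x.1).thetaRep m (sol x.1) x.2 r - (S x.1).thetaI m (sol x.1) x.2) ^ 4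
        ∂(S x.1).replicate x.2 := by
  obtain ⟨C, D, hC0, hD0, hD, hrep⟩ := A.exists_repDiff_bound
  obtain ⟨d, hd0, hd⟩ := A.exists_diam
  obtain ⟨k, hk⟩ : ∃ k : ℝ, k = 4 / Λ.τ.c + d / Λ.τ.η := ⟨_, rfl⟩
  have hb : ∀ᶠ x in dataFilter S,
      Integrable (fun r => ((S x.1).thetaRep m (sol x.1) x.2 r -
        (S x.1).thetaI m (sol x.1) x.2) ^ 4) ((S x.1).replicate x.2) ∧
      ∫ r, ((S x.1).thetaRep m (sol x.1) x.2 r - (S x.1).thetaI m (sol x.1) x.2) ^ 4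
        ∂(S x.1).replicate x.2 ≤
      64 * (D x.1 * (S x.1).wmean x.2.1.1 x.2.2 (fun i => K (x.2.1.1 i).1 ^ 4) +
        D x.1 * (S x.1).wmean x.2.1.1 x.2.2 (fun i => K (x.2.1.1 i).1 ^ 4) *
          (8 * (‖betaHat (sol x.1) x.2.1 - β₀‖ ^ 4 +
            k ^ 4 * bootDevFour (S x.1) (sol x.1) m h K Λ.τ x.2)) +
        ((S x.1).wmean x.2.1.1 x.2.2 (fun i => K (x.2.1.1 i).1) * k) ^ 4 *
          bootDevFour (S x.1) (sol x.1) m h K Λ.τ x.2) := by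
    filter_upwards [A.tendsto_good_data Λ, hrep] with x hx h1
    exact replicate_pow_four A.reg (A.solver x.1) (hD0 x.1) h1 fun c => by
      rw [hk]
      exact A.norm_sol_sub_le Λ hd hx c
  refine ⟨hb.mono fun x hx => hx.1, ?_⟩
  have hW := A.isBigOp_bootDevFour Λ
  have hK := A.isBigOp_wmean_env
  have hK4 := A.isBigOp_wmean_env_pow_four
  have hδ := IsBigOp.of_tendsto (A.tendsto_dist Λ)
  have key := (IsBigOp.const 64).mul ((((IsBigOp.const C).mul hK4).add
    (((IsBigOp.const C).mul hK4).mul ((IsBigOp.const 8).mul ((hδ.pow 4).add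
      ((IsBigOp.const (k ^ 4)).mul hW))))).add (((hK.mul (IsBigOp.const k)).pow 4).mul hW))
  refine key.mono ?_
  filter_upwards [hb, eventually_whp_of_fst hD, eventually_whp_of_fst A.nB_pos] with x hx hDx hn
  have hT : 0 ≤ ∫ r, ((S x.1).thetaRep m (sol x.1) x.2 r - (S x.1).thetaI m (sol x.1) x.2) ^ 4
      ∂(S x.1).replicate x.2 := integral_nonneg fun _ => by positivity
  have hk4 : 0 ≤ (S x.1).wmean x.2.1.1 x.2.2 fun i => K (x.2.1.1 i).1 ^ 4 :=
    (S x.1).wmean_nonneg _ _ fun i => by positivity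
  have hw : 0 ≤ bootDevFour (S x.1) (sol x.1) m h K Λ.τ x.2 := bootDevFour_nonneg
  have hx2 := hx.2
  rw [abs_of_nonneg (by positivity)]
  refine le_trans ?_ (le_abs_self _)
  generalize (S x.1).wmean x.2.1.1 x.2.2 (fun i => K (x.2.1.1 i).1 ^ 4) = a at *
  generalize bootDevFour (S x.1) (sol x.1) m h K Λ.τ x.2 = w at *
  generalize (S x.1).wmean x.2.1.1 x.2.2 (fun i => K (x.2.1.1 i).1) = b at *
  generalize ‖betaHat (sol x.1) x.2.1 - β₀‖ = δ at *
  have hw' : w ≤ nB x.1 ^ 2 * w := le_mul_of_one_le_left hw (one_le_pow₀ hn)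
  calc nB x.1 ^ 2 * _
      ≤ nB x.1 ^ 2 * (64 * (D x.1 * a + D x.1 * a * (8 * (δ ^ 4 + k ^ 4 * w)) +
          (b * k) ^ 4 * w)) := mul_le_mul_of_nonneg_left hx2 (by positivity)
    _ = 64 * (nB x.1 ^ 2 * D x.1 * a + nB x.1 ^ 2 * D x.1 * a * (8 * (δ ^ 4 + k ^ 4 * w)) +
          (b * k) ^ 4 * (nB x.1 ^ 2 * w)) := by ring
    _ ≤ 64 * (C * a + C * a * (8 * (δ ^ 4 + k ^ 4 * (nB x.1 ^ 2 * w))) +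
          (b * k) ^ 4 * (nB x.1 ^ 2 * w)) := by gcongr

/-- The average over `B` that governs the effect of resampling converges to the variance of the
influence of `B`. -/
theorem tendsto_avg_functional_sq :
    Tendsto (fun x : Data S => nB x.1 * ((x.2.1.2.card : ℝ)⁻¹ * avg x.2.1.2 fun i =>
        Λ.α x.1 (psi m h (x.2.1.1 i) (betaHat (sol x.1) x.2.1)) ^ 2) -
      ∫ ω, influenceVar m h β₀ (Λ.α x.1) ω ∂(S x.1).lawB) (dataFilter S) (𝓝 0) := by
  obtain ⟨C, hC0, hC⟩ := A.exists_influenceVar_bound Λ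
  have h1 : Tendsto (fun x : Data S => avg x.2.1.2 (fun i =>
      Λ.α x.1 (psi m h (x.2.1.1 i) (betaHat (sol x.1) x.2.1)) ^ 2) -
      influenceVar m h β₀ (Λ.α x.1) x.2.1) (dataFilter S) (𝓝 0) := by
    have h2 := ((IsBigOp.const (1 : ℝ)).add A.isBigOp_env) _
      ((A.tendsto_dist Λ).const_mul (4 * Λ.M ^ 2) |>.trans (by rw [mul_zero]))
    refine squeeze_zero_norm' ?_ h2
    filter_upwards [eventually_whp_of_fst Λ.α_le] with x hx
    exact A.reg.abs_avg_functional_sq_sub_le x.2.1.1 hx ((A.solver x.1).betaHat_mem x.2.1)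
  have h2 := h1.add ((A.tendsto_influenceVar Λ).comp tendsto_sampleB)
  simp only [Function.comp_def, sub_add_sub_cancel, add_zero] at h2
  have h3 : IsBigOp (dataFilter S) fun x : Data S =>
      ∫ ω, influenceVar m h β₀ (Λ.α x.1) ω ∂(S x.1).lawB :=
    IsBigOp.of_bdd (C := 1 + C) ((eventually_whp_of_fst hC).mono fun x hx => hx.2.2)
  have h4 : Tendsto (fun x : Data S => nB x.1 * (x.2.1.2.card : ℝ)⁻¹) (dataFilter S) (𝓝 1) := by
    have := ((A.tendsto_card.comp tendsto_sampleB).inv₀ one_ne_zero)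
    rw [inv_one] at this
    refine this.congr fun x => ?_
    simp only [Function.comp_def]
    rw [inv_div, div_eq_mul_inv]
  have h5 : Tendsto (fun x : Data S => nB x.1 * (x.2.1.2.card : ℝ)⁻¹ - 1) (dataFilter S) (𝓝 0) := by
    simpa using h4.sub_const 1
  have h6 := (h4.mul h2).add (h3 _ h5)
  rw [mul_zero, add_zero] at h6
  refine h6.congr fun x => ?_
  ring

include Λ in
/-- Given the data, the second moment of the error of a bootstrap replicate is close to the
variance of the imputation estimator. -/
theorem tendsto_replicate_sq :
    Tendsto (fun x : Data S => nB x.1 * ∫ r, ((S x.1).thetaRep m (sol x.1) x.2 r -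
      (S x.1).thetaI m (sol x.1) x.2) ^ 2 ∂(S x.1).replicate x.2 -
      nB x.1 * Var[fun d => (S x.1).thetaI m (sol x.1) d - (S x.1).thetaN d.1.1; (S x.1).lawBA])
      (dataFilter S) (𝓝 0) := by
  obtain ⟨C, D, hC0, hD0, hD, hrep⟩ := A.exists_repDiff_bound
  obtain ⟨d, hd0, hd⟩ := A.exists_diam
  obtain ⟨r, hr0, hr⟩ := A.exists_ratio
  obtain ⟨CV, hCV⟩ := A.exists_designVar_bound
  obtain ⟨CI, hCI0, hCI⟩ := A.exists_influenceVar_bound Λ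
  obtain ⟨k, hk⟩ : ∃ k : ℝ, k = 4 / Λ.τ.c + d / Λ.τ.η := ⟨_, rfl⟩
  obtain ⟨k₂, hk₂⟩ : ∃ k₂ : ℝ, k₂ = 4 * (Λ.τ.C + 1) * (1 + k) * k + 2 * k +
    (1 + Λ.M * k) / Λ.τ.η := ⟨_, rfl⟩
  set V : Data S → ℝ := fun x => ∫ v, (S x.1).repDiff x.2.1.1 x.2.2
    (fun i => m (x.2.1.1 i).1 β₀) v ^ 2 ∂(S x.1).repW (x.2.1.1, x.2.2) +
      (x.2.1.2.card : ℝ)⁻¹ * avg x.2.1.2 (fun i =>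
        Λ.α x.1 (psi m h (x.2.1.1 i) (betaHat (sol x.1) x.2.1)) ^ 2) with hV
  set w : Data S → ℝ := fun x => bootDevFour (S x.1) (sol x.1) m h K Λ.τ x.2 with hw
  set a : Data S → ℝ := fun x => (S x.1).wmean x.2.1.1 x.2.2 (fun i => K (x.2.1.1 i).1) with ha
  set a₄ : Data S → ℝ := fun x =>
    (S x.1).wmean x.2.1.1 x.2.2 (fun i => K (x.2.1.1 i).1 ^ 4) with ha₄
  set δ : Data S → ℝ := fun x => ‖betaHat (sol x.1) x.2.1 - β₀‖ with hδ
  set ε : Data S → ℝ := fun x => k * (a x * δ x + gradDev (S x.1) m β₀ (Λ.γ x.1) (x.2.1.1, x.2.2)) +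
    Λ.M * k₂ * (δ x + noiseSize m h Λ.τ x.2.1.1 x.2.1.2 +
      ‖jacMap m h β₀ x.2.1.1 x.2.1.2 - Λ.J x.1‖) with hε
  set b : Data S → ℝ := fun x => k ^ 2 * a x + Λ.M * k₂ with hb
  set Y : Data S → ℝ := fun x => 2 * √(D x.1 * a₄ x * (8 * (δ x ^ 4 + k ^ 4 * w x))) +
    4 * (ε x ^ 2 * √(w x) + b x ^ 2 * w x) with hY
  have hδ0 : Tendsto δ (dataFilter S) (𝓝 0) := A.tendsto_dist Λ
  have haO : IsBigOp (dataFilter S) a := A.isBigOp_wmean_env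
  have ha₄O : IsBigOp (dataFilter S) a₄ := A.isBigOp_wmean_env_pow_four
  have hwO : IsBigOp (dataFilter S) fun x => nB x.1 ^ 2 * w x := A.isBigOp_bootDevFour Λ
  have hninv : Tendsto (fun x : Data S => (nB x.1)⁻¹) (dataFilter S) (𝓝 0) :=
    (tendsto_inv_atTop_zero.comp A.nB_top).comp tendsto_fst_whp
  have hn : ∀ᶠ x in dataFilter S, 1 ≤ nB x.1 := eventually_whp_of_fst A.nB_pos
  -- `w` is of order `n_B⁻²`, so it vanishes even after multiplication by `n_B`
  have hnw : Tendsto (fun x => nB x.1 * w x) (dataFilter S) (𝓝 0) := by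
    refine (hwO _ hninv).congr' ?_
    filter_upwards [hn] with x hx
    have : nB x.1 ≠ 0 := by linarith
    field_simp
  have hw0 : Tendsto w (dataFilter S) (𝓝 0) := by
    have h1 := hninv.mul hnw
    rw [mul_zero] at h1
    refine h1.congr' ?_
    filter_upwards [hn] with x hx
    have : nB x.1 ≠ 0 := by linarith
    field_simp
  have hε0 : Tendsto ε (dataFilter S) (𝓝 0) := by
    have h1 := haO _ hδ0
    have h2 := ((h1.add (A.tendsto_gradDev Λ)).const_mul k).add
      (((hδ0.add (A.tendsto_noiseSize Λ)).add (A.tendsto_jacMap Λ)).const_mul (Λ.M * k₂))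
    simp only [add_zero, mul_zero] at h2
    refine h2.congr fun x => ?_
    simp only [hε]
    ring
  have hbO : IsBigOp (dataFilter S) b :=
    ((IsBigOp.const (k ^ 2)).mul haO).add (IsBigOp.const _)
  -- in each part of `Y` a factor of order `n_B⁻¹` comes with one that tends to zero
  have hY0 : Tendsto (fun x => nB x.1 * Y x) (dataFilter S) (𝓝 0) := by
    have h1 : Tendsto (fun x => (nB x.1 ^ 2 * D x.1) * a₄ x * (8 * (δ x ^ 4 + k ^ 4 * w x)))
        (dataFilter S) (𝓝 0) := by
      have h2 : Tendsto (fun x => 8 * (δ x ^ 4 + k ^ 4 * w x)) (dataFilter S) (𝓝 0) := by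
        have := ((hδ0.pow 4).add (hw0.const_mul (k ^ 4))).const_mul 8
        simpa using this
      have h3 : IsBigOp (dataFilter S) fun x : Data S => nB x.1 ^ 2 * D x.1 := by
        refine IsBigOp.of_bdd (C := C) ((eventually_whp_of_fst hD).mono fun x hx => ?_)
        rw [abs_of_nonneg (mul_nonneg (sq_nonneg _) (hD0 _))]
        exact hx
      refine ((h3.mul ha₄O) _ h2).congr fun x => ?_
      ring
    have h2 := (((Real.continuous_sqrt.tendsto 0).comp h1).const_mul 2).add
      (((hwO.sqrt _ (hε0.pow 2 |>.trans (by simp))).add ((hbO.pow 2) _ hnw)).const_mul 4)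
    simp only [Real.sqrt_zero, mul_zero, add_zero] at h2
    refine h2.congr' ?_
    filter_upwards [hn] with x hx
    have hx0 : 0 ≤ nB x.1 := by linarith
    have e1 : ∀ y, √(nB x.1 ^ 2 * y) = nB x.1 * √y := fun y => by
      rw [Real.sqrt_mul (sq_nonneg _), Real.sqrt_sq hx0]
    simp only [Function.comp_def, hY]
    rw [mul_assoc (nB x.1 ^ 2), mul_assoc (nB x.1 ^ 2), e1, e1]
    ring
  have hbound : ∀ᶠ x in dataFilter S,
      |∫ r, ((S x.1).thetaRep m (sol x.1) x.2 r - (S x.1).thetaI m (sol x.1) x.2) ^ 2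
        ∂(S x.1).replicate x.2 - V x| ≤ 2 * (√(V x) * √(Y x)) + Y x := by
    filter_upwards [A.tendsto_good_data Λ, hrep, hn, eventually_whp_of_fst Λ.α_comp,
      eventually_whp_of_fst Λ.α_le, eventually_whp_of_fst Λ.J_le] with x hx h1 h2 h3 h4 h5
    have hc : (0 : ℝ) < x.2.1.2.card := by linarith [hx.2]
    exact abs_replicate_sq_sub_le A.reg (A.solver x.1) (τ := Λ.τ) (hD0 x.1) h1 (k := k)
      (fun c => by
        rw [hk]
        exact A.norm_sol_sub_le Λ hd hx c)
      (Finset.card_pos.1 (by exact_mod_cast hc))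
      (A.reg.sample_root (A.solver x.1) x.2.1.1 x.2.1.2 hx.1).1 (Λ.α x.1) (ε := ε x) (b := b x)
      (abs_wmean_sub_functional_le A.reg (A.solver x.1) hd hx.1 h3 h4 h5 hk.ge hk₂.ge) rfl le_rfl
  -- the limit of `n_B V` is bounded
  have hVlim : Tendsto (fun x => nB x.1 * V x -
      (nB x.1 * Var[fun d => (S x.1).htError d.1 (fun i => m (d.1 i).1 β₀) d.2; (S x.1).lawA] +
        ∫ ω, influenceVar m h β₀ (Λ.α x.1) ω ∂(S x.1).lawB)) (dataFilter S) (𝓝 0) := by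
    have h1 := (isLittleOp_iff.1 A.rep_var).comp tendsto_sampleA
    have h2 : IsBigOp (dataFilter S) fun x : Data S => nB x.1 / nA x.1 := by
      refine IsBigOp.of_bdd (C := r) ?_
      filter_upwards [eventually_whp_of_fst hr, hn] with x h3 h4
      rw [abs_of_nonneg (div_nonneg (by linarith) h3.1.le)]
      exact h3.2
    have h3 := (h2 _ h1).add (A.tendsto_avg_functional_sq Λ)
    rw [add_zero] at h3
    refine h3.congr' ?_
    filter_upwards [eventually_whp_of_fst hr] with x h4
    have : nA x.1 ≠ 0 := h4.1.ne'
    simp only [Function.comp_def, hV]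
    field_simp
    ring
  have hVO : IsBigOp (dataFilter S) fun x => nB x.1 * V x := by
    have h1 : IsBigOp (dataFilter S) fun x : Data S =>
        nB x.1 * Var[fun d => (S x.1).htError d.1 (fun i => m (d.1 i).1 β₀) d.2; (S x.1).lawA] := by
      refine IsBigOp.of_bdd (C := CV) ?_
      filter_upwards [eventually_whp_of_fst hCV, hn] with x h1 h2
      rw [abs_of_nonneg (mul_nonneg (by linarith) (variance_nonneg _ _))]
      exact h1
    have h2 : IsBigOp (dataFilter S) fun x : Data S =>
        ∫ ω, influenceVar m h β₀ (Λ.α x.1) ω ∂(S x.1).lawB :=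
      IsBigOp.of_bdd (C := 1 + CI) ((eventually_whp_of_fst hCI).mono fun x hx => hx.2.2)
    have h3 := (IsBigOp.of_tendsto hVlim).add (h1.add h2)
    simpa only [sub_add_cancel] using h3
  -- the cross term is `√(n_B V) √(n_B Y)`, bounded times vanishing
  have hdiff : Tendsto (fun x => nB x.1 * (∫ r, ((S x.1).thetaRep m (sol x.1) x.2 r -
      (S x.1).thetaI m (sol x.1) x.2) ^ 2 ∂(S x.1).replicate x.2 - V x)) (dataFilter S) (𝓝 0) := by
    have hsY : Tendsto (fun x => √(nB x.1 * Y x)) (dataFilter S) (𝓝 0) := by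
      simpa [Function.comp_def] using (Real.continuous_sqrt.tendsto 0).comp hY0
    have h1 := ((hVO.sqrt _ hsY).const_mul 2).add hY0
    simp only [mul_zero, add_zero] at h1
    refine squeeze_zero_norm' ?_ h1
    filter_upwards [hbound, hn] with x h2 h3
    have h4 : 0 ≤ nB x.1 := by linarith
    rw [norm_mul, Real.norm_of_nonneg h4, Real.norm_eq_abs]
    refine (mul_le_mul_of_nonneg_left h2 h4).trans (le_of_eq ?_)
    rw [Real.sqrt_mul h4, Real.sqrt_mul h4]
    have := Real.mul_self_sqrt h4
    calc _ = 2 * ((√(nB x.1) * √(nB x.1)) * (√(V x) * √(Y x))) + nB x.1 * Y x := by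
          rw [this]
          ring
      _ = _ := by ring
  have h1 := (hdiff.add hVlim).sub ((A.tendsto_variance Λ).comp tendsto_fst_whp)
  simp only [add_zero, sub_zero] at h1
  refine h1.congr fun x => ?_
  simp only [Function.comp_def]
  ring

end Assumptions

end

section

/-! ### Averages of independent bootstrap replicates -/

section Abstract

/-- Chebyshev's inequality for the mean of `L` independent copies of `f`. -/
theorem measure_pi_mean_le {X : Type*} [MeasurableSpace X] {μ : Measure X} [IsProbabilityMeasure μ]
    {f : X → ℝ} (hf : MemLp f 2 μ) {L : ℕ} (hL : 0 < L) (n : ℝ) {ε : ℝ} (hε : 0 < ε) :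
    (Measure.pi fun _ : Fin L => μ).real
      {r | ε ≤ |n * ((L : ℝ)⁻¹ * ∑ k, f (r k) - ∫ x, f x ∂μ)|} ≤
      (n ^ 2 * ∫ x, f x ^ 2 ∂μ) / L / ε ^ 2 := by
  have hL' : (0 : ℝ) < L := by exact_mod_cast hL
  have hfk : ∀ k : Fin L, MemLp (fun r : Fin L → X => f (r k)) 2 (Measure.pi fun _ => μ) :=
    fun k => hf.comp_measurePreserving (measurePreserving_eval (fun _ : Fin L => μ) k)
  have hs : MemLp (fun r : Fin L → X => ∑ k, f (r k)) 2 (Measure.pi fun _ => μ) :=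
    memLp_finsetSum _ fun k _ => hfk k
  set Y : (Fin L → X) → ℝ := fun r => n * ((L : ℝ)⁻¹ * ∑ k, f (r k)) with hY
  have hYm : MemLp Y 2 (Measure.pi fun _ : Fin L => μ) := (hs.const_mul _).const_mul n
  have hmean : ∫ r, Y r ∂(Measure.pi fun _ : Fin L => μ) = n * ∫ x, f x ∂μ := by
    have h1 : ∀ k : Fin L, ∫ r : Fin L → X, f (r k) ∂(Measure.pi fun _ => μ) = ∫ x, f x ∂μ :=
      fun k => by
        have h2 := measurePreserving_eval (fun _ : Fin L => μ) k
        conv_rhs => rw [← h2.map_eq]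
        rw [integral_map h2.measurable.aemeasurable (by rw [h2.map_eq]; exact hf.1)]
    rw [hY, integral_const_mul, integral_const_mul,
      integral_finsetSum _ fun k _ => (hfk k).integrable (by norm_num)]
    simp only [h1, Finset.sum_const, Finset.card_univ, Fintype.card_fin, nsmul_eq_mul]
    field_simp
  have hvar : Var[Y; Measure.pi fun _ : Fin L => μ] ≤ (n ^ 2 * ∫ x, f x ^ 2 ∂μ) / L := by
    have h1 : Var[fun r : Fin L → X => ∑ k, f (r k); Measure.pi fun _ => μ] = L * Var[f; μ] := by
      have h2 := variance_sum_pi (μ := fun _ : Fin L => μ) (X := fun _ => f) fun _ => hf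
      simp only [Finset.sum_const, Finset.card_univ, Fintype.card_fin, nsmul_eq_mul] at h2
      rw [← h2]
      congr 1
      ext r
      simp
    have h3 : Var[f; μ] ≤ ∫ x, f x ^ 2 ∂μ := by
      rw [variance_eq_sub hf]
      have := sq_nonneg (∫ x, f x ∂μ)
      simp only [Pi.pow_apply]
      linarith
    rw [hY, variance_const_mul, variance_const_mul, h1]
    calc n ^ 2 * ((L : ℝ)⁻¹ ^ 2 * (L * Var[f; μ])) = n ^ 2 * Var[f; μ] / L := by
          field_simp
      _ ≤ _ := by gcongr
  have key := meas_ge_le_variance_div_sq hYm hε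
  rw [hmean] at key
  have hset : {r : Fin L → X | ε ≤ |Y r - n * ∫ x, f x ∂μ|} =
      {r | ε ≤ |n * ((L : ℝ)⁻¹ * ∑ k, f (r k) - ∫ x, f x ∂μ)|} := by
    simp only [hY, mul_sub]
  rw [hset] at key
  refine ENNReal.toReal_le_of_le_ofReal (by positivity) (key.trans (ENNReal.ofReal_le_ofReal ?_))
  gcongr

/-- Convergence in probability from convergence of the conditional probabilities. -/
theorem tendsto_whp_compProd {Ω Ω' : ℕ → Type*} [∀ ν, MeasurableSpace (Ω ν)]
    [∀ ν, MeasurableSpace (Ω' ν)] {P : ∀ ν, Measure (Ω ν)} [∀ ν, IsProbabilityMeasure (P ν)]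
    {κ : ∀ ν, Kernel (Ω ν) (Ω' ν)} [∀ ν, IsMarkovKernel (κ ν)] {g : ∀ ν, Ω ν × Ω' ν → ℝ}
    (hg : ∀ ν, Measurable (g ν)) {b : (Σ ν, Ω ν) → ℝ} (hb : Tendsto b (whp P) (𝓝 0))
    (h : ∀ ε > 0, ∀ᶠ x in whp P, (κ x.1 x.2).real {y | ε ≤ |g x.1 (x.2, y)|} ≤ b x / ε ^ 2) :
    Tendsto (fun y : Σ ν, Ω ν × Ω' ν => g y.1 y.2) (whp fun ν => P ν ⊗ₘ κ ν) (𝓝 0) := by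
  refine (isLittleOp_iff (P := fun ν => P ν ⊗ₘ κ ν)).1 fun ε hε => ?_
  have hE : ∀ ν, MeasurableSet {ω | ε ≤ |g ν ω|} := fun ν =>
    measurableSet_le measurable_const (hg ν).abs
  have h0 : Tendsto (fun x : Σ ν, Ω ν => (κ x.1 x.2).real {y | ε ≤ |g x.1 (x.2, y)|}) (whp P)
      (𝓝 0) := by
    refine squeeze_zero' (.of_forall fun _ => measureReal_nonneg) (h ε hε) ?_
    simpa using hb.div_const (ε ^ 2)
  have h1 := tendsto_lintegral_of_whp (C := 1) (.of_forall fun ν ω => measureReal_le_one) h0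
  have h2 := (ENNReal.tendsto_toReal ENNReal.zero_ne_top).comp h1
  refine h2.congr fun ν => ?_
  simp only [Function.comp_def, Measure.real]
  rw [Measure.compProd_apply (hE ν)]
  congr 1
  refine lintegral_congr fun ω => ?_
  rw [ENNReal.ofReal_toReal (measure_ne_top _ _)]
  rfl

/-- Means of conditionally independent variables are close to their conditional expectations. -/
theorem tendsto_whp_mean_iid {Ω Ω' : ℕ → Type*} [∀ ν, MeasurableSpace (Ω ν)]
    [∀ ν, MeasurableSpace (Ω' ν)] {P : ∀ ν, Measure (Ω ν)} [∀ ν, IsProbabilityMeasure (P ν)]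
    {κ : ∀ ν, Kernel (Ω ν) (Ω' ν)} [∀ ν, IsMarkovKernel (κ ν)] {f : ∀ ν, Ω ν × Ω' ν → ℝ}
    (hf : ∀ ν, Measurable (f ν)) {L : ℕ → ℕ} (hL : Tendsto L atTop atTop) (n : ℕ → ℝ)
    (hi : ∀ᶠ x in whp P, Integrable (fun r => f x.1 (x.2, r) ^ 2) (κ x.1 x.2))
    (hO : IsBigOp (whp P) fun x => n x.1 ^ 2 * ∫ r, f x.1 (x.2, r) ^ 2 ∂κ x.1 x.2) :
    Tendsto (fun y : Σ ν, Ω ν × (Fin (L ν) → Ω' ν) => n y.1 * ((L y.1 : ℝ)⁻¹ *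
      ∑ k, f y.1 (y.2.1, y.2.2 k) - ∫ r, f y.1 (y.2.1, r) ∂κ y.1 y.2.1))
      (whp fun ν => P ν ⊗ₘ iidKernel (κ ν) (L ν)) (𝓝 0) := by
  have hLinv : Tendsto (fun x : Σ ν, Ω ν => (L x.1 : ℝ)⁻¹) (whp P) (𝓝 0) :=
    ((tendsto_inv_atTop_zero.comp tendsto_natCast_atTop_atTop).comp hL).comp tendsto_fst_whp
  have hb := hO _ hLinv
  have hI : ∀ ν, Measurable fun x => ∫ r, f ν (x, r) ∂κ ν x := fun ν =>
    ((hf ν).stronglyMeasurable.integral_kernel_prod_right' (κ := κ ν)).measurable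
  have hφ : ∀ ν, ∀ k : Fin (L ν), Measurable fun ω : Ω ν × (Fin (L ν) → Ω' ν) => (ω.1, ω.2 k) :=
    fun ν k => measurable_fst.prodMk ((measurable_pi_apply k).comp measurable_snd)
  have hg : ∀ ν, Measurable fun ω : Ω ν × (Fin (L ν) → Ω' ν) => n ν * ((L ν : ℝ)⁻¹ *
      ∑ k, f ν (ω.1, ω.2 k) - ∫ r, f ν (ω.1, r) ∂κ ν ω.1) := fun ν =>
    (((Finset.measurable_sum _ fun k _ => (hf ν).comp (hφ ν k)).const_mul _).sub
      ((hI ν).comp measurable_fst)).const_mul _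
  refine tendsto_whp_compProd (P := P) (κ := fun ν => iidKernel (κ ν) (L ν))
    (g := fun ν ω => n ν * ((L ν : ℝ)⁻¹ * ∑ k, f ν (ω.1, ω.2 k) - ∫ r, f ν (ω.1, r) ∂κ ν ω.1))
    hg hb fun ε hε => ?_
  filter_upwards [hi, eventually_whp_of_fst (hL.eventually_gt_atTop 0)] with x hx hLx
  have hfx : Measurable fun r => f x.1 (x.2, r) := (hf x.1).comp measurable_prodMk_left
  refine (measure_pi_mean_le ((memLp_two_iff_integrable_sq hfx.aestronglyMeasurable).2 hx) hLx
    (n x.1) hε).trans (le_of_eq ?_)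
  rw [div_eq_inv_mul (n x.1 ^ 2 * _)]

end Abstract

variable {p q : ℕ} {S : ℕ → Stage q} {nA nB : ℕ → ℝ} {m : Cov q → Param p → ℝ}
  {h : Cov q → Param p → Param p} {K : Cov q → ℝ} {Θ : Set (Param p)} {β₀ : Param p}
  {sol : ∀ ν, Pop q (S ν).N → (Fin (S ν).N → ℕ) → Param p}

namespace Assumptions

variable (A : Assumptions S nA nB m h K Θ β₀ sol) (Λ : Linearization S nB m h K Θ β₀)
include A

theorem measurable_replicate_sub (ν : ℕ) :
    Measurable fun t : ((Pop q (S ν).N × Finset (Fin (S ν).N)) × Finset (Fin (S ν).N)) ×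
      ((Fin (S ν).N → ℝ) × (Fin (S ν).N → ℕ)) =>
      (S ν).thetaRep m (sol ν) t.1 t.2 - (S ν).thetaI m (sol ν) t.1 := by
  have hm : ∀ (i : Fin (S ν).N) (c : Fin (S ν).N → ℕ), Measurable fun pop : Pop q (S ν).N =>
      m (pop i).1 (sol ν pop c) := fun i c =>
    A.reg.meas_m.comp ((measurable_fst.comp (measurable_pi_apply i)).prodMk ((A.solver ν).meas c))
  have hT : ∀ (s : Finset (Fin (S ν).N)) (c : Fin (S ν).N → ℕ), Measurable
      fun t : Pop q (S ν).N × (Fin (S ν).N → ℝ) =>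
        ((S ν).N : ℝ)⁻¹ * ∑ i ∈ s, t.2 i * m (t.1 i).1 (sol ν t.1 c) := fun s c =>
    (Finset.measurable_sum _ fun i _ => ((measurable_pi_apply i).comp measurable_snd).mul
      ((hm i c).comp measurable_fst)).const_mul _
  have hI : Measurable fun d : (Pop q (S ν).N × Finset (Fin (S ν).N)) × Finset (Fin (S ν).N) =>
      (S ν).thetaI m (sol ν) d := by
    refine measurable_from_prod_countable_left fun s => measurable_from_prod_countable_left fun B => ?_
    exact (Finset.measurable_sum _ fun i _ => ((S ν).measurable_weight i).mul
      (hm i (ofSample B))).const_mul _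
  have hR : Measurable fun t : (Pop q (S ν).N × (Fin (S ν).N → ℝ)) ×
      (Finset (Fin (S ν).N) × (Fin (S ν).N → ℕ)) =>
        ((S ν).N : ℝ)⁻¹ * ∑ i ∈ t.2.1, t.1.2 i * m (t.1.1 i).1 (sol ν t.1.1 t.2.2) :=
    measurable_from_prod_countable_left fun u => hT u.1 u.2
  have hφ : Measurable fun t : ((Pop q (S ν).N × Finset (Fin (S ν).N)) × Finset (Fin (S ν).N)) ×
      ((Fin (S ν).N → ℝ) × (Fin (S ν).N → ℕ)) => ((t.1.1.1, t.2.1), (t.1.2, t.2.2)) := by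
    fun_prop
  exact Measurable.sub (hR.comp hφ) (hI.comp measurable_fst)

include Λ in
/-- The bootstrap variance is close to its conditional mean given the data. -/
theorem tendsto_bootVar_sub : Tendsto (fun y : Σ ν, (S ν).Outcome => nB y.1 *
    ((S y.1).bootVar m (sol y.1) y.2 - ∫ r, ((S y.1).thetaRep m (sol y.1) y.2.1 r -
      (S y.1).thetaI m (sol y.1) y.2.1) ^ 2 ∂(S y.1).replicate y.2.1))
    (whp fun ν => (S ν).law) (𝓝 0) := by
  obtain ⟨h1, h2⟩ := A.isBigOp_replicate_pow_four Λ
  simp only [show ∀ t : ℝ, t ^ 4 = (t ^ 2) ^ 2 from fun t => by ring] at h1 h2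
  exact tendsto_whp_mean_iid (P := fun ν => (S ν).lawBA) (κ := fun ν => (S ν).replicate)
    (f := fun ν t => ((S ν).thetaRep m (sol ν) t.1 t.2 - (S ν).thetaI m (sol ν) t.1) ^ 2)
    (fun ν => (A.measurable_replicate_sub ν).pow_const 2) A.L_top nB h1 h2

include Λ in
theorem isLittleOp_bootVar : IsLittleOp (fun ν => (S ν).law) fun ν ω => (ω.1.1.2.card : ℝ) *
    ((S ν).bootVar m (sol ν) ω -
      Var[fun d => (S ν).thetaI m (sol ν) d - (S ν).thetaN d.1.1; (S ν).lawBA]) := by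
  rw [isLittleOp_iff]
  have hφ : Tendsto (fun y : Σ ν, (S ν).Outcome => (⟨y.1, y.2.1⟩ : Data S))
      (whp fun ν => (S ν).law) (dataFilter S) :=
    tendsto_whp_map (P := fun ν => (S ν).lawBA) (P' := fun ν => (S ν).law) (fun _ => Prod.fst)
      (fun _ => measurable_fst) fun ν => (S ν).map_fst_law
  have h1 := (A.tendsto_bootVar_sub Λ).add ((A.tendsto_replicate_sq Λ).comp hφ)
  rw [add_zero] at h1
  -- `|B| / n_B` is bounded in probability, so the normalization by `n_B` may be replaced by `|B|`
  have h2 := IsBigOp.of_tendsto ((A.tendsto_card.comp tendsto_sampleB).comp hφ)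
  refine (h2 _ h1).congr' ?_
  filter_upwards [eventually_whp_of_fst A.nB_pos] with y hy
  have : nB y.1 ≠ 0 := by linarith
  simp only [Function.comp_def]
  field_simp
  ring

end Assumptions

end

end MassImputation

open MassImputation in
theorem theorem2 {p q : ℕ}
    -- the sequence of populations and samples, and the rates of the two sample sizes
    (S : ℕ → Stage q) (nA nB : ℕ → ℝ)
    (hnB : Tendsto nB atTop atTop)
    (hnBN : Tendsto (fun ν => nB ν / (S ν).N) atTop (𝓝 0))
    (hnBA : ∃ C : ℝ, ∀ ν, nB ν ≤ C * nA ν)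
    (hL : Tendsto (fun ν => (S ν).L) atTop atTop)
    (hcardB : ∀ ε > 0, Tendsto (fun ν => nB ν *
      (S ν).lawB.real {ω | ε ≤ |(ω.2.card : ℝ) / nB ν - 1|}) atTop (𝓝 0))
    (hcardA : ∀ ν, ∀ᵐ pop ∂(S ν).popLaw, ∑ i, (S ν).incl pop i = nA ν)
    -- the imputation model and the estimating equations
    (m : Cov q → Param p → ℝ) (h : Cov q → Param p → Param p)
    (hm_meas : Measurable (Function.uncurry m)) (hh_meas : Measurable (Function.uncurry h))
    (Θ : Set (Param p)) (hΘ : IsCompact Θ) (hΘconv : Convex ℝ Θ)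
    (β₀ : Param p) (hβ₀ : β₀ ∈ interior Θ)
    (hmodel : ∀ ν, (S ν).MeanModel m β₀)
    (hMAR : ∀ ν, (S ν).Ignorable)
    (sol : ∀ ν, Pop q (S ν).N → (Fin (S ν).N → ℕ) → Param p)
    (hsol : ∀ ν, IsSolver m h Θ (sol ν))
    -- smoothness, with an envelope `K`
    (O : Set (Param p)) (hO : IsOpen O) (hΘO : Θ ⊆ O)
    (hm_smooth : ∀ x, ContDiffOn ℝ 2 (m x) O) (hh_smooth : ∀ x, ContDiffOn ℝ 2 (h x) O)
    (K : Cov q → ℝ) (hK_meas : Measurable K)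
    (hmK : ∀ x, ∀ β ∈ Θ, ∀ j ≤ 2, ‖iteratedFDeriv ℝ j (m x) β‖ ≤ K x)
    (hhK : ∀ x, ∀ β ∈ Θ, ∀ j ≤ 2, ‖iteratedFDeriv ℝ j (h x) β‖ ≤ K x)
    -- bounded fourth moments over the sequence of populations, and in the samples `B`
    (hmom : ∃ C : ℝ, ∀ ν, ∫⁻ pop, ENNReal.ofReal (((S ν).N : ℝ)⁻¹ *
      ∑ i, (‖(pop i).1‖ ^ 4 + (pop i).2 ^ 4 + K (pop i).1 ^ 4)) ∂(S ν).popLaw ≤ ENNReal.ofReal C)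
    (hmomB : ∃ C : ℝ, ∀ ν, ∫⁻ ω, ENNReal.ofReal (avg ω.2 fun i =>
      ((|(ω.1 i).2| + K (ω.1 i).1) * K (ω.1 i).1) ^ 4) ∂(S ν).lawB ≤ ENNReal.ofReal C)
    (hbddB : ∃ C : ℝ, Tendsto (fun ν => nB ν * (S ν).lawB.real {ω | C < avg ω.2 fun i =>
      (|(ω.1 i).2| + K (ω.1 i).1) * K (ω.1 i).1}) atTop (𝓝 0))
    -- the samples `B` identify `β₀`, and two averages over `B` obey the law of large numbers
    (hident : ∃ c > 0, Tendsto (fun ν => nB ν * (S ν).lawB.real {ω | ∃ β ∈ Θ,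
      ‖meanEstFun m h β₀ ω.1 ω.2 β‖ < c * ‖β - β₀‖}) atTop (𝓝 0))
    (hjac : ∀ j l, IsLittleOp (fun ν => (S ν).lawB) fun ν ω =>
      jacobian m h β₀ j l ω - ∫ ω', jacobian m h β₀ j l ω' ∂(S ν).lawB)
    (hscore : ∀ j l, IsLittleOp (fun ν => (S ν).lawB) fun ν ω =>
      scoreVar m h β₀ j l ω - ∫ ω', scoreVar m h β₀ j l ω' ∂(S ν).lawB)
    -- the design of `A`
    (hincl : ∀ ν, ∀ᵐ pop ∂(S ν).popLaw, ∀ i, 0 < (S ν).incl pop i)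
    (hdesign : ∃ C : ℝ, ∀ ν, ∀ᵐ pop ∂(S ν).popLaw, ∀ z : Fin (S ν).N → ℝ,
      ∫ A, (S ν).htError pop z A ^ 2 ∂(S ν).design pop ≤
        C / nA ν * (((S ν).N : ℝ)⁻¹ * ∑ i, z i ^ 2))
    -- the replication weights of `A`: fourth moments, and consistency for the design variance
    (hrep4 : ∃ C : ℝ, Tendsto (fun ν => (S ν).lawA.real {d | ¬ ∀ z : Fin (S ν).N → ℝ,
      ∫⁻ v, ENNReal.ofReal ((S ν).repDiff d.1 d.2 z v ^ 4) ∂(S ν).repW d ≤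
        ENNReal.ofReal (C / nA ν ^ 2 *
          (((S ν).N : ℝ)⁻¹ * ∑ i ∈ d.2, (S ν).weight d.1 i * z i ^ 4))}) atTop (𝓝 0))
    (hrepV : IsLittleOp (fun ν => (S ν).lawA) fun ν d => nA ν *
      (∫ v, (S ν).repDiff d.1 d.2 (fun i => m (d.1 i).1 β₀) v ^ 2 ∂(S ν).repW d -
        Var[fun d' => (S ν).htError d'.1 (fun i => m (d'.1 i).1 β₀) d'.2; (S ν).lawA])) :
    (∀ ν, MemLp (fun d => (S ν).thetaI m (sol ν) d - (S ν).thetaN d.1.1) 2 (S ν).lawBA) ∧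
    IsLittleOp (fun ν => (S ν).law) fun ν ω => (ω.1.1.2.card : ℝ) *
      ((S ν).bootVar m (sol ν) ω -
        Var[fun d => (S ν).thetaI m (sol ν) d - (S ν).thetaN d.1.1; (S ν).lawBA]) := by
  have A : Assumptions S nA nB m h K Θ β₀ sol :=
    { reg := regular_of_contDiffOn hm_meas hh_meas hΘ hΘconv hβ₀ hO hΘO hm_smooth hh_smooth hK_meas
        hmK hhK
      nB_top := hnB
      nB_N := hnBN
      nB_nA := hnBA
      L_top := hL
      card_B := hcardB
      card_A := hcardA
      model := hmodel
      ignorable := hMAR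
      solver := hsol
      mom := hmom
      mom_B := hmomB
      bdd_B := hbddB
      ident := hident
      jac := hjac
      score := hscore
      incl_pos := hincl
      design := hdesign
      rep_four := hrep4
      rep_var := hrepV }
  obtain ⟨Λ⟩ := A.exists_linearization
  exact ⟨A.memLp_theta, A.isLittleOp_bootVar Λ⟩
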